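/- Setting. A topological causal space is a set $X$ with a preorder $\le$, a transitive relation $\ll$ contained in $\le$, and a topology induced by a proper metric, such that $\le$ is closed and $\ll$ is open in $X\times X$. Let $H\subset X$ be closed and achronal (no $x,y\in H$ satisfy $x\ll y$). A point $p\in H$ is initial (resp. final) if no $x\in H$, $x\ne p$, satisfies $x\le p$ (resp. $p\le x$); $\mathcal I$ and $\mathcal F$ are the sets of initial and final points, and $H^\circ=H\setminus(\mathcal I\cup\mathcal F)$. A causal curve is a non-constant continuous curve, defined on a real interval, that is non-decreasing for $\le$. A gauge is a Borel map $G:H^\circ\to\mathbb R$ such that $G\circ\gamma$ is strictly increasing and continuous for every injective causal curve $\gamma$ in $H^\circ$, and $G$ is bounded on $\gamma((0,1))$ for every causal curve $\gamma:[0,1]\to H$ with $\gamma((0,1))\subset H^\circ$. A synthetic null hypersurface is a triple $(H,G,\mathfrak m)$ with $H$ closed and achronal, $G$ a gauge for $H$, and $\mathfrak m$ a non-negative Radon measure on $H$ with $\mathfrak m(\mathcal I\cap\mathcal F)=0$. $H$ is null non-branching if for any two injective causal curves $\gamma^1,\gamma^2:[0,1]\to H$ with $\gamma^1_0=\gamma^2_0$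 and $\gamma^1_{1/2}=\gamma^2_{1/2}$, the image of one is contained in the image of the other, and the same holds for the reversed causal relation. $H$ is weakly convex if any $x,y\in H$ with $x\le y$, $x\neq y$, are joined by a causal curve in $H$. A $G$-causal curve is either a constant curve in $H$ or a causal curve $\gamma:[0,1]\to H$ with $\gamma((0,1))\subset H^\circ$ and $G\circ\gamma|_{(0,1)}$ affine. For a probability measure $\mu$ on $H$, put $\mathrm{Ent}(\mu|\mathfrak m)=\int\rho\log\rho\,d\mathfrak m\in[-\infty,\infty)$ if $\mu=\rho\,\mathfrak m$ and $(\rho\log\rho)_+$ is integrable, $\mathrm{Ent}(\mu|\mathfrak m)=+\infty$ otherwise, and $U_{N-1}(\mu)=\exp(-\mathrm{Ent}(\mu|\mathfrak m)/(N-1))\in[0,\infty]$. The condition $\mathsf{NC}^e(N)$ says: for all Borel probability measures $\mu_0,\mu_1$ on $H$ that admit a coupling concentrated on $\{x\le y\}$, there is a Borel probability measure $\nu$ on $C([0,1];H)$, concentrated on $G$-causal curves, with marginals $\mu_t=(e_t)_\sharp\nu$ equal to $\mu_0,\mu_1$ at $t=0,1$, such that $U_{N-1}(\mu_t)\ge(1-t)U_{N-1}(\mu_0)+tU_{N-1}(\mu_1)$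 for all $t\in[0,1]$ (with $0\cdot\infty=0$). Call $x,y\in H^\circ$ related if $x\le y$ or $y\le x$; when $H$ is weakly convex and null non-branching this is an equivalence relation, whose classes are the rays $H^\circ_\alpha$. A disintegration of $\mathfrak m$ restricted to $H^\circ$ along the rays consists of a quotient map $\mathfrak Q:H^\circ\to H^\circ$ ($x$ is related to $\mathfrak Q(x)$; $\mathfrak Q(x)=\mathfrak Q(y)$ if and only if $x,y$ are related), measurable for the $\sigma$-algebra generated by the analytic sets, a Borel probability measure $\mathfrak q$ on $Q=\mathfrak Q(H^\circ)$ with $\mathfrak Q_\sharp(\mathfrak m\llcorner_{H^\circ})\ll\mathfrak q$, and measures $\mathfrak m_\alpha$ on $H^\circ$ such that: $\alpha\mapsto\mathfrak m_\alpha(B)$ is $\mathfrak q$-measurable for each $\mathfrak m$-measurable $B\subset H^\circ$; $\mathfrak m_\alpha$ is concentrated on $\mathfrak Q^{-1}(\alpha)$ for $\mathfrak q$-a.e. $\alpha$; $\mathfrak m(B\cap\mathfrak Q^{-1}(C))=\int_C\mathfrak m_\alpha(B)\,\mathfrak q(d\alpha)$ for all $\mathfrak m$-measurable $B\subset H^\circ$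 and $\mathfrak q$-measurable $C$; and for every compact $K\subset X$ there is a finite $C_K$ with $\mathfrak m_\alpha(K)\le C_K$ for $\mathfrak q$-a.e. $\alpha$. Theorem. Let $N>2$ and let $(H,G,\mathfrak m)$ be a null non-branching synthetic null hypersurface with $H^\circ\ne\emptyset$. The following are equivalent. (1) $(H,G,\mathfrak m)$ satisfies $\mathsf{NC}^e(N)$. (2) $H$ is weakly convex, $\mathfrak m(\mathcal I\cup\mathcal F)=0$, and there is a disintegration of $\mathfrak m$ (restricted to $H^\circ$, which carries all of $\mathfrak m$) along the rays such that, for $\mathfrak q$-a.e. $\alpha\in Q$, the generator $(H_\alpha,|G(\cdot)-G(\cdot)|,\mathfrak m_\alpha)$ satisfies $\mathsf{CD}(0,N-1)$, that is: let $I_\alpha$ be the set of values $G(y)-G(\alpha)$, $y\in H^\circ_\alpha$, together with their infimum if some initial point $x$ satisfies $x\le\alpha$ and their supremum if some final point $x$ satisfies $\alpha\le x$; then the image of $\mathfrak m_\alpha$ under $y\mapsto G(y)-G(\alpha)$ is absolutely continuous with a density $h_\alpha:I_\alpha\to[0,\infty)$ such that $I_\alpha$ is an interval and $h_\alpha^{1/(N-2)}$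 is concave on $I_\alpha$. (3) $H$ is weakly convex, $\mathfrak m(\mathcal I\cup\mathcal F)=0$, and every disintegration of $\mathfrak m$ restricted to $H^\circ$ along the rays has the property stated in (2). -/

import Mathlib

open MeasureTheory Set
open scoped ENNReal NNReal

namespace NullEnergy

universe u

/-- A topological causal space: a preorder `≤` (the causal relation, a closed relation), a transitive
open relation `chron` (written `≪`) contained in `≤`, and a topology induced by a proper metric
(such a metric is complete and separable, so the topology is Polish). -/
class TopologicalCausalSpace (X : Type u) extends TopologicalSpace X, Preorder X where
  chron : X → X → Prop
  chron_trans : ∀ x y z : X, chron x y → chron y z → chron x z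
  le_of_chron : ∀ x y : X, chron x y → x ≤ y
  proper : ∃ d : MetricSpace X,
    d.toUniformSpace.toTopologicalSpace = toTopologicalSpace ∧ @ProperSpace X d.toPseudoMetricSpace
  isClosed_le : _root_.IsClosed ({p : X × X | p.1 ≤ p.2} : Set (X × X))
  isOpen_chron : _root_.IsOpen ({p : X × X | chron p.1 p.2} : Set (X × X))

/-- A (future-directed) causal curve on `I` (a real interval): continuous, non-constant, and
non-decreasing for `≤`. -/
def IsCausalCurve {Y : Type u} [TopologicalSpace Y] [Preorder Y] {I : Set ℝ} (γ : I → Y) : Prop :=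
  Continuous γ ∧ Monotone γ ∧ ∃ s t, γ s ≠ γ t

/-- The space `C([0,1]; Y)` carries the Borel σ-algebra of the compact-open topology, which is the
topology of uniform convergence. -/
instance curveMeasurableSpace (Y : Type u) [TopologicalSpace Y] :
    MeasurableSpace C(unitInterval, Y) := borel _

instance curveBorelSpace (Y : Type u) [TopologicalSpace Y] :
    BorelSpace C(unitInterval, Y) := ⟨rfl⟩

section Causal

variable {X : Type u} [TopologicalCausalSpace X]

/-- No two points of `H` are chronologically related. -/
def IsAchronal (H : Set X) : Prop :=
  ∀ x ∈ H, ∀ y ∈ H, ¬ TopologicalCausalSpace.chron x y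

/-- The initial elements of `H`. -/
def initialPoints (H : Set X) : Set H := {p | ¬ ∃ x : H, x ≤ p ∧ x ≠ p}

/-- The final elements of `H`. -/
def finalPoints (H : Set X) : Set H := {p | ¬ ∃ x : H, p ≤ x ∧ x ≠ p}

/-- The static elements of `H`. -/
def staticPoints (H : Set X) : Set H := initialPoints H ∩ finalPoints H

/-- `H` without its initial and final elements, written `H°`. -/
def noEnds (H : Set X) : Set H := (initialPoints H ∪ finalPoints H)ᶜ

/-- Any two distinct causally related points of `H` are joined by a causal curve inside `H`. -/
def WeaklyConvex (H : Set X) : Prop :=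
  ∀ x y : H, x ≤ y → x ≠ y →
    ∃ γ : unitInterval → H, IsCausalCurve γ ∧ γ 0 = x ∧ γ 1 = y

def ForwardNonBranching (H : Set X) : Prop :=
  ∀ γ₁ γ₂ : unitInterval → H,
    Continuous γ₁ → Monotone γ₁ → Function.Injective γ₁ →
    Continuous γ₂ → Monotone γ₂ → Function.Injective γ₂ →
    γ₁ 0 = γ₂ 0 →
    γ₁ ⟨1 / 2, by norm_num, by norm_num⟩ = γ₂ ⟨1 / 2, by norm_num, by norm_num⟩ →
    range γ₁ ⊆ range γ₂ ∨ range γ₂ ⊆ range γ₁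

/-- Forward non-branching for the reversed causal relation. -/
def BackwardNonBranching (H : Set X) : Prop :=
  ∀ γ₁ γ₂ : unitInterval → H,
    Continuous γ₁ → Antitone γ₁ → Function.Injective γ₁ →
    Continuous γ₂ → Antitone γ₂ → Function.Injective γ₂ →
    γ₁ 0 = γ₂ 0 →
    γ₁ ⟨1 / 2, by norm_num, by norm_num⟩ = γ₂ ⟨1 / 2, by norm_num, by norm_num⟩ →
    range γ₁ ⊆ range γ₂ ∨ range γ₂ ⊆ range γ₁

def NullNonBranching (H : Set X) : Prop :=
  ForwardNonBranching H ∧ BackwardNonBranching H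

/-- `G`-causal curves `[0,1] → H`: causal curves which lie in `H°` on `(0,1)` and along which `G` is
affine on `(0,1)`; the constant curves are included as degenerate ones. -/
def gCausalCurves {H : Set X} (G : noEnds H → ℝ) : Set C(unitInterval, H) :=
  {γ | Monotone γ ∧
    ((∀ s t, γ s = γ t) ∨
      ∃ hγ : ∀ t ∈ Ioo (0 : unitInterval) 1, γ t ∈ noEnds H,
        ∃ a b : ℝ, ∀ (t : unitInterval) (ht : t ∈ Ioo (0 : unitInterval) 1),
          G ⟨γ t, hγ t ht⟩ = a + b * (t : ℝ))}

/-- The transport relation on `H°`: being causally related, in one direction or the other. -/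
def Related {H : Set X} (x y : noEnds H) : Prop := x ≤ y ∨ y ≤ x

/-- The values `G y - G α`, for `y` in the ray without end-points `H°_α`. -/
def openRayInterval {H : Set X} (G : noEnds H → ℝ) (α : noEnds H) : Set ℝ :=
  {t | ∃ y : noEnds H, Related y α ∧ G y - G α = t}

/-- The set `I_α` parametrising the ray with end-points `H_α`: the values `G y - G α` on `H°_α`,
together with their infimum if `H_α` has an initial point, and their supremum if it has a final
point. -/
def rayInterval {H : Set X} (G : noEnds H → ℝ) (α : noEnds H) : Set ℝ :=
  openRayInterval G α
    ∪ {r | (∃ x ∈ initialPoints H, x ≤ (α : H)) ∧ IsGLB (openRayInterval G α) r}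
    ∪ {r | (∃ x ∈ finalPoints H, (α : H) ≤ x) ∧ IsLUB (openRayInterval G α) r}

variable [MeasurableSpace X]

structure IsGauge (H : Set X) (G : noEnds H → ℝ) : Prop where
  measurable : Measurable G
  strictMono_continuous : ∀ (I : Set ℝ), I.OrdConnected → ∀ γ : I → noEnds H,
    IsCausalCurve γ → Function.Injective γ → StrictMono (G ∘ γ) ∧ Continuous (G ∘ γ)
  bounded : ∀ γ : unitInterval → H, IsCausalCurve γ →
    ∀ hγ : ∀ t ∈ Ioo (0 : unitInterval) 1, γ t ∈ noEnds H,
      BddAbove {r | ∃ (t : unitInterval) (ht : t ∈ Ioo (0 : unitInterval) 1),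
        r = G ⟨γ t, hγ t ht⟩} ∧
      BddBelow {r | ∃ (t : unitInterval) (ht : t ∈ Ioo (0 : unitInterval) 1),
        r = G ⟨γ t, hγ t ht⟩}

/-- Synthetic null hypersurfaces `(H, G, m)`. A Borel measure on `H` that is finite on compact sets
is a Radon measure, because `H` is locally compact with a countable base. -/
structure IsSyntheticNullHypersurface (H : Set X) (G : noEnds H → ℝ) (m : Measure H) : Prop where
  isClosed : IsClosed H
  achronal : IsAchronal H
  gauge : IsGauge H G
  radon : IsFiniteMeasureOnCompacts m
  static_null : m (staticPoints H) = 0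

/-- `π` is a causal coupling of `μ₀` and `μ₁`. -/
structure IsCausalCoupling {H : Set X} (μ₀ μ₁ : Measure H) (π : Measure (H × H)) : Prop where
  isProbabilityMeasure : IsProbabilityMeasure π
  map_fst : π.map Prod.fst = μ₀
  map_snd : π.map Prod.snd = μ₁
  causal : ∀ᵐ p ∂π, p.1 ≤ p.2

/-- The time-`t` marginal of a measure on curves. -/
noncomputable def marginal {H : Set X} (ν : Measure C(unitInterval, H)) (t : unitInterval) :
    Measure H :=
  ν.map (fun γ => γ t)

/-- `ν` is a `G`-causal dynamical plan from `μ₀` to `μ₁`. -/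
structure IsGCausalPlan {H : Set X} (G : noEnds H → ℝ) (μ₀ μ₁ : Measure H)
    (ν : Measure C(unitInterval, H)) : Prop where
  isProbabilityMeasure : IsProbabilityMeasure ν
  marginal_zero : marginal ν 0 = μ₀
  marginal_one : marginal ν 1 = μ₁
  gCausal : ∀ᵐ γ ∂ν, γ ∈ gCausalCurves G

end Causal

section Entropy

variable {Y : Type u} [MeasurableSpace Y]

/-- `ρ log ρ`, for the density `ρ` of `μ` with respect to `m`. -/
noncomputable def rhoLogRho (μ m : Measure Y) (y : Y) : ℝ :=
  (μ.rnDeriv m y).toReal * Real.log (μ.rnDeriv m y).toReal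

open Classical in
/-- The Boltzmann-Shannon entropy of `μ` relative to `m`: the integral of `ρ log ρ`, with values
in `[-∞, ∞)`, if `μ = ρ m` and the positive part of `ρ log ρ` is integrable, and `+∞` otherwise. -/
noncomputable def entropy (μ m : Measure Y) : EReal :=
  if μ ≪ m ∧ ∫⁻ y, ENNReal.ofReal (rhoLogRho μ m y) ∂m ≠ ∞ then
    ((∫⁻ y, ENNReal.ofReal (rhoLogRho μ m y) ∂m : ℝ≥0∞) : EReal)
      - ((∫⁻ y, ENNReal.ofReal (-rhoLogRho μ m y) ∂m : ℝ≥0∞) : EReal)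
  else ⊤

/-- The entropy power `exp (-Ent(μ|m) / N)`, with values in `[0, ∞]`; it is `0` if the entropy
is `+∞` and `∞` if the entropy is `-∞`. -/
noncomputable def entropyPower (N : ℝ) (μ m : Measure Y) : ℝ≥0∞ :=
  if entropy μ m = ⊤ then 0
  else if entropy μ m = ⊥ then ∞
  else ENNReal.ofReal (Real.exp (-(entropy μ m).toReal / N))

end Entropy

section Main

variable {X : Type u} [TopologicalCausalSpace X] [MeasurableSpace X]

/-- The null energy condition `NC^e(N)`. -/
def NCe {H : Set X} (G : noEnds H → ℝ) (m : Measure H) (N : ℝ) : Prop :=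
  ∀ μ₀ μ₁ : Measure H, IsProbabilityMeasure μ₀ → IsProbabilityMeasure μ₁ →
    (∃ π : Measure (H × H), IsCausalCoupling μ₀ μ₁ π) →
    ∃ ν : Measure C(unitInterval, H), IsGCausalPlan G μ₀ μ₁ ν ∧
      ∀ t : unitInterval,
        ENNReal.ofReal (1 - (t : ℝ)) * entropyPower (N - 1) μ₀ m
            + ENNReal.ofReal (t : ℝ) * entropyPower (N - 1) μ₁ m
          ≤ entropyPower (N - 1) (marginal ν t) m

/-- `𝔔 : H° → H°` is a quotient map for the transport relation, measurable with respect to the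
σ-algebra generated by the analytic sets. -/
structure IsQuotientMap {H : Set X} (𝔔 : noEnds H → noEnds H) : Prop where
  measurable : ∀ B : Set (noEnds H), MeasurableSet B →
    MeasurableSet[MeasurableSpace.generateFrom {A : Set (noEnds H) | AnalyticSet A}] (𝔔 ⁻¹' B)
  related : ∀ x, Related x (𝔔 x)
  eq_iff : ∀ x y, 𝔔 x = 𝔔 y ↔ Related x y

/-- The restriction of `m` to `H°`, as a measure on the subtype `H°`. -/
noncomputable def restrictNoEnds {H : Set X} (m : Measure H) : Measure (noEnds H) :=
  m.comap Subtype.val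

/-- A disintegration of `m` restricted to `H°` along the rays, with quotient map `𝔔`,
quotient probability `q` on `Q = range 𝔔`, and conditional measures `mc α`. -/
structure IsDisintegration {H : Set X} (m : Measure H) (𝔔 : noEnds H → noEnds H)
    (q : Measure (noEnds H)) (mc : noEnds H → Measure (noEnds H)) : Prop where
  quotient : IsQuotientMap 𝔔
  isProbabilityMeasure : IsProbabilityMeasure q
  concentrated_quotient : ∀ᵐ α ∂q, α ∈ range 𝔔
  map_absolutelyContinuous : ∀ B : Set (noEnds H), MeasurableSet B → q B = 0 →
    restrictNoEnds m (𝔔 ⁻¹' B) = 0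
  measurable : ∀ B : Set (noEnds H), NullMeasurableSet B (restrictNoEnds m) →
    AEMeasurable (fun α => mc α B) q
  concentrated : ∀ᵐ α ∂q, ∀ᵐ x ∂(mc α), 𝔔 x = α
  disintegration : ∀ B C : Set (noEnds H), NullMeasurableSet B (restrictNoEnds m) →
    NullMeasurableSet C q →
    restrictNoEnds m (B ∩ 𝔔 ⁻¹' C) = ∫⁻ α in C, mc α B ∂q
  locally_bounded : ∀ K : Set X, IsCompact K → ∃ c : ℝ≥0,
    ∀ᵐ α ∂q, mc α {x : noEnds H | ((x : H) : X) ∈ K} ≤ c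

/-- The ray `H_α` with the distance `|G - G|` and the measure `mα` satisfies `CD(0, N - 1)`: in the
gauge parametrisation `y ↦ G y - G α` the measure `mα` has a density `h` on the interval `I_α` such
that `h ^ (1 / (N - 2))` is concave. -/
def RayCD {H : Set X} (G : noEnds H → ℝ) (N : ℝ) (α : noEnds H) (mα : Measure (noEnds H)) : Prop :=
  ∃ h : ℝ → ℝ, Measurable h ∧ (∀ t ∈ rayInterval G α, 0 ≤ h t) ∧
    mα.map (fun y => G y - G α)
      = (volume.restrict (rayInterval G α)).withDensity (fun t => ENNReal.ofReal (h t)) ∧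
    ConcaveOn ℝ (rayInterval G α) (fun t => h t ^ (1 / (N - 2)))

end Main

end NullEnergy

/-!
# Null energy and concave densities along the rays of a null hypersurface

In a weakly convex, null non-branching hypersurface the set `H°` is partitioned into rays, each of
which is parametrised by the gauge (`RaySetting`, `rayIndex`, `rayGauge`, `rayPoint`). The null energy
condition gives the Brunn-Minkowski inequality on almost every ray, hence a density with a concave
power (`NCe.hasConcaveDensity`). Conversely, monotone rearrangement along the rays gives plans with
concave entropy power (`IsRayDisintegration.exists_plan`). An arbitrary disintegration is compared
with a canonical one in `IsDisintegration.exists_comparison`.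
-/

/-! Structure of `H`. A causal curve between distinct points can be made injective
(`exists_injective_path`), and the gauge increases strictly along injective curves in `H°`. Hence
`≤` is antisymmetric on a weakly convex `H`. A point of `H°` is neither initial nor final, so two
arcs issuing from it extend backwards to a common arc, and non-branching makes their ends
comparable. Rays are therefore totally ordered; the gauge identifies each with an open interval, to
which end-points add at most its extremities. The causal relations involved are σ-compact, so the
coordinates (ray, gauge) and their inverse are Borel.

From `NCe` to concave densities. Dirac masses give weak convexity. If the initial points had
positive mass, plans moving a piece of that mass into `H°` would be confined, near the start, to
sets of arbitrarily small measure, although the entropy power at half time stays bounded below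
(`measure_eq_zero_of_plans`). On a set of rays of positive `q`-measure, transport between two gauge
intervals compares the conditional masses of the two intervals and of the interpolated one; the mass
of the set of rays cancels. This is a Brunn-Minkowski inequality with exponent `1/(N-1)`
(`NCe.brunnMinkowski_of_subset`), valid on almost every ray once countably many rational parameters
are treated. Differentiating it on small intervals of well chosen unequal lengths turns exponent
`1/(N-1)` for masses into exponent `1/(N-2)` for the lower density
(`BrunnMinkowski.lowerDensity_of_lt`), which is then finite, concave after taking the power, and a
genuine density.

From concave densities to `NCe`. A causal coupling with at least one absolutely continuous marginal
is decomposed along rays and replaced on each ray by the monotone coupling of the conditional laws,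
which is still causal. With quantile functions `Y` as maps, the density `ρ` satisfies `ρ ^
(-1/(N-1)) = (h(Y) Y' / θ) ^ (1/(N-1))`, and this is concave in time by Hölder's inequality and the
concavity of `h ^ (1/(N-2))`. Jensen's inequality for the logarithm of a sum of exponentials
converts the pointwise statement into concavity of the entropy power (`add_mul_entropyPower_le`).

Independence of the disintegration. The conditional measures of any disintegration are, almost
surely, multiples of those of one Borel disintegration by a factor depending only on the ray
(`IsDisintegration.exists_comparison`). Concavity of a power of the density is insensitive to such
factors, which gives the passage between "some" and "every". -/

namespace NullEnergy

open Filter Topology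

set_option linter.unusedSectionVars false

/-! ### Monotone paths contain monotone arcs -/

section Arcs

/-- Closed sets containing the end-points such that a path takes the same value at both ends of
each gap. -/
def IsExcision {Y : Type*} (γ : unitInterval → Y) (C : Set unitInterval) : Prop :=
  IsClosed C ∧ 0 ∈ C ∧ 1 ∈ C ∧ ∀ a ∈ C, ∀ b ∈ C, a < b → Disjoint (Ioo a b) C → γ a = γ b

/-- By Zorn's lemma it is enough that the intersection of a chain of excisions is an excision. If
`γ` took different values at the ends of a gap of the intersection, it would do so at all nearby
pairs; by compactness some member of the chain has a gap with ends that near. -/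
theorem exists_minimal_isExcision {Y : Type*} [TopologicalSpace Y] [T2Space Y]
    {γ : unitInterval → Y} (hγ : Continuous γ) :
    ∃ C, Minimal (fun C => C ∈ {C | IsExcision γ C}) C := by
  refine zorn_superset _ fun c hc hch => ?_
  rcases c.eq_empty_or_nonempty with rfl | hne
  · refine ⟨univ, ⟨isClosed_univ, mem_univ _, mem_univ _, fun a _ b _ hab hd => ?_⟩, by simp⟩
    obtain ⟨x, hx⟩ := exists_between hab
    exact absurd (mem_univ x) (disjoint_left.1 hd hx)
  refine ⟨⋂₀ c, ⟨isClosed_sInter fun C hC => (hc hC).1, fun C hC => (hc hC).2.1,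
    fun C hC => (hc hC).2.2.1, fun a ha b hb hab hd => ?_⟩, fun s hs => sInter_subset_of_mem hs⟩
  by_contra hne'
  have hopen : IsOpen {p : unitInterval × unitInterval | γ p.1 ≠ γ p.2} :=
    isOpen_ne_fun (hγ.comp continuous_fst) (hγ.comp continuous_snd)
  obtain ⟨U, hU, V, hV, hUV⟩ := mem_nhds_prod_iff.1 (hopen.mem_nhds (show (a, b) ∈ _ from hne'))
  obtain ⟨m, ham, hmb⟩ := exists_between hab
  obtain ⟨a1, ha1, ha1U⟩ := exists_Ico_subset_of_mem_nhds hU ⟨m, ham⟩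
  obtain ⟨b1, hb1, hb1V⟩ := exists_Ioc_subset_of_mem_nhds hV ⟨m, hmb⟩
  set a2 := min a1 m
  set b2 := max b1 m
  have haa2 : a < a2 := lt_min ha1 ham
  have hb2b : b2 < b := max_lt hb1 hmb
  have h22 : a2 ≤ b2 := (min_le_right _ _).trans (le_max_right _ _)
  -- `[a2, b2]` lies in a gap of the intersection. If every member of the chain met it, compactness
  -- would produce a common point.
  obtain ⟨C, hC, hCe⟩ : ∃ C ∈ c, Icc a2 b2 ∩ C = ∅ := by
    by_contra hcon
    push Not at hcon
    have : Nonempty c := hne.to_subtype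
    have := (isCompact_Icc (a := a2) (b := b2)).inter_iInter_nonempty
      (fun C : c => (C : Set unitInterval)) (fun C => (hc C.2).1) ?_
    · obtain ⟨x, hx, hx'⟩ := this
      refine disjoint_left.1 hd (show x ∈ Ioo a b from ⟨haa2.trans_le hx.1, hx.2.trans_lt hb2b⟩) ?_
      intro C hC
      exact mem_iInter.1 hx' ⟨C, hC⟩
    · intro u
      rcases u.eq_empty_or_nonempty with rfl | hu
      · simpa using h22
      · obtain ⟨C, hCu, hC⟩ : ∃ C ∈ u, ∀ D ∈ u, (C : Set unitInterval) ⊆ D := by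
          refine u.exists_minimal hu |>.imp fun C hC => ⟨hC.1, fun D hD => ?_⟩
          rcases hch.total C.2 D.2 with h | h
          · exact h
          · exact hC.2 hD h
        refine (hcon C C.2).mono fun x hx => ⟨hx.1, ?_⟩
        simp only [mem_iInter]
        exact fun D hD => hC D hD hx.2
  have hCc := hc hC
  obtain ⟨a', ha'⟩ := (hCc.1.inter (isClosed_Iic (a := a2))).isCompact.exists_isGreatest
    ⟨0, hCc.2.1, unitInterval.nonneg'⟩
  obtain ⟨b', hb'⟩ := (hCc.1.inter (isClosed_Ici (a := b2))).isCompact.exists_isLeast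
    ⟨1, hCc.2.2.1, unitInterval.le_one'⟩
  have haC : a ∈ C := ha C hC
  have hbC : b ∈ C := hb C hC
  have h1 : a ≤ a' := ha'.2 ⟨haC, haa2.le⟩
  have h2 : b' ≤ b := hb'.2 ⟨hbC, hb2b.le⟩
  have h3 : a' < a2 := lt_of_le_of_ne ha'.1.2 fun h => by
    have : a2 ∈ Icc a2 b2 ∩ C := ⟨⟨le_rfl, h22⟩, h ▸ ha'.1.1⟩
    simp [hCe] at this
  have h4 : b2 < b' := lt_of_le_of_ne hb'.1.2 fun h => by
    have : b2 ∈ Icc a2 b2 ∩ C := ⟨⟨h22, le_rfl⟩, h ▸ hb'.1.1⟩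
    simp [hCe] at this
  have hgap : γ a' = γ b' := by
    refine hCc.2.2.2 a' ha'.1.1 b' hb'.1.1 (h3.trans_le (h22.trans h4.le)) ?_
    refine disjoint_left.2 fun x hx hxC => ?_
    rcases le_or_gt x a2 with h | h
    · exact absurd (ha'.2 ⟨hxC, h⟩) (not_le.2 hx.1)
    rcases le_or_gt b2 x with h' | h'
    · exact absurd (hb'.2 ⟨hxC, h'⟩) (not_le.2 hx.2)
    have : x ∈ Icc a2 b2 ∩ C := ⟨⟨h.le, h'.le⟩, hxC⟩
    simp [hCe] at this
  have := hUV (show (a', b') ∈ U ×ˢ V from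
    ⟨ha1U ⟨h1, h3.trans_le (min_le_left _ _)⟩, hb1V ⟨(le_max_left _ _).trans_lt h4, h2⟩⟩)
  exact this hgap

/-- Loop erasure: a path factors through a monotone selection `r` in such a way that it becomes
constant between any two parameters at which it takes the same value. -/
theorem exists_loopErasure {Y : Type*} [TopologicalSpace Y] [T2Space Y]
    {γ : unitInterval → Y} (hγ : Continuous γ) :
    ∃ r : unitInterval → unitInterval, Monotone r ∧ r 0 = 0 ∧ r 1 = 1 ∧ Continuous (γ ∘ r) ∧
      ∀ s t, s ≤ t → γ (r s) = γ (r t) → ∀ w ∈ Icc s t, γ (r w) = γ (r s) := by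
  obtain ⟨C, ⟨hCcl, h0, h1, hgap⟩, hmin⟩ := exists_minimal_isExcision hγ
  have hex : ∀ u : unitInterval, ∃ r, IsGreatest (C ∩ Iic u) r := fun u =>
    (hCcl.inter isClosed_Iic).isCompact.exists_isGreatest ⟨0, h0, unitInterval.nonneg'⟩
  choose r hr using hex
  have hrC : ∀ u, r u ∈ C := fun u => (hr u).1.1
  have hrle : ∀ u, r u ≤ u := fun u => (hr u).1.2
  have hrge : ∀ u, ∀ c ∈ C, c ≤ u → c ≤ r u := fun u c hc hcu => (hr u).2 ⟨hc, hcu⟩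
  have hrid : ∀ u ∈ C, r u = u := fun u hu => le_antisymm (hrle u) (hrge u u hu le_rfl)
  have hrmono : Monotone r := fun u v huv => hrge v _ (hrC u) ((hrle u).trans huv)
  -- Minimality: when `γ s = γ t`, the part of `C` strictly between `s` and `t` can be discarded
  -- without losing the excision property, so it was already empty.
  have hkey : ∀ s ∈ C, ∀ t ∈ C, s < t → γ s = γ t → Disjoint (Ioo s t) C := by
    intro s hs t ht hst hγst
    have hE : IsExcision γ (C \ Ioo s t) := by
      refine ⟨hCcl.sdiff isOpen_Ioo, ⟨h0, fun h => not_lt.2 unitInterval.nonneg' h.1⟩,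
        ⟨h1, fun h => not_lt.2 unitInterval.le_one' h.2⟩, fun a ha b hb hab hd => ?_⟩
      by_cases hint : Disjoint (Ioo a b) C
      · exact hgap a ha.1 b hb.1 hab hint
      · obtain ⟨x, hx, hxC⟩ := not_disjoint_iff.1 hint
        have hxst : x ∈ Ioo s t := by
          by_contra hxn
          exact disjoint_left.1 hd hx ⟨hxC, hxn⟩
        have has : a ≤ s := by
          by_contra h
          exact ha.2 ⟨not_le.1 h, hx.1.trans hxst.2⟩
        have htb : t ≤ b := by
          by_contra h
          exact hb.2 ⟨hxst.1.trans hx.2, not_le.1 h⟩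
        have has' : a = s := by
          by_contra h
          exact disjoint_left.1 hd (show s ∈ Ioo a b from
            ⟨lt_of_le_of_ne has h, hst.trans_le htb⟩) ⟨hs, fun h => lt_irrefl _ h.1⟩
        have htb' : t = b := by
          by_contra h
          exact disjoint_left.1 hd (show t ∈ Ioo a b from
            ⟨has.trans_lt hst, lt_of_le_of_ne htb h⟩) ⟨ht, fun h => lt_irrefl _ h.2⟩
        rw [has', ← htb', hγst]
    have := hmin hE sdiff_subset
    exact disjoint_left.2 fun x hx hxC => (this hxC).2 hx
  refine ⟨r, hrmono, hrid 0 h0, hrid 1 h1, ?_, ?_⟩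
  · refine continuous_iff_continuousAt.2 fun u => ?_
    by_cases hu : u ∈ C
    · refine continuousAt_iff_continuous_left_right.2 ⟨?_, ?_⟩
      -- From the left, either `u` ends a gap, on which `γ ∘ r` is constant with the value `γ u`, or
      -- `u` is a limit of points of `C` and `r` itself tends to `u`.
      · by_cases hg : ∃ l < u, Disjoint (Ioo l u) C
        · obtain ⟨l, hl, hd⟩ := hg
          have hau : r l < u := (hrle l).trans_lt hl
          have hd' : Disjoint (Ioo (r l) u) C := by
            refine disjoint_left.2 fun x hx hxC => ?_
            rcases le_or_gt x l with h | h
            · exact absurd (hrge l x hxC h) (not_le.2 hx.1)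
            · exact disjoint_left.1 hd ⟨h, hx.2⟩ hxC
          have hγa := hgap _ (hrC l) u hu hau hd'
          have : ∀ᶠ v in 𝓝[≤] u, (γ ∘ r) v = (γ ∘ r) u := by
            filter_upwards [Ioc_mem_nhdsLE hau] with v hv
            rcases hv.2.eq_or_lt with h | h
            · rw [h]
            · have : r v = r l := by
                refine le_antisymm ?_ (hrge v _ (hrC l) hv.1.le)
                by_contra hcon
                exact disjoint_left.1 hd' ⟨not_le.1 hcon, (hrle v).trans_lt h⟩ (hrC v)
              simp only [Function.comp, this, hγa, hrid u hu]
          exact (tendsto_congr' this).2 tendsto_const_nhds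
        · push Not at hg
          have : Tendsto r (𝓝[≤] u) (𝓝 u) := by
            refine tendsto_order.2 ⟨fun l hl => ?_, fun l hl => ?_⟩
            · obtain ⟨c, hc, hcC⟩ := not_disjoint_iff.1 (hg l hl)
              filter_upwards [Ioc_mem_nhdsLE hc.2] with v hv
              exact hc.1.trans_le (hrge v c hcC hv.1.le)
            · filter_upwards [self_mem_nhdsWithin] with v hv
              exact ((hrle v).trans hv).trans_lt hl
          have h2 := (hγ.tendsto u).comp this
          simpa [ContinuousWithinAt, hrid u hu] using h2
      · have : Tendsto r (𝓝[≥] u) (𝓝 u) := by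
          have hid : Tendsto (fun v : unitInterval => v) (𝓝[≥] u) (𝓝 u) :=
            tendsto_id.mono_left nhdsWithin_le_nhds
          refine tendsto_of_tendsto_of_tendsto_of_le_of_le' tendsto_const_nhds hid ?_ ?_
          · filter_upwards [self_mem_nhdsWithin] with v hv
            exact hrge v u hu hv
          · exact Eventually.of_forall hrle
        have h2 := (hγ.tendsto u).comp this
        simpa [ContinuousWithinAt, hrid u hu] using h2
    · have hsm : Tendsto (fun v => uIcc u v) (𝓝 u) (𝓝 u).smallSets :=
        tendsto_const_nhds.uIcc tendsto_id
      have hev := tendsto_smallSets_iff.1 hsm _ (hCcl.isOpen_compl.mem_nhds hu)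
      have : ∀ᶠ v in 𝓝 u, (γ ∘ r) v = (γ ∘ r) u := by
        filter_upwards [hev] with v hv
        have : r v = r u := by
          rcases le_total u v with h | h
          · rw [uIcc_of_le h] at hv
            refine le_antisymm (hrge u _ (hrC v) ?_) (hrmono h)
            by_contra hcon
            exact hv ⟨(not_le.1 hcon).le, hrle v⟩ (hrC v)
          · rw [uIcc_of_ge h] at hv
            refine le_antisymm (hrmono h) (hrge v _ (hrC u) ?_)
            by_contra hcon
            exact hv ⟨(not_le.1 hcon).le, hrle u⟩ (hrC u)
        simp [Function.comp, this]
      exact (tendsto_congr' this).2 tendsto_const_nhds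
  · intro s t hst heq w hw
    have hsw := hrmono hw.1
    have hwt := hrmono hw.2
    rcases (hrmono hst).eq_or_lt with h | h
    · rw [le_antisymm (hwt.trans h.ge) hsw]
    · have hd := hkey _ (hrC s) _ (hrC t) h heq
      rcases hsw.eq_or_lt with h' | h'
      · rw [h']
      rcases hwt.eq_or_lt with h'' | h''
      · rw [h'', heq]
      exact absurd (hrC w) (disjoint_left.1 hd ⟨h', h''⟩)

/-- A path that is constant between parameters with equal values can be reparametrised, by a
monotone map, to an injective path. -/
theorem exists_monotone_factor {Y : Type*} [MetricSpace Y] {δ : unitInterval → Y}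
    (hδ : Continuous δ) (hc : ∀ s t, s ≤ t → δ s = δ t → ∀ w ∈ Icc s t, δ w = δ s)
    (hne : δ 0 ≠ δ 1) :
    ∃ ψ : unitInterval → unitInterval, Continuous ψ ∧ Monotone ψ ∧ ψ 0 = 0 ∧ ψ 1 = 1 ∧
      ∀ s t, ψ s = ψ t ↔ δ s = δ t := by
  -- `D q s` is the largest distance from `δ q` reached by `δ` on `[q, s]`, and is `0` for `s ≤ q`.
  -- It is continuous and non-decreasing in `s`; a weighted sum over a dense sequence of `q` detects
  -- every movement of `δ`.
  let F : unitInterval → unitInterval → unitInterval → ℝ := fun q s r =>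
    dist (δ q) (δ (max q (min r s)))
  let D : unitInterval → unitInterval → ℝ := fun q s => sSup (F q s '' univ)
  have hFc : ∀ q, Continuous ↿(F q) := fun q => by
    refine Continuous.dist continuous_const (hδ.comp ?_)
    exact continuous_const.max (continuous_snd.min continuous_fst)
  have hDc : ∀ q, Continuous (D q) := fun q => isCompact_univ.continuous_sSup (hFc q)
  have hbdd : ∀ q s, BddAbove (F q s '' univ) := fun q s =>
    isCompact_univ.bddAbove_image ((hFc q).comp (Continuous.prodMk_right s)).continuousOn
  have hFD : ∀ q s r, F q s r ≤ D q s := fun q s r => le_csSup (hbdd q s) ⟨r, mem_univ _, rfl⟩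
  have hDle : ∀ q s b, (∀ r, F q s r ≤ b) → D q s ≤ b := fun q s b hb =>
    csSup_le ⟨_, 0, mem_univ _, rfl⟩ (by rintro _ ⟨r, -, rfl⟩; exact hb r)
  have hD0 : ∀ q s, 0 ≤ D q s := fun q s => dist_nonneg.trans (hFD q s 0)
  have hDmono : ∀ q, Monotone (D q) := fun q s t hst => by
    refine hDle _ _ _ fun r => ?_
    have : F q s r = F q t (min r s) := by
      simp only [F, min_assoc, min_eq_left hst]
    rw [this]
    exact hFD _ _ _
  have hDconst : ∀ q s t, s ≤ t → δ s = δ t → D q s = D q t := by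
    intro q s t hst heq
    have : F q s = F q t := by
      funext r
      have hxy : max q (min r s) ≤ max q (min r t) := max_le_max le_rfl (min_le_min le_rfl hst)
      rcases hxy.eq_or_lt with h | h
      · simp only [F, h]
      have hrs : s ≤ r := by
        by_contra hcon
        push Not at hcon
        rw [min_eq_left hcon.le, min_eq_left (hcon.le.trans hst)] at h
        exact lt_irrefl _ h
      rw [min_eq_right hrs] at h
      have hq : q ≤ t := by
        by_contra hcon
        push Not at hcon
        rw [max_eq_left (hst.trans hcon.le), max_eq_left ((min_le_right _ _).trans hcon.le)] at h
        exact lt_irrefl _ h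
      have e1 := hc s t hst heq (max q s) ⟨le_max_right _ _, max_le hq hst⟩
      have e2 := hc s t hst heq (max q (min r t))
        ⟨(le_max_right q s).trans h.le, max_le hq (min_le_right _ _)⟩
      simp only [F, min_eq_right hrs, e1, e2]
    simp only [D, this]
  let q : ℕ → unitInterval := TopologicalSpace.denseSeq unitInterval
  let f : ℕ → unitInterval → ℝ := fun k s => (1 / 2 : ℝ) ^ k * min 1 (D (q k) s)
  have hf0 : ∀ k s, 0 ≤ f k s := fun k s => by
    have := hD0 (q k) s
    positivity
  have hf1 : ∀ k s, f k s ≤ (1 / 2 : ℝ) ^ k := fun k s =>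
    mul_le_of_le_one_right (by positivity) (min_le_left _ _)
  have hsum : ∀ s, Summable fun k => f k s := fun s =>
    Summable.of_nonneg_of_le (fun k => hf0 k s) (fun k => hf1 k s) summable_geometric_two
  have hfmono : ∀ k, Monotone (f k) := fun k s t hst =>
    mul_le_mul_of_nonneg_left (min_le_min le_rfl (hDmono _ hst)) (by positivity)
  let φ : unitInterval → ℝ := fun s => ∑' k, f k s
  have hφc : Continuous φ := by
    refine continuous_tsum (fun k => ?_) summable_geometric_two (fun k s => ?_)
    · exact continuous_const.mul (continuous_const.min (hDc _))
    · rw [Real.norm_of_nonneg (hf0 k s)]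
      exact hf1 k s
  have hφmono : Monotone φ := fun s t hst => (hsum s).tsum_le_tsum (fun k => hfmono k hst) (hsum t)
  have hφle : ∀ s t, s ≤ t → (φ s = φ t ↔ δ s = δ t) := by
    intro s t hst
    refine ⟨fun h => ?_, fun h => ?_⟩
    · rcases hst.eq_or_lt with rfl | hlt
      · rfl
      have hk : ∀ k, f k s = f k t := by
        by_contra hcon
        push Not at hcon
        obtain ⟨k, hk⟩ := hcon
        exact absurd h (ne_of_lt ((hsum s).tsum_lt_tsum (i := k) (fun k => hfmono k hst)
          (lt_of_le_of_ne (hfmono k hst) hk) (hsum t)))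
      -- If the sum does not grow from `s` to `t`, then no term does; for `q k` in between, the term
      -- vanishes at `s`, hence at `t`, so `δ` does not move on `[q k, t]`.
      have hqt : ∀ k, q k ∈ Ioo s t → δ (q k) = δ t := by
        intro k hkq
        have h1 : D (q k) s = 0 := by
          refine le_antisymm (hDle _ _ _ fun r => ?_) (hD0 _ _)
          have : max (q k) (min r s) = q k := max_eq_left ((min_le_right _ _).trans hkq.1.le)
          simp [F, this]
        have h2 := hk k
        simp only [f, h1] at h2
        have h3 : min 1 (D (q k) t) = 0 := by
          have : (0 : ℝ) < (1 / 2) ^ k := by positivity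
          rw [min_eq_right zero_le_one, mul_zero, eq_comm, mul_eq_zero] at h2
          exact h2.resolve_left this.ne'
        have h4 : D (q k) t = 0 := by
          rcases min_choice 1 (D (q k) t) with h | h <;> rw [h] at h3
          · norm_num at h3
          · exact h3
        have h5 := hFD (q k) t t
        rw [h4] at h5
        have h6 : dist (δ (q k)) (δ (max (q k) (min t t))) ≤ 0 := h5
        rw [min_self, max_eq_right hkq.2.le] at h6
        exact dist_le_zero.1 h6
      have hcl : s ∈ closure (Ioo s t ∩ range q) := by
        have : Dense (range q) := TopologicalSpace.denseRange_denseSeq _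
        have h2 := this.open_subset_closure_inter (isOpen_Ioo (a := s) (b := t))
        have h3 := closure_minimal h2 isClosed_closure
        refine h3 ?_
        rw [closure_Ioo hlt.ne]
        exact left_mem_Icc.2 hst
      have hset : IsClosed {x | δ x = δ t} := isClosed_eq hδ continuous_const
      refine (closure_minimal ?_ hset) hcl
      rintro _ ⟨hx, k, rfl⟩
      exact hqt k hx
    · exact tsum_congr fun k => by simp only [f, hDconst (q k) s t hst h]
  have hφ : ∀ s t, φ s = φ t ↔ δ s = δ t := fun s t => by
    rcases le_total s t with h | h
    · exact hφle s t h
    · rw [eq_comm, hφle t s h, eq_comm]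
  have hL : 0 < φ 1 - φ 0 := by
    have := hφmono (unitInterval.nonneg' (t := 1))
    have h2 : φ 0 ≠ φ 1 := fun h => hne ((hφ 0 1).1 h)
    exact sub_pos.2 (lt_of_le_of_ne this h2)
  refine ⟨fun s => ⟨(φ s - φ 0) / (φ 1 - φ 0), ?_, ?_⟩, ?_, ?_, ?_, ?_, ?_⟩
  · exact div_nonneg (sub_nonneg.2 (hφmono unitInterval.nonneg')) hL.le
  · exact (div_le_one hL).2 (sub_le_sub_right (hφmono unitInterval.le_one') _)
  · exact ((hφc.sub continuous_const).div_const _).subtype_mk _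
  · intro s t hst
    exact Subtype.mk_le_mk.2 (div_le_div_of_nonneg_right (sub_le_sub_right (hφmono hst) _) hL.le)
  · ext; simp
  · ext; simp [div_self hL.ne']
  · intro s t
    refine Iff.trans Subtype.mk_eq_mk ?_
    rw [div_left_inj' hL.ne', sub_left_inj, hφ]

/-- The arc theorem, in the form: a path between two distinct points can be replaced by an injective
one, which is monotone if the path is. -/
theorem exists_injective_path {Y : Type*} [TopologicalSpace Y] [TopologicalSpace.MetrizableSpace Y]
    [Preorder Y] {γ : unitInterval → Y} (hγ : Continuous γ) (hmono : Monotone γ)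
    (hne : γ 0 ≠ γ 1) :
    ∃ σ : unitInterval → Y, Continuous σ ∧ Monotone σ ∧ Function.Injective σ ∧
      σ 0 = γ 0 ∧ σ 1 = γ 1 := by
  let := TopologicalSpace.metrizableSpaceMetric Y
  obtain ⟨r, hr, hr0, hr1, hrc, hrconst⟩ := exists_loopErasure hγ
  obtain ⟨ψ, hψc, hψm, hψ0, hψ1, hψ⟩ := exists_monotone_factor hrc hrconst
    (by simpa [hr0, hr1] using hne)
  have hsurj : Function.Surjective ψ := by
    intro y
    have := intermediate_value_univ (0 : unitInterval) 1 hψc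
    rw [hψ0, hψ1] at this
    exact this ⟨unitInterval.nonneg', unitInterval.le_one'⟩
  let g := Function.surjInv hsurj
  have hg : ∀ y, ψ (g y) = y := Function.surjInv_eq hsurj
  have hgψ : ∀ s, γ (r (g (ψ s))) = γ (r s) := fun s => (hψ _ _).1 (hg _)
  -- The right inverse `g` need not be continuous; continuity of `γ ∘ r ∘ g` is checked after
  -- composition with the quotient map `ψ`, where it becomes `γ ∘ r`.
  have hq : Topology.IsQuotientMap ψ := hψc.isClosedMap.isQuotientMap hψc hsurj
  refine ⟨γ ∘ r ∘ g, ?_, ?_, ?_, ?_, ?_⟩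
  · rw [hq.continuous_iff]
    convert hrc using 1
    funext s
    exact hgψ s
  · intro a b hab
    rcases hab.eq_or_lt with rfl | hlt
    · exact le_rfl
    refine hmono (hr ?_)
    by_contra hcon
    have := hψm (not_le.1 hcon).le
    rw [hg, hg] at this
    exact absurd hlt (not_lt.2 this)
  · intro a b hab
    have := (hψ (g a) (g b)).2 hab
    rwa [hg, hg] at this
  · have := hgψ 0
    rwa [hψ0, hr0] at this
  · have := hgψ 1
    rwa [hψ1, hr1] at this

end Arcs

/-! ### Polish and locally compact structure, σ-compact sets -/

section Spaces

variable {X : Type*} [TopologicalCausalSpace X]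

instance : PolishSpace X := by
  obtain ⟨d, hd, hp⟩ := TopologicalCausalSpace.proper (X := X)
  have h : @PolishSpace X d.toUniformSpace.toTopologicalSpace := inferInstance
  rwa [hd] at h

instance : LocallyCompactSpace X := by
  obtain ⟨d, hd, hp⟩ := TopologicalCausalSpace.proper (X := X)
  have h := (inferInstance : @LocallyCompactSpace X d.toUniformSpace.toTopologicalSpace)
  rwa [hd] at h

instance : OrderClosedTopology X := ⟨TopologicalCausalSpace.isClosed_le⟩

variable {H : Set X} [hH : Fact (IsClosed H)]

instance : PolishSpace H := hH.out.polishSpace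

instance : LocallyCompactSpace H := hH.out.locallyCompactSpace

/-- Relations defined by `≤` and `≠` are of this form. Unlike a general Borel set, a σ-compact set
has σ-compact, hence Borel, projections. -/
theorem isSigmaCompact_of_isClosed_inter_isOpen {Y : Type*} [TopologicalSpace Y]
    [LocallyCompactSpace Y] [SecondCountableTopology Y] {C U : Set Y} (hC : IsClosed C)
    (hU : IsOpen U) : IsSigmaCompact (C ∩ U) := by
  have : LocallyCompactSpace (C ∩ U : Set Y) :=
    (hC.isLocallyClosed.inter hU.isLocallyClosed).locallyCompactSpace
  exact isSigmaCompact_iff_sigmaCompactSpace.2 inferInstance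

theorem _root_.IsSigmaCompact.measurableSet' {Y : Type*} [TopologicalSpace Y] [T2Space Y]
    [MeasurableSpace Y] [BorelSpace Y] {s : Set Y} (hs : IsSigmaCompact s) : MeasurableSet s := by
  obtain ⟨K, hK, rfl⟩ := hs
  exact MeasurableSet.iUnion fun n => (hK n).isClosed.measurableSet

instance (Y : Type*) [TopologicalSpace Y] [PolishSpace Y] : PolishSpace C(unitInterval, Y) := by
  let := TopologicalSpace.upgradeIsCompletelyMetrizable Y
  infer_instance

/-- A map into `C([0,1]; Y)` is measurable as soon as its evaluations are. -/
theorem measurable_curve_iff {Ω Y : Type*} [MeasurableSpace Ω] [TopologicalSpace Y] [PolishSpace Y]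
    [MeasurableSpace Y] [BorelSpace Y] {f : Ω → C(unitInterval, Y)} :
    Measurable f ↔ ∀ t, Measurable fun ω => f ω t := by
  refine ⟨fun hf t => (continuous_eval_const t).measurable.comp hf, fun hf => ?_⟩
  let e : C(unitInterval, Y) → ℕ → Y := fun γ k => γ (TopologicalSpace.denseSeq unitInterval k)
  have he : Continuous e := continuous_pi fun k => continuous_eval_const _
  have hinj : Function.Injective e := by
    intro γ₁ γ₂ h
    refine DFunLike.coe_injective (Continuous.ext_on
      (TopologicalSpace.denseRange_denseSeq unitInterval) γ₁.continuous γ₂.continuous ?_)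
    rintro _ ⟨k, rfl⟩
    exact congrFun h k
  -- Lusin-Souslin: an injective continuous map between Polish spaces is a Borel embedding.
  have hemb : MeasurableEmbedding e := he.measurableEmbedding hinj
  refine hemb.measurable_comp_iff.1 (measurable_pi_iff.2 fun k => hf _)

end Spaces

section

/-! ### Concatenation of arcs and non-branching -/

section Concatenation

variable {Y : Type*} [TopologicalSpace Y] [Preorder Y]

theorem _root_.Path.monotone_trans {x y z : Y} {p : Path x y} {p' : Path y z} (hp : Monotone p)
    (hp' : Monotone p') : Monotone (p.trans p') := by
  intro s t hst
  have hst' : (s : ℝ) ≤ t := hst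
  rw [Path.trans_apply, Path.trans_apply]
  split_ifs with h1 h2 h2
  · exact hp (Subtype.mk_le_mk.2 (by linarith))
  · have e1 := hp (unitInterval.le_one' (t := ⟨2 * s, (unitInterval.mul_pos_mem_iff zero_lt_two).2
      ⟨s.2.1, h1⟩⟩))
    have e2 := hp' (unitInterval.nonneg' (t := ⟨2 * t - 1, unitInterval.two_mul_sub_one_mem_iff.2
      ⟨(not_le.1 h2).le, t.2.2⟩⟩))
    rw [p.target] at e1
    rw [p'.source] at e2
    exact e1.trans e2
  · exact absurd (hst'.trans h2) h1
  · exact hp' (Subtype.mk_le_mk.2 (by linarith))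

theorem _root_.Path.injective_trans (hanti : ∀ x y : Y, x ≤ y → y ≤ x → x = y) {x y z : Y}
    {p : Path x y} {p' : Path y z} (hp : Monotone p) (hp' : Monotone p')
    (hpi : Function.Injective p) (hpi' : Function.Injective p') :
    Function.Injective (p.trans p') := by
  have key : ∀ s t : unitInterval, (s : ℝ) ≤ 1 / 2 → ¬ (t : ℝ) ≤ 1 / 2 →
      p.trans p' s ≠ p.trans p' t := by
    intro s t h1 h2 h
    rw [Path.trans_apply, Path.trans_apply, dif_pos h1, dif_neg h2] at h
    have e1 := hp (unitInterval.le_one' (t := ⟨2 * s, (unitInterval.mul_pos_mem_iff zero_lt_two).2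
      ⟨s.2.1, h1⟩⟩))
    have e2 := hp' (unitInterval.nonneg' (t := ⟨2 * t - 1, unitInterval.two_mul_sub_one_mem_iff.2
      ⟨(not_le.1 h2).le, t.2.2⟩⟩))
    rw [p.target] at e1
    rw [p'.source] at e2
    rw [h] at e1
    have e3 := hanti _ _ e1 e2
    have e4 := hpi' (e3.trans p'.source.symm)
    have e5 : 2 * (t : ℝ) - 1 = 0 := congrArg Subtype.val e4
    exact h2 (by linarith)
  intro s t h
  by_cases h1 : (s : ℝ) ≤ 1 / 2 <;> by_cases h2 : (t : ℝ) ≤ 1 / 2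
  · rw [Path.trans_apply, Path.trans_apply, dif_pos h1, dif_pos h2] at h
    have : 2 * (s : ℝ) = 2 * t := congrArg Subtype.val (hpi h)
    exact Subtype.ext (by linarith)
  · exact absurd h (key s t h1 h2)
  · exact absurd h.symm (key t s h2 h1)
  · rw [Path.trans_apply, Path.trans_apply, dif_neg h1, dif_neg h2] at h
    have : 2 * (s : ℝ) - 1 = 2 * t - 1 := congrArg Subtype.val (hpi' h)
    exact Subtype.ext (by linarith)

/-- In a non-branching space, two points in the future of a non-initial point are comparable. -/
theorem comparable_of_nonBranching (hanti : ∀ x y : Y, x ≤ y → y ≤ x → x = y)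
    (harc : ∀ x y : Y, x ≤ y → x ≠ y → ∃ σ : unitInterval → Y, Continuous σ ∧ Monotone σ ∧
      Function.Injective σ ∧ σ 0 = x ∧ σ 1 = y)
    (hbr : ∀ γ₁ γ₂ : unitInterval → Y,
      Continuous γ₁ → Monotone γ₁ → Function.Injective γ₁ →
      Continuous γ₂ → Monotone γ₂ → Function.Injective γ₂ →
      γ₁ 0 = γ₂ 0 →
      γ₁ ⟨1 / 2, by norm_num, by norm_num⟩ = γ₂ ⟨1 / 2, by norm_num, by norm_num⟩ →
      range γ₁ ⊆ range γ₂ ∨ range γ₂ ⊆ range γ₁)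
    {w x y z : Y} (hwx : w ≤ x) (hne : w ≠ x) (hxy : x ≤ y) (hxz : x ≤ z) : y ≤ z ∨ z ≤ y := by
  by_cases h1 : x = y
  · exact Or.inl (h1 ▸ hxz)
  by_cases h2 : x = z
  · exact Or.inr (h2 ▸ hxy)
  -- The common first half from `w` to `x` makes the two concatenated arcs agree at `0` and at
  -- `1/2`, as the non-branching hypothesis requires. The end of one arc then lies on the other,
  -- hence below its end.
  obtain ⟨σ₀, c₀, m₀, i₀, s₀, t₀⟩ := harc w x hwx hne
  obtain ⟨σ₁, c₁, m₁, i₁, s₁, t₁⟩ := harc x y hxy h1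
  obtain ⟨σ₂, c₂, m₂, i₂, s₂, t₂⟩ := harc x z hxz h2
  let p₀ : Path w x := ⟨⟨σ₀, c₀⟩, s₀, t₀⟩
  let p₁ : Path x y := ⟨⟨σ₁, c₁⟩, s₁, t₁⟩
  let p₂ : Path x z := ⟨⟨σ₂, c₂⟩, s₂, t₂⟩
  have M₁ : Monotone (p₀.trans p₁) := Path.monotone_trans (p := p₀) (p' := p₁) m₀ m₁
  have M₂ : Monotone (p₀.trans p₂) := Path.monotone_trans (p := p₀) (p' := p₂) m₀ m₂
  have hhalf : ∀ {b : Y} (p : Path x b), p₀.trans p ⟨1 / 2, by norm_num, by norm_num⟩ = x := by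
    intro b p
    rw [Path.trans_apply, dif_pos le_rfl]
    convert p₀.target
    norm_num
  rcases hbr (p₀.trans p₁) (p₀.trans p₂) (p₀.trans p₁).continuous M₁
    (Path.injective_trans hanti (p := p₀) (p' := p₁) m₀ m₁ i₀ i₁)
    (p₀.trans p₂).continuous M₂ (Path.injective_trans hanti (p := p₀) (p' := p₂) m₀ m₂ i₀ i₂)
    (by rw [Path.source, Path.source]) (by rw [hhalf, hhalf]) with h | h
  · obtain ⟨t, ht⟩ := h ⟨1, (p₀.trans p₁).target⟩
    have := M₂ (unitInterval.le_one' (t := t))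
    rw [ht, Path.target] at this
    exact Or.inl this
  · obtain ⟨t, ht⟩ := h ⟨1, (p₀.trans p₂).target⟩
    have := M₁ (unitInterval.le_one' (t := t))
    rw [ht, Path.target] at this
    exact Or.inr this

end Concatenation

/-! ### Order structure of the rays -/

variable {X : Type*} [TopologicalCausalSpace X] {H : Set X}

theorem WeaklyConvex.exists_arc (hwc : WeaklyConvex H) {x y : H} (hxy : x ≤ y) (hne : x ≠ y) :
    ∃ σ : unitInterval → H, Continuous σ ∧ Monotone σ ∧ Function.Injective σ ∧
      σ 0 = x ∧ σ 1 = y := by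
  obtain ⟨γ, ⟨hc, hm, -⟩, h0, h1⟩ := hwc x y hxy hne
  obtain ⟨σ, h⟩ := exists_injective_path hc hm (by rwa [h0, h1])
  exact ⟨σ, h.1, h.2.1, h.2.2.1, h.2.2.2.1.trans h0, h.2.2.2.2.trans h1⟩

theorem mem_noEnds {z : H} :
    z ∈ noEnds H ↔ (∃ x : H, x ≤ z ∧ x ≠ z) ∧ ∃ y : H, z ≤ y ∧ y ≠ z := by
  simp [noEnds, initialPoints, finalPoints]

theorem eq_of_le_initial {x z : H} (hx : x ∈ initialPoints H) (hz : z ≤ x) : z = x := by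
  by_contra h
  exact hx ⟨z, hz, h⟩

theorem eq_of_final_le {x z : H} (hx : x ∈ finalPoints H) (hz : x ≤ z) : z = x := by
  by_contra h
  exact hx ⟨z, hz, h⟩

theorem initial_notMem_noEnds {x : H} (hx : x ∈ initialPoints H) : x ∉ noEnds H :=
  fun h => h (Or.inl hx)

theorem final_notMem_noEnds {x : H} (hx : x ∈ finalPoints H) : x ∉ noEnds H :=
  fun h => h (Or.inr hx)

theorem mem_noEnds_of_between {x y z : H} (hxz : x ≤ z) (hzy : z ≤ y)
    (hx : x ≠ z ∨ x ∈ noEnds H) (hy : y ≠ z ∨ y ∈ noEnds H) : z ∈ noEnds H := by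
  by_cases h1 : x = z
  · rcases hx with hx | hx
    · exact absurd h1 hx
    · exact h1 ▸ hx
  by_cases h2 : y = z
  · rcases hy with hy | hy
    · exact absurd h2 hy
    · exact h2 ▸ hy
  exact mem_noEnds.2 ⟨⟨x, hxz, h1⟩, ⟨y, hzy, h2⟩⟩

theorem Related.symm {x y : noEnds H} (h : Related x y) : Related y x := Or.symm h

theorem Related.refl (x : noEnds H) : Related x x := Or.inl le_rfl

/-- The points of `H`, including end-points, on the ray through `β`. -/
def OnRay (β : noEnds H) (x : H) : Prop := x ≤ (β : H) ∨ (β : H) ≤ x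

theorem onRay_coe {β x : noEnds H} : OnRay β x ↔ Related x β := Iff.rfl

theorem OnRay.le_of_initial {β : noEnds H} {x : H} (h : OnRay β x) (hx : x ∈ initialPoints H) :
    x ≤ β := by
  rcases h with h | h
  · exact h
  · exact (eq_of_le_initial hx h).ge

theorem OnRay.le_of_final {β : noEnds H} {x : H} (h : OnRay β x) (hx : x ∈ finalPoints H) :
    (β : H) ≤ x := by
  rcases h with h | h
  · exact (eq_of_final_le hx h).le
  · exact h

theorem OnRay.notMem_final {β : noEnds H} {x : H} (h : OnRay β x) (hx : x ∈ initialPoints H) :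
    x ∉ finalPoints H := fun hf =>
  final_notMem_noEnds hf ((eq_of_final_le hf (h.le_of_initial hx)) ▸ β.2)

/-- A path issuing from an initial point enters the past of each point of its ray. -/
theorem exists_le_of_initial {σ : unitInterval → H} (hc : Continuous σ)
    (h0 : σ 0 ∈ initialPoints H) (y : noEnds H)
    (hrel : ∀ t ∈ Ioo (0 : unitInterval) 1, OnRay y (σ t)) :
    ∃ t ∈ Ioo (0 : unitInterval) 1, σ t ≤ y := by
  by_contra hcon
  push Not at hcon
  have hcl : IsClosed {t | (y : H) ≤ σ t} := isClosed_le continuous_const hc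
  have h : (y : H) ≤ σ 0 := by
    refine closure_minimal (s := Ioo 0 1) (fun t ht => ?_) hcl ?_
    · exact (hrel t ht).resolve_left (hcon t ht)
    · rw [closure_Ioo zero_ne_one]
      exact left_mem_Icc.2 unitInterval.nonneg'
  exact initial_notMem_noEnds h0 (eq_of_le_initial h0 h ▸ y.2)

theorem exists_ge_of_final {σ : unitInterval → H} (hc : Continuous σ)
    (h1 : σ 1 ∈ finalPoints H) (y : noEnds H)
    (hrel : ∀ t ∈ Ioo (0 : unitInterval) 1, OnRay y (σ t)) :
    ∃ t ∈ Ioo (0 : unitInterval) 1, (y : H) ≤ σ t := by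
  by_contra hcon
  push Not at hcon
  have hcl : IsClosed {t | σ t ≤ y} := isClosed_le hc continuous_const
  have h : σ 1 ≤ y := by
    refine closure_minimal (s := Ioo 0 1) (fun t ht => ?_) hcl ?_
    · exact (hrel t ht).resolve_right (hcon t ht)
    · rw [closure_Ioo zero_ne_one]
      exact right_mem_Icc.2 unitInterval.nonneg'
  exact final_notMem_noEnds h1 (eq_of_final_le h1 h ▸ y.2)

theorem mem_noEnds_of_arc {σ : unitInterval → H} (hm : Monotone σ) (hi : Function.Injective σ)
    {t : unitInterval} (ht : t ∈ Ioo (0 : unitInterval) 1) : σ t ∈ noEnds H :=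
  mem_noEnds_of_between (hm unitInterval.nonneg') (hm unitInterval.le_one')
    (Or.inl fun h => ht.1.ne (hi h)) (Or.inl fun h => ht.2.ne' (hi h))

theorem half_mem_Ioo : (⟨1 / 2, by norm_num, by norm_num⟩ : unitInterval) ∈ Ioo 0 1 :=
  ⟨Subtype.mk_lt_mk.2 (by norm_num), Subtype.mk_lt_mk.2 (by norm_num)⟩

variable [MeasurableSpace X]

/-- The standing assumptions under which `H` is ruled by rays. -/
structure RaySetting (H : Set X) (G : noEnds H → ℝ) : Prop where
  weaklyConvex : WeaklyConvex H
  nonBranching : NullNonBranching H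
  gauge : IsGauge H G

variable {G : noEnds H → ℝ}

/-- The gauge axiom concerns curves inside `H°` defined on a real interval, whereas an arc may start
or end outside `H°`. The parameters at which it is in `H°` form an interval by monotonicity, and the
axiom is applied there. -/
theorem IsGauge.strictMono_of_arc (hG : IsGauge H G) {σ : unitInterval → H} (hc : Continuous σ)
    (hm : Monotone σ) (hi : Function.Injective σ) :
    StrictMono (fun t : {t // σ t ∈ noEnds H} => G ⟨σ t, t.2⟩) ∧
      Continuous (fun t : {t // σ t ∈ noEnds H} => G ⟨σ t, t.2⟩) := by
  by_cases hsub : Subsingleton {t // σ t ∈ noEnds H}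
  · exact ⟨fun a b hab => absurd (Subsingleton.elim a b) hab.ne, continuous_of_const
      fun a b => by rw [Subsingleton.elim a b]⟩
  rw [not_subsingleton_iff_nontrivial] at hsub
  obtain ⟨a, b, hab⟩ := hsub
  let I : Set ℝ := {t | ∃ h : t ∈ unitInterval, σ ⟨t, h⟩ ∈ noEnds H}
  have hI : I.OrdConnected := by
    refine ⟨fun s hs t ht u hu => ?_⟩
    obtain ⟨hs1, hs2⟩ := hs
    obtain ⟨ht1, ht2⟩ := ht
    have hu1 : u ∈ unitInterval := ⟨hs1.1.trans hu.1, hu.2.trans ht1.2⟩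
    exact ⟨hu1, mem_noEnds_of_between (hm (show (⟨s, hs1⟩ : unitInterval) ≤ ⟨u, hu1⟩ from hu.1))
      (hm (show (⟨u, hu1⟩ : unitInterval) ≤ ⟨t, ht1⟩ from hu.2)) (Or.inr hs2) (Or.inr ht2)⟩
  let γ : I → noEnds H := fun t => ⟨σ ⟨t, t.2.1⟩, t.2.2⟩
  let e : {t // σ t ∈ noEnds H} → I := fun t => ⟨t.1.1, t.1.2, t.2⟩
  have hγi : Function.Injective γ := fun s t h => by
    have h1 : σ ⟨s, s.2.1⟩ = σ ⟨t, t.2.1⟩ := congrArg Subtype.val h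
    exact Subtype.ext (congrArg (fun u : unitInterval => (u : ℝ)) (hi h1))
  have hγ : IsCausalCurve γ := by
    refine ⟨?_, fun s t hst => hm (show (⟨s, _⟩ : unitInterval) ≤ ⟨t, _⟩ from hst), e a, e b,
      fun h => hab ?_⟩
    · refine Continuous.subtype_mk (hc.comp ?_) _
      exact Continuous.subtype_mk continuous_subtype_val _
    · have h1 : σ a.1 = σ b.1 := congrArg Subtype.val h
      exact Subtype.ext (hi h1)
  obtain ⟨h1, h2⟩ := hG.strictMono_continuous I hI γ hγ hγi
  refine ⟨fun s t hst => h1 (show e s < e t from hst), h2.comp (f := e) ?_⟩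
  exact (continuous_subtype_val.comp continuous_subtype_val).subtype_mk _

namespace RaySetting

/-- On an arc between two distinct equivalent points all points are equivalent and belong to `H°`,
so the reversed arc is causal too; the gauge would increase strictly in both directions. -/
theorem antisymm (hS : RaySetting H G) {x y : H} (hxy : x ≤ y) (hyx : y ≤ x) : x = y := by
  by_contra hne
  obtain ⟨σ, hc, hm, hi, h0, h1⟩ := hS.weaklyConvex.exists_arc hxy hne
  have hl : ∀ t, x ≤ σ t := fun t => h0 ▸ hm unitInterval.nonneg'
  have hr : ∀ t, σ t ≤ y := fun t => h1 ▸ hm unitInterval.le_one'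
  have hE : ∀ t, σ t ∈ noEnds H := fun t => by
    rw [mem_noEnds]
    by_cases h : x = σ t
    · rw [← h]
      exact ⟨⟨y, hyx, Ne.symm hne⟩, ⟨y, hxy, Ne.symm hne⟩⟩
    · exact ⟨⟨x, hl t, h⟩, ⟨x, (hr t).trans hyx, h⟩⟩
  have hlt : ∀ (τ : unitInterval → H) (_ : Continuous τ) (_ : Monotone τ)
      (_ : Function.Injective τ) (hτ : ∀ t, τ t ∈ noEnds H), G ⟨τ 0, hτ 0⟩ < G ⟨τ 1, hτ 1⟩ := by
    intro τ c m i hτ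
    exact (hS.gauge.strictMono_of_arc c m i).1
      (show (⟨0, hτ 0⟩ : {t // τ t ∈ noEnds H}) < ⟨1, hτ 1⟩ from
        Subtype.mk_lt_mk.2 zero_lt_one)
  have a := hlt σ hc hm hi hE
  have b := hlt (σ ∘ unitInterval.symm) (hc.comp unitInterval.continuous_symm)
    (fun s t _ => (hr _).trans (hyx.trans (hl _)))
    (hi.comp unitInterval.symm_bijective.injective) (fun t => hE _)
  simp only [Function.comp, unitInterval.symm_zero, unitInterval.symm_one] at b
  exact lt_asymm a b

theorem gauge_lt (hS : RaySetting H G) {x y : noEnds H} (hxy : x ≤ y) (hne : x ≠ y) :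
    G x < G y := by
  obtain ⟨σ, hc, hm, hi, h0, h1⟩ :=
    hS.weaklyConvex.exists_arc (x := x) (y := y) hxy (fun h => hne (Subtype.ext h))
  have e0 : σ 0 ∈ noEnds H := h0 ▸ x.2
  have e1 : σ 1 ∈ noEnds H := h1 ▸ y.2
  have := (hS.gauge.strictMono_of_arc hc hm hi).1
    (show (⟨0, e0⟩ : {t // σ t ∈ noEnds H}) < ⟨1, e1⟩ from Subtype.mk_lt_mk.2 zero_lt_one)
  simpa only [h0, h1] using this

theorem gauge_mono (hS : RaySetting H G) {x y : noEnds H} (hxy : x ≤ y) : G x ≤ G y := by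
  by_cases h : x = y
  · rw [h]
  · exact (hS.gauge_lt hxy h).le

theorem le_of_gauge_le (hS : RaySetting H G) {x y : noEnds H} (h : Related x y)
    (hG : G x ≤ G y) : x ≤ y := by
  rcases h with h | h
  · exact h
  · by_cases e : y = x
    · rw [e]
    · exact absurd hG (not_le.2 (hS.gauge_lt h e))

theorem eq_of_gauge_eq (hS : RaySetting H G) {x y : noEnds H} (h : Related x y)
    (hG : G x = G y) : x = y :=
  Subtype.ext (hS.antisymm (hS.le_of_gauge_le h hG.le) (hS.le_of_gauge_le h.symm hG.ge))

/-- Since `x` is not initial, some `w` lies strictly before it and provides the common past needed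
by `comparable_of_nonBranching`. -/
theorem related_of_ge (hS : RaySetting H G) {x y z : noEnds H} (hxy : x ≤ y) (hxz : x ≤ z) :
    Related y z := by
  obtain ⟨w, hw, hne⟩ := (mem_noEnds.1 x.2).1
  exact comparable_of_nonBranching (fun _ _ => hS.antisymm)
    (fun _ _ => hS.weaklyConvex.exists_arc) hS.nonBranching.1 hw hne hxy hxz

/-- Time reversal of `related_of_ge`: the same argument in the order dual, where backward
non-branching takes the role of forward non-branching. -/
theorem related_of_le (hS : RaySetting H G) {x y z : noEnds H} (hyx : y ≤ x) (hzx : z ≤ x) :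
    Related y z := by
  obtain ⟨w, hw, hne⟩ := (mem_noEnds.1 x.2).2
  refine Or.symm (comparable_of_nonBranching (Y := Hᵒᵈ) (w := w) (x := x.1) (y := y.1) (z := z.1)
    (fun _ _ h h' => hS.antisymm h' h) ?_ ?_ hw hne hyx hzx)
  · intro a b hab hne
    obtain ⟨σ, hc, hm, hi, h0, h1⟩ := hS.weaklyConvex.exists_arc (x := b) (y := a) hab (Ne.symm hne)
    refine ⟨σ ∘ unitInterval.symm, hc.comp unitInterval.continuous_symm, ?_,
      hi.comp unitInterval.symm_bijective.injective, ?_, ?_⟩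
    · exact fun s t hst => hm (unitInterval.symm_le_symm.2 hst)
    · exact (congrArg σ unitInterval.symm_zero).trans h1
    · exact (congrArg σ unitInterval.symm_one).trans h0
  · intro γ₁ γ₂ c₁ m₁ i₁ c₂ m₂ i₂
    exact hS.nonBranching.2 γ₁ γ₂ c₁ (fun _ _ h => m₁ h) i₁ c₂ (fun _ _ h => m₂ h) i₂

theorem related_trans (hS : RaySetting H G) {x y z : noEnds H} (hxy : Related x y)
    (hyz : Related y z) : Related x z := by
  rcases hxy with h | h <;> rcases hyz with h' | h'
  · exact Or.inl (h.trans h')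
  · exact hS.related_of_le h h'
  · exact hS.related_of_ge h h'
  · exact Or.inr (h'.trans h)

end RaySetting

namespace RaySetting

/-- The interior of an arc from `x` to `α` lies on the ray, and close to `x` it enters the past of
every point of the ray. -/
theorem le_of_initial (hS : RaySetting H G) {x : H} {α y : noEnds H} (hx : x ∈ initialPoints H)
    (hxα : x ≤ α) (hy : Related y α) : x ≤ y := by
  have hne : x ≠ α := fun h => initial_notMem_noEnds hx (h ▸ α.2)
  obtain ⟨σ, hc, hm, hi, h0, h1⟩ := hS.weaklyConvex.exists_arc hxα hne
  obtain ⟨t, ht, hle⟩ := exists_le_of_initial hc (h0 ▸ hx) y fun t ht => by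
    have hE := mem_noEnds_of_arc hm hi ht
    have hα : Related ⟨σ t, hE⟩ α := Or.inl (show σ t ≤ α from h1 ▸ hm unitInterval.le_one')
    exact hS.related_trans hα hy.symm
  exact (h0 ▸ hm unitInterval.nonneg' : x ≤ σ t).trans hle

theorem le_of_final (hS : RaySetting H G) {x : H} {α y : noEnds H} (hx : x ∈ finalPoints H)
    (hxα : (α : H) ≤ x) (hy : Related y α) : (y : H) ≤ x := by
  have hne : (α : H) ≠ x := fun h => final_notMem_noEnds hx (h ▸ α.2)
  obtain ⟨σ, hc, hm, hi, h0, h1⟩ := hS.weaklyConvex.exists_arc hxα hne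
  obtain ⟨t, ht, hle⟩ := exists_ge_of_final hc (h1 ▸ hx) y fun t ht => by
    have hE := mem_noEnds_of_arc hm hi ht
    have hα : Related ⟨σ t, hE⟩ α := Or.inr (show α ≤ σ t from h0 ▸ hm unitInterval.nonneg')
    exact hS.related_trans hα hy.symm
  exact hle.trans (h1 ▸ hm unitInterval.le_one' : σ t ≤ x)

theorem onRay_congr (hS : RaySetting H G) {β β' : noEnds H} {x : H} (h : Related β β')
    (hx : OnRay β x) : OnRay β' x := by
  by_cases hE : x ∈ noEnds H
  · exact hS.related_trans (x := ⟨x, hE⟩) hx h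
  · rcases not_not.1 hE with hi | hf
    · exact Or.inl (hS.le_of_initial hi (hx.le_of_initial hi) h.symm)
    · exact Or.inr (hS.le_of_final hf (hx.le_of_final hf) h.symm)

theorem onRay_of_between (hS : RaySetting H G) {β : noEnds H} {x y z : H} (hx : OnRay β x)
    (hy : OnRay β y) (hxz : x ≤ z) (hzy : z ≤ y) (hE : x ∈ noEnds H ∨ y ∈ noEnds H) :
    OnRay β z := by
  rcases hE with hE | hE
  · have : OnRay ⟨x, hE⟩ z := Or.inr hxz
    exact hS.onRay_congr (β := ⟨x, hE⟩) hx this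
  · have : OnRay ⟨y, hE⟩ z := Or.inl hzy
    exact hS.onRay_congr (β := ⟨y, hE⟩) hy this

/-- Two distinct causally related points of a ray are joined by an arc inside this ray. -/
theorem exists_ray_arc (hS : RaySetting H G) {β : noEnds H} {x y : H} (hx : OnRay β x)
    (hy : OnRay β y) (hxy : x ≤ y) (hne : x ≠ y) :
    ∃ σ : unitInterval → H, Continuous σ ∧ Monotone σ ∧ Function.Injective σ ∧
      σ 0 = x ∧ σ 1 = y ∧ ∀ t, OnRay β (σ t) := by
  by_cases hE : x ∈ noEnds H ∨ y ∈ noEnds H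
  · obtain ⟨σ, hc, hm, hi, h0, h1⟩ := hS.weaklyConvex.exists_arc hxy hne
    exact ⟨σ, hc, hm, hi, h0, h1, fun t => hS.onRay_of_between hx hy
      (h0 ▸ hm unitInterval.nonneg') (h1 ▸ hm unitInterval.le_one') hE⟩
  -- Both points are end-points of `H`, and they may be joined along a different ray as well.
  -- Concatenating arcs through `β` keeps the arc on the ray of `β`.
  · push Not at hE
    have hxI : x ∈ initialPoints H := (not_not.1 hE.1).resolve_right fun h =>
      hne (eq_of_final_le h hxy).symm
    have hyF : y ∈ finalPoints H := (not_not.1 hE.2).resolve_left fun h =>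
      hne (eq_of_le_initial h hxy)
    obtain ⟨σ, c, m, i, h0, h1⟩ := hS.weaklyConvex.exists_arc (hx.le_of_initial hxI)
      (fun h => hE.1 (h ▸ β.2))
    obtain ⟨σ', c', m', i', h0', h1'⟩ := hS.weaklyConvex.exists_arc (hy.le_of_final hyF)
      (fun h => hE.2 (h ▸ β.2))
    let p : Path x β := ⟨⟨σ, c⟩, h0, h1⟩
    let p' : Path (β : H) y := ⟨⟨σ', c'⟩, h0', h1'⟩
    refine ⟨p.trans p', (p.trans p').continuous, Path.monotone_trans (p := p) (p' := p') m m',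
      Path.injective_trans (fun _ _ => hS.antisymm) (p := p) (p' := p') m m' i i',
      (p.trans p').source, (p.trans p').target, fun t => ?_⟩
    have : p.trans p' t ∈ range p ∪ range p' := Path.trans_range p p' ▸ mem_range_self t
    rcases this with ⟨s, hs⟩ | ⟨s, hs⟩
    · exact Or.inl (hs ▸ (h1 ▸ m unitInterval.le_one' : σ s ≤ β))
    · exact Or.inr (hs ▸ (h0' ▸ m' unitInterval.nonneg' : (β : H) ≤ σ' s))

/-- The delicate cases are two initial or two final points. In the first, an arc leaving one of them
consists, apart from its start, of points of the ray, all above the other one; closedness of `≤`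
passes to the start. -/
theorem total_onRay (hS : RaySetting H G) {β : noEnds H} {x y : H} (hx : OnRay β x)
    (hy : OnRay β y) : x ≤ y ∨ y ≤ x := by
  by_cases hE : y ∈ noEnds H
  · exact hS.onRay_congr (β' := ⟨y, hE⟩) hy.symm hx
  by_cases hE' : x ∈ noEnds H
  · exact (hS.onRay_congr (β' := ⟨x, hE'⟩) hx.symm hy).symm
  rcases not_not.1 hE with hi | hf <;> rcases not_not.1 hE' with hi' | hf'
  · left
    have hne : x ≠ β := fun h => hE' (h ▸ β.2)
    obtain ⟨σ, hc, hm, hin, h0, h1⟩ := hS.weaklyConvex.exists_arc (hy.le_of_initial hi)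
      (fun h => hE (h ▸ β.2))
    have hcl : IsClosed {t | x ≤ σ t} := isClosed_le continuous_const hc
    have : x ≤ σ 0 := by
      refine closure_minimal (s := Ioo 0 1) (fun t ht => ?_) hcl ?_
      · exact hS.le_of_initial (α := β) (y := ⟨σ t, mem_noEnds_of_arc hm hin ht⟩) hi'
          (hx.le_of_initial hi') (Or.inl (h1 ▸ hm unitInterval.le_one' : σ t ≤ (β : H)))
      · rw [closure_Ioo zero_ne_one]
        exact left_mem_Icc.2 unitInterval.nonneg'
    exact h0 ▸ this
  · exact Or.inr ((hy.le_of_initial hi).trans (hx.le_of_final hf'))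
  · exact Or.inl ((hx.le_of_initial hi').trans (hy.le_of_final hf))
  · left
    obtain ⟨σ, hc, hm, hin, h0, h1⟩ := hS.weaklyConvex.exists_arc (hx.le_of_final hf')
      (fun h => hE' (h ▸ β.2))
    have hcl : IsClosed {t | σ t ≤ y} := isClosed_le hc continuous_const
    have : σ 1 ≤ y := by
      refine closure_minimal (s := Ioo 0 1) (fun t ht => ?_) hcl ?_
      · exact hS.le_of_final (α := β) (y := ⟨σ t, mem_noEnds_of_arc hm hin ht⟩) hf
          (hy.le_of_final hf) (Or.inr (h0 ▸ hm unitInterval.nonneg' : (β : H) ≤ σ t))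
      · rw [closure_Ioo zero_ne_one]
        exact right_mem_Icc.2 unitInterval.nonneg'
    exact h1 ▸ this

end RaySetting

/-! ### The gauge extended to the end-points of a ray -/

/-- The infimum of the gauge along the ray through `β` (a junk value if it is `-∞`). -/
noncomputable def lowerEnd (G : noEnds H → ℝ) (β : noEnds H) : ℝ :=
  (⨅ y : {y : noEnds H // Related y β}, (G y : EReal)).toReal

/-- The supremum of the gauge along the ray through `β` (a junk value if it is `∞`). -/
noncomputable def upperEnd (G : noEnds H → ℝ) (β : noEnds H) : ℝ :=
  (⨆ y : {y : noEnds H // Related y β}, (G y : EReal)).toReal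

open Classical in
/-- The gauge, extended to the end-points of the ray through `β`. -/
noncomputable def rayGauge (G : noEnds H → ℝ) (β : noEnds H) (x : H) : ℝ :=
  if h : x ∈ noEnds H then G ⟨x, h⟩ else if x ∈ initialPoints H then lowerEnd G β else upperEnd G β

theorem rayGauge_coe (β x : noEnds H) : rayGauge G β x = G x := by
  simp [rayGauge]

theorem rayGauge_initial {β : noEnds H} {x : H} (hx : x ∈ initialPoints H) :
    rayGauge G β x = lowerEnd G β := by
  simp [rayGauge, initial_notMem_noEnds hx, hx]

theorem rayGauge_final {β : noEnds H} {x : H} (hx : x ∈ finalPoints H)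
    (hx' : x ∉ initialPoints H) : rayGauge G β x = upperEnd G β := by
  simp [rayGauge, final_notMem_noEnds hx, hx']

theorem isGLB_lowerEnd {β : noEnds H} (hb : BddBelow {r | ∃ y, Related y β ∧ r = G y}) :
    IsGLB {r | ∃ y, Related y β ∧ r = G y} (lowerEnd G β) := by
  obtain ⟨b, hb⟩ := hb
  set e : EReal := ⨅ y : {y : noEnds H // Related y β}, (G y : EReal) with he
  have h1 : (b : EReal) ≤ e := le_iInf fun y => EReal.coe_le_coe_iff.2 (hb ⟨y, y.2, rfl⟩)
  have h2 : ∀ y, Related y β → e ≤ (G y : EReal) := fun y hy =>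
    iInf_le (fun y : {y : noEnds H // Related y β} => (G y : EReal)) ⟨y, hy⟩
  have hc : ((e.toReal : ℝ) : EReal) = e := by
    refine EReal.coe_toReal (ne_top_of_le_ne_top (EReal.coe_ne_top _) (h2 β (Related.refl β))) ?_
    exact ne_bot_of_le_ne_bot (EReal.coe_ne_bot b) h1
  refine ⟨?_, fun r hr => ?_⟩
  · rintro _ ⟨y, hy, rfl⟩
    have := h2 y hy
    rw [← hc] at this
    exact EReal.coe_le_coe_iff.1 this
  · have : (r : EReal) ≤ e := le_iInf fun y => EReal.coe_le_coe_iff.2 (hr ⟨y, y.2, rfl⟩)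
    rw [← hc] at this
    exact EReal.coe_le_coe_iff.1 this

theorem isLUB_upperEnd {β : noEnds H} (hb : BddAbove {r | ∃ y, Related y β ∧ r = G y}) :
    IsLUB {r | ∃ y, Related y β ∧ r = G y} (upperEnd G β) := by
  obtain ⟨b, hb⟩ := hb
  set e : EReal := ⨆ y : {y : noEnds H // Related y β}, (G y : EReal) with he
  have h1 : e ≤ (b : EReal) := iSup_le fun y => EReal.coe_le_coe_iff.2 (hb ⟨y, y.2, rfl⟩)
  have h2 : ∀ y, Related y β → (G y : EReal) ≤ e := fun y hy =>
    le_iSup (fun y : {y : noEnds H // Related y β} => (G y : EReal)) ⟨y, hy⟩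
  have hc : ((e.toReal : ℝ) : EReal) = e := by
    refine EReal.coe_toReal (ne_top_of_le_ne_top (EReal.coe_ne_top _) h1) ?_
    exact ne_bot_of_le_ne_bot (EReal.coe_ne_bot _) (h2 β (Related.refl β))
  refine ⟨?_, fun r hr => ?_⟩
  · rintro _ ⟨y, hy, rfl⟩
    have := h2 y hy
    rw [← hc] at this
    exact EReal.coe_le_coe_iff.1 this
  · have : e ≤ (r : EReal) := iSup_le fun y => EReal.coe_le_coe_iff.2 (hr ⟨y, y.2, rfl⟩)
    rw [← hc] at this
    exact EReal.coe_le_coe_iff.1 this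

namespace RaySetting

/-- The gauge is bounded on an arc issuing from the initial point `x`, and every point of the ray
dominates some interior point of that arc. So the infimum is finite and `lowerEnd` is not a junk
value. -/
theorem isGLB_of_initial (hS : RaySetting H G) {β : noEnds H} {x : H} (hx : x ∈ initialPoints H)
    (hxβ : x ≤ β) : IsGLB {r | ∃ y, Related y β ∧ r = G y} (lowerEnd G β) := by
  refine isGLB_lowerEnd ?_
  obtain ⟨σ, hc, hm, hi, h0, h1, hon⟩ := hS.exists_ray_arc (β := β) (Or.inl hxβ)
    (onRay_coe.2 (Related.refl β)) hxβ (fun h => initial_notMem_noEnds hx (h ▸ β.2))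
  have hE : ∀ t ∈ Ioo (0 : unitInterval) 1, σ t ∈ noEnds H := fun t => mem_noEnds_of_arc hm hi
  obtain ⟨b, hb⟩ := (hS.gauge.bounded σ ⟨hc, hm, 0, 1, fun h => zero_ne_one (hi h)⟩ hE).2
  refine ⟨b, ?_⟩
  rintro _ ⟨y, hy, rfl⟩
  obtain ⟨t, ht, hle⟩ := exists_le_of_initial hc (h0 ▸ hx) y
    fun t _ => hS.onRay_congr hy.symm (hon t)
  exact (hb ⟨t, ht, rfl⟩).trans (hS.gauge_mono (x := ⟨σ t, hE t ht⟩) hle)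

theorem isLUB_of_final (hS : RaySetting H G) {β : noEnds H} {x : H} (hx : x ∈ finalPoints H)
    (hxβ : (β : H) ≤ x) : IsLUB {r | ∃ y, Related y β ∧ r = G y} (upperEnd G β) := by
  refine isLUB_upperEnd ?_
  obtain ⟨σ, hc, hm, hi, h0, h1, hon⟩ := hS.exists_ray_arc (β := β)
    (onRay_coe.2 (Related.refl β)) (Or.inr hxβ) hxβ (fun h => final_notMem_noEnds hx (h ▸ β.2))
  have hE : ∀ t ∈ Ioo (0 : unitInterval) 1, σ t ∈ noEnds H := fun t => mem_noEnds_of_arc hm hi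
  obtain ⟨b, hb⟩ := (hS.gauge.bounded σ ⟨hc, hm, 0, 1, fun h => zero_ne_one (hi h)⟩ hE).1
  refine ⟨b, ?_⟩
  rintro _ ⟨y, hy, rfl⟩
  obtain ⟨t, ht, hle⟩ := exists_ge_of_final hc (h1 ▸ hx) y
    fun t _ => hS.onRay_congr hy.symm (hon t)
  exact (hS.gauge_mono (y := ⟨σ t, hE t ht⟩) hle).trans (hb ⟨t, ht, rfl⟩)

/-- Strictly between two distinct points of a ray there is another one, inside `H°`. -/
theorem exists_between_onRay (hS : RaySetting H G) {β : noEnds H} {x y : H} (hx : OnRay β x)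
    (hy : OnRay β y) (hxy : x ≤ y) (hne : x ≠ y) :
    ∃ z : noEnds H, Related z β ∧ x ≤ z ∧ (z : H) ≤ y ∧ x ≠ z ∧ (z : H) ≠ y := by
  obtain ⟨σ, hc, hm, hi, h0, h1, hon⟩ := hS.exists_ray_arc hx hy hxy hne
  refine ⟨⟨σ _, mem_noEnds_of_arc hm hi half_mem_Ioo⟩, hon _, h0 ▸ hm unitInterval.nonneg',
    h1 ▸ hm unitInterval.le_one', fun h => ?_, fun h => ?_⟩
  · exact half_mem_Ioo.1.ne (hi (h0.trans h))
  · exact half_mem_Ioo.2.ne (hi (h.trans h1.symm))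

/-- An intermediate point `z` of `H°` separates the two values. If `x` is initial, a further point
between `x` and `z` makes the inequality with the infimum strict; symmetrically for a final `y`. -/
theorem rayGauge_lt (hS : RaySetting H G) {β : noEnds H} {x y : H} (hx : OnRay β x)
    (hy : OnRay β y) (hxy : x ≤ y) (hne : x ≠ y) : rayGauge G β x < rayGauge G β y := by
  obtain ⟨z, hz, hxz, hzy, hxz', hzy'⟩ := hS.exists_between_onRay hx hy hxy hne
  have h1 : rayGauge G β x < G z := by
    by_cases hE : x ∈ noEnds H
    · have := hS.gauge_lt (x := ⟨x, hE⟩) (y := z) hxz (fun h => hxz' (congrArg Subtype.val h))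
      rwa [← rayGauge_coe (G := G) β ⟨x, hE⟩] at this
    · have hI : x ∈ initialPoints H := (not_not.1 hE).resolve_right fun h =>
        hne (eq_of_final_le h hxy).symm
      rw [rayGauge_initial hI]
      obtain ⟨w, hw, -, hwz, -, hne'⟩ := hS.exists_between_onRay hx hz hxz hxz'
      exact ((hS.isGLB_of_initial hI (hx.le_of_initial hI)).1 ⟨w, hw, rfl⟩).trans_lt
        (hS.gauge_lt hwz (fun h => hne' (congrArg Subtype.val h)))
  have h2 : G z < rayGauge G β y := by
    by_cases hE : y ∈ noEnds H
    · have := hS.gauge_lt (x := z) (y := ⟨y, hE⟩) hzy (fun h => hzy' (congrArg Subtype.val h))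
      rwa [← rayGauge_coe (G := G) β ⟨y, hE⟩] at this
    · have hF : y ∈ finalPoints H := (not_not.1 hE).resolve_left fun h =>
        hne (eq_of_le_initial h hxy)
      rw [rayGauge_final hF fun h => hne (eq_of_le_initial h hxy)]
      obtain ⟨w, hw, hzw, -, hne', -⟩ := hS.exists_between_onRay hz hy hzy hzy'
      exact (hS.gauge_lt hzw (fun h => hne' (congrArg Subtype.val h))).trans_le
        ((hS.isLUB_of_final hF (hy.le_of_final hF)).1 ⟨w, hw, rfl⟩)
  exact h1.trans h2

theorem rayGauge_mono (hS : RaySetting H G) {β : noEnds H} {x y : H} (hx : OnRay β x)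
    (hy : OnRay β y) (hxy : x ≤ y) : rayGauge G β x ≤ rayGauge G β y := by
  by_cases h : x = y
  · rw [h]
  · exact (hS.rayGauge_lt hx hy hxy h).le

theorem le_of_rayGauge_le (hS : RaySetting H G) {β : noEnds H} {x y : H} (hx : OnRay β x)
    (hy : OnRay β y) (h : rayGauge G β x ≤ rayGauge G β y) : x ≤ y := by
  rcases hS.total_onRay hx hy with h' | h'
  · exact h'
  · by_cases e : y = x
    · rw [e]
    · exact absurd h (not_le.2 (hS.rayGauge_lt hy hx h' e))

theorem eq_of_rayGauge_eq (hS : RaySetting H G) {β : noEnds H} {x y : H} (hx : OnRay β x)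
    (hy : OnRay β y) (h : rayGauge G β x = rayGauge G β y) : x = y :=
  hS.antisymm (hS.le_of_rayGauge_le hx hy h.le) (hS.le_of_rayGauge_le hy hx h.ge)

end RaySetting

end

section

variable {X : Type*} [TopologicalCausalSpace X] {H : Set X} [MeasurableSpace X]
variable {G : noEnds H → ℝ}

namespace RaySetting

/-- Inside `H°` this is the gauge axiom. At an initial end-point, the value is the infimum of the
gauge over the ray and the arc descends below every point of the ray, so monotonicity gives
convergence; similarly at a final one. -/
theorem continuous_rayGauge_arc (hS : RaySetting H G) {β : noEnds H} {σ : unitInterval → H}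
    (hc : Continuous σ) (hm : Monotone σ) (hi : Function.Injective σ) (hon : ∀ t, OnRay β (σ t)) :
    Continuous fun t => rayGauge G β (σ t) := by
  set f : unitInterval → ℝ := fun t => rayGauge G β (σ t)
  have hfm : Monotone f := fun s t hst => hS.rayGauge_mono (hon s) (hon t) (hm hst)
  have hIoo : ∀ t ∈ Ioo (0 : unitInterval) 1, σ t ∈ noEnds H := fun t => mem_noEnds_of_arc hm hi
  set S : Set unitInterval := {t | σ t ∈ noEnds H} with hSdef
  have hSo : IsOpen S := by
    have hsub : Sᶜ ⊆ {0, 1} := by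
      intro t ht
      by_contra hcon
      simp only [mem_insert_iff, mem_singleton_iff, not_or] at hcon
      exact ht (hIoo t ⟨lt_of_le_of_ne unitInterval.nonneg' (Ne.symm hcon.1),
        lt_of_le_of_ne unitInterval.le_one' hcon.2⟩)
    exact isClosed_compl_iff.1 ((toFinite _).subset hsub).isClosed
  have hcont : ContinuousOn f S := by
    rw [continuousOn_iff_continuous_domRestrict]
    refine (hS.gauge.strictMono_of_arc hc hm hi).2.congr fun t => ?_
    exact (rayGauge_coe (G := G) β ⟨σ t, t.2⟩).symm
  refine continuous_iff_continuousAt.2 fun t => ?_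
  by_cases ht : t ∈ S
  · exact hcont.continuousAt (hSo.mem_nhds ht)
  rcases not_not.1 (show ¬ ¬ (σ t ∈ initialPoints H ∪ finalPoints H) from ht) with hI | hF
  · have ht0 : t = 0 := hi (eq_of_le_initial hI (hm unitInterval.nonneg')).symm
    subst ht0
    have hglb := hS.isGLB_of_initial hI ((hon 0).le_of_initial hI)
    have hf0 : f 0 = lowerEnd G β := rayGauge_initial hI
    refine tendsto_order.2 ⟨fun a ha => Eventually.of_forall fun s =>
      ha.trans_le (hfm unitInterval.nonneg'), fun a ha => ?_⟩
    rw [hf0] at ha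
    obtain ⟨_, ⟨y, hy, rfl⟩, -, hya⟩ := hglb.exists_between ha
    obtain ⟨s, hs, hsy⟩ := exists_le_of_initial hc hI y
      fun s _ => hS.onRay_congr hy.symm (hon s)
    filter_upwards [Iio_mem_nhds hs.1] with r hr
    refine (hfm hr.le).trans_lt (lt_of_le_of_lt ?_ hya)
    have := hS.gauge_mono (x := ⟨σ s, hIoo s hs⟩) hsy
    rwa [← rayGauge_coe (G := G) β ⟨σ s, hIoo s hs⟩] at this
  · have ht1 : t = 1 := hi (eq_of_final_le hF (hm unitInterval.le_one')).symm
    subst ht1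
    have hI : σ 1 ∉ initialPoints H := fun h =>
      zero_ne_one (hi (eq_of_le_initial h (hm unitInterval.nonneg')))
    have hlub := hS.isLUB_of_final hF ((hon 1).le_of_final hF)
    have hf1 : f 1 = upperEnd G β := rayGauge_final hF hI
    refine tendsto_order.2 ⟨fun a ha => ?_, fun a ha => Eventually.of_forall fun s =>
      (hfm unitInterval.le_one').trans_lt ha⟩
    rw [hf1] at ha
    obtain ⟨_, ⟨y, hy, rfl⟩, hya, -⟩ := hlub.exists_between ha
    obtain ⟨s, hs, hsy⟩ := exists_ge_of_final hc hF y
      fun s _ => hS.onRay_congr hy.symm (hon s)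
    filter_upwards [Ioi_mem_nhds hs.2] with r hr
    refine lt_of_lt_of_le (hya.trans_le ?_) (hfm (le_of_lt hr))
    have := hS.gauge_mono (y := ⟨σ s, hIoo s hs⟩) hsy
    rwa [← rayGauge_coe (G := G) β ⟨σ s, hIoo s hs⟩] at this

/-- Two causally related points of a ray are joined by a curve inside this ray which is affine in
the gauge. -/
theorem exists_affine_curve (hS : RaySetting H G) {β : noEnds H} {x y : H} (hx : OnRay β x)
    (hy : OnRay β y) (hxy : x ≤ y) :
    ∃ c : C(unitInterval, H), Monotone c ∧ c 0 = x ∧ c 1 = y ∧ (∀ t, OnRay β (c t)) ∧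
      ∀ t, rayGauge G β (c t) = (1 - (t : ℝ)) * rayGauge G β x + t * rayGauge G β y := by
  by_cases hne : x = y
  · subst hne
    exact ⟨ContinuousMap.const _ x, fun _ _ _ => le_rfl, rfl, rfl, fun _ => hx,
      fun t => by simp; ring⟩
  obtain ⟨σ, hc, hm, hi, h0, h1, hon⟩ := hS.exists_ray_arc hx hy hxy hne
  set f : unitInterval → ℝ := fun t => rayGauge G β (σ t)
  have hfc : Continuous f := hS.continuous_rayGauge_arc hc hm hi hon
  have hfm : StrictMono f := fun s t hst =>
    hS.rayGauge_lt (hon s) (hon t) (hm hst.le) (fun h => hst.ne (hi h))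
  have hL : 0 < f 1 - f 0 := sub_pos.2 (hfm zero_lt_one)
  let ψ : unitInterval → unitInterval := fun t => ⟨(f t - f 0) / (f 1 - f 0),
    div_nonneg (sub_nonneg.2 (hfm.monotone unitInterval.nonneg')) hL.le,
    (div_le_one hL).2 (sub_le_sub_right (hfm.monotone unitInterval.le_one') _)⟩
  have hψ0 : ψ 0 = 0 := Subtype.ext (by simp [ψ])
  have hψ1 : ψ 1 = 1 := Subtype.ext (by simp [ψ, div_self hL.ne'])
  have hψm : StrictMono ψ := fun s t hst =>
    Subtype.mk_lt_mk.2 (div_lt_div_of_pos_right (sub_lt_sub_right (hfm hst) _) hL)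
  have hψc : Continuous ψ := ((hfc.sub continuous_const).div_const _).subtype_mk _
  have hψs : Function.Surjective ψ := fun y => by
    have := intermediate_value_univ (0 : unitInterval) 1 hψc
    rw [hψ0, hψ1] at this
    exact this ⟨unitInterval.nonneg', unitInterval.le_one'⟩
  let e : unitInterval ≃o unitInterval := hψm.orderIsoOfSurjective ψ hψs
  have he : ∀ t, ψ (e.symm t) = t := fun t => e.apply_symm_apply t
  have he0 : e.symm 0 = 0 := hψm.injective ((he 0).trans hψ0.symm)
  have he1 : e.symm 1 = 1 := hψm.injective ((he 1).trans hψ1.symm)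
  refine ⟨⟨σ ∘ e.symm, hc.comp e.symm.continuous⟩, fun s t hst => hm (e.symm.monotone hst), ?_, ?_,
    fun t => hon _, fun t => ?_⟩
  · exact (congrArg σ he0).trans h0
  · exact (congrArg σ he1).trans h1
  · have h2 : (f (e.symm t) - f 0) / (f 1 - f 0) = t := congrArg Subtype.val (he t)
    rw [div_eq_iff hL.ne'] at h2
    have h3 : f (e.symm t) = (1 - (t : ℝ)) * f 0 + t * f 1 := by linarith
    simp only [f, h0, h1] at h3
    exact h3

theorem mem_gCausalCurves (hS : RaySetting H G) {β : noEnds H} {c : C(unitInterval, H)}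
    (hm : Monotone c) (hon : ∀ t, OnRay β (c t))
    (ha : ∀ t, rayGauge G β (c t) =
      (1 - (t : ℝ)) * rayGauge G β (c 0) + t * rayGauge G β (c 1)) :
    c ∈ gCausalCurves G := by
  refine ⟨hm, ?_⟩
  by_cases hne : c 0 = c 1
  · left
    have h : ∀ t, c t = c 0 := fun t => hS.antisymm
      ((hm unitInterval.le_one').trans hne.ge) (hm unitInterval.nonneg')
    exact fun s t => by rw [h s, h t]
  right
  have hlt := hS.rayGauge_lt (hon 0) (hon 1) (hm unitInterval.nonneg') hne
  have hE : ∀ t ∈ Ioo (0 : unitInterval) 1, c t ∈ noEnds H := by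
    intro t ht
    have ht0 : (0 : ℝ) < t := ht.1
    have ht1 : (t : ℝ) < 1 := ht.2
    refine mem_noEnds_of_between (hm unitInterval.nonneg') (hm unitInterval.le_one')
      (Or.inl fun h => ?_) (Or.inl fun h => ?_)
    · have := ha t
      rw [← h] at this
      nlinarith
    · have := ha t
      rw [← h] at this
      nlinarith
  refine ⟨hE, rayGauge G β (c 0), rayGauge G β (c 1) - rayGauge G β (c 0), fun t ht => ?_⟩
  rw [← rayGauge_coe (G := G) β ⟨c t, hE t ht⟩, ha t]
  ring

theorem eq_of_gauge_eq_of_le (hS : RaySetting H G) {x y : noEnds H} (h : x ≤ y) (hG : G x = G y) :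
    x = y := hS.eq_of_gauge_eq (Or.inl h) hG

/-- Along a `G`-causal curve with end-points in `H°`, the gauge is affine up to the end-points. -/
theorem gauge_gCausal (hS : RaySetting H G) {c : C(unitInterval, H)} (hc : c ∈ gCausalCurves G)
    (h0 : c 0 ∈ noEnds H) (h1 : c 1 ∈ noEnds H) (t : unitInterval) :
    ∃ h : c t ∈ noEnds H,
      G ⟨c t, h⟩ = (1 - (t : ℝ)) * G ⟨c 0, h0⟩ + t * G ⟨c 1, h1⟩ := by
  obtain ⟨hm, hcon | ⟨hE, a, b, hab⟩⟩ := hc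
  · have ht : c t ∈ noEnds H := hcon 0 t ▸ h0
    refine ⟨ht, ?_⟩
    have e0 : (⟨c 0, h0⟩ : noEnds H) = ⟨c t, ht⟩ := Subtype.ext (hcon 0 t)
    have e1 : (⟨c 1, h1⟩ : noEnds H) = ⟨c t, ht⟩ := Subtype.ext (hcon 1 t)
    rw [e0, e1]
    ring
  have hall : ∀ t, c t ∈ noEnds H := fun t =>
    mem_noEnds_of_between (hm unitInterval.nonneg') (hm unitInterval.le_one') (Or.inr h0) (Or.inr h1)
  have hdense : Dense (Ioo (0 : unitInterval) 1) := by
    rw [dense_iff_closure_eq, closure_Ioo zero_ne_one]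
    exact eq_univ_of_forall fun t => ⟨unitInterval.nonneg', unitInterval.le_one'⟩
  refine ⟨hall t, ?_⟩
  by_cases hconst : ∀ s ∈ Ioo (0 : unitInterval) 1, ∀ t ∈ Ioo (0 : unitInterval) 1, c s = c t
  · have : ∀ t, c t = c ⟨1 / 2, by norm_num, by norm_num⟩ := by
      have := Continuous.ext_on hdense c.continuous
        (continuous_const (y := c ⟨1 / 2, by norm_num, by norm_num⟩))
        fun s hs => hconst s hs _ half_mem_Ioo
      exact congrFun this
    have e0 : (⟨c 0, h0⟩ : noEnds H) = ⟨c t, hall t⟩ := Subtype.ext ((this 0).trans (this t).symm)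
    have e1 : (⟨c 1, h1⟩ : noEnds H) = ⟨c t, hall t⟩ := Subtype.ext ((this 1).trans (this t).symm)
    rw [e0, e1]
    ring
  -- A zero slope would make the gauge constant on `(0,1)`, and causally related points with equal
  -- gauge coincide. With non-zero slope the curve is injective, so the gauge is continuous along it
  -- and the affine formula extends from `(0,1)` to the end-points.
  have hb : b ≠ 0 := by
    rintro rfl
    have key : ∀ s ∈ Ioo (0 : unitInterval) 1, ∀ t ∈ Ioo (0 : unitInterval) 1, s ≤ t →
        c s = c t := fun s hs t ht hst => by
      have := hS.eq_of_gauge_eq_of_le (x := ⟨c s, hE s hs⟩) (y := ⟨c t, hE t ht⟩) (hm hst)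
        (by rw [hab s hs, hab t ht]; ring)
      exact congrArg Subtype.val this
    exact hconst fun s hs t ht => (le_total s t).elim (key s hs t ht)
      fun h => (key t ht s hs h).symm
  -- A repeated value forces, by monotonicity and antisymmetry, repetition at two interior
  -- parameters `u < v`, where the affine formula distinguishes the points.
  have hinj : Function.Injective c := by
    have key : ∀ s t : unitInterval, s < t → c s ≠ c t := by
      intro s t hlt hst
      obtain ⟨u, hsu, hut⟩ := exists_between hlt
      obtain ⟨v, huv, hvt⟩ := exists_between hut
      have huI : u ∈ Ioo (0 : unitInterval) 1 :=
        ⟨lt_of_le_of_lt unitInterval.nonneg' hsu, lt_of_lt_of_le hut unitInterval.le_one'⟩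
      have hvI : v ∈ Ioo (0 : unitInterval) 1 :=
        ⟨lt_of_le_of_lt unitInterval.nonneg' (hsu.trans huv), lt_of_lt_of_le hvt unitInterval.le_one'⟩
      have huv' : c u = c v := hS.antisymm (hm huv.le)
        ((hm hvt.le).trans (hst.symm.le.trans (hm hsu.le)))
      have h2 := hab u huI
      have h3 := hab v hvI
      have e : (⟨c u, hE u huI⟩ : noEnds H) = ⟨c v, hE v hvI⟩ := Subtype.ext huv'
      rw [e, h3] at h2
      have h4 : (v : ℝ) = u := mul_left_cancel₀ hb (by linarith)
      exact huv.ne' (Subtype.ext h4)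
    intro s t hst
    rcases lt_trichotomy s t with h | h | h
    · exact absurd hst (key s t h)
    · exact h
    · exact absurd hst.symm (key t s h)
  have hcont : Continuous fun t => G ⟨c t, hall t⟩ := by
    have := (hS.gauge.strictMono_of_arc c.continuous hm hinj).2
    exact this.comp (f := fun t => ⟨t, hall t⟩) (continuous_id.subtype_mk _)
  have haff : Continuous fun t : unitInterval => a + b * (t : ℝ) := by fun_prop
  have heq := congrFun (Continuous.ext_on hdense hcont haff fun t ht => hab t ht)
  have e0 := heq 0
  have e1 := heq 1
  have et := heq t
  simp only [Icc.coe_zero, Icc.coe_one] at e0 e1 et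
  rw [e0, e1, et]
  ring

/-- The values of the gauge along a ray form an interval. -/
theorem exists_gauge_eq (hS : RaySetting H G) {β : noEnds H} {x y : H} (hx : OnRay β x)
    (hy : OnRay β y) {s : ℝ} (hs : s ∈ Icc (rayGauge G β x) (rayGauge G β y)) :
    ∃ z, OnRay β z ∧ rayGauge G β z = s := by
  have hxy := hS.le_of_rayGauge_le hx hy (hs.1.trans hs.2)
  obtain ⟨c, -, -, -, hon, ha⟩ := hS.exists_affine_curve hx hy hxy
  rcases (hs.1.trans hs.2).eq_or_lt with h | h
  · exact ⟨x, hx, le_antisymm hs.1 (hs.2.trans h.ge)⟩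
  have hL := sub_pos.2 h
  refine ⟨c ⟨(s - rayGauge G β x) / (rayGauge G β y - rayGauge G β x),
    div_nonneg (sub_nonneg.2 hs.1) hL.le, (div_le_one hL).2 (sub_le_sub_right hs.2 _)⟩, hon _, ?_⟩
  rw [ha]
  field_simp
  ring

/-- Every ray extends strictly beyond each of its points, in both directions. -/
theorem exists_gauge_lt (hS : RaySetting H G) (β : noEnds H) :
    (∃ y, Related y β ∧ G y < G β) ∧ ∃ y, Related y β ∧ G β < G y := by
  obtain ⟨⟨x, hx, hxne⟩, y, hy, hyne⟩ := mem_noEnds.1 β.2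
  have hβ : OnRay β (β : H) := Or.inl le_rfl
  obtain ⟨z, hz, -, hzβ, -, hne⟩ := hS.exists_between_onRay (Or.inl hx) hβ hx hxne
  obtain ⟨w, hw, hβw, -, hne', -⟩ := hS.exists_between_onRay hβ (Or.inr hy) hy hyne.symm
  exact ⟨⟨z, hz, hS.gauge_lt hzβ fun h => hne (congrArg Subtype.val h)⟩,
    ⟨w, hw, hS.gauge_lt hβw fun h => hne' (congrArg Subtype.val h)⟩⟩

end RaySetting

/-- The open interval of values of the gauge along the ray through `β`. -/
def gaugeRange (G : noEnds H → ℝ) (β : noEnds H) : Set ℝ := {s | ∃ y, Related y β ∧ G y = s}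

theorem mem_gaugeRange_self (β : noEnds H) : G β ∈ gaugeRange G β := ⟨β, Related.refl β, rfl⟩

namespace RaySetting

theorem ordConnected_gaugeRange (hS : RaySetting H G) (β : noEnds H) :
    (gaugeRange G β).OrdConnected := by
  refine ⟨?_⟩
  rintro _ ⟨x, hx, rfl⟩ _ ⟨y, hy, rfl⟩ s hs
  have hs' : s ∈ Icc (rayGauge G β x) (rayGauge G β y) := by
    rwa [rayGauge_coe, rayGauge_coe]
  obtain ⟨z, hz, rfl⟩ := hS.exists_gauge_eq hx hy hs'
  have hzE : z ∈ noEnds H := by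
    refine mem_noEnds_of_between (H := H) (x := x) (y := y) ?_ ?_ (Or.inr x.2) (Or.inr y.2)
    · exact hS.le_of_rayGauge_le hx hz hs'.1
    · exact hS.le_of_rayGauge_le hz hy hs'.2
  exact ⟨⟨z, hzE⟩, hz, (rayGauge_coe (G := G) β ⟨z, hzE⟩).symm⟩

theorem isOpen_gaugeRange (hS : RaySetting H G) (β : noEnds H) : IsOpen (gaugeRange G β) := by
  refine isOpen_iff_mem_nhds.2 ?_
  rintro _ ⟨x, hx, rfl⟩
  obtain ⟨⟨y, hy, hyx⟩, z, hz, hxz⟩ := hS.exists_gauge_lt x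
  have hy' : G y ∈ gaugeRange G β := ⟨y, hS.related_trans hy hx, rfl⟩
  have hz' : G z ∈ gaugeRange G β := ⟨z, hS.related_trans hz hx, rfl⟩
  exact Filter.mem_of_superset (Icc_mem_nhds hyx hxz)
    ((hS.ordConnected_gaugeRange β).out hy' hz')

theorem gaugeRange_congr (hS : RaySetting H G) {β β' : noEnds H} (h : Related β β') :
    gaugeRange G β = gaugeRange G β' := by
  ext s
  exact ⟨fun ⟨y, hy, e⟩ => ⟨y, hS.related_trans hy h, e⟩,
    fun ⟨y, hy, e⟩ => ⟨y, hS.related_trans hy h.symm, e⟩⟩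

end RaySetting

end

section

/-! ### Borel selections -/

section Selection

theorem continuous_cantorFunction {c : ℝ} (h0 : 0 ≤ c) (h1 : c < 1) :
    Continuous (Cardinal.cantorFunction c) := by
  refine continuous_tsum (u := fun n => c ^ n) (fun n => ?_) (summable_geometric_of_lt_one h0 h1)
    fun n f => ?_
  · have : Continuous fun b : Bool => cond b (c ^ n) 0 := continuous_of_discreteTopology
    exact this.comp (continuous_apply n)
  · rcases h : f n <;> simp [Cardinal.cantorFunctionAux, h, abs_of_nonneg h0]
    exact pow_nonneg h0 n

/-- The second projection of `K` is a continuous image of the Cantor space, which embeds in the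
line. The selection takes the smallest code of an admissible point; the condition that this code be
at most `r` is the projection of a compact set, hence closed. -/
theorem exists_measurable_selection_of_isCompact {A B : Type*} [TopologicalSpace A] [T2Space A]
    [MeasurableSpace A] [BorelSpace A] [TopologicalSpace B] [TopologicalSpace.MetrizableSpace B]
    [MeasurableSpace B] [BorelSpace B] [Nonempty B] {K : Set (A × B)} (hK : IsCompact K) :
    ∃ f : A → B, Measurable f ∧ ∀ a ∈ Prod.fst '' K, (a, f a) ∈ K := by
  rcases K.eq_empty_or_nonempty with rfl | hne
  · exact ⟨fun _ => Classical.arbitrary B, measurable_const, by simp⟩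
  let := TopologicalSpace.metrizableSpaceMetric B
  have hB : IsCompact (Prod.snd '' K) := hK.image continuous_snd
  have : CompactSpace (Prod.snd '' K) := isCompact_iff_compactSpace.1 hB
  have : Nonempty (Prod.snd '' K) := (hne.image _).to_subtype
  obtain ⟨φ, hφ, hφs⟩ := exists_nat_bool_continuous_surjective_of_compact (Prod.snd '' K)
  let e : (ℕ → Bool) → ℝ := Cardinal.cantorFunction (1 / 3)
  have he : Continuous e := continuous_cantorFunction (by norm_num) (by norm_num)
  have hei : Function.Injective e := Cardinal.cantorFunction_injective (by norm_num) (by norm_num)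
  have hemb : MeasurableEmbedding e := (he.isClosedEmbedding hei).measurableEmbedding
  obtain ⟨g, hg, hge⟩ := hemb.exists_measurable_extend measurable_id fun _ => inferInstance
  let V : A → Set ℝ := fun a => e '' {c | (a, (φ c : B)) ∈ K}
  have hφB : Continuous fun c => (φ c : B) := continuous_subtype_val.comp hφ
  have hVc : ∀ a, IsCompact (V a) := fun a => by
    refine IsCompact.image (IsClosed.isCompact ?_) he
    exact hK.isClosed.preimage (continuous_const.prodMk hφB)
  have hVne : ∀ a ∈ Prod.fst '' K, (V a).Nonempty := by
    rintro _ ⟨⟨a, b⟩, hab, rfl⟩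
    obtain ⟨c, hc⟩ := hφs ⟨b, (a, b), hab, rfl⟩
    exact ⟨e c, c, by simpa [hc] using hab, rfl⟩
  have hVe : ∀ a, a ∉ Prod.fst '' K → V a = ∅ := by
    intro a ha
    simp only [V, image_eq_empty]
    exact eq_empty_of_forall_notMem fun c hc => ha ⟨_, hc, rfl⟩
  -- Outside the projection of `K` the set `V a` is empty and its `sInf` takes the default value
  -- `0`, which explains the second piece of the preimages computed below.
  let F : A → ℝ := fun a => sInf (V a)
  have hFV : ∀ a ∈ Prod.fst '' K, F a ∈ V a := fun a ha => (hVc a).sInf_mem (hVne a ha)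
  have hcl : IsClosed (Prod.fst '' K) := (hK.image continuous_fst).isClosed
  have hF : Measurable F := by
    refine measurable_of_Iic fun r => ?_
    have hset : F ⁻¹' Iic r = (Prod.fst '' {p : A × (ℕ → Bool) | p.1 ∈ Prod.fst '' K ∧
        (p.1, (φ p.2 : B)) ∈ K ∧ e p.2 ≤ r}) ∪ ((Prod.fst '' K)ᶜ ∩ {_a | (0 : ℝ) ≤ r}) := by
      ext a
      by_cases ha : a ∈ Prod.fst '' K
      · simp only [mem_preimage, mem_Iic, mem_union, mem_inter_iff, mem_compl_iff, ha, not_true,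
          false_and, or_false]
        constructor
        · intro h
          obtain ⟨c, hc, hce⟩ := hFV a ha
          exact ⟨(a, c), ⟨ha, hc, hce.le.trans h⟩, rfl⟩
        · rintro ⟨⟨a', c⟩, ⟨-, hc, hce⟩, rfl⟩
          exact (csInf_le (hVc _).bddBelow ⟨c, hc, rfl⟩).trans hce
      · have h0 : F a = 0 := by simp [F, hVe a ha]
        have h1 : a ∉ Prod.fst '' {p : A × (ℕ → Bool) | p.1 ∈ Prod.fst '' K ∧
            (p.1, (φ p.2 : B)) ∈ K ∧ e p.2 ≤ r} := by
          rintro ⟨⟨a', c⟩, ⟨h, -⟩, rfl⟩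
          exact ha h
        simp only [mem_preimage, mem_Iic, h0, mem_union, h1, ha, mem_inter_iff, mem_compl_iff,
          not_false_iff, true_and, false_or, mem_ofPred_eq]
    rw [hset]
    refine MeasurableSet.union ?_ (hcl.measurableSet.compl.inter (MeasurableSet.const _))
    have hcpt : IsCompact {p : A × (ℕ → Bool) | p.1 ∈ Prod.fst '' K ∧
        (p.1, (φ p.2 : B)) ∈ K ∧ e p.2 ≤ r} := by
      refine ((hK.image continuous_fst).prod isCompact_univ).of_isClosed_subset ?_
        fun p hp => ⟨hp.1, mem_univ _⟩
      exact (hcl.preimage continuous_fst).inter ((hK.isClosed.preimage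
        (continuous_fst.prodMk (hφB.comp continuous_snd))).inter
        (isClosed_le (he.comp continuous_snd) continuous_const))
    exact (hcpt.image continuous_fst).isClosed.measurableSet
  refine ⟨fun a => φ (g (F a)), hφB.measurable.comp (hg.comp hF), fun a ha => ?_⟩
  obtain ⟨c, hc, hce⟩ := hFV a ha
  have : g (F a) = c := by
    rw [← hce]
    exact congrFun hge c
  simpa [this] using hc

/-- A relation with a σ-compact graph admits a Borel selection. -/
theorem exists_measurable_selection {A B : Type*} [TopologicalSpace A] [T2Space A]
    [MeasurableSpace A] [BorelSpace A] [TopologicalSpace B] [TopologicalSpace.MetrizableSpace B]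
    [MeasurableSpace B] [BorelSpace B] [Nonempty B] {R : Set (A × B)} (hR : IsSigmaCompact R) :
    ∃ f : A → B, Measurable f ∧ ∀ a b, (a, b) ∈ R → (a, f a) ∈ R := by
  classical
  obtain ⟨K, hK, rfl⟩ := hR
  choose f hf hfK using fun n => exists_measurable_selection_of_isCompact (hK n)
  have hcl : ∀ n, MeasurableSet (Prod.fst '' K n) := fun n =>
    ((hK n).image continuous_fst).isClosed.measurableSet
  -- The second alternative makes the search for the first admissible `n` succeed also at points
  -- with nothing to select.
  let p : ℕ → A → Prop := fun n a => a ∈ Prod.fst '' K n ∨ a ∉ ⋃ k, Prod.fst '' K k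
  have hp : ∀ a, ∃ n, p n a := fun a => by
    by_cases h : a ∈ ⋃ k, Prod.fst '' K k
    · obtain ⟨n, hn⟩ := mem_iUnion.1 h
      exact ⟨n, Or.inl hn⟩
    · exact ⟨0, Or.inr h⟩
  refine ⟨fun a => f (Nat.find (hp a)) a, Measurable.find hf (fun n => ?_) hp, fun a b hab => ?_⟩
  · exact (hcl n).union (MeasurableSet.iUnion hcl).compl
  · obtain ⟨k, hk⟩ := mem_iUnion.1 hab
    rcases Nat.find_spec (hp a) with h | h
    · exact mem_iUnion_of_mem _ (hfK _ a h)
    · exact absurd (mem_iUnion.2 ⟨k, mem_image_of_mem Prod.fst hk⟩) h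

end Selection

/-! ### Borel coordinates on the rays -/

variable {X : Type*} [TopologicalCausalSpace X] [MeasurableSpace X] [BorelSpace X] {H : Set X}
variable [hH : Fact (IsClosed H)]

/-- A closed relation minus the diagonal. Its two projections are the complements of the final and
of the initial points, so `H°` is Borel. -/
theorem isSigmaCompact_lt : IsSigmaCompact {p : H × H | p.1 ≤ p.2 ∧ p.1 ≠ p.2} :=
  isSigmaCompact_of_isClosed_inter_isOpen (isClosed_le (α := H) continuous_fst continuous_snd)
    (isOpen_ne_fun continuous_fst continuous_snd)

theorem isSigmaCompact_compl_initialPoints : IsSigmaCompact (initialPoints H)ᶜ := by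
  have : (initialPoints H)ᶜ = Prod.snd '' {p : H × H | p.1 ≤ p.2 ∧ p.1 ≠ p.2} := by
    ext z
    simp [initialPoints]
  rw [this]
  exact isSigmaCompact_lt.image continuous_snd

theorem isSigmaCompact_compl_finalPoints : IsSigmaCompact (finalPoints H)ᶜ := by
  have : (finalPoints H)ᶜ = Prod.fst '' {p : H × H | p.1 ≤ p.2 ∧ p.1 ≠ p.2} := by
    ext z
    simp only [finalPoints, mem_compl_iff, mem_ofPred_eq, not_not, mem_image, Prod.exists,
      exists_and_right, exists_eq_right]
    exact exists_congr fun x => and_congr_right fun _ => ne_comm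
  rw [this]
  exact isSigmaCompact_lt.image continuous_fst

theorem measurableSet_initialPoints : MeasurableSet (initialPoints H) :=
  MeasurableSet.compl_iff.1 isSigmaCompact_compl_initialPoints.measurableSet'

theorem measurableSet_finalPoints : MeasurableSet (finalPoints H) :=
  MeasurableSet.compl_iff.1 isSigmaCompact_compl_finalPoints.measurableSet'

theorem measurableSet_noEnds : MeasurableSet (noEnds H) :=
  (measurableSet_initialPoints.union measurableSet_finalPoints).compl

theorem measurableEmbedding_noEnds : MeasurableEmbedding (Subtype.val : noEnds H → H) :=
  MeasurableEmbedding.subtype_coe measurableSet_noEnds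

instance : StandardBorelSpace (noEnds H) := measurableSet_noEnds.standardBorel

theorem measurableSet_related : MeasurableSet {p : noEnds H × noEnds H | Related p.1 p.2} := by
  refine IsClosed.measurableSet ?_
  have h1 : Continuous fun p : noEnds H × noEnds H => (p.1 : H) :=
    continuous_subtype_val.comp continuous_fst
  have h2 : Continuous fun p : noEnds H × noEnds H => (p.2 : H) :=
    continuous_subtype_val.comp continuous_snd
  exact (isClosed_le (α := H) h1 h2).union (isClosed_le (α := H) h2 h1)

theorem isClosed_onRay : IsClosed {p : noEnds H × H | OnRay p.1 p.2} := by
  have h1 : Continuous fun p : noEnds H × H => (p.1 : H) :=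
    continuous_subtype_val.comp continuous_fst
  exact (isClosed_le (α := H) continuous_snd h1).union (isClosed_le (α := H) h1 continuous_snd)

variable {G : noEnds H → ℝ}

open Classical in
/-- The point at level `s` of the gauge on the ray through `x`, if there is one. -/
noncomputable def levelPoint (G : noEnds H → ℝ) (s : ℝ) (x : noEnds H) : noEnds H :=
  if h : s ∈ gaugeRange G x then h.choose else x

theorem levelPoint_spec {s : ℝ} {x : noEnds H} (h : s ∈ gaugeRange G x) :
    Related (levelPoint G s x) x ∧ G (levelPoint G s x) = s := by
  rw [levelPoint, dif_pos h]
  exact h.choose_spec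

theorem related_levelPoint (s : ℝ) (x : noEnds H) : Related (levelPoint G s x) x := by
  by_cases h : s ∈ gaugeRange G x
  · exact (levelPoint_spec h).1
  · rw [levelPoint, dif_neg h]
    exact Related.refl x

namespace RaySetting

theorem levelPoint_eq (hS : RaySetting H G) {x y : noEnds H} (h : Related y x) :
    levelPoint G (G y) x = y := by
  obtain ⟨h1, h2⟩ := levelPoint_spec (G := G) (s := G y) (x := x) ⟨y, h, rfl⟩
  exact hS.eq_of_gauge_eq (hS.related_trans h1 h.symm) h2

/-- The set is a projection of a Borel set of pairs. A ray meets a gauge level at most once, so the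
projection is injective there and its image is Borel by Lusin-Souslin. -/
theorem measurableSet_levelPoint (hS : RaySetting H G) (s : ℝ) {B : Set (noEnds H)}
    (hB : MeasurableSet B) : MeasurableSet {x | s ∈ gaugeRange G x ∧ levelPoint G s x ∈ B} := by
  have hG := hS.gauge.measurable
  have hset : {x | s ∈ gaugeRange G x ∧ levelPoint G s x ∈ B} =
      Prod.fst '' {p : noEnds H × noEnds H | Related p.1 p.2 ∧ G p.2 = s ∧ p.2 ∈ B} := by
    ext x
    constructor
    · rintro ⟨h, hx⟩
      obtain ⟨h1, h2⟩ := levelPoint_spec h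
      exact ⟨(x, levelPoint G s x), ⟨h1.symm, h2, hx⟩, rfl⟩
    · rintro ⟨⟨x, y⟩, ⟨h1, rfl, h3⟩, rfl⟩
      refine ⟨⟨y, h1.symm, rfl⟩, ?_⟩
      rw [hS.levelPoint_eq h1.symm]
      exact h3
  rw [hset]
  refine MeasurableSet.image_of_measurable_injOn ?_ measurable_fst ?_
  · exact measurableSet_related.inter ((hG.comp measurable_snd (measurableSet_singleton s)).inter
      (measurable_snd hB))
  · rintro ⟨x, y⟩ ⟨h1, h2, -⟩ ⟨x', y'⟩ ⟨h1', h2', -⟩ (rfl : x = x')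
    exact Prod.ext rfl (hS.eq_of_gauge_eq (hS.related_trans h1.symm h1') (h2.trans h2'.symm))

theorem measurableSet_mem_gaugeRange (hS : RaySetting H G) (s : ℝ) :
    MeasurableSet {x | s ∈ gaugeRange G x} := by
  simpa using hS.measurableSet_levelPoint s MeasurableSet.univ

theorem measurable_levelPoint (hS : RaySetting H G) (s : ℝ) : Measurable (levelPoint G s) := by
  intro B hB
  have : levelPoint G s ⁻¹' B = {x | s ∈ gaugeRange G x ∧ levelPoint G s x ∈ B} ∪
      ({x | s ∈ gaugeRange G x}ᶜ ∩ B) := by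
    ext x
    by_cases h : s ∈ gaugeRange G x
    · simp [h]
    · simp [h, levelPoint]
  rw [this]
  exact (hS.measurableSet_levelPoint s hB).union ((hS.measurableSet_mem_gaugeRange s).compl.inter hB)

theorem exists_rat_mem_gaugeRange (hS : RaySetting H G) (x : noEnds H) :
    ∃ n, ((Denumerable.ofNat ℚ n : ℚ) : ℝ) ∈ gaugeRange G x := by
  obtain ⟨⟨y, hy, hlt⟩, -⟩ := hS.exists_gauge_lt x
  obtain ⟨r, hr1, hr2⟩ := exists_rat_btwn hlt
  obtain ⟨n, rfl⟩ := (Denumerable.eqv ℚ).symm.surjective r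
  refine ⟨n, ?_⟩
  exact (hS.ordConnected_gaugeRange x).out ⟨y, hy, rfl⟩ (mem_gaugeRange_self x) ⟨hr1.le, hr2.le⟩

open Classical in
/-- A Borel choice of a point on each ray. -/
noncomputable def rayIndex (hS : RaySetting H G) (x : noEnds H) : noEnds H :=
  levelPoint G (Denumerable.ofNat ℚ (Nat.find (hS.exists_rat_mem_gaugeRange x)) : ℚ) x

theorem measurable_rayIndex (hS : RaySetting H G) : Measurable hS.rayIndex := by
  classical
  exact Measurable.find (f := fun n => levelPoint G (Denumerable.ofNat ℚ n : ℚ))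
    (fun n => hS.measurable_levelPoint _)
    (fun n => hS.measurableSet_mem_gaugeRange _) hS.exists_rat_mem_gaugeRange

theorem related_rayIndex (hS : RaySetting H G) (x : noEnds H) : Related (hS.rayIndex x) x :=
  related_levelPoint _ _

/-- Related points have the same gauge range, so the same first rational level, at which their
common ray has a single point. -/
theorem rayIndex_eq_iff (hS : RaySetting H G) {x y : noEnds H} :
    hS.rayIndex x = hS.rayIndex y ↔ Related x y := by
  classical
  refine ⟨fun h => ?_, fun h => ?_⟩
  · exact hS.related_trans (hS.related_rayIndex x).symm (h ▸ hS.related_rayIndex y)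
  · have hr := hS.gaugeRange_congr h
    have hn : Nat.find (hS.exists_rat_mem_gaugeRange x) =
        Nat.find (hS.exists_rat_mem_gaugeRange y) := by
      congr 1
      funext n
      rw [hr]
    rw [rayIndex, rayIndex, hn]
    obtain ⟨h1, h2⟩ := levelPoint_spec (Nat.find_spec (hS.exists_rat_mem_gaugeRange y))
    have := hS.levelPoint_eq (hS.related_trans h1 h.symm)
    rwa [h2] at this

theorem rayIndex_rayIndex (hS : RaySetting H G) (x : noEnds H) :
    hS.rayIndex (hS.rayIndex x) = hS.rayIndex x :=
  hS.rayIndex_eq_iff.2 (hS.related_rayIndex x)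

theorem isQuotientMap_rayIndex (hS : RaySetting H G) : IsQuotientMap hS.rayIndex where
  measurable B hB := by
    have hle : (inferInstance : MeasurableSpace (noEnds H)) ≤
        MeasurableSpace.generateFrom {A : Set (noEnds H) | AnalyticSet A} := by
      intro A hA
      exact MeasurableSpace.measurableSet_generateFrom
        (by simpa using MeasurableSet.analyticSet_image hA measurable_id)
    exact hle _ (hS.measurable_rayIndex hB)
  related x := (hS.related_rayIndex x).symm
  eq_iff _ _ := hS.rayIndex_eq_iff

/-- Replaces an uncountable infimum by a countable one, for the sake of measurability. It is
legitimate because the gauge range is an interval without least element. -/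
theorem lowerEnd_eq_rat (hS : RaySetting H G) (β : noEnds H) :
    (⨅ y : {y : noEnds H // Related y β}, (G y : EReal)) =
      ⨅ r : ℚ, ⨅ _ : (r : ℝ) ∈ gaugeRange G β, ((r : ℝ) : EReal) := by
  refine le_antisymm (le_iInf₂ fun r hr => ?_) (le_iInf fun y => ?_)
  · obtain ⟨y, hy, he⟩ := hr
    rw [← he]
    exact iInf_le (fun y : {y : noEnds H // Related y β} => (G y : EReal)) ⟨y, hy⟩
  · obtain ⟨⟨z, hz, hlt⟩, -⟩ := hS.exists_gauge_lt y
    obtain ⟨r, hr1, hr2⟩ := exists_rat_btwn hlt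
    refine (iInf₂_le r ?_).trans (EReal.coe_le_coe_iff.2 hr2.le)
    exact (hS.ordConnected_gaugeRange β).out ⟨z, hS.related_trans hz y.2, rfl⟩ ⟨y, y.2, rfl⟩
      ⟨hr1.le, hr2.le⟩

theorem upperEnd_eq_rat (hS : RaySetting H G) (β : noEnds H) :
    (⨆ y : {y : noEnds H // Related y β}, (G y : EReal)) =
      ⨆ r : ℚ, ⨆ _ : (r : ℝ) ∈ gaugeRange G β, ((r : ℝ) : EReal) := by
  refine le_antisymm (iSup_le fun y => ?_) (iSup₂_le fun r hr => ?_)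
  · obtain ⟨-, z, hz, hlt⟩ := hS.exists_gauge_lt y
    obtain ⟨r, hr1, hr2⟩ := exists_rat_btwn hlt
    refine (EReal.coe_le_coe_iff.2 hr1.le).trans
      (le_iSup₂ (f := fun (r : ℚ) (_ : (r : ℝ) ∈ gaugeRange G β) => ((r : ℝ) : EReal)) r ?_)
    exact (hS.ordConnected_gaugeRange β).out ⟨y, y.2, rfl⟩ ⟨z, hS.related_trans hz y.2, rfl⟩
      ⟨hr1.le, hr2.le⟩
  · obtain ⟨y, hy, he⟩ := hr
    rw [← he]
    exact le_iSup (fun y : {y : noEnds H // Related y β} => (G y : EReal)) ⟨y, hy⟩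

theorem measurable_lowerEnd (hS : RaySetting H G) : Measurable (lowerEnd G) := by
  classical
  have : lowerEnd G = fun β => (⨅ r : ℚ, if (r : ℝ) ∈ gaugeRange G β then ((r : ℝ) : EReal)
      else ⊤).toReal := by
    funext β
    rw [lowerEnd, hS.lowerEnd_eq_rat]
    congr 2
    funext r
    split_ifs with h <;> simp [h]
  rw [this]
  refine Measurable.ereal_toReal (Measurable.iInf fun r => ?_)
  exact Measurable.ite (hS.measurableSet_mem_gaugeRange r) measurable_const measurable_const

theorem measurable_upperEnd (hS : RaySetting H G) : Measurable (upperEnd G) := by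
  classical
  have : upperEnd G = fun β => (⨆ r : ℚ, if (r : ℝ) ∈ gaugeRange G β then ((r : ℝ) : EReal)
      else ⊥).toReal := by
    funext β
    rw [upperEnd, hS.upperEnd_eq_rat]
    congr 2
    funext r
    split_ifs with h <;> simp [h]
  rw [this]
  refine Measurable.ereal_toReal (Measurable.iSup fun r => ?_)
  exact Measurable.ite (hS.measurableSet_mem_gaugeRange r) measurable_const measurable_const

theorem measurable_rayGauge (hS : RaySetting H G) :
    Measurable fun p : noEnds H × H => rayGauge G p.1 p.2 := by
  classical
  refine Measurable.dite (s := {p : noEnds H × H | p.2 ∈ noEnds H})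
    (f := fun p => G ⟨p.1.2, p.2⟩) (g := fun p => if p.1.2 ∈ initialPoints H then lowerEnd G p.1.1
      else upperEnd G p.1.1) ?_ ?_ (measurable_snd measurableSet_noEnds)
  · exact hS.gauge.measurable.comp (measurable_snd.comp measurable_subtype_coe).subtype_mk
  · exact Measurable.ite ((measurable_snd.comp measurable_subtype_coe) measurableSet_initialPoints)
      (hS.measurable_lowerEnd.comp (measurable_fst.comp measurable_subtype_coe))
      (hS.measurable_upperEnd.comp (measurable_fst.comp measurable_subtype_coe))

/-- The pairs formed by a point and a value of the extended gauge on its ray. -/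
def rayRange (G : noEnds H → ℝ) : Set (noEnds H × ℝ) :=
  {p | ∃ x, OnRay p.1 x ∧ rayGauge G p.1 x = p.2}

/-- The extended gauge separates the points of a closed ray, so these coordinates are injective and
Borel on a standard Borel space. This yields at once the measurability of `rayRange` and a Borel
inverse `rayPoint`. -/
theorem measurableEmbedding_rayGauge (hS : RaySetting H G) :
    MeasurableEmbedding fun p : {p : noEnds H × H | OnRay p.1 p.2} =>
      (p.1.1, rayGauge G p.1.1 p.1.2) := by
  have : StandardBorelSpace {p : noEnds H × H | OnRay p.1 p.2} :=
    isClosed_onRay.measurableSet.standardBorel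
  refine Measurable.measurableEmbedding ?_ ?_
  · exact (measurable_fst.comp measurable_subtype_coe).prodMk
      (hS.measurable_rayGauge.comp measurable_subtype_coe)
  · rintro ⟨⟨β, x⟩, hx⟩ ⟨⟨β', x'⟩, hx'⟩ h
    obtain ⟨rfl, h2⟩ := Prod.mk.inj h
    obtain rfl := hS.eq_of_rayGauge_eq hx hx' h2
    rfl

theorem measurableSet_rayRange (hS : RaySetting H G) : MeasurableSet (rayRange G) := by
  convert hS.measurableEmbedding_rayGauge.measurableSet_range using 1
  ext ⟨β, s⟩
  constructor
  · rintro ⟨x, hx, h⟩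
    exact ⟨⟨(β, x), hx⟩, Prod.ext rfl h⟩
  · rintro ⟨⟨⟨β', x⟩, hx⟩, h⟩
    obtain ⟨rfl, h2⟩ := Prod.mk.inj h
    exact ⟨x, hx, h2⟩

theorem exists_rayPoint (hS : RaySetting H G) : ∃ Ψ : noEnds H × ℝ → H, Measurable Ψ ∧
    ∀ β x, OnRay β x → Ψ (β, rayGauge G β x) = x := by
  obtain ⟨Ψ, hΨ, h⟩ := hS.measurableEmbedding_rayGauge.exists_measurable_extend
    (measurable_snd.comp measurable_subtype_coe) fun p => ⟨(p.1 : H)⟩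
  exact ⟨Ψ, hΨ, fun β x hx => congrFun h ⟨(β, x), hx⟩⟩

/-- The point with a given value of the extended gauge on the ray through `β`. -/
noncomputable def rayPoint (hS : RaySetting H G) : noEnds H × ℝ → H :=
  Classical.choose hS.exists_rayPoint

theorem measurable_rayPoint (hS : RaySetting H G) : Measurable hS.rayPoint :=
  (Classical.choose_spec hS.exists_rayPoint).1

theorem rayPoint_rayGauge (hS : RaySetting H G) {β : noEnds H} {x : H} (hx : OnRay β x) :
    hS.rayPoint (β, rayGauge G β x) = x :=
  (Classical.choose_spec hS.exists_rayPoint).2 β x hx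

theorem rayPoint_gauge (hS : RaySetting H G) {β x : noEnds H} (hx : Related x β) :
    hS.rayPoint (β, G x) = x := by
  have := hS.rayPoint_rayGauge (onRay_coe.2 hx)
  rwa [rayGauge_coe] at this

theorem onRay_rayPoint (hS : RaySetting H G) {β : noEnds H} {s : ℝ} (h : (β, s) ∈ rayRange G) :
    OnRay β (hS.rayPoint (β, s)) ∧ rayGauge G β (hS.rayPoint (β, s)) = s := by
  obtain ⟨x, hx, h⟩ := h
  simp only at hx h
  subst h
  rw [hS.rayPoint_rayGauge hx]
  exact ⟨hx, rfl⟩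

/-- The admissible end-points of a gauge-affine curve on a ray. -/
def curveDomain (G : noEnds H → ℝ) : Set (noEnds H × ℝ × ℝ) :=
  {p | (p.1, p.2.1) ∈ rayRange G ∧ (p.1, p.2.2) ∈ rayRange G ∧ p.2.1 ≤ p.2.2}

theorem exists_curve (hS : RaySetting H G) {p : noEnds H × ℝ × ℝ} (hp : p ∈ curveDomain G) :
    ∃ c : C(unitInterval, H), c ∈ gCausalCurves G ∧
      ∀ t, OnRay p.1 (c t) ∧ rayGauge G p.1 (c t) = (1 - (t : ℝ)) * p.2.1 + t * p.2.2 := by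
  obtain ⟨⟨x, hx, ex⟩, ⟨y, hy, ey⟩, hle⟩ := hp
  have hxy := hS.le_of_rayGauge_le hx hy (ex.le.trans (hle.trans ey.ge))
  obtain ⟨c, hm, h0, h1, hon, ha⟩ := hS.exists_affine_curve hx hy hxy
  refine ⟨c, hS.mem_gCausalCurves hm hon fun t => by rw [h0, h1, ha t], fun t => ⟨hon t, ?_⟩⟩
  rw [ha t, ex, ey]

open Classical in
/-- The gauge-affine curve on a ray with given end-points, as a function of the ray and of the
values of the gauge at the end-points. -/
noncomputable def affineCurve (hS : RaySetting H G) (p : noEnds H × ℝ × ℝ) : C(unitInterval, H) :=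
  if hp : p ∈ curveDomain G then (hS.exists_curve hp).choose else ContinuousMap.const _ p.1

theorem affineCurve_mem (hS : RaySetting H G) {p : noEnds H × ℝ × ℝ} (hp : p ∈ curveDomain G) :
    hS.affineCurve p ∈ gCausalCurves G := by
  rw [affineCurve, dif_pos hp]
  exact (hS.exists_curve hp).choose_spec.1

theorem affineCurve_apply (hS : RaySetting H G) {p : noEnds H × ℝ × ℝ} (hp : p ∈ curveDomain G)
    (t : unitInterval) :
    hS.affineCurve p t = hS.rayPoint (p.1, (1 - (t : ℝ)) * p.2.1 + t * p.2.2) := by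
  rw [affineCurve, dif_pos hp]
  obtain ⟨h1, h2⟩ := (hS.exists_curve hp).choose_spec.2 t
  rw [← h2, hS.rayPoint_rayGauge h1]

theorem measurableSet_curveDomain (hS : RaySetting H G) : MeasurableSet (curveDomain G) := by
  have h := hS.measurableSet_rayRange
  refine MeasurableSet.inter ?_ (MeasurableSet.inter ?_ ?_)
  · exact (measurable_fst.prodMk (measurable_fst.comp measurable_snd)) h
  · exact (measurable_fst.prodMk (measurable_snd.comp measurable_snd)) h
  · exact measurableSet_le (measurable_fst.comp measurable_snd) (measurable_snd.comp measurable_snd)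

/-- The curve is obtained by choice, but its evaluations are determined by `rayPoint`, and
measurability of a curve-valued map is tested on evaluations. -/
theorem measurable_affineCurve (hS : RaySetting H G) : Measurable hS.affineCurve := by
  classical
  refine measurable_curve_iff.2 fun t => ?_
  have : (fun p => hS.affineCurve p t) = fun p => if p ∈ curveDomain G then
      hS.rayPoint (p.1, (1 - (t : ℝ)) * p.2.1 + t * p.2.2) else p.1 := by
    funext p
    split_ifs with hp
    · exact hS.affineCurve_apply hp t
    · rw [affineCurve, dif_neg hp]
      rfl
  rw [this]
  refine Measurable.ite hS.measurableSet_curveDomain (hS.measurable_rayPoint.comp ?_)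
    (measurable_subtype_coe.comp measurable_fst)
  fun_prop

end RaySetting

end

/-! ### Entropy power in terms of the logarithm of the density -/

theorem integrable_of_lintegral_pos_neg {Ω : Type*} [MeasurableSpace Ω] {P : Measure Ω} {f : Ω → ℝ}
    (hf : AEMeasurable f P) (hp : ∫⁻ ω, ENNReal.ofReal (f ω) ∂P ≠ ∞)
    (hn : ∫⁻ ω, ENNReal.ofReal (-f ω) ∂P ≠ ∞) : Integrable f P := by
  refine ⟨hf.aestronglyMeasurable, ?_⟩
  refine lt_of_le_of_lt (lintegral_mono (g := fun ω => ENNReal.ofReal (f ω) +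
    ENNReal.ofReal (-f ω)) fun ω => ?_) ?_
  · rw [Real.enorm_eq_ofReal_abs]
    rcases le_total 0 (f ω) with h | h
    · rw [abs_of_nonneg h]
      exact le_self_add
    · rw [abs_of_nonpos h]
      exact le_add_self
  · rw [lintegral_add_left' hf.ennreal_ofReal]
    exact ENNReal.add_lt_top.2 ⟨hp.lt_top, hn.lt_top⟩

theorem lintegral_ofReal_lt_top {Ω : Type*} [MeasurableSpace Ω] {P : Measure Ω} {f : Ω → ℝ}
    (hf : Integrable f P) : ∫⁻ ω, ENNReal.ofReal (f ω) ∂P < ∞ :=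
  lt_of_le_of_lt (lintegral_mono fun _ => ENNReal.ofReal_le_ofReal (Real.le_norm_self _))
    (by simpa only [ofReal_norm] using hasFiniteIntegral_iff_enorm.1 hf.2)

section EntropyPower

variable {Y : Type*} [MeasurableSpace Y] {μ m : Measure Y}

/-- The logarithm of the density of `μ` with respect to `m`. -/
noncomputable def logDensity (μ m : Measure Y) (y : Y) : ℝ := Real.log (μ.rnDeriv m y).toReal

theorem measurable_logDensity : Measurable (logDensity μ m) :=
  (Measure.measurable_rnDeriv μ m).ennreal_toReal.log

/-- Integrating `log ρ` against `μ` instead of `ρ log ρ` against `m` allows the entropies of several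
laws to be written on one probability space that carries a coupling. -/
theorem lintegral_rhoLogRho [SigmaFinite μ] [SigmaFinite m] (hac : μ ≪ m) :
    ∫⁻ y, ENNReal.ofReal (rhoLogRho μ m y) ∂m = ∫⁻ y, ENNReal.ofReal (logDensity μ m y) ∂μ := by
  rw [← lintegral_rnDeriv_mul hac measurable_logDensity.ennreal_ofReal.aemeasurable]
  refine lintegral_congr_ae ?_
  filter_upwards [Measure.rnDeriv_lt_top μ m] with y hy
  rw [rhoLogRho, ENNReal.ofReal_mul ENNReal.toReal_nonneg, ENNReal.ofReal_toReal hy.ne, logDensity]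

theorem lintegral_neg_rhoLogRho [SigmaFinite μ] [SigmaFinite m] (hac : μ ≪ m) :
    ∫⁻ y, ENNReal.ofReal (-rhoLogRho μ m y) ∂m = ∫⁻ y, ENNReal.ofReal (-logDensity μ m y) ∂μ := by
  rw [← lintegral_rnDeriv_mul hac (f := fun y => ENNReal.ofReal (-logDensity μ m y))
    measurable_logDensity.neg.ennreal_ofReal.aemeasurable]
  refine lintegral_congr_ae ?_
  filter_upwards [Measure.rnDeriv_lt_top μ m] with y hy
  rw [rhoLogRho, ← mul_neg, ENNReal.ofReal_mul ENNReal.toReal_nonneg, ENNReal.ofReal_toReal hy.ne,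
    logDensity]

variable {n : ℝ}

theorem entropy_eq [SigmaFinite μ] [SigmaFinite m] (hac : μ ≪ m)
    (hP : ∫⁻ y, ENNReal.ofReal (logDensity μ m y) ∂μ ≠ ∞) :
    entropy μ m = ((∫⁻ y, ENNReal.ofReal (logDensity μ m y) ∂μ : ℝ≥0∞) : EReal) -
      ((∫⁻ y, ENNReal.ofReal (-logDensity μ m y) ∂μ : ℝ≥0∞) : EReal) := by
  rw [entropy, if_pos ⟨hac, by rwa [lintegral_rhoLogRho hac]⟩, lintegral_rhoLogRho hac,
    lintegral_neg_rhoLogRho hac]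

theorem entropyPower_eq_zero [SigmaFinite μ] [SigmaFinite m]
    (h : ¬ (μ ≪ m ∧ ∫⁻ y, ENNReal.ofReal (logDensity μ m y) ∂μ ≠ ∞)) :
    entropyPower n μ m = 0 := by
  rw [entropyPower, if_pos]
  rw [entropy, if_neg]
  rintro ⟨hac, hP⟩
  exact h ⟨hac, by rwa [← lintegral_rhoLogRho hac]⟩

theorem entropyPower_eq_top [SigmaFinite μ] [SigmaFinite m] (hac : μ ≪ m)
    (hP : ∫⁻ y, ENNReal.ofReal (logDensity μ m y) ∂μ ≠ ∞)
    (hQ : ∫⁻ y, ENNReal.ofReal (-logDensity μ m y) ∂μ = ∞) : entropyPower n μ m = ∞ := by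
  have : entropy μ m = ⊥ := by
    rw [entropy_eq hac hP, hQ]
    lift (∫⁻ y, ENNReal.ofReal (logDensity μ m y) ∂μ) to ℝ≥0 using hP with p
    simp
  rw [entropyPower, if_neg (by simp [this]), if_pos this]

theorem entropyPower_of_integrable [SigmaFinite μ] [SigmaFinite m] (hac : μ ≪ m)
    (hi : Integrable (logDensity μ m) μ) :
    entropyPower n μ m = ENNReal.ofReal (Real.exp (-(∫ y, logDensity μ m y ∂μ) / n)) := by
  have hP : ∫⁻ y, ENNReal.ofReal (logDensity μ m y) ∂μ ≠ ∞ := (lintegral_ofReal_lt_top hi).ne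
  have hQ : ∫⁻ y, ENNReal.ofReal (-logDensity μ m y) ∂μ ≠ ∞ := (lintegral_ofReal_lt_top hi.neg).ne
  have : entropy μ m = ((∫ y, logDensity μ m y ∂μ : ℝ) : EReal) := by
    rw [entropy_eq hac hP, integral_eq_lintegral_pos_part_sub_lintegral_neg_part hi]
    rw [EReal.coe_sub, EReal.coe_ennreal_toReal hP, EReal.coe_ennreal_toReal hQ]
  rw [entropyPower, this, if_neg (EReal.coe_ne_top _), if_neg (EReal.coe_ne_bot _),
    EReal.toReal_coe]

/-- A lower bound for the entropy power of the law of `x`. -/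
theorem le_entropyPower [SigmaFinite m] {Ω : Type*} [MeasurableSpace Ω] {P : Measure Ω}
    [IsProbabilityMeasure P] {x : Ω → Y} (hx : Measurable x) (hac : P.map x ≪ m) (hn : 0 < n) {b : Ω → ℝ}
    (hb : Integrable b P) (hle : ∀ᵐ ω ∂P, b ω ≤ -logDensity (P.map x) m (x ω) / n) :
    ENNReal.ofReal (Real.exp (∫ ω, b ω ∂P)) ≤ entropyPower n (P.map x) m := by
  have := Measure.isProbabilityMeasure_map (μ := P) hx.aemeasurable
  have hle' : ∀ᵐ ω ∂P, logDensity (P.map x) m (x ω) ≤ -n * b ω := by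
    filter_upwards [hle] with ω h
    rw [le_div_iff₀ hn] at h
    linarith
  have hP : ∫⁻ y, ENNReal.ofReal (logDensity (P.map x) m y) ∂(P.map x) ≠ ∞ := by
    rw [lintegral_map measurable_logDensity.ennreal_ofReal hx]
    refine ne_top_of_le_ne_top (lintegral_ofReal_lt_top (hb.const_mul (-n))).ne (lintegral_mono_ae ?_)
    filter_upwards [hle'] with ω h
    exact ENNReal.ofReal_le_ofReal h
  by_cases hQ : ∫⁻ y, ENNReal.ofReal (-logDensity (P.map x) m y) ∂(P.map x) = ∞
  · rw [entropyPower_eq_top hac hP hQ]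
    exact le_top
  have hi : Integrable (logDensity (P.map x) m) (P.map x) :=
    integrable_of_lintegral_pos_neg measurable_logDensity.aemeasurable hP hQ
  rw [entropyPower_of_integrable hac hi]
  refine ENNReal.ofReal_le_ofReal (Real.exp_le_exp.2 ?_)
  rw [integral_map hx.aemeasurable measurable_logDensity.aestronglyMeasurable, ← integral_neg,
    ← integral_div]
  refine integral_mono_ae hb ?_ hle
  exact ((integrable_map_measure measurable_logDensity.aestronglyMeasurable
    hx.aemeasurable).1 hi).neg.div_const _

/-- Integrable lower bounds exhaust the entropy power of the law of `x`. -/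
theorem exists_integrable_of_lt_entropyPower [SigmaFinite m] {Ω : Type*} [MeasurableSpace Ω]
    {P : Measure Ω} [IsProbabilityMeasure P] {x : Ω → Y} (hx : Measurable x) {c : ℝ≥0∞}
    (hc : c < entropyPower n (P.map x) m) (hn : 0 < n) :
    P.map x ≪ m ∧ ∃ b : Ω → ℝ, Integrable b P ∧
      (∀ ω, b ω ≤ -logDensity (P.map x) m (x ω) / n) ∧ c ≤ ENNReal.ofReal (Real.exp (∫ ω, b ω ∂P)) := by
  have := Measure.isProbabilityMeasure_map (μ := P) hx.aemeasurable
  by_cases h : P.map x ≪ m ∧ ∫⁻ y, ENNReal.ofReal (logDensity (P.map x) m y) ∂(P.map x) ≠ ∞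
  swap
  · rw [entropyPower_eq_zero h] at hc
    exact absurd hc not_lt_zero
  obtain ⟨hac, hP⟩ := h
  refine ⟨hac, ?_⟩
  set a : Ω → ℝ := fun ω => -logDensity (P.map x) m (x ω) / n with ha
  have ham : Measurable a := (measurable_logDensity.comp hx).neg.div_const n
  have hPa : ∫⁻ ω, ENNReal.ofReal (-a ω) ∂P ≠ ∞ := by
    rw [lintegral_map measurable_logDensity.ennreal_ofReal hx] at hP
    have : ∀ ω, ENNReal.ofReal (-a ω) =
        ENNReal.ofReal (1 / n) * ENNReal.ofReal (logDensity (P.map x) m (x ω)) := fun ω => by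
      rw [← ENNReal.ofReal_mul (by positivity)]
      congr 1
      simp only [ha]
      ring
    simp only [this]
    rw [lintegral_const_mul' _ _ ENNReal.ofReal_ne_top]
    exact ENNReal.mul_ne_top ENNReal.ofReal_ne_top hP
  by_cases hQ : ∫⁻ ω, ENNReal.ofReal (a ω) ∂P = ∞
  -- Entropy `-∞`: the truncations `min a k` are integrable and their positive parts have integrals
  -- tending to infinity. The `+ 1` keeps the argument of the logarithm positive when `c = 0`.
  · have hcT : c ≠ ∞ := hc.ne_top
    set D := (∫⁻ ω, ENNReal.ofReal (-a ω) ∂P).toReal with hD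
    have hmono : ∫⁻ ω, ⨆ k : ℕ, ENNReal.ofReal (min (a ω) k) ∂P =
        ⨆ k : ℕ, ∫⁻ ω, ENNReal.ofReal (min (a ω) k) ∂P := by
      refine lintegral_iSup (fun k => (ham.min measurable_const).ennreal_ofReal) ?_
      exact fun i j hij ω => ENNReal.ofReal_le_ofReal (min_le_min le_rfl (Nat.cast_le.2 hij))
    have hsup : ∀ ω, ⨆ k : ℕ, ENNReal.ofReal (min (a ω) k) = ENNReal.ofReal (a ω) := fun ω => by
      refine le_antisymm (iSup_le fun k => ENNReal.ofReal_le_ofReal (min_le_left _ _)) ?_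
      obtain ⟨k, hk⟩ := exists_nat_ge (a ω)
      exact le_iSup_of_le k (by rw [min_eq_left hk])
    simp only [hsup, hQ] at hmono
    have hlt : ENNReal.ofReal (D + Real.log (c.toReal + 1)) <
        ⨆ k : ℕ, ∫⁻ ω, ENNReal.ofReal (min (a ω) k) ∂P := hmono ▸ ENNReal.ofReal_lt_top
    obtain ⟨k, hk⟩ := lt_iSup_iff.1 hlt
    have hneg : ∀ ω, ENNReal.ofReal (-min (a ω) k) = ENNReal.ofReal (-a ω) := fun ω => by
      rcases le_total (a ω) k with h | h
      · rw [min_eq_left h]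
      · rw [min_eq_right h, ENNReal.ofReal_of_nonpos (by simp),
          ENNReal.ofReal_of_nonpos (by linarith [Nat.cast_nonneg (α := ℝ) k])]
    have hfin : ∫⁻ ω, ENNReal.ofReal (min (a ω) k) ∂P ≠ ∞ := by
      refine ne_top_of_le_ne_top (b := ENNReal.ofReal k) ENNReal.ofReal_ne_top ?_
      refine (lintegral_mono fun ω => ENNReal.ofReal_le_ofReal (min_le_right _ _)).trans ?_
      simp
    have hi : Integrable (fun ω => min (a ω) k) P :=
      integrable_of_lintegral_pos_neg (ham.min measurable_const).aemeasurable hfin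
        (by simpa only [hneg] using hPa)
    refine ⟨_, hi, fun ω => min_le_left _ _, ?_⟩
    rw [integral_eq_lintegral_pos_part_sub_lintegral_neg_part hi]
    simp only [hneg]
    rw [← hD]
    have h2 : D + Real.log (c.toReal + 1) ≤ (∫⁻ ω, ENNReal.ofReal (min (a ω) k) ∂P).toReal := by
      exact (ENNReal.ofReal_le_iff_le_toReal hfin).1 hk.le
    have hpos : 0 < c.toReal + 1 := by positivity
    calc c = ENNReal.ofReal c.toReal := (ENNReal.ofReal_toReal hcT).symm
      _ ≤ ENNReal.ofReal (c.toReal + 1) := ENNReal.ofReal_le_ofReal (by linarith)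
      _ = ENNReal.ofReal (Real.exp (Real.log (c.toReal + 1))) := by rw [Real.exp_log hpos]
      _ ≤ _ := ENNReal.ofReal_le_ofReal (Real.exp_le_exp.2 (by linarith))
  · have hai : Integrable a P := integrable_of_lintegral_pos_neg ham.aemeasurable hQ hPa
    refine ⟨a, hai, fun ω => le_rfl, ?_⟩
    have hi : Integrable (logDensity (P.map x) m) (P.map x) := by
      refine (integrable_map_measure measurable_logDensity.aestronglyMeasurable
        hx.aemeasurable).2 ?_
      refine (hai.const_mul (-n)).congr (Eventually.of_forall fun ω => ?_)
      simp only [ha, Function.comp]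
      field_simp
    rw [entropyPower_of_integrable hac hi,
      integral_map hx.aemeasurable measurable_logDensity.aestronglyMeasurable] at hc
    refine hc.le.trans (le_of_eq ?_)
    simp only [ha]
    rw [integral_div, integral_neg]

/-- The density of `μ` is at most `c`, so `-log ρ ≥ -log c`; a constant serves as the integrable
lower bound. -/
theorem le_entropyPower_of_le_smul [SigmaFinite m] [IsProbabilityMeasure μ] {c : ℝ} (hc : 0 < c)
    (hμ : μ ≤ ENNReal.ofReal c • m) (hn : 0 < n) :
    ENNReal.ofReal (c ^ (-1 / n)) ≤ entropyPower n μ m := by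
  have hac : μ ≪ m := (Measure.absolutelyContinuous_of_le hμ).trans
    (Measure.smul_absolutelyContinuous)
  have hle : ∀ᵐ y ∂m, μ.rnDeriv m y ≤ ENNReal.ofReal c := by
    refine ae_le_of_forall_setLIntegral_le_of_sigmaFinite (Measure.measurable_rnDeriv μ m) ?_
    intro s hs _
    rw [setLIntegral_const]
    refine (Measure.setLIntegral_rnDeriv_le s).trans ?_
    simpa using hμ s
  have h := le_entropyPower (P := μ) (x := id) (m := m) (n := n) (b := fun _ => -Real.log c / n)
    measurable_id (by simpa using hac) hn (integrable_const _) (by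
      simp only [Measure.map_id, id]
      filter_upwards [hac.ae_le hle, Measure.rnDeriv_pos hac] with y hy hpos
      refine div_le_div_of_nonneg_right (neg_le_neg ?_) hn.le
      refine Real.log_le_log (ENNReal.toReal_pos hpos.ne' (ne_top_of_le_ne_top
        ENNReal.ofReal_ne_top hy)) ?_
      rw [← ENNReal.toReal_ofReal hc.le]
      exact ENNReal.toReal_mono ENNReal.ofReal_ne_top hy)
  simp only [Measure.map_id, integral_const, probReal_univ, one_smul] at h
  convert h using 2
  rw [Real.rpow_def_of_pos hc]
  congr 1
  ring

/-- Jensen's inequality: the integral of `1/ρ` against `μ` is at most `m A`, so that of `-log ρ` is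
at most `log (m A)`. -/
theorem entropyPower_le_of_concentrated [SigmaFinite m] [IsProbabilityMeasure μ] {A : Set Y}
    (hA : MeasurableSet A) (hμA : μ Aᶜ = 0) (hmA : m A ≠ ∞) (hn : 0 < n) :
    entropyPower n μ m ≤ ENNReal.ofReal ((m A).toReal ^ (1 / n)) := by
  by_cases h : μ ≪ m ∧ ∫⁻ y, ENNReal.ofReal (logDensity μ m y) ∂μ ≠ ∞
  swap
  · rw [entropyPower_eq_zero h]
    exact zero_le
  obtain ⟨hac, hP⟩ := h
  set c := (m A).toReal with hcdef
  have hmA0 : m A ≠ 0 := fun h0 => by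
    have h1 := hac h0
    have h2 : μ univ = 0 := by
      rw [← union_compl_self A]
      exact measure_union_null h1 hμA
    simp at h2
  have hc : 0 < c := ENNReal.toReal_pos hmA0 hmA
  have hρ : ∀ᵐ y ∂μ, 0 < μ.rnDeriv m y ∧ μ.rnDeriv m y < ∞ :=
    (Measure.rnDeriv_pos hac).and (hac.ae_le (Measure.rnDeriv_lt_top μ m))
  have hinv : ∫⁻ y, (μ.rnDeriv m y)⁻¹ ∂μ ≤ m A := by
    have hres : μ.restrict A = μ := Measure.restrict_eq_self_of_ae_mem (mem_ae_iff.2 hμA)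
    calc ∫⁻ y, (μ.rnDeriv m y)⁻¹ ∂μ = ∫⁻ y in A, (μ.rnDeriv m y)⁻¹ ∂μ := by rw [hres]
      _ = ∫⁻ y in A, μ.rnDeriv m y * (μ.rnDeriv m y)⁻¹ ∂m :=
        (setLIntegral_rnDeriv_mul hac (Measure.measurable_rnDeriv μ m).inv.aemeasurable hA).symm
      _ ≤ ∫⁻ _ in A, 1 ∂m := lintegral_mono fun y => ENNReal.mul_inv_le_one _
      _ = m A := by simp
  set g : Y → ℝ := fun y => ((μ.rnDeriv m y)⁻¹).toReal with hg
  have hgm : Measurable g := (Measure.measurable_rnDeriv μ m).inv.ennreal_toReal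
  have hg1 : ∫⁻ y, ENNReal.ofReal (g y) ∂μ ≤ m A :=
    (lintegral_mono fun y => ENNReal.ofReal_toReal_le).trans hinv
  have hg0 : ∀ y, 0 ≤ g y := fun y => ENNReal.toReal_nonneg
  have hgi : Integrable g μ := by
    refine integrable_of_lintegral_pos_neg hgm.aemeasurable (ne_top_of_le_ne_top hmA hg1) ?_
    simp [ENNReal.ofReal_of_nonpos, hg0]
  have hgc : ∫ y, g y ∂μ ≤ c := by
    rw [integral_eq_lintegral_of_nonneg_ae (Eventually.of_forall hg0) hgm.aestronglyMeasurable]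
    exact ENNReal.toReal_mono hmA hg1
  -- The tangent to the logarithm at `c = m A` gives Jensen's inequality together with the
  -- integrability that it presupposes.
  have hle : ∀ᵐ y ∂μ, -logDensity μ m y ≤ g y / c + (Real.log c - 1) := by
    filter_upwards [hρ] with y hy
    have hr : 0 < (μ.rnDeriv m y).toReal := ENNReal.toReal_pos hy.1.ne' hy.2.ne
    have h1 : g y = ((μ.rnDeriv m y).toReal)⁻¹ := ENNReal.toReal_inv _
    have h2 := Real.log_le_sub_one_of_pos (x := g y / c) (by rw [h1]; positivity)
    rw [Real.log_div (by rw [h1]; positivity) hc.ne', h1, Real.log_inv] at h2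
    rw [logDensity, h1]
    linarith
  have hbi : Integrable (fun y => g y / c + (Real.log c - 1)) μ :=
    (hgi.div_const c).add (integrable_const _)
  have hQ : ∫⁻ y, ENNReal.ofReal (-logDensity μ m y) ∂μ ≠ ∞ := by
    refine ne_top_of_le_ne_top (lintegral_ofReal_lt_top hbi).ne (lintegral_mono_ae ?_)
    filter_upwards [hle] with y hy
    exact ENNReal.ofReal_le_ofReal hy
  have hi : Integrable (logDensity μ m) μ :=
    integrable_of_lintegral_pos_neg measurable_logDensity.aemeasurable hP hQ
  rw [entropyPower_of_integrable hac hi]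
  refine ENNReal.ofReal_le_ofReal ?_
  rw [Real.rpow_def_of_pos hc, ← integral_neg]
  refine Real.exp_le_exp.2 ?_
  rw [mul_one_div]
  refine div_le_div_of_nonneg_right ?_ hn.le
  refine (integral_mono_ae hi.neg hbi hle).trans ?_
  rw [integral_add (hgi.div_const c) (integrable_const _), integral_div]
  simp only [integral_const, probReal_univ, one_smul]
  have : (∫ y, g y ∂μ) / c ≤ 1 := (div_le_one hc).2 hgc
  linarith

end EntropyPower

/-- The parameter `1/2` of the unit interval. -/
noncomputable def half : unitInterval := ⟨1 / 2, by norm_num, by norm_num⟩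

theorem half_mem : half ∈ Ioo (0 : unitInterval) 1 := half_mem_Ioo

theorem coe_half : (half : ℝ) = 1 / 2 := rfl

/-! ### Vanishing of the mass of the end-points -/

section Plans

variable {Z : Type*} [TopologicalSpace Z] [PolishSpace Z] [MeasurableSpace Z] [BorelSpace Z]

theorem measurable_eval (t : unitInterval) : Measurable fun γ : C(unitInterval, Z) => γ t :=
  (continuous_eval_const t).measurable

theorem ae_marginal {ν : Measure C(unitInterval, Z)} {μ : Measure Z} {t : unitInterval}
    (h : ν.map (fun γ => γ t) = μ) {p : Z → Prop} (hp : ∀ᵐ x ∂μ, p x) : ∀ᵐ γ ∂ν, p (γ t) := by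
  rw [← h] at hp
  exact ae_of_ae_map (measurable_eval t).aemeasurable hp

/-- If all points of `E` are initial for `R`, and transport plans for `R` do not lose more entropy
power than allowed by concavity, then `E` is negligible: transport away from `E` would concentrate
the mass on sets of arbitrarily small measure. -/
theorem measure_eq_zero_of_plans [LocallyCompactSpace Z] {m : Measure Z}
    [IsFiniteMeasureOnCompacts m] {n : ℝ} (hn : 0 < n) {R : Z → Z → Prop} {D E : Set Z}
    (hR : IsClosed {p : Z × Z | R p.1 p.2}) (hanti : ∀ x y, R x y → R y x → x = y)
    (htrans : ∀ x y z, R x y → R y z → R x z) (htot : ∀ w z, ∀ y ∈ D, R w y → R z y → R w z ∨ R z w)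
    (hinit : ∀ x ∈ E, ∀ w, R w x → w = x) (hED : Disjoint E D) (hD : MeasurableSet D)
    (hE : MeasurableSet E) (y : Z → Z) (hy : Measurable y) (hyR : ∀ x ∈ E, R x (y x) ∧ y x ∈ D)
    (hNC : ∀ (π : Measure (Z × Z)), IsProbabilityMeasure π → (∀ᵐ p ∂π, R p.1 p.2) →
      ∃ ν : Measure C(unitInterval, Z), IsProbabilityMeasure ν ∧
        ν.map (fun γ => γ 0) = π.map Prod.fst ∧ ν.map (fun γ => γ 1) = π.map Prod.snd ∧
        (∀ᵐ γ ∂ν, (∀ s t, s ≤ t → R (γ s) (γ t)) ∧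
          (γ 0 ≠ γ 1 → ∀ t ∈ Ioo (0 : unitInterval) 1, γ t ∈ D)) ∧
        2⁻¹ * entropyPower n (π.map Prod.fst) m ≤ entropyPower n (ν.map fun γ => γ half) m) :
    m E = 0 := by
  let := TopologicalSpace.metrizableSpaceMetric Z
  by_contra hmE
  obtain ⟨K, hKE, hK, hmK⟩ := hE.exists_lt_isCompact (μ := m) (r := 0) (pos_iff_ne_zero.2 hmE)
  have hmKtop : m K ≠ ∞ := hK.measure_lt_top.ne
  have hKr : 0 < (m K).toReal := ENNReal.toReal_pos hmK.ne' hmKtop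
  -- The normalised restriction of `m` to `K` has density `1 / m K`; the factor `2` absorbs a later
  -- conditioning on an event of probability above `1/2`.
  set κ : ℝ := 2 / (m K).toReal with hκ
  have hκ0 : 0 < κ := by positivity
  set μ₀ : Measure Z := (m K)⁻¹ • m.restrict K with hμ₀
  have hμ₀p : IsProbabilityMeasure μ₀ := ⟨by
    simp [hμ₀, ENNReal.inv_mul_cancel hmK.ne' hmKtop]⟩
  have hμ₀K : ∀ᵐ x ∂μ₀, x ∈ K := by
    refine Measure.ae_smul_measure ?_ _
    exact ae_restrict_mem hK.measurableSet
  have hgr : Measurable fun x => (x, y x) := measurable_id.prodMk hy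
  have hπ : IsProbabilityMeasure (μ₀.map fun x => (x, y x)) :=
    Measure.isProbabilityMeasure_map hgr.aemeasurable
  obtain ⟨ν, hνp, hν0, hν1, hνg, -⟩ := hNC (μ₀.map fun x => (x, y x)) hπ (by
    rw [ae_map_iff hgr.aemeasurable hR.measurableSet]
    filter_upwards [hμ₀K] with x hx using (hyR x (hKE hx)).1)
  rw [Measure.map_map measurable_fst hgr] at hν0
  rw [Measure.map_map measurable_snd hgr] at hν1
  have hν0' : ν.map (fun γ => γ 0) = μ₀ := hν0.trans Measure.map_id
  have hνK : ∀ᵐ γ ∂ν, γ 0 ∈ K := ae_marginal hν0' hμ₀K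
  have hνD : ∀ᵐ γ ∂ν, γ 1 ∈ D := by
    refine ae_marginal hν1 ?_
    rw [ae_map_iff (p := fun x => x ∈ D) (measurable_snd.comp hgr).aemeasurable hD]
    filter_upwards [hμ₀K] with x hx using (hyR x (hKE hx)).2
  -- The left side does not depend on `ε`, while `D ∩ cthickening ε K` shrinks to `D ∩ K = ∅`: this
  -- is the contradiction.
  have key : ∀ ε > 0, m (D ∩ Metric.cthickening ε K) ≠ ∞ →
      2⁻¹ * ENNReal.ofReal (κ ^ (-1 / n)) ≤
        ENNReal.ofReal ((m (D ∩ Metric.cthickening ε K)).toReal ^ (1 / n)) := by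
    intro ε hε hfin
    let τ : ℕ → unitInterval := fun k => ⟨1 / (k + 2), by positivity, by
      rw [div_le_one (by positivity)]
      linarith [Nat.cast_nonneg (α := ℝ) k]⟩
    have hτ : ∀ k, τ k ∈ Ioo (0 : unitInterval) 1 := fun k =>
      ⟨Subtype.mk_lt_mk.2 (by positivity), Subtype.mk_lt_mk.2 (by
        rw [div_lt_one (by positivity)]
        linarith [Nat.cast_nonneg (α := ℝ) k])⟩
    -- Curves that stay within `ε` of their start up to time `τ k`. They exhaust all curves as `k`
    -- grows, so some `S k` has probability above `1/2`.
    let S : ℕ → Set C(unitInterval, Z) := fun k => {γ | ∀ s ≤ τ k, dist (γ s) (γ 0) ≤ ε}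
    have hSm : ∀ k, MeasurableSet (S k) := fun k => by
      refine IsClosed.measurableSet ?_
      simp only [S, ofPred_forall]
      exact isClosed_iInter fun s => isClosed_iInter fun _ =>
        isClosed_le ((continuous_eval_const s).dist (continuous_eval_const 0)) continuous_const
    have hSmono : Monotone S := fun i j hij γ hγ s hs => hγ s (hs.trans (Subtype.mk_le_mk.2 (by
      have : (i : ℝ) ≤ j := Nat.cast_le.2 hij
      gcongr)))
    have hSU : ⋃ k, S k = univ := by
      refine eq_univ_of_forall fun γ => ?_
      have hev : ∀ᶠ s in 𝓝 (0 : unitInterval), dist (γ s) (γ 0) < ε :=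
        (γ.continuous.tendsto 0).eventually (Metric.ball_mem_nhds _ hε)
      obtain ⟨δ, hδ, hball⟩ := Metric.eventually_nhds_iff.1 hev
      obtain ⟨k, hk⟩ := exists_nat_one_div_lt hδ
      refine mem_iUnion.2 ⟨k, fun s hs => (hball ?_).le⟩
      rw [Subtype.dist_eq, Real.dist_eq]
      have h1 : (s : ℝ) ≤ 1 / (k + 2) := hs
      have h2 : (1 : ℝ) / (k + 2) ≤ 1 / (k + 1) := by gcongr; norm_num
      have h3 : (0 : ℝ) ≤ s := s.2.1
      simp only [Icc.coe_zero, sub_zero, abs_of_nonneg h3]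
      linarith
    obtain ⟨k, hk⟩ : ∃ k, 2⁻¹ < ν (S k) := by
      have h1 := tendsto_measure_iUnion_atTop (μ := ν) hSmono
      rw [hSU, measure_univ] at h1
      exact (h1.eventually (lt_mem_nhds ENNReal.one_half_lt_one)).exists
    have hS0 : ν (S k) ≠ 0 := (lt_of_le_of_lt bot_le hk).ne'
    set ν' : Measure C(unitInterval, Z) := (ν (S k))⁻¹ • ν.restrict (S k) with hν'
    have hν'p : IsProbabilityMeasure ν' := ⟨by
      simp [hν', ENNReal.inv_mul_cancel hS0 (measure_ne_top _ _)]⟩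
    have hν'ac : ν' ≪ ν :=
      Measure.smul_absolutelyContinuous.trans Measure.restrict_le_self.absolutelyContinuous
    have hν'S : ∀ᵐ γ ∂ν', γ ∈ S k := Measure.ae_smul_measure (ae_restrict_mem (hSm k)) _
    have hpair : Measurable fun γ : C(unitInterval, Z) => (γ 0, γ (τ k)) :=
      (measurable_eval 0).prodMk (measurable_eval (τ k))
    have hπ' : IsProbabilityMeasure (ν'.map fun γ => (γ 0, γ (τ k))) :=
      Measure.isProbabilityMeasure_map hpair.aemeasurable
    -- The transport hypothesis is used a second time, for the coupling of `γ 0` and `γ (τ k)` under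
    -- the conditioned plan. Nothing says that the new plan follows the old curves; the set `B`
    -- below controls every causal route between `K` and the new targets.
    obtain ⟨ν'', hν''p, h0, h1, hg, hU⟩ := hNC _ hπ' (by
      rw [ae_map_iff hpair.aemeasurable hR.measurableSet]
      filter_upwards [hν'ac.ae_le hνg] with γ hγ using hγ.1 0 (τ k) unitInterval.nonneg')
    rw [Measure.map_map measurable_fst hpair] at h0 hU
    rw [Measure.map_map measurable_snd hpair] at h1
    have hev0 : Prod.fst ∘ (fun γ : C(unitInterval, Z) => (γ 0, γ (τ k))) = fun γ => γ 0 := rfl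
    have hev1 : Prod.snd ∘ (fun γ : C(unitInterval, Z) => (γ 0, γ (τ k))) = fun γ => γ (τ k) := rfl
    rw [hev0] at h0 hU
    rw [hev1] at h1
    have hle : ν'.map (fun γ => γ 0) ≤ ENNReal.ofReal κ • m := by
      have e1 : ν' ≤ (2 : ℝ≥0∞) • ν := by
        refine Measure.le_iff.2 fun s _ => ?_
        simp only [hν', Measure.smul_apply, smul_eq_mul]
        refine mul_le_mul' ?_ (Measure.restrict_apply_le _ _)
        rw [ENNReal.inv_le_iff_inv_le]
        exact hk.le
      have e2 : (2 : ℝ≥0∞) • μ₀ ≤ ENNReal.ofReal κ • m := by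
        refine Measure.le_iff.2 fun s _ => ?_
        simp only [hμ₀, Measure.smul_apply, smul_eq_mul]
        rw [← mul_assoc, hκ, ENNReal.ofReal_div_of_pos hKr, ENNReal.ofReal_toReal hmKtop,
          ENNReal.div_eq_inv_mul, mul_comm (2 : ℝ≥0∞)]
        refine mul_le_mul' (by simp) (Measure.restrict_apply_le _ _)
      refine le_trans (Measure.map_mono e1 (measurable_eval 0)) ?_
      rw [Measure.map_smul, hν0']
      exact e2
    have hp0 : IsProbabilityMeasure (ν'.map fun γ => γ 0) :=
      Measure.isProbabilityMeasure_map (measurable_eval 0).aemeasurable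
    have hp2 : IsProbabilityMeasure (ν''.map fun γ => γ half) :=
      Measure.isProbabilityMeasure_map (measurable_eval half).aemeasurable
    have hlow := le_entropyPower_of_le_smul hκ0 hle hn
    -- bounded causal intervals
    let B : Set Z := {y' | ∀ x ∈ K, ∀ z, R x z → R z y' → dist z x ≤ ε}
    have hB : MeasurableSet B := by
      have hcl : IsClosed {q : Z × Z × Z | q.1 ∈ K ∧ R q.1 q.2.1 ∧ R q.2.1 q.2.2} := by
        refine (hK.isClosed.preimage continuous_fst).inter ((hR.preimage
          (continuous_fst.prodMk (continuous_fst.comp continuous_snd))).inter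
          (hR.preimage continuous_snd))
      have hop : IsOpen {q : Z × Z × Z | ε < dist q.2.1 q.1} :=
        isOpen_lt continuous_const ((continuous_fst.comp continuous_snd).dist continuous_fst)
      have hσ := (isSigmaCompact_of_isClosed_inter_isOpen hcl hop).image
        (continuous_snd.comp continuous_snd)
      refine MeasurableSet.compl_iff.1 ?_
      convert hσ.measurableSet' using 1
      ext y'
      simp only [B, mem_compl_iff, mem_ofPred_eq, not_forall, not_le, mem_image, mem_inter_iff,
        Function.comp, Prod.exists]
      constructor
      · rintro ⟨x, hx, z, h1, h2, h3⟩
        exact ⟨x, z, y', ⟨⟨hx, h1, h2⟩, h3⟩, rfl⟩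
      · rintro ⟨x, z, _, ⟨⟨hx, h1, h2⟩, h3⟩, rfl⟩
        exact ⟨x, hx, z, h1, h2, h3⟩
    -- A point `x` of `K` in the past of `γ (τ k)` is comparable with `γ 0`; both are initial, so
    -- they coincide. A point `z` between them is comparable with every `γ s`, and by connectedness
    -- of `[0, τ k]` it is one of the `γ s`, hence within `ε` of `γ 0`.
    have hDB : ∀ᵐ γ ∂ν', γ (τ k) ∈ D ∩ B := by
      filter_upwards [hν'ac.ae_le hνg, hν'ac.ae_le hνK, hν'ac.ae_le hνD, hν'S]
        with γ hγ hγK hγD hγS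
      have hne : γ 0 ≠ γ 1 := fun h => disjoint_left.1 hED (hKE hγK) (h ▸ hγD)
      have hD1 := hγ.2 hne (τ k) (hτ k)
      refine ⟨hD1, fun x hx z hxz hzy => ?_⟩
      have hle0 : R (γ 0) (γ (τ k)) := hγ.1 _ _ unitInterval.nonneg'
      obtain rfl : γ 0 = x := by
        rcases htot (γ 0) x _ hD1 hle0 (htrans _ _ _ hxz hzy) with h | h
        · exact hinit x (hKE hx) _ h
        · exact (hinit _ (hKE hγK) _ h).symm
      have hcl1 : IsClosed {s : unitInterval | R (γ s) z} :=
        hR.preimage (γ.continuous.prodMk continuous_const)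
      have hcl2 : IsClosed {s : unitInterval | R z (γ s)} :=
        hR.preimage (continuous_const.prodMk γ.continuous)
      obtain ⟨s, hs, hs1, hs2⟩ := isPreconnected_closed_iff.1
        (isPreconnected_Icc (a := (0 : unitInterval)) (b := τ k)) _ _ hcl1 hcl2
        (fun s hs => htot (γ s) z _ hD1 (hγ.1 _ _ hs.2) hzy)
        ⟨0, ⟨le_rfl, unitInterval.nonneg'⟩, hxz⟩ ⟨τ k, ⟨unitInterval.nonneg', le_rfl⟩, hzy⟩
      rw [← hanti _ _ hs1 hs2]
      exact hγS s hs.2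
    -- At half time the new curve lies between a point of `K` and a point of `B`, hence in the
    -- thickening of `K`, and it has already entered `D`.
    have hmid : ∀ᵐ γ ∂ν'', γ half ∈ D ∩ Metric.cthickening ε K := by
      have hK'' : ∀ᵐ γ ∂ν'', γ 0 ∈ K := by
        refine ae_marginal h0 ?_
        rw [ae_map_iff (p := fun x => x ∈ K) (measurable_eval 0).aemeasurable hK.measurableSet]
        exact hν'ac.ae_le hνK
      have hDB'' : ∀ᵐ γ ∂ν'', γ 1 ∈ D ∩ B := by
        refine ae_marginal h1 ?_
        rw [ae_map_iff (p := fun x => x ∈ D ∩ B) (measurable_eval _).aemeasurable (hD.inter hB)]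
        exact hDB
      filter_upwards [hg, hK'', hDB''] with γ hγ hγK hγD
      have hne : γ 0 ≠ γ 1 := fun h => disjoint_left.1 hED (hKE hγK) (h ▸ hγD.1)
      refine ⟨hγ.2 hne half half_mem, ?_⟩
      exact Metric.mem_cthickening_of_dist_le _ _ _ _ hγK
        (hγD.2 _ hγK _ (hγ.1 _ _ unitInterval.nonneg') (hγ.1 _ _ unitInterval.le_one'))
    have hAm : MeasurableSet (D ∩ Metric.cthickening ε K) :=
      hD.inter Metric.isClosed_cthickening.measurableSet
    have hup := entropyPower_le_of_concentrated (μ := ν''.map fun γ => γ half) (m := m) hAm (by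
      rw [← mem_ae_iff]
      exact (ae_map_iff (p := fun x => x ∈ D ∩ Metric.cthickening ε K)
        (measurable_eval half).aemeasurable hAm).2 hmid) hfin hn
    exact ((mul_le_mul' le_rfl hlow).trans hU).trans hup
  obtain ⟨δ, hδ, hδK⟩ := hK.exists_isCompact_cthickening
  have hfin : ∀ ε ≤ δ, m (D ∩ Metric.cthickening ε K) ≠ ∞ := fun ε hε =>
    ne_top_of_le_ne_top hδK.measure_lt_top.ne
      (measure_mono (inter_subset_right.trans (Metric.cthickening_mono hε K)))
  have hlim : Tendsto (fun ε => m (D ∩ Metric.cthickening ε K)) (𝓝[>] 0) (𝓝 0) := by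
    have hinter : ⋂ ε > 0, D ∩ Metric.cthickening ε K = (∅ : Set Z) := by
      refine eq_empty_of_forall_notMem fun z hz => ?_
      simp only [mem_iInter] at hz
      have hzK : z ∈ closure K := by
        rw [Metric.closure_eq_iInter_cthickening]
        exact mem_iInter₂.2 fun ε hε => (hz ε hε).2
      rw [hK.isClosed.closure_eq] at hzK
      exact disjoint_left.1 hED (hKE hzK) (hz 1 one_pos).1
    have := tendsto_measure_biInter_gt (μ := m) (s := fun ε => D ∩ Metric.cthickening ε K)
      (a := (0 : ℝ)) (fun ε _ => (hD.inter Metric.isClosed_cthickening.measurableSet).nullMeasurableSet)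
      (fun i j _ hij => inter_subset_inter_right _ (Metric.cthickening_mono hij K))
      ⟨δ, hδ, hfin δ le_rfl⟩
    rwa [hinter, measure_empty] at this
  have hlim2 : Tendsto (fun ε => ENNReal.ofReal ((m (D ∩ Metric.cthickening ε K)).toReal ^ (1 / n)))
      (𝓝[>] 0) (𝓝 0) := by
    have h1 := (ENNReal.tendsto_toReal ENNReal.zero_ne_top).comp hlim
    have h2 := h1.rpow_const (p := 1 / n) (Or.inr (by positivity))
    have h3 := ENNReal.tendsto_ofReal h2
    rw [ENNReal.toReal_zero, Real.zero_rpow (by positivity), ENNReal.ofReal_zero] at h3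
    exact h3
  have hcontra : 2⁻¹ * ENNReal.ofReal (κ ^ (-1 / n)) ≤ 0 := by
    refine ge_of_tendsto hlim2 ?_
    filter_upwards [Ioc_mem_nhdsGT hδ] with ε hε
    exact key ε hε.1 (hfin ε hε.2)
  have hpos : 0 < 2⁻¹ * ENNReal.ofReal (κ ^ (-1 / n)) :=
    ENNReal.mul_pos (by simp) (ENNReal.ofReal_pos.2 (Real.rpow_pos_of_pos hκ0 _)).ne'
  exact absurd hcontra (not_le.2 hpos)

end Plans

/-! ### Weak convexity and negligible end-points from the null energy condition -/

section Consequences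

variable {X : Type*} [TopologicalCausalSpace X] [MeasurableSpace X] [BorelSpace X] {H : Set X}
variable [hH : Fact (IsClosed H)] {G : noEnds H → ℝ} {m : Measure H} {N : ℝ}

/-- A plan between the Dirac masses at `x` and `y` is carried by causal curves from `x` to `y`; the
entropy inequality is not needed. -/
theorem NCe.weaklyConvex (h : NCe G m N) : WeaklyConvex H := by
  intro x y hxy hne
  obtain ⟨ν, hν, -⟩ := h (Measure.dirac x) (Measure.dirac y) inferInstance inferInstance
    ⟨Measure.dirac (x, y), inferInstance, Measure.map_dirac' measurable_fst (x, y),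
      Measure.map_dirac' measurable_snd (x, y), by
        rw [ae_dirac_iff (isClosed_le continuous_fst continuous_snd).measurableSet]
        exact hxy⟩
  have := hν.isProbabilityMeasure
  have h0 : ∀ᵐ γ ∂ν, γ 0 = x := ae_marginal (p := fun z => z = x) hν.marginal_zero (by
    rw [ae_dirac_eq]; exact rfl)
  have h1 : ∀ᵐ γ ∂ν, γ 1 = y := ae_marginal (p := fun z => z = y) hν.marginal_one (by
    rw [ae_dirac_eq]; exact rfl)
  obtain ⟨γ, hγ0, hγ1, hγ⟩ := (h0.and (h1.and hν.gCausal)).exists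
  exact ⟨γ, ⟨γ.continuous, hγ.1, 0, 1, by rwa [hγ0, hγ1]⟩, hγ0, hγ1⟩

theorem mem_noEnds_of_gCausal {γ : C(unitInterval, H)} (hγ : γ ∈ gCausalCurves G)
    (hne : γ 0 ≠ γ 1) {t : unitInterval} (ht : t ∈ Ioo (0 : unitInterval) 1) : γ t ∈ noEnds H := by
  rcases hγ.2 with h | ⟨h, -⟩
  · exact absurd (h 0 1) hne
  · exact h t ht

/-- Reversal of time. -/
def reverseCurve (γ : C(unitInterval, H)) : C(unitInterval, H) :=
  γ.comp ⟨unitInterval.symm, unitInterval.continuous_symm⟩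

theorem reverseCurve_apply (γ : C(unitInterval, H)) (t : unitInterval) :
    reverseCurve γ t = γ (unitInterval.symm t) := rfl

theorem measurable_reverseCurve :
    Measurable (reverseCurve : C(unitInterval, H) → C(unitInterval, H)) :=
  measurable_curve_iff.2 fun _ => measurable_eval _

/-- Reversal of time, as a measurable equivalence. -/
def reverseEquiv : C(unitInterval, H) ≃ᵐ C(unitInterval, H) :=
  MeasurableEquiv.ofInvolutive reverseCurve
    (fun γ => by ext t; simp [reverseCurve_apply]) measurable_reverseCurve

theorem symm_half : unitInterval.symm half = half := by
  ext
  rw [unitInterval.coe_symm_eq, coe_half]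
  norm_num

theorem inv_two_mul_le_of_half {a b c : ℝ≥0∞}
    (h : ENNReal.ofReal (1 - (half : ℝ)) * a + ENNReal.ofReal (half : ℝ) * b ≤ c) :
    2⁻¹ * a ≤ c ∧ 2⁻¹ * b ≤ c := by
  have e : ENNReal.ofReal (1 / 2) = 2⁻¹ := by
    rw [one_div, ENNReal.ofReal_inv_of_pos two_pos]; simp
  rw [coe_half, show (1 : ℝ) - 1 / 2 = 1 / 2 by norm_num, e] at h
  exact ⟨le_self_add.trans h, le_add_self.trans h⟩

/-- `measure_eq_zero_of_plans` is applied to `≤` for the initial points that are not final, and to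
the reversed relation, with plans run backwards, for the final points that are not initial. Static
points are null by assumption. -/
theorem NCe.measure_ends_eq_zero (hNC : NCe G m N) (hS : RaySetting H G)
    [IsFiniteMeasureOnCompacts m] (hs : m (staticPoints H) = 0) (hN : 1 < N) :
    m (initialPoints H ∪ finalPoints H) = 0 := by
  rcases isEmpty_or_nonempty H with hemp | hnon
  · rw [eq_empty_of_isEmpty (initialPoints H ∪ finalPoints H), measure_empty]
  have htot : ∀ w z : H, ∀ y ∈ noEnds H, (w ≤ y ∨ y ≤ w) → (z ≤ y ∨ y ≤ z) → w ≤ z ∨ z ≤ w :=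
    fun w z y hy hw hz => hS.total_onRay (β := ⟨y, hy⟩) hw hz
  have hle : IsClosed {p : H × H | p.1 ≤ p.2} := isClosed_le continuous_fst continuous_snd
  have hge : IsClosed {p : H × H | p.2 ≤ p.1} := isClosed_le continuous_snd continuous_fst
  have hIF : m (initialPoints H \ finalPoints H) = 0 := by
    -- Pairs `(x, y)` for which `y` lies strictly between `x` and a third point, so that `y` belongs
    -- to `H°`. A Borel selection provides the targets of the transport.
    have hσ : IsSigmaCompact ((fun p : H × H × H => (p.1, p.2.1)) ''
        ({p | p.1 ≤ p.2.1 ∧ p.2.1 ≤ p.2.2} ∩ {p | p.1 ≠ p.2.1 ∧ p.2.2 ≠ p.2.1})) := by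
      refine (isSigmaCompact_of_isClosed_inter_isOpen ?_ ?_).image (by fun_prop)
      · exact (isClosed_le (by fun_prop) (by fun_prop)).inter
          (isClosed_le (by fun_prop) (by fun_prop))
      · exact (isOpen_ne_fun (by fun_prop) (by fun_prop)).inter
          (isOpen_ne_fun (by fun_prop) (by fun_prop))
    obtain ⟨y, hy, hyR⟩ := exists_measurable_selection hσ
    refine measure_eq_zero_of_plans (n := N - 1) (R := (· ≤ ·)) (D := noEnds H) (by linarith) hle
      (fun x y => hS.antisymm) (fun x y z => le_trans)
      (fun w z y hy hw hz => htot w z y hy (Or.inl hw) (Or.inl hz))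
      (fun x hx w hw => eq_of_le_initial hx.1 hw)
      (disjoint_left.2 fun x hx => initial_notMem_noEnds hx.1) measurableSet_noEnds
      (measurableSet_initialPoints.diff measurableSet_finalPoints) y hy ?_ ?_
    · intro x hx
      obtain ⟨x', hxx', hne⟩ : ∃ x' : H, x ≤ x' ∧ x' ≠ x := not_not.1 hx.2
      obtain ⟨σ, -, hm, hi, h0, h1⟩ := hS.weaklyConvex.exists_arc hxx' hne.symm
      have := hyR x (σ half) ⟨(x, σ half, x'), ⟨⟨?_, ?_⟩, ?_, ?_⟩, rfl⟩
      · obtain ⟨⟨a, b, c⟩, ⟨⟨h1, h2⟩, h3, h4⟩, h5⟩ := this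
        simp only [Prod.mk.injEq] at h1 h2 h3 h4 h5
        obtain ⟨rfl, rfl⟩ := h5
        exact ⟨h1, mem_noEnds.2 ⟨⟨_, h1, h3⟩, ⟨_, h2, h4⟩⟩⟩
      · exact h0 ▸ hm half_mem.1.le
      · exact h1 ▸ hm half_mem.2.le
      · exact h0 ▸ fun h => half_mem.1.ne (hi h)
      · exact h1 ▸ fun h => half_mem.2.ne (hi h).symm
    · intro π hπ hπR
      obtain ⟨ν, hν, hU⟩ := hNC (π.map Prod.fst) (π.map Prod.snd)
        (Measure.isProbabilityMeasure_map measurable_fst.aemeasurable)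
        (Measure.isProbabilityMeasure_map measurable_snd.aemeasurable) ⟨π, hπ, rfl, rfl, hπR⟩
      refine ⟨ν, hν.isProbabilityMeasure, hν.marginal_zero, hν.marginal_one, ?_,
        (inv_two_mul_le_of_half (hU half)).1⟩
      filter_upwards [hν.gCausal] with γ hγ
      exact ⟨fun s t h => hγ.1 h, fun hne t ht => mem_noEnds_of_gCausal hγ hne ht⟩
  have hFI : m (finalPoints H \ initialPoints H) = 0 := by
    have hσ : IsSigmaCompact ((fun p : H × H × H => (p.1, p.2.1)) ''
        ({p | p.2.1 ≤ p.1 ∧ p.2.2 ≤ p.2.1} ∩ {p | p.1 ≠ p.2.1 ∧ p.2.2 ≠ p.2.1})) := by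
      refine (isSigmaCompact_of_isClosed_inter_isOpen ?_ ?_).image (by fun_prop)
      · exact (isClosed_le (by fun_prop) (by fun_prop)).inter
          (isClosed_le (by fun_prop) (by fun_prop))
      · exact (isOpen_ne_fun (by fun_prop) (by fun_prop)).inter
          (isOpen_ne_fun (by fun_prop) (by fun_prop))
    obtain ⟨y, hy, hyR⟩ := exists_measurable_selection hσ
    refine measure_eq_zero_of_plans (n := N - 1) (R := fun a b => b ≤ a) (D := noEnds H)
      (by linarith) hge
      (fun x y h h' => hS.antisymm h' h) (fun x y z h h' => le_trans h' h)
      (fun w z y hy hw hz => (htot w z y hy (Or.inr hw) (Or.inr hz)).symm)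
      (fun x hx w hw => eq_of_final_le hx.1 hw)
      (disjoint_left.2 fun x hx => final_notMem_noEnds hx.1) measurableSet_noEnds
      (measurableSet_finalPoints.diff measurableSet_initialPoints) y hy ?_ ?_
    · intro x hx
      obtain ⟨x', hxx', hne⟩ : ∃ x' : H, x' ≤ x ∧ x' ≠ x := not_not.1 hx.2
      obtain ⟨σ, -, hm, hi, h0, h1⟩ := hS.weaklyConvex.exists_arc hxx' hne
      have := hyR x (σ half) ⟨(x, σ half, x'), ⟨⟨?_, ?_⟩, ?_, ?_⟩, rfl⟩
      · obtain ⟨⟨a, b, c⟩, ⟨⟨h1, h2⟩, h3, h4⟩, h5⟩ := this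
        simp only [Prod.mk.injEq] at h1 h2 h3 h4 h5
        obtain ⟨rfl, rfl⟩ := h5
        exact ⟨h1, mem_noEnds.2 ⟨⟨_, h2, h4⟩, ⟨_, h1, h3⟩⟩⟩
      · exact h1 ▸ hm half_mem.2.le
      · exact h0 ▸ hm half_mem.1.le
      · exact h1 ▸ fun h => half_mem.2.ne (hi h).symm
      · exact h0 ▸ fun h => half_mem.1.ne (hi h)
    · intro π hπ hπR
      obtain ⟨ν, hν, hU⟩ := hNC (π.map Prod.snd) (π.map Prod.fst)
        (Measure.isProbabilityMeasure_map measurable_snd.aemeasurable)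
        (Measure.isProbabilityMeasure_map measurable_fst.aemeasurable)
        ⟨π.map Prod.swap, Measure.isProbabilityMeasure_map measurable_swap.aemeasurable,
          by rw [Measure.map_map measurable_fst measurable_swap]; rfl,
          by rw [Measure.map_map measurable_snd measurable_swap]; rfl,
          (ae_map_iff measurable_swap.aemeasurable hle.measurableSet).2 hπR⟩
      have := hν.isProbabilityMeasure
      have hmap : ∀ t, (ν.map reverseCurve).map (fun γ => γ t) =
          marginal ν (unitInterval.symm t) := fun t => by
        rw [Measure.map_map (measurable_eval t) measurable_reverseCurve]; rfl
      refine ⟨ν.map reverseCurve,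
        Measure.isProbabilityMeasure_map measurable_reverseCurve.aemeasurable, ?_, ?_, ?_, ?_⟩
      · rw [hmap, unitInterval.symm_zero]; exact hν.marginal_one
      · rw [hmap, unitInterval.symm_one]; exact hν.marginal_zero
      · rw [reverseEquiv.measurableEmbedding.ae_map_iff (f := reverseCurve)]
        filter_upwards [hν.gCausal] with γ hγ
        refine ⟨fun s t h => hγ.1 (unitInterval.symm_le_symm.2 h), fun hne t ht => ?_⟩
        rw [reverseCurve_apply, reverseCurve_apply, unitInterval.symm_zero,
          unitInterval.symm_one] at hne
        refine mem_noEnds_of_gCausal hγ hne.symm ⟨?_, ?_⟩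
        · exact unitInterval.pos_iff_ne_zero.2 fun h => ht.2.ne (unitInterval.symm_eq_zero.1 h)
        · exact unitInterval.lt_one_iff_ne_one.2 fun h => ht.1.ne' (unitInterval.symm_eq_one.1 h)
      · rw [hmap, symm_half]
        exact (inv_two_mul_le_of_half (hU half)).2
  refine measure_mono_null (t := (initialPoints H \ finalPoints H) ∪
    ((finalPoints H \ initialPoints H) ∪ staticPoints H)) ?_
    (measure_union_null hIF (measure_union_null hFI hs))
  intro x hx
  by_cases h1 : x ∈ initialPoints H <;> by_cases h2 : x ∈ finalPoints H <;>
    simp_all [staticPoints]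

end Consequences

/-! ### From the Brunn-Minkowski inequality on an interval to a concave density -/

section BrunnMinkowski

/-- The Brunn-Minkowski inequality with exponent `1/n` for pairs of disjoint intervals in `J`. -/
def BrunnMinkowski (n : ℝ) (J : Set ℝ) (M : Measure ℝ) : Prop :=
  ∀ a₀ b₀ a₁ b₁ t : ℝ, a₀ ≤ b₀ → b₀ < a₁ → a₁ ≤ b₁ → 0 < t → t < 1 → a₀ ∈ J → b₁ ∈ J →
    (1 - t) * (M (Icc a₀ b₀)).toReal ^ (1 / n) + t * (M (Icc a₁ b₁)).toReal ^ (1 / n) ≤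
      (M (Icc ((1 - t) * a₀ + t * a₁) ((1 - t) * b₀ + t * b₁))).toReal ^ (1 / n)

variable {n : ℝ} {J : Set ℝ} {M : Measure ℝ}

theorem tendsto_measure_Icc {a b : ℝ} {ε : ℝ} (hε : 0 < ε) (hfin : M (Icc (a - ε) (b + ε)) ≠ ∞) :
    Tendsto (fun η => M (Icc (a - η) (b + η))) (𝓝[>] 0) (𝓝 (M (Icc a b))) := by
  have h := tendsto_measure_biInter_gt (μ := M) (s := fun η => Icc (a - η) (b + η)) (a := (0 : ℝ))
    (fun _ _ => measurableSet_Icc.nullMeasurableSet)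
    (fun i j _ hij => Icc_subset_Icc (by linarith) (by linarith)) ⟨ε, hε, hfin⟩
  have e : ⋂ r > (0 : ℝ), Icc (a - r) (b + r) = Icc a b := by
    ext x
    simp only [mem_iInter, mem_Icc]
    refine ⟨fun hx => ⟨?_, ?_⟩, fun hx r hr => ⟨by linarith [hx.1], by linarith [hx.2]⟩⟩
    · exact le_of_forall_pos_le_add fun η hη => by linarith [(hx η hη).1]
    · exact le_of_forall_pos_le_add fun η hη => by linarith [(hx η hη).2]
  rwa [e] at h

/-- The given intervals are enclosed in slightly larger rational ones, which only increases the left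
side; the interpolated interval is eventually inside an `η`-enlargement of the limit one, and the
measure is continuous from above as `η` tends to `0`. Rational parameters leave only countably many
exceptional null sets of rays. -/
theorem brunnMinkowski_of_rat (hn : 0 < n) (hJo : IsOpen J)
    (hfin : ∀ a ∈ J, ∀ b ∈ J, M (Icc a b) ≠ ∞)
    (hrat : ∀ a₀ b₀ a₁ b₁ t : ℚ, a₀ ≤ b₀ → b₀ < a₁ → a₁ ≤ b₁ → 0 < t → t < 1 → (a₀ : ℝ) ∈ J →
      (b₁ : ℝ) ∈ J →
      (1 - t) * (M (Icc (a₀ : ℝ) b₀)).toReal ^ (1 / n) + t * (M (Icc (a₁ : ℝ) b₁)).toReal ^ (1 / n) ≤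
      (M (Icc ((1 - t) * a₀ + t * a₁ : ℝ) ((1 - t) * b₀ + t * b₁))).toReal ^ (1 / n)) :
    BrunnMinkowski n J M := by
  intro a₀ b₀ a₁ b₁ t h0 h01 h1 ht0 ht1 ha hb
  obtain ⟨ε₁, hε₁, hJ₁⟩ := Metric.isOpen_iff.1 hJo a₀ ha
  obtain ⟨ε₂, hε₂, hJ₂⟩ := Metric.isOpen_iff.1 hJo b₁ hb
  obtain ⟨A₀, -, hA₀, hA₀t⟩ := Real.exists_seq_rat_strictMono_tendsto a₀
  obtain ⟨A₁, -, hA₁, hA₁t⟩ := Real.exists_seq_rat_strictMono_tendsto a₁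
  obtain ⟨B₀, -, hB₀, hB₀t⟩ := Real.exists_seq_rat_strictAnti_tendsto b₀
  obtain ⟨B₁, -, hB₁, hB₁t⟩ := Real.exists_seq_rat_strictAnti_tendsto b₁
  obtain ⟨T, -, hT, hTt⟩ := Real.exists_seq_rat_strictAnti_tendsto t
  have hAJ : ∀ᶠ k in atTop, (A₀ k : ℝ) ∈ J := hA₀t.eventually (hJo.mem_nhds ha)
  have hBJ : ∀ᶠ k in atTop, (B₁ k : ℝ) ∈ J := hB₁t.eventually (hJo.mem_nhds hb)
  set at' := (1 - t) * a₀ + t * a₁ with hat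
  set bt' := (1 - t) * b₀ + t * b₁ with hbt
  have hatJ : a₀ < at' := by nlinarith
  have hbtJ : bt' < b₁ := by nlinarith
  obtain ⟨ε, hε, hεJ⟩ : ∃ ε > 0, M (Icc (at' - ε) (bt' + ε)) ≠ ∞ := by
    refine ⟨min (at' - a₀) (b₁ - bt'), lt_min (by linarith) (by linarith),
      ne_top_of_le_ne_top (hfin a₀ ha b₁ hb) (measure_mono (Icc_subset_Icc ?_ ?_))⟩
    · linarith [min_le_left (at' - a₀) (b₁ - bt')]
    · linarith [min_le_right (at' - a₀) (b₁ - bt')]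
  have hlim := (((ENNReal.tendsto_toReal (by
    exact ne_top_of_le_ne_top hεJ (measure_mono (Icc_subset_Icc (by linarith) (by linarith))))).comp
    (tendsto_measure_Icc hε hεJ)).rpow_const (p := 1 / n) (Or.inr (by positivity)))
  refine ge_of_tendsto hlim ?_
  filter_upwards [Ioc_mem_nhdsGT hε] with η hη
  have hL : Tendsto (fun k => (1 - (T k : ℝ)) * (M (Icc a₀ b₀)).toReal ^ (1 / n) +
      T k * (M (Icc a₁ b₁)).toReal ^ (1 / n)) atTop
      (𝓝 ((1 - t) * (M (Icc a₀ b₀)).toReal ^ (1 / n) + t * (M (Icc a₁ b₁)).toReal ^ (1 / n))) :=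
    ((tendsto_const_nhds.sub hTt).mul_const _).add (hTt.mul_const _)
  refine le_of_tendsto hL ?_
  have e1 : ∀ᶠ k in atTop, (B₀ k : ℝ) < A₁ k := hB₀t.eventually_lt hA₁t h01
  have e2 : ∀ᶠ k in atTop, (T k : ℝ) < 1 := hTt.eventually (gt_mem_nhds ht1)
  have e3 : ∀ᶠ k in atTop, at' - η < (1 - T k) * A₀ k + T k * A₁ k :=
    (((tendsto_const_nhds.sub hTt).mul hA₀t).add (hTt.mul hA₁t)).eventually
      (lt_mem_nhds (by rw [hat]; linarith [hη.1]))
  have e4 : ∀ᶠ k in atTop, (1 - T k) * B₀ k + T k * B₁ k < bt' + η :=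
    (((tendsto_const_nhds.sub hTt).mul hB₀t).add (hTt.mul hB₁t)).eventually
      (gt_mem_nhds (by rw [hbt]; linarith [hη.1]))
  filter_upwards [hAJ, hBJ, e1, e2, e3, e4] with k k1 k2 k3 k4 k5 k6
  have q0 := hA₀ k; have q1 := hA₁ k; have q2 := hB₀ k; have q3 := hB₁ k; have q4 := hT k
  have key := hrat (A₀ k) (B₀ k) (A₁ k) (B₁ k) (T k) (by exact_mod_cast (by linarith : (A₀ k : ℝ) ≤ B₀ k))
    (by exact_mod_cast k3) (by exact_mod_cast (by linarith : (A₁ k : ℝ) ≤ B₁ k))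
    (by exact_mod_cast (by linarith : (0 : ℝ) < T k)) (by exact_mod_cast k4) k1 k2
  refine le_trans ?_ (key.trans ?_)
  · have f0 : M (Icc (A₀ k : ℝ) (B₀ k)) ≠ ∞ := ne_top_of_le_ne_top (hfin _ k1 _ k2)
      (measure_mono (Icc_subset_Icc le_rfl (by linarith)))
    have f1 : M (Icc (A₁ k : ℝ) (B₁ k)) ≠ ∞ := ne_top_of_le_ne_top (hfin _ k1 _ k2)
      (measure_mono (Icc_subset_Icc (by linarith) le_rfl))
    have g0 := ENNReal.toReal_mono f0 (measure_mono (μ := M) (Icc_subset_Icc q0.le q2.le))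
    have g1 := ENNReal.toReal_mono f1 (measure_mono (μ := M) (Icc_subset_Icc q1.le q3.le))
    have t1 : 0 ≤ 1 - (T k : ℝ) := by linarith
    have t2 : 0 ≤ (T k : ℝ) := by linarith
    gcongr
  · refine Real.rpow_le_rpow ENNReal.toReal_nonneg (ENNReal.toReal_mono ?_ (measure_mono
      (Icc_subset_Icc k5.le k6.le))) (by positivity)
    exact ne_top_of_le_ne_top hεJ (measure_mono (Icc_subset_Icc (by linarith [hη.2])
      (by linarith [hη.2])))

/-- The lower density of `M` with respect to the Lebesgue measure. -/
noncomputable def lowerDensity (M : Measure ℝ) (x : ℝ) : ℝ≥0∞ :=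
  liminf (fun r => M (Metric.closedBall x r) / ENNReal.ofReal (2 * r)) (𝓝[>] 0)

theorem eventually_lt_of_lt_lowerDensity {x c : ℝ} (hc : ENNReal.ofReal c < lowerDensity M x) :
    ∀ᶠ r in 𝓝[>] 0, ENNReal.ofReal (2 * r * c) ≤ M (Icc (x - r) (x + r)) := by
  filter_upwards [eventually_lt_of_lt_liminf hc, self_mem_nhdsWithin] with r hr hr0
  have hr0 : 0 < r := hr0
  rw [ENNReal.lt_div_iff_mul_lt (Or.inl (by simpa using hr0)) (Or.inl ENNReal.ofReal_ne_top)] at hr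
  rw [ENNReal.ofReal_mul (by positivity), mul_comm, ← Real.closedBall_eq_Icc]
  exact hr.le

theorem tendsto_mul_nhdsGT_zero {k : ℝ} (hk : 0 < k) :
    Tendsto (fun δ : ℝ => δ * k) (𝓝[>] 0) (𝓝[>] 0) := by
  refine tendsto_nhdsWithin_iff.2 ⟨?_, ?_⟩
  · have : Tendsto (fun δ : ℝ => δ * k) (𝓝 0) (𝓝 (0 * k)) := tendsto_id.mul_const k
    rw [zero_mul] at this
    exact this.mono_left nhdsWithin_le_nhds
  · filter_upwards [self_mem_nhdsWithin] with δ hδ using mul_pos hδ hk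

/-- The inequality is applied to intervals of radii `δ k₀` and `δ k₁` with `k = c ^ (1/(n-1))`.
Their masses are at least `2 δ k c = 2 δ k ^ n`, whose `n`-th root is linear in `k`, so the interval
of radius `δ kt` has mass at least `2 δ kt ^ n`; dividing by its length leaves `kt ^ (n-1)`. The
value `c = 0` needs no lower bound on the density. -/
theorem BrunnMinkowski.lowerDensity_of_lt (hBM : BrunnMinkowski n J M) (hn : 1 < n)
    (hJo : IsOpen J) (hfin : ∀ a ∈ J, ∀ b ∈ J, M (Icc a b) ≠ ∞) {x₀ x₁ t c₀ c₁ : ℝ}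
    (hx₀ : x₀ ∈ J) (hx₁ : x₁ ∈ J) (hx : x₀ < x₁) (ht0 : 0 < t) (ht1 : t < 1)
    (h₀ : 0 ≤ c₀) (h₁ : 0 ≤ c₁) (hc₀ : c₀ = 0 ∨ ENNReal.ofReal c₀ < lowerDensity M x₀)
    (hc₁ : c₁ = 0 ∨ ENNReal.ofReal c₁ < lowerDensity M x₁) :
    ENNReal.ofReal (((1 - t) * c₀ ^ (1 / (n - 1)) + t * c₁ ^ (1 / (n - 1))) ^ (n - 1)) ≤
      lowerDensity M ((1 - t) * x₀ + t * x₁) := by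
  have hn1 : 0 < n - 1 := by linarith
  have hn0 : n ≠ 0 := by linarith
  set k₀ := c₀ ^ (1 / (n - 1)) with hk₀
  set k₁ := c₁ ^ (1 / (n - 1)) with hk₁
  have hk₀0 : 0 ≤ k₀ := Real.rpow_nonneg h₀ _
  have hk₁0 : 0 ≤ k₁ := Real.rpow_nonneg h₁ _
  have ek : ∀ c : ℝ, 0 ≤ c → c ^ (1 / (n - 1)) * c = (c ^ (1 / (n - 1))) ^ n := fun c hc => by
    rcases hc.eq_or_lt with rfl | hc
    · rw [mul_zero, Real.zero_rpow (by positivity), Real.zero_rpow hn0]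
    · rw [← Real.rpow_mul hc.le]
      nth_rewrite 2 [← Real.rpow_one c]
      rw [← Real.rpow_add hc]
      congr 1
      field_simp
      ring
  set kt := (1 - t) * k₀ + t * k₁ with hkt
  have hkt0 : 0 ≤ kt := by have : 0 ≤ 1 - t := by linarith
                           positivity
  rcases hkt0.eq_or_lt with hz | hktpos
  · rw [← hz, Real.zero_rpow hn1.ne', ENNReal.ofReal_zero]; exact zero_le
  have hball : ∀ (c k x : ℝ), 0 ≤ c → k = c ^ (1 / (n - 1)) → (c = 0 ∨ ENNReal.ofReal c < lowerDensity M x) →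
      ∀ᶠ δ in 𝓝[>] (0 : ℝ), ENNReal.ofReal (2 * δ * k ^ n) ≤ M (Icc (x - δ * k) (x + δ * k)) := by
    rintro c k x hc rfl (rfl | hcl)
    · refine Eventually.of_forall fun δ => ?_
      rw [Real.zero_rpow (by positivity), Real.zero_rpow hn0]
      simp
    · rcases hc.eq_or_lt with rfl | hc'
      · refine Eventually.of_forall fun δ => ?_
        rw [Real.zero_rpow (by positivity), Real.zero_rpow hn0]
        simp
      · have := (tendsto_mul_nhdsGT_zero (Real.rpow_pos_of_pos hc' (1 / (n - 1)))).eventually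
          (eventually_lt_of_lt_lowerDensity hcl)
        filter_upwards [this] with δ hδ
        rwa [← ek c hc, ← mul_assoc, mul_assoc 2 δ]
  have hz : ∀ k : ℝ, Tendsto (fun δ : ℝ => δ * k) (𝓝[>] 0) (𝓝 0) := fun k => by
    have : Tendsto (fun δ : ℝ => δ * k) (𝓝 0) (𝓝 (0 * k)) := tendsto_id.mul_const k
    rw [zero_mul] at this
    exact this.mono_left nhdsWithin_le_nhds
  have f1 : ∀ᶠ δ in 𝓝[>] (0 : ℝ), x₀ - δ * k₀ ∈ J := by
    have : Tendsto (fun δ : ℝ => x₀ - δ * k₀) (𝓝[>] 0) (𝓝 (x₀ - 0)) := (hz k₀).const_sub x₀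
    rw [sub_zero] at this
    exact this.eventually (hJo.mem_nhds hx₀)
  have f2 : ∀ᶠ δ in 𝓝[>] (0 : ℝ), x₁ + δ * k₁ ∈ J := by
    have : Tendsto (fun δ : ℝ => x₁ + δ * k₁) (𝓝[>] 0) (𝓝 (x₁ + 0)) := (hz k₁).const_add x₁
    rw [add_zero] at this
    exact this.eventually (hJo.mem_nhds hx₁)
  have f3 : ∀ᶠ δ in 𝓝[>] (0 : ℝ), x₀ + δ * k₀ < x₁ - δ * k₁ := by
    have l1 : Tendsto (fun δ : ℝ => x₀ + δ * k₀) (𝓝[>] 0) (𝓝 (x₀ + 0)) := (hz k₀).const_add x₀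
    have l2 : Tendsto (fun δ : ℝ => x₁ - δ * k₁) (𝓝[>] 0) (𝓝 (x₁ - 0)) := (hz k₁).const_sub x₁
    exact l1.eventually_lt l2 (by simpa using hx)
  have key : ∀ᶠ δ in 𝓝[>] (0 : ℝ), ENNReal.ofReal (kt ^ (n - 1)) ≤
      M (Metric.closedBall ((1 - t) * x₀ + t * x₁) (δ * kt)) / ENNReal.ofReal (2 * (δ * kt)) := by
    filter_upwards [f1, f2, f3, hball c₀ k₀ x₀ h₀ hk₀ hc₀, hball c₁ k₁ x₁ h₁ hk₁ hc₁,
      self_mem_nhdsWithin] with δ g1 g2 g3 g4 g5 hδ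
    have hδ : 0 < δ := hδ
    have d0 : 0 ≤ δ * k₀ := by positivity
    have d1 : 0 ≤ δ * k₁ := by positivity
    have B := hBM (x₀ - δ * k₀) (x₀ + δ * k₀) (x₁ - δ * k₁) (x₁ + δ * k₁) t (by linarith) g3
      (by linarith) ht0 ht1 g1 g2
    have fin : ∀ a b, x₀ - δ * k₀ ≤ a → b ≤ x₁ + δ * k₁ → M (Icc a b) ≠ ∞ := fun a b ha hb =>
      ne_top_of_le_ne_top (hfin _ g1 _ g2) (measure_mono (Icc_subset_Icc ha hb))
    have low : ∀ (k : ℝ) (S : Set ℝ), 0 ≤ k → M S ≠ ∞ → ENNReal.ofReal (2 * δ * k ^ n) ≤ M S →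
        (2 * δ) ^ (1 / n) * k ≤ (M S).toReal ^ (1 / n) := fun k S hk hS h => by
      have h' := (ENNReal.ofReal_le_iff_le_toReal hS).1 h
      have e : (2 * δ) ^ (1 / n) * k = (2 * δ * k ^ n) ^ (1 / n) := by
        rw [Real.mul_rpow (x := 2 * δ) (by positivity) (by positivity), ← Real.rpow_mul hk,
          mul_one_div_cancel hn0, Real.rpow_one]
      rw [e]
      exact Real.rpow_le_rpow (by positivity) h' (by positivity)
    have L0 := low k₀ _ hk₀0 (fin _ _ le_rfl (by linarith)) g4
    have L1 := low k₁ _ hk₁0 (fin _ _ (by linarith) le_rfl) g5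
    have eset : Icc ((1 - t) * (x₀ - δ * k₀) + t * (x₁ - δ * k₁))
        ((1 - t) * (x₀ + δ * k₀) + t * (x₁ + δ * k₁)) =
        Metric.closedBall ((1 - t) * x₀ + t * x₁) (δ * kt) := by
      rw [Real.closedBall_eq_Icc]
      congr 1 <;> rw [hkt] <;> ring
    rw [eset] at B
    have fint : M (Metric.closedBall ((1 - t) * x₀ + t * x₁) (δ * kt)) ≠ ∞ := by
      rw [← eset]
      exact fin _ _ (by nlinarith) (by nlinarith)
    have L : (2 * δ) ^ (1 / n) * kt ≤
        (M (Metric.closedBall ((1 - t) * x₀ + t * x₁) (δ * kt))).toReal ^ (1 / n) := by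
      refine le_trans ?_ B
      rw [hkt]
      nlinarith [mul_le_mul_of_nonneg_left L0 (by linarith : (0 : ℝ) ≤ 1 - t),
        mul_le_mul_of_nonneg_left L1 ht0.le]
    have L' : 2 * δ * kt ^ n ≤
        (M (Metric.closedBall ((1 - t) * x₀ + t * x₁) (δ * kt))).toReal := by
      have := Real.rpow_le_rpow (by positivity) L (by linarith : 0 ≤ n)
      rwa [Real.mul_rpow (by positivity) hktpos.le, ← Real.rpow_mul (by positivity),
        ← Real.rpow_mul ENNReal.toReal_nonneg, one_div_mul_cancel hn0, Real.rpow_one,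
        Real.rpow_one] at this
    rw [ENNReal.le_div_iff_mul_le (Or.inl (by simp; positivity)) (Or.inl ENNReal.ofReal_ne_top),
      ← ENNReal.ofReal_mul (by positivity)]
    refine (ENNReal.ofReal_le_iff_le_toReal fint).2 (le_of_eq_of_le ?_ L')
    have : kt ^ n = kt ^ (n - 1) * kt := by
      nth_rewrite 3 [← Real.rpow_one kt]
      rw [← Real.rpow_add hktpos]; congr 1; ring
    rw [this]; ring
  -- The radii `δ * kt` run through all small positive radii, so the estimate bounds the full lower
  -- limit.
  have hmap : map (fun δ : ℝ => δ * kt) (𝓝[>] 0) = 𝓝[>] 0 := by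
    refine le_antisymm (tendsto_mul_nhdsGT_zero hktpos) ?_
    have h := map_mono (m := fun δ : ℝ => δ * kt) (tendsto_mul_nhdsGT_zero (inv_pos.2 hktpos))
    rw [Filter.map_map] at h
    have hid : (fun δ : ℝ => δ * kt) ∘ (fun δ : ℝ => δ * kt⁻¹) = id := by
      ext δ; simp [mul_assoc, inv_mul_cancel₀ hktpos.ne']
    rwa [hid, Filter.map_id] at h
  have key' : ∀ᶠ r in 𝓝[>] (0 : ℝ), ENNReal.ofReal (kt ^ (n - 1)) ≤
      M (Metric.closedBall ((1 - t) * x₀ + t * x₁) r) / ENNReal.ofReal (2 * r) := by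
    rw [← hmap]; exact key
  exact le_liminf_of_le (by isBoundedDefault) key'

theorem ae_lowerDensity_eq {a b : ℝ} (hfin : M (Icc a b) ≠ ∞) :
    ∀ᵐ x, x ∈ Ioo a b → lowerDensity M x = (M.restrict (Ioo a b)).rnDeriv volume x := by
  have : IsFiniteMeasure (M.restrict (Ioo a b)) := ⟨by
    rw [Measure.restrict_apply_univ]
    exact (measure_mono Ioo_subset_Icc_self).trans_lt hfin.lt_top⟩
  filter_upwards [Besicovitch.ae_tendsto_rnDeriv (M.restrict (Ioo a b)) volume] with x hx hxab
  refine Tendsto.liminf_eq (hx.congr' ?_)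
  have : ∀ᶠ r in 𝓝[>] (0 : ℝ), Metric.closedBall x r ⊆ Ioo a b :=
    ((eventually_closedBall_subset (isOpen_Ioo.mem_nhds hxab))).filter_mono nhdsWithin_le_nhds
  filter_upwards [this] with r hr
  rw [Measure.restrict_apply' measurableSet_Ioo, inter_eq_self_of_subset_left hr,
    Real.volume_closedBall]

/-- An infinite lower density at `x` would propagate, by `lowerDensity_of_lt` with `c₀ = 0` at `a`,
to every point of `(a, x)`, while almost everywhere it equals a Radon-Nikodym derivative, which is
finite. -/
theorem BrunnMinkowski.lowerDensity_lt_top (hBM : BrunnMinkowski n J M) (hn : 1 < n)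
    (hJo : IsOpen J) (hfin : ∀ a ∈ J, ∀ b ∈ J, M (Icc a b) ≠ ∞) {x : ℝ} (hx : x ∈ J) :
    lowerDensity M x < ∞ := by
  by_contra htop
  rw [not_lt_top_iff] at htop
  obtain ⟨ε, hε, hball⟩ := Metric.isOpen_iff.1 hJo x hx
  set a := x - ε / 2 with ha
  have haJ : a ∈ J := hball (by
    rw [Metric.mem_ball, Real.dist_eq, ha, sub_sub_cancel_left, abs_neg, abs_of_pos (by positivity)]
    linarith)
  have hax : a < x := by linarith
  have : IsFiniteMeasure (M.restrict (Ioo a x)) := ⟨by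
    rw [Measure.restrict_apply_univ]
    exact (measure_mono Ioo_subset_Icc_self).trans_lt (hfin a haJ x hx).lt_top⟩
  have hinf : ∀ y ∈ Ioo a x, lowerDensity M y = ∞ := by
    intro y hy
    set t := (y - a) / (x - a) with ht
    have ht0 : 0 < t := div_pos (by linarith [hy.1]) (by linarith)
    have ht1 : t < 1 := (div_lt_one (by linarith)).2 (by linarith [hy.2])
    have hyt : (1 - t) * a + t * x = y := by
      rw [ht]
      have : x - a ≠ 0 := by linarith
      field_simp
      ring
    refine ENNReal.eq_top_of_forall_nnreal_le fun c => ?_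
    -- Chosen so that `(t * C ^ (1/(n-1))) ^ (n-1) = c`.
    set C : ℝ := c / t ^ (n - 1) with hC
    have hC0 : 0 ≤ C := div_nonneg c.2 (Real.rpow_nonneg ht0.le _)
    have key := hBM.lowerDensity_of_lt hn hJo hfin haJ hx hax ht0 ht1 le_rfl hC0 (Or.inl rfl)
      (Or.inr (htop ▸ ENNReal.ofReal_lt_top))
    have hn1 : n - 1 ≠ 0 := by linarith
    rw [hyt, Real.zero_rpow (one_div_ne_zero hn1), mul_zero, zero_add,
      Real.mul_rpow ht0.le (Real.rpow_nonneg hC0 _), ← Real.rpow_mul hC0, one_div_mul_cancel hn1,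
      Real.rpow_one, hC, mul_div_cancel₀ _ (Real.rpow_pos_of_pos ht0 _).ne',
      ENNReal.ofReal_coe_nnreal] at key
    exact key
  have hae : ∀ᵐ y, y ∉ Ioo a x := by
    filter_upwards [ae_lowerDensity_eq (hfin a haJ x hx),
      Measure.rnDeriv_lt_top (M.restrict (Ioo a x)) volume] with y h1 h2 hy
    exact h2.ne ((h1 hy).symm.trans (hinf y hy))
  have h0 : volume (Ioo a x) = 0 := by
    have := ae_iff.1 hae
    simp only [not_not] at this
    exact this
  rw [Real.volume_Ioo, ENNReal.ofReal_eq_zero] at h0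
  linarith

/-- The lower density is finite at every point of the interval. Where it is below `k`, a Vitali
covering argument bounds `M` by `k` times the Lebesgue measure, so a null set is a countable union
of `M`-null pieces. -/
theorem BrunnMinkowski.absolutelyContinuous (hBM : BrunnMinkowski n J M) (hn : 1 < n)
    (hJo : IsOpen J) (hJc : J.OrdConnected) (hfin : ∀ a ∈ J, ∀ b ∈ J, M (Icc a b) ≠ ∞) {a b : ℝ}
    (ha : a ∈ J) (hb : b ∈ J) : M.restrict (Ioo a b) ≪ volume := by
  have : IsFiniteMeasure (M.restrict (Ioo a b)) := ⟨by
    rw [Measure.restrict_apply_univ]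
    exact (measure_mono Ioo_subset_Icc_self).trans_lt (hfin a ha b hb).lt_top⟩
  intro A hA
  have hcover : A ∩ Ioo a b ⊆ ⋃ k : ℕ, A ∩ {x | lowerDensity M x < k} := by
    rintro x ⟨hxA, hx⟩
    obtain ⟨k, hk⟩ := ENNReal.exists_nat_gt (hBM.lowerDensity_lt_top hn hJo hfin
      (hJc.out ha hb (Ioo_subset_Icc_self hx))).ne
    exact mem_iUnion.2 ⟨k, hxA, hk⟩
  have hnull : ∀ k : ℕ, M.restrict (Ioo a b) (A ∩ {x | lowerDensity M x < k}) = 0 := by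
    intro k
    refine le_antisymm (le_trans (VitaliFamily.measure_le_of_frequently_le
      (Besicovitch.vitaliFamily (M.restrict (Ioo a b))) ((k : ℝ≥0) • (volume : Measure ℝ))
      Measure.AbsolutelyContinuous.rfl _ ?_) ?_) zero_le
    · rintro x ⟨-, hx⟩
      have h1 := frequently_lt_of_liminf_lt (by isBoundedDefault) (show lowerDensity M x < k from hx)
      refine (Besicovitch.tendsto_filterAt (M.restrict (Ioo a b)) x).frequently ?_
      refine (h1.and_eventually self_mem_nhdsWithin).mono fun r ⟨hr, hr0⟩ => ?_
      have hr0 : 0 < r := hr0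
      rw [ENNReal.div_lt_iff (Or.inl (by simpa using hr0)) (Or.inl ENNReal.ofReal_ne_top)] at hr
      refine (Measure.restrict_apply_le _ _).trans (hr.le.trans_eq ?_)
      rw [Measure.smul_apply, Real.volume_closedBall, ENNReal.smul_def, smul_eq_mul]
      simp
    · rw [Measure.smul_apply, measure_mono_null inter_subset_left hA, smul_zero]
  have h0 := measure_mono_null hcover (measure_iUnion_null hnull)
  rw [← Measure.restrict_apply_self (μ := M.restrict (Ioo a b))] at h0
  rw [← nonpos_iff_eq_zero, ← h0]
  rw [Measure.restrict_apply_self]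
  have e : M.restrict (Ioo a b) A = (M.restrict (Ioo a b)).restrict (Ioo a b) A := by
    rw [Measure.restrict_restrict measurableSet_Ioo, inter_self]
  rw [e, Measure.restrict_apply' measurableSet_Ioo]

/-- The lower density itself is the required version of the density: it is defined everywhere, its
power is concave, hence it is continuous on the open set `J`, and it agrees almost everywhere with
the Radon-Nikodym derivative on rational subintervals, which cover `J`. -/
theorem BrunnMinkowski.exists_density (hBM : BrunnMinkowski n J M) (hn : 1 < n)
    (hJo : IsOpen J) (hJc : J.OrdConnected) (hfin : ∀ a ∈ J, ∀ b ∈ J, M (Icc a b) ≠ ∞) :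
    ∃ h : ℝ → ℝ, Measurable h ∧ (∀ x, 0 ≤ h x) ∧ (∀ x ∉ J, h x = 0) ∧
      ConcaveOn ℝ J (fun x => h x ^ (1 / (n - 1))) ∧
      M.restrict J = volume.withDensity fun x => ENNReal.ofReal (h x) := by
  have hn1 : 0 < n - 1 := by linarith
  have hlt := fun x (hx : x ∈ J) => (hBM.lowerDensity_lt_top hn hJo hfin hx).ne
  set g : ℝ → ℝ := fun x => (lowerDensity M x).toReal with hg
  have hg0 : ∀ x, 0 ≤ g x := fun x => ENNReal.toReal_nonneg
  have hconv : Convex ℝ J := hJc.convex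
  have hineq : ∀ x₀ ∈ J, ∀ x₁ ∈ J, x₀ < x₁ → ∀ t : ℝ, 0 < t → t < 1 →
      (1 - t) * g x₀ ^ (1 / (n - 1)) + t * g x₁ ^ (1 / (n - 1)) ≤
        g ((1 - t) * x₀ + t * x₁) ^ (1 / (n - 1)) := by
    intro x₀ hx₀ x₁ hx₁ hx t ht0 ht1
    have hxt : (1 - t) * x₀ + t * x₁ ∈ J :=
      hconv hx₀ hx₁ (by linarith) ht0.le (by ring)
    have t1 : 0 ≤ 1 - t := by linarith
    -- `lowerDensity_of_lt` wants values strictly below the density unless they vanish; both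
    -- densities are multiplied by `s < 1` and `s` tends to `1` afterwards.
    have hE : ∀ s ∈ Ioo (0 : ℝ) 1, (s ^ (1 / (n - 1))) *
        ((1 - t) * g x₀ ^ (1 / (n - 1)) + t * g x₁ ^ (1 / (n - 1))) ≤
        g ((1 - t) * x₀ + t * x₁) ^ (1 / (n - 1)) := by
      intro s hs
      have hc : ∀ x ∈ J, s * g x = 0 ∨ ENNReal.ofReal (s * g x) < lowerDensity M x := by
        intro x hx
        rcases (hg0 x).eq_or_lt with h | h
        · left; rw [← h, mul_zero]
        · right
          rw [ENNReal.ofReal_lt_iff_lt_toReal (mul_nonneg hs.1.le (hg0 x)) (hlt x hx)]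
          exact mul_lt_of_lt_one_left h hs.2
      have key := hBM.lowerDensity_of_lt hn hJo hfin hx₀ hx₁ hx ht0 ht1
        (mul_nonneg hs.1.le (hg0 x₀)) (mul_nonneg hs.1.le (hg0 x₁)) (hc _ hx₀) (hc _ hx₁)
      rw [ENNReal.ofReal_le_iff_le_toReal (hlt _ hxt), Real.mul_rpow hs.1.le (hg0 _),
        Real.mul_rpow hs.1.le (hg0 _)] at key
      have p0 := Real.rpow_nonneg (hg0 x₀) (1 / (n - 1))
      have p1 := Real.rpow_nonneg (hg0 x₁) (1 / (n - 1))
      have ps := Real.rpow_nonneg hs.1.le (1 / (n - 1))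
      have key2 := Real.rpow_le_rpow (by positivity) key (by positivity : 0 ≤ 1 / (n - 1))
      rw [← Real.rpow_mul (by positivity), mul_one_div_cancel hn1.ne', Real.rpow_one] at key2
      calc _ = _ := by ring
        _ ≤ _ := key2
    have hlim : Tendsto (fun s : ℝ => s ^ (1 / (n - 1)) *
        ((1 - t) * g x₀ ^ (1 / (n - 1)) + t * g x₁ ^ (1 / (n - 1)))) (𝓝[<] 1)
        (𝓝 (1 ^ (1 / (n - 1)) *
          ((1 - t) * g x₀ ^ (1 / (n - 1)) + t * g x₁ ^ (1 / (n - 1))))) := by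
      have : Tendsto (fun s : ℝ => s) (𝓝[<] 1) (𝓝 1) := nhdsWithin_le_nhds
      exact (this.rpow_const (Or.inl one_ne_zero)).mul_const _
    rw [Real.one_rpow, one_mul] at hlim
    refine le_of_tendsto hlim ?_
    filter_upwards [Ioo_mem_nhdsLT zero_lt_one] with s hs using hE s hs
  have hconc : ConcaveOn ℝ J (fun x => g x ^ (1 / (n - 1))) := by
    refine LinearOrder.concaveOn_of_lt hconv ?_
    intro x hx y hy hxy a b ha hb hab
    obtain rfl : a = 1 - b := by linarith
    exact hineq x hx y hy hxy b hb (by linarith)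
  have hcont : ContinuousOn g J := by
    have h1 := (hconc.continuousOn hJo).rpow_const (p := n - 1) (fun _ _ => Or.inr hn1.le)
    refine h1.congr fun x _ => ?_
    simp only
    rw [← Real.rpow_mul (hg0 x), one_div_mul_cancel hn1.ne', Real.rpow_one]
  refine ⟨J.indicator g, ?_, ?_, ?_, ?_, ?_⟩
  · classical
    rw [← piecewise_eq_indicator]
    exact hcont.measurable_piecewise continuousOn_const hJo.measurableSet
  · exact fun x => indicator_nonneg (fun x _ => hg0 x) x
  · exact fun x hx => indicator_of_notMem hx _
  · exact hconc.congr fun x hx => by simp only [indicator_of_mem hx]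
  · set F : ℝ → ℝ≥0∞ := fun x => ENNReal.ofReal (J.indicator g x) with hF
    let ι := {p : ℚ × ℚ // (p.1 : ℝ) ∈ J ∧ (p.2 : ℝ) ∈ J}
    have hcov : J = ⋃ p : ι, Ioo ((p.1.1 : ℚ) : ℝ) (p.1.2 : ℚ) := by
      refine Subset.antisymm (fun x hx => ?_) (iUnion_subset fun p =>
        Ioo_subset_Icc_self.trans (hJc.out p.2.1 p.2.2))
      obtain ⟨l, u, hlu, hsub⟩ := mem_nhds_iff_exists_Ioo_subset.1 (hJo.mem_nhds hx)
      obtain ⟨a, ha, ha'⟩ := exists_rat_btwn hlu.1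
      obtain ⟨b, hb, hb'⟩ := exists_rat_btwn hlu.2
      exact mem_iUnion.2 ⟨⟨(a, b), hsub ⟨ha, ha'.trans hlu.2⟩, hsub ⟨hlu.1.trans hb, hb'⟩⟩, ha', hb⟩
    have hres : volume.withDensity F = (volume.withDensity F).restrict J := by
      rw [restrict_withDensity hJo.measurableSet, ← withDensity_indicator hJo.measurableSet]
      congr 1
      ext x
      by_cases hx : x ∈ J <;> simp [hF, hx]
    rw [hres, hcov, Measure.restrict_iUnion_congr]
    rintro ⟨⟨a, b⟩, ha, hb⟩
    simp only at ha hb ⊢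
    have hac := hBM.absolutelyContinuous hn hJo hJc hfin ha hb
    have : IsFiniteMeasure (M.restrict (Ioo (a : ℝ) b)) := ⟨by
      rw [Measure.restrict_apply_univ]
      exact (measure_mono Ioo_subset_Icc_self).trans_lt (hfin a ha b hb).lt_top⟩
    have e1 : M.restrict (Ioo (a : ℝ) b) = (M.restrict (Ioo (a : ℝ) b)).restrict (Ioo (a : ℝ) b) := by
      rw [Measure.restrict_restrict measurableSet_Ioo, inter_self]
    rw [e1, ← Measure.withDensity_rnDeriv_eq _ _ hac, restrict_withDensity measurableSet_Ioo,
      restrict_withDensity measurableSet_Ioo]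
    refine withDensity_congr_ae ?_
    filter_upwards [ae_restrict_of_ae (ae_lowerDensity_eq (hfin a ha b hb)),
      ae_restrict_mem measurableSet_Ioo] with x hx hxab
    have hxJ : x ∈ J := hJc.out ha hb (Ioo_subset_Icc_self hxab)
    simp only [hF, indicator_of_mem hxJ, hg]
    rw [← hx hxab, ENNReal.ofReal_toReal (hlt x hxJ)]

end BrunnMinkowski

/-! ### Change of variables for monotone functions -/

section Rearrangement

variable {Y : ℝ → ℝ} {s : Set ℝ}

theorem ae_differentiableAt_of_monotoneOn (hs : IsOpen s) (hY : MonotoneOn Y s) :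
    ∀ᵐ u ∂volume.restrict s, u ∈ s ∧ DifferentiableAt ℝ Y u ∧ 0 ≤ deriv Y u := by
  filter_upwards [hY.ae_differentiableWithinAt hs.measurableSet, ae_restrict_mem hs.measurableSet]
    with u hu hus
  refine ⟨hus, hu.differentiableAt (hs.mem_nhds hus), ?_⟩
  rw [← derivWithin_of_isOpen hs hus]
  exact hY.derivWithin_nonneg

/-- The points of `s` at which `Y` has positive derivative. -/
def derivPos (Y : ℝ → ℝ) (s : Set ℝ) : Set ℝ := {u ∈ s | DifferentiableAt ℝ Y u ∧ 0 < deriv Y u}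

theorem measurableSet_derivPos (hs : MeasurableSet s) : MeasurableSet (derivPos Y s) :=
  hs.inter ((measurableSet_of_differentiableAt ℝ Y).inter
    (measurableSet_lt measurable_const (measurable_deriv Y)))

/-- Equal values at `u < v` force a monotone function to be constant on `[u, v]`, so its derivative
at `u` would vanish. -/
theorem injOn_derivPos (hc : s.OrdConnected) (hY : MonotoneOn Y s) :
    InjOn Y (derivPos Y s) := by
  have key : ∀ u ∈ derivPos Y s, ∀ v ∈ derivPos Y s, u < v → Y u ≠ Y v := by
    intro u hu v hv huv h
    have hd := hu.2.1.hasDerivAt.hasDerivWithinAt (s := Ici u)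
    have h0 : HasDerivWithinAt Y 0 (Ici u) u := by
      refine (hasDerivWithinAt_const u (Ici u) (Y u)).congr_of_eventuallyEq ?_ rfl
      filter_upwards [Icc_mem_nhdsGE huv] with w hw
      have hws : w ∈ s := hc.out hu.1 hv.1 hw
      exact le_antisymm (h ▸ hY hws hv.1 hw.2) (hY hu.1 hws hw.1)
    exact hu.2.2.ne' ((uniqueDiffWithinAt_Ici u).eq_deriv _ hd h0)
  intro u hu v hv h
  by_contra hne
  rcases lt_or_gt_of_ne hne with hlt | hlt
  · exact key u hu v hv hlt h
  · exact key v hv u hu hlt h.symm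

theorem hasDerivWithinAt_derivPos {t : Set ℝ} (ht : t ⊆ derivPos Y s) :
    ∀ u ∈ t, HasDerivWithinAt Y (deriv Y u) t u :=
  fun _ hu => (ht hu).2.1.hasDerivAt.hasDerivWithinAt

/-- If the push-forward of the Lebesgue measure by a monotone function has a density, then it is
given by the change of variables formula. -/
theorem deriv_mul_density_eq_one (hs : IsOpen s) (hc : s.OrdConnected) (hY : MonotoneOn Y s)
    (hYm : Measurable Y) {f : ℝ → ℝ≥0∞} (hf : Measurable f)
    (h : (volume.restrict s).map Y = volume.withDensity f) :
    ∀ᵐ u ∂volume.restrict s, u ∈ derivPos Y s ∧ ENNReal.ofReal (deriv Y u) * f (Y u) = 1 := by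
  have hnull : ∀ A : Set ℝ, volume A = 0 → volume.restrict s (Y ⁻¹' A) = 0 := fun A hA =>
    Measure.preimage_null_of_map_null hYm.aemeasurable
      (h ▸ withDensity_absolutelyContinuous _ _ hA)
  -- The set where the derivative vanishes has a Lebesgue null image; since the push-forward has a
  -- density, the set itself is null.
  have hpos : ∀ᵐ u ∂volume.restrict s, u ∈ derivPos Y s := by
    set D₀ : Set ℝ := {u ∈ s | DifferentiableAt ℝ Y u ∧ deriv Y u = 0} with hD₀
    have hD₀m : MeasurableSet D₀ := hs.measurableSet.inter
      ((measurableSet_of_differentiableAt ℝ Y).inter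
        (measurableSet_eq_fun (measurable_deriv Y) measurable_const))
    have him : volume (Y '' D₀) = 0 := by
      rw [← lintegral_deriv_eq_volume_image_of_monotoneOn hD₀m
        (fun u hu => hu.2.1.hasDerivAt.hasDerivWithinAt) (hY.mono fun u hu => hu.1),
        setLIntegral_congr_fun (g := fun _ => 0) hD₀m fun u hu => by simp [hu.2.2]]
      simp
    have h0 : volume.restrict s D₀ = 0 := measure_mono_null (subset_preimage_image Y D₀) (hnull _ him)
    filter_upwards [ae_differentiableAt_of_monotoneOn hs hY, measure_eq_zero_iff_ae_notMem.1 h0]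
      with u hu hu0
    exact ⟨hu.1, hu.2.1, hu.2.2.lt_of_ne fun e => hu0 ⟨hu.1, hu.2.1, e.symm⟩⟩
  have hmeas := measurableSet_derivPos (Y := Y) hs.measurableSet
  have hres : volume.restrict (derivPos Y s) = volume.restrict s := by
    refine Measure.restrict_congr_set ?_
    rw [ae_restrict_iff' hs.measurableSet] at hpos
    filter_upwards [hpos] with u hu
    exact propext ⟨fun h => h.1, hu⟩
  have hae : (fun u => ENNReal.ofReal (deriv Y u) * f (Y u)) =ᵐ[volume.restrict (derivPos Y s)]
      fun _ => 1 := by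
    refine ae_eq_of_forall_setLIntegral_eq_of_sigmaFinite
      ((measurable_deriv Y).ennreal_ofReal.mul (hf.comp hYm)) measurable_const fun B hB _ => ?_
    rw [Measure.restrict_restrict hB]
    have hsub : B ∩ derivPos Y s ⊆ derivPos Y s := inter_subset_right
    have hBm := hB.inter hmeas
    have hmono : MonotoneOn Y (B ∩ derivPos Y s) := hY.mono fun u hu => hu.2.1
    rw [← lintegral_image_eq_lintegral_deriv_mul_of_monotoneOn hBm
      (hasDerivWithinAt_derivPos hsub) hmono f]
    have him : MeasurableSet (Y '' (B ∩ derivPos Y s)) := hBm.image_of_monotoneOn hmono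
    rw [← withDensity_apply _ him, ← h, Measure.map_apply hYm him, ← hres,
      Measure.restrict_apply (hYm him), setLIntegral_one]
    -- By injectivity on `derivPos`, the preimage of the image of `B` adds no points there.
    congr 1
    ext u
    constructor
    · rintro ⟨⟨v, hv, hvu⟩, hu⟩
      rwa [← injOn_derivPos hc hY hv.2 hu hvu]
    · exact fun hu => ⟨mem_image_of_mem Y hu, hu.2⟩
  rw [hres] at hae
  exact hpos.and hae

/-- The integral of the positive function `deriv Y` over the part of `Y ⁻¹' A` in `derivPos` is the
measure of its image, contained in the null set `A`; so that part is null. -/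
theorem map_absolutelyContinuous_of_deriv_pos (hs : IsOpen s) (hY : MonotoneOn Y s)
    (hYm : Measurable Y) (hpos : ∀ᵐ u ∂volume.restrict s, u ∈ derivPos Y s) :
    (volume.restrict s).map Y ≪ volume := by
  refine Measure.AbsolutelyContinuous.mk fun A hA hA0 => ?_
  rw [Measure.map_apply hYm hA]
  set B := Y ⁻¹' A ∩ derivPos Y s with hB
  have hBm : MeasurableSet B := (hYm hA).inter (measurableSet_derivPos hs.measurableSet)
  have hint := lintegral_deriv_eq_volume_image_of_monotoneOn hBm
    (hasDerivWithinAt_derivPos inter_subset_right) (hY.mono fun u hu => hu.2.1)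
  rw [measure_mono_null (image_subset_iff.2 inter_subset_left) hA0,
    lintegral_eq_zero_iff (measurable_deriv Y).ennreal_ofReal] at hint
  have hB0 : volume B = 0 := by
    rw [Filter.EventuallyEq, ae_restrict_iff' hBm] at hint
    rw [measure_eq_zero_iff_ae_notMem]
    filter_upwards [hint] with u hu huB
    have := hu huB
    simp only [Pi.zero_apply, ENNReal.ofReal_eq_zero] at this
    exact not_lt.2 this huB.2.2.2
  rw [← nonpos_iff_eq_zero, ← hB0]
  refine (measure_mono_ae ?_).trans (Measure.restrict_apply_le s B)
  filter_upwards [hpos] with u hu huA using ⟨huA, hu⟩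

end Rearrangement

/-! ### Concavity inequalities, pointwise and for entropy powers -/

section Interpolation

/-- Hölder's inequality with exponents `n/(n-1)` and `n` on a two-point set. It merges exponent
`1/(n-1)` for the density with the affine Jacobian into exponent `1/n`. -/
theorem rpow_mul_rpow_concave {n t a₀ a₁ b₀ b₁ : ℝ} (hn : 1 < n) (ht0 : 0 ≤ t) (ht1 : t ≤ 1)
    (ha₀ : 0 ≤ a₀) (ha₁ : 0 ≤ a₁) (hb₀ : 0 ≤ b₀) (hb₁ : 0 ≤ b₁) :
    (1 - t) * (a₀ ^ (n - 1) * b₀) ^ (1 / n) + t * (a₁ ^ (n - 1) * b₁) ^ (1 / n) ≤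
      (((1 - t) * a₀ + t * a₁) ^ (n - 1) * ((1 - t) * b₀ + t * b₁)) ^ (1 / n) := by
  have h1 : 0 ≤ 1 - t := by linarith
  have hn0 : n ≠ 0 := by linarith
  have hn1 : n - 1 ≠ 0 := by linarith
  have hpq : (n / (n - 1)).HolderConjugate n := by
    have := (Real.HolderConjugate.conjExponent hn).symm
    simpa [Real.conjExponent] using this
  have key := Real.inner_le_Lp_mul_Lq_of_nonneg (s := Finset.univ) (hpq := hpq)
    (f := ![((1 - t) * a₀) ^ ((n - 1) / n), (t * a₁) ^ ((n - 1) / n)])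
    (g := ![((1 - t) * b₀) ^ (1 / n), (t * b₁) ^ (1 / n)])
    (by intro i _; fin_cases i <;> simp <;> positivity)
    (by intro i _; fin_cases i <;> simp <;> positivity)
  simp only [Fin.sum_univ_two, Matrix.cons_val_zero, Matrix.cons_val_one] at key
  have e1 : ∀ x : ℝ, 0 ≤ x → (x ^ ((n - 1) / n)) ^ (n / (n - 1)) = x := fun x hx => by
    rw [← Real.rpow_mul hx, div_mul_div_cancel₀ hn0, div_self hn1, Real.rpow_one]
  have e2 : ∀ x : ℝ, 0 ≤ x → (x ^ (1 / n)) ^ n = x := fun x hx => by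
    rw [← Real.rpow_mul hx, one_div_mul_cancel hn0, Real.rpow_one]
  have e3 : ∀ w a b : ℝ, 0 ≤ w → 0 ≤ a → 0 ≤ b →
      (w * a) ^ ((n - 1) / n) * (w * b) ^ (1 / n) = w * (a ^ (n - 1) * b) ^ (1 / n) := by
    intro w a b hw ha hb
    rw [Real.mul_rpow hw ha, Real.mul_rpow hw hb, Real.mul_rpow (Real.rpow_nonneg ha _) hb,
      ← Real.rpow_mul ha, mul_one_div]
    rcases hw.eq_or_lt with rfl | hw
    · rw [Real.zero_rpow (one_div_ne_zero hn0)]; ring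
    · have : w ^ ((n - 1) / n) * w ^ (1 / n) = w := by
        rw [← Real.rpow_add hw, ← add_div, sub_add_cancel, div_self hn0, Real.rpow_one]
      calc _ = (w ^ ((n - 1) / n) * w ^ (1 / n)) * (a ^ ((n - 1) / n) * b ^ (1 / n)) := by ring
        _ = _ := by rw [this]
  rw [e1 _ (by positivity), e1 _ (by positivity), e2 _ (by positivity), e2 _ (by positivity),
    e3 _ _ _ h1 ha₀ hb₀, e3 _ _ _ ht0 ha₁ hb₁] at key
  refine key.trans_eq ?_
  have hA : 0 ≤ (1 - t) * a₀ + t * a₁ := by positivity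
  have hB : 0 ≤ (1 - t) * b₀ + t * b₁ := by positivity
  rw [Real.mul_rpow (Real.rpow_nonneg hA _) hB, ← Real.rpow_mul hA, mul_one_div, one_div_div]

variable {Y : Type*} [MeasurableSpace Y] {m : Measure Y} [SigmaFinite m]
variable {Ω : Type*} [MeasurableSpace Ω] {P : Measure Ω} [IsProbabilityMeasure P]
variable {n : ℝ} {x₀ x₁ xt : Ω → Y}

theorem mul_entropyPower_le (hn : 0 < n) (h₀ : Measurable x₀) (ht : Measurable xt)
    (hac : P.map xt ≪ m) {w : ℝ} (hw : 0 < w)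
    (hle : ∀ᵐ ω ∂P, w * Real.exp (-logDensity (P.map x₀) m (x₀ ω) / n) ≤
      Real.exp (-logDensity (P.map xt) m (xt ω) / n)) :
    ENNReal.ofReal w * entropyPower n (P.map x₀) m ≤ entropyPower n (P.map xt) m := by
  refine ENNReal.mul_le_of_forall_lt fun a ha c hc => ?_
  obtain ⟨-, b, hb, hbl, hcb⟩ := exists_integrable_of_lt_entropyPower h₀ hc hn
  have key := le_entropyPower ht hac hn (b := fun ω => Real.log w + b ω)
    ((integrable_const _).add hb) (by
      filter_upwards [hle] with ω hω
      rw [← Real.exp_le_exp, Real.exp_add, Real.exp_log hw]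
      exact (mul_le_mul_of_nonneg_left (Real.exp_le_exp.2 (hbl ω)) hw.le).trans hω)
  refine le_trans ?_ key
  rw [integral_add (integrable_const _) hb]
  simp only [integral_const, probReal_univ, smul_eq_mul, one_mul]
  rw [Real.exp_add, Real.exp_log hw, ENNReal.ofReal_mul hw.le]
  exact mul_le_mul' ha.le hcb

/-- The function `(B₀, B₁) ↦ log (w₀ e^B₀ + w₁ e^B₁)` is convex, so the pointwise inequality
survives taking means of the exponents. Infinite entropy powers are reached through integrable lower
bounds; positivity of both powers ensures that there are values strictly below them. -/
theorem add_mul_entropyPower_le (hn : 0 < n) (h₀ : Measurable x₀) (h₁ : Measurable x₁)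
    (ht : Measurable xt) (hac : P.map xt ≪ m) {w₀ w₁ : ℝ} (hw₀ : 0 < w₀) (hw₁ : 0 < w₁)
    (hle : ∀ᵐ ω ∂P, w₀ * Real.exp (-logDensity (P.map x₀) m (x₀ ω) / n) +
      w₁ * Real.exp (-logDensity (P.map x₁) m (x₁ ω) / n) ≤
      Real.exp (-logDensity (P.map xt) m (xt ω) / n)) (hU₀ : entropyPower n (P.map x₀) m ≠ 0)
    (hU₁ : entropyPower n (P.map x₁) m ≠ 0) :
    ENNReal.ofReal w₀ * entropyPower n (P.map x₀) m + ENNReal.ofReal w₁ * entropyPower n (P.map x₁) m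
      ≤ entropyPower n (P.map xt) m := by
  have hmul : ∀ c₀ < entropyPower n (P.map x₀) m, ∀ c₁ < entropyPower n (P.map x₁) m,
      ENNReal.ofReal w₀ * c₀ + ENNReal.ofReal w₁ * c₁ ≤ entropyPower n (P.map xt) m := by
    intro c₀ hc₀ c₁ hc₁
    obtain ⟨-, b₀, hb₀, hbl₀, hcb₀⟩ := exists_integrable_of_lt_entropyPower h₀ hc₀ hn
    obtain ⟨-, b₁, hb₁, hbl₁, hcb₁⟩ := exists_integrable_of_lt_entropyPower h₁ hc₁ hn
    set B₀ := ∫ ω, b₀ ω ∂P with hB₀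
    set B₁ := ∫ ω, b₁ ω ∂P with hB₁
    -- The weights `p₀`, `p₁` are the gradient of that convex function at the means `(B₀, B₁)`; its
    -- supporting plane is an integrable lower bound whose mean is exactly `log S`.
    set S := w₀ * Real.exp B₀ + w₁ * Real.exp B₁ with hS
    have hS0 : 0 < S := by positivity
    set p₀ := w₀ * Real.exp B₀ / S with hp₀
    set p₁ := w₁ * Real.exp B₁ / S with hp₁
    have hi₀ : Integrable (fun ω => p₀ * (b₀ ω - B₀)) P := (hb₀.sub (integrable_const _)).const_mul _
    have hi₁ : Integrable (fun ω => p₁ * (b₁ ω - B₁)) P := (hb₁.sub (integrable_const _)).const_mul _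
    have hi : Integrable (fun ω => Real.log S + p₀ * (b₀ ω - B₀)) P := (integrable_const _).add hi₀
    have key := le_entropyPower ht hac hn
      (b := fun ω => Real.log S + p₀ * (b₀ ω - B₀) + p₁ * (b₁ ω - B₁))
      (hi.add hi₁) (by
        filter_upwards [hle] with ω hω
        rw [← Real.exp_le_exp]
        refine le_trans ?_ ((add_le_add
          (mul_le_mul_of_nonneg_left (Real.exp_le_exp.2 (hbl₀ ω)) hw₀.le)
          (mul_le_mul_of_nonneg_left (Real.exp_le_exp.2 (hbl₁ ω)) hw₁.le)).trans hω)
        have hconv := convexOn_exp.2 (mem_univ (b₀ ω - B₀)) (mem_univ (b₁ ω - B₁))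
          (show 0 ≤ p₀ by positivity) (show 0 ≤ p₁ by positivity)
          (by rw [hp₀, hp₁, ← add_div, ← hS, div_self hS0.ne'])
        simp only [smul_eq_mul] at hconv
        rw [add_assoc, Real.exp_add, Real.exp_log hS0]
        refine (mul_le_mul_of_nonneg_left hconv hS0.le).trans_eq ?_
        rw [hp₀, hp₁, Real.exp_sub, Real.exp_sub]
        field_simp)
    refine le_trans ?_ key
    rw [integral_add hi hi₁, integral_add (integrable_const _) hi₀,
      integral_const_mul, integral_const_mul, integral_sub hb₀ (integrable_const _),
      integral_sub hb₁ (integrable_const _)]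
    simp only [integral_const, probReal_univ, smul_eq_mul, one_mul, ← hB₀, ← hB₁, sub_self,
      mul_zero, add_zero]
    rw [Real.exp_log hS0, hS, ENNReal.ofReal_add (by positivity) (by positivity),
      ENNReal.ofReal_mul hw₀.le, ENNReal.ofReal_mul hw₁.le]
    gcongr
  -- The suprema over `c₀` and over `c₁` are taken one after the other, each by continuity of an
  -- affine map of `[0, ∞]`.
  have step : ∀ c₁ < entropyPower n (P.map x₁) m,
      ENNReal.ofReal w₀ * entropyPower n (P.map x₀) m + ENNReal.ofReal w₁ * c₁ ≤
        entropyPower n (P.map xt) m := by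
    intro c₁ hc₁
    by_contra hlt
    push Not at hlt
    have hcont : Continuous fun c : ℝ≥0∞ => ENNReal.ofReal w₀ * c + ENNReal.ofReal w₁ * c₁ :=
      (ENNReal.continuous_const_mul ENNReal.ofReal_ne_top).add continuous_const
    have hev := (hcont.tendsto (entropyPower n (P.map x₀) m)).eventually (lt_mem_nhds hlt)
    obtain ⟨a, ha, hsub⟩ := exists_Ioc_subset_of_mem_nhds hev ⟨0, pos_iff_ne_zero.2 hU₀⟩
    obtain ⟨c, hac, hc⟩ := exists_between ha
    exact absurd (hsub ⟨hac, hc.le⟩) (not_lt.2 (hmul c hc c₁ hc₁))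
  by_contra hlt
  push Not at hlt
  have hcont : Continuous fun c : ℝ≥0∞ => ENNReal.ofReal w₀ * entropyPower n (P.map x₀) m +
      ENNReal.ofReal w₁ * c :=
    continuous_const.add (ENNReal.continuous_const_mul ENNReal.ofReal_ne_top)
  have hev := (hcont.tendsto (entropyPower n (P.map x₁) m)).eventually (lt_mem_nhds hlt)
  obtain ⟨a, ha, hsub⟩ := exists_Ioc_subset_of_mem_nhds hev ⟨0, pos_iff_ne_zero.2 hU₁⟩
  obtain ⟨c, hac, hc⟩ := exists_between ha
  exact absurd (hsub ⟨hac, hc.le⟩) (not_lt.2 (step c hc))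

end Interpolation

/-! ### Quantile functions and monotone couplings -/

section Quantile

open ProbabilityTheory Classical

/-- The quantile function of `μ` on `(0,1)`, extended by `0`. -/
noncomputable def quantile (μ : Measure ℝ) (u : ℝ) : ℝ :=
  if u ∈ Ioo (0 : ℝ) 1 then sInf {s | u ≤ cdf μ s} else 0

variable {μ : Measure ℝ} [IsProbabilityMeasure μ]

/-- The infimum is attained because the distribution function is right-continuous. This adjunction
carries monotonicity, measurability and the computation of the law. -/
theorem quantile_le_iff {u : ℝ} (hu : u ∈ Ioo (0 : ℝ) 1) {s : ℝ} :
    quantile μ u ≤ s ↔ u ≤ cdf μ s := by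
  rw [quantile, if_pos hu]
  have hbdd : BddBelow {s | u ≤ cdf μ s} := by
    obtain ⟨a, ha⟩ := ((tendsto_cdf_atBot μ).eventually (gt_mem_nhds hu.1)).exists
    exact ⟨a, fun s hs => le_of_not_gt fun h => absurd (hs.trans (monotone_cdf μ h.le)) (not_le.2 ha)⟩
  have hne : {s | u ≤ cdf μ s}.Nonempty := by
    obtain ⟨a, ha⟩ := ((tendsto_cdf_atTop μ).eventually (lt_mem_nhds hu.2)).exists
    exact ⟨a, le_of_lt ha⟩
  refine ⟨fun h => ?_, fun h => csInf_le hbdd h⟩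
  have hev : ∀ᶠ r in 𝓝[>] s, u ≤ cdf μ r := by
    filter_upwards [self_mem_nhdsWithin] with r hr
    obtain ⟨v, hv, hvr⟩ := exists_lt_of_csInf_lt hne (lt_of_le_of_lt h hr)
    exact le_trans hv (monotone_cdf μ hvr.le)
  exact ge_of_tendsto (((cdf μ).right_continuous s).mono_left
    (nhdsWithin_mono _ Ioi_subset_Ici_self)) hev

theorem monotoneOn_quantile : MonotoneOn (quantile μ) (Ioo 0 1) := fun _ hu _ hv huv =>
  (quantile_le_iff hu).2 (huv.trans ((quantile_le_iff hv).1 le_rfl))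

theorem measurable_quantile {α : Type*} [MeasurableSpace α] (κ : Kernel α ℝ) [IsMarkovKernel κ] :
    Measurable fun p : α × ℝ => quantile (κ p.1) p.2 := by
  refine measurable_of_Iic fun s => ?_
  have hcdf : Measurable fun p : α × ℝ => cdf (κ p.1) s := by
    simp only [cdf_eq_real]
    exact ((κ.measurable_coe measurableSet_Iic).comp measurable_fst).ennreal_toReal
  have hU : MeasurableSet {p : α × ℝ | p.2 ∈ Ioo (0 : ℝ) 1} := measurable_snd measurableSet_Ioo
  have e : (fun p : α × ℝ => quantile (κ p.1) p.2) ⁻¹' Iic s =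
      ({p | p.2 ∈ Ioo (0 : ℝ) 1} ∩ {p | p.2 ≤ cdf (κ p.1) s}) ∪
        ({p | p.2 ∈ Ioo (0 : ℝ) 1}ᶜ ∩ {_p | 0 ≤ s}) := by
    ext p
    by_cases hp : p.2 ∈ Ioo (0 : ℝ) 1
    · simp [hp, quantile_le_iff hp, -mem_Ioo]
    · simp [hp, quantile, -mem_Ioo]
  rw [e]
  exact (hU.inter (measurableSet_le measurable_snd hcdf)).union
    (hU.compl.inter (MeasurableSet.const _))

theorem measurable_quantile_right : Measurable (quantile μ) := by
  have := (measurable_quantile (Kernel.const Unit μ)).comp (measurable_prodMk_left (x := ()))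
  exact this

theorem map_quantile : (volume.restrict (Ioo 0 1)).map (quantile μ) = μ := by
  have : IsFiniteMeasure ((volume.restrict (Ioo (0 : ℝ) 1)).map (quantile μ)) := inferInstance
  refine Measure.ext_of_Iic _ _ fun s => ?_
  rw [Measure.map_apply measurable_quantile_right measurableSet_Iic,
    Measure.restrict_apply' measurableSet_Ioo]
  have e : quantile μ ⁻¹' Iic s ∩ Ioo 0 1 = Ioo 0 1 ∩ Iic (cdf μ s) := by
    ext u
    simp only [mem_inter_iff, mem_preimage, mem_Iic]
    exact ⟨fun h => ⟨h.2, (quantile_le_iff h.2).1 h.1⟩, fun h => ⟨(quantile_le_iff h.1).2 h.2, h.1⟩⟩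
  rw [e, ← ofReal_cdf μ s]
  have h1 := cdf_le_one μ s
  have h0 := cdf_nonneg μ s
  refine le_antisymm ?_ ?_
  · refine (measure_mono (t := Ioc 0 (cdf μ s)) fun u hu => ⟨hu.1.1, hu.2⟩).trans ?_
    rw [Real.volume_Ioc, sub_zero]
  · refine le_trans (by rw [Real.volume_Ioo, sub_zero]) (measure_mono
      (s := Ioo 0 (cdf μ s)) fun u hu => ⟨⟨hu.1, hu.2.trans_le h1⟩, hu.2.le⟩)

/-- One uniform variable, shared by all rays, realises every conditional law; using it for two
kernels couples them monotonically on each ray. -/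
theorem map_prod_quantile {α : Type*} [MeasurableSpace α] (p : Measure α) [SFinite p]
    (κ : Kernel α ℝ) [IsMarkovKernel κ] :
    (p.prod (volume.restrict (Ioo 0 1))).map (fun z => (z.1, quantile (κ z.1) z.2)) = p ⊗ₘ κ := by
  have hm : Measurable fun z : α × ℝ => (z.1, quantile (κ z.1) z.2) :=
    measurable_fst.prodMk (measurable_quantile κ)
  ext A hA
  rw [Measure.map_apply hm hA, Measure.prod_apply (hm hA), Measure.compProd_apply hA]
  refine lintegral_congr fun a => ?_
  rw [← map_quantile (μ := κ a)]
  rw [Measure.map_apply measurable_quantile_right (measurable_prodMk_left hA)]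
  rfl

theorem quantile_le_quantile {ν : Measure ℝ} [IsProbabilityMeasure ν]
    (h : ∀ r : ℚ, ν (Iic (r : ℝ)) ≤ μ (Iic (r : ℝ))) {u : ℝ} (hu : u ∈ Ioo (0 : ℝ) 1) :
    quantile μ u ≤ quantile ν u := by
  refine le_of_forall_gt_imp_ge_of_dense fun s hs => ?_
  obtain ⟨r, hr, hrs⟩ := exists_rat_btwn hs
  refine le_trans ((quantile_le_iff hu).2 ?_) hrs.le
  refine ((quantile_le_iff hu).1 hr.le).trans ?_
  rw [cdf_eq_real, cdf_eq_real]
  exact ENNReal.toReal_mono (measure_ne_top _ _) (h r)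

/-- The event `S₁ ≤ r` is almost surely contained in `S₀ ≤ r`, also after restriction to an event on
`β`. The resulting stochastic order of the conditional laws makes the monotone coupling causal,
whatever the original coupling was. -/
theorem ae_condKernel_Iic_le {α Ω : Type*} [MeasurableSpace α] [MeasurableSpace Ω] {π : Measure Ω}
    [IsProbabilityMeasure π] {β : Ω → α} {S₀ S₁ : Ω → ℝ} (hβ : Measurable β) (h₀ : Measurable S₀)
    (h₁ : Measurable S₁) (hle : ∀ᵐ ω ∂π, S₀ ω ≤ S₁ ω) :
    ∀ᵐ a ∂π.map β, ∀ r : ℚ, condDistrib S₁ β π a (Iic (r : ℝ)) ≤ condDistrib S₀ β π a (Iic (r : ℝ)) := by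
  rw [ae_all_iff]
  intro r
  refine ae_le_of_forall_setLIntegral_le_of_sigmaFinite
    (Kernel.measurable_coe _ measurableSet_Iic) fun C hC _ => ?_
  have e : ∀ S : Ω → ℝ, Measurable S → ∫⁻ a in C, condDistrib S β π a (Iic (r : ℝ)) ∂π.map β =
      π (β ⁻¹' C ∩ S ⁻¹' Iic (r : ℝ)) := fun S hS => by
    rw [← Measure.compProd_apply_prod hC measurableSet_Iic,
      compProd_map_condDistrib hS.aemeasurable, Measure.map_apply (hβ.prodMk hS)
      (hC.prod measurableSet_Iic)]
    rfl
  rw [e S₁ h₁, e S₀ h₀]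
  refine measure_mono_ae ?_
  filter_upwards [hle] with ω hω h using ⟨h.1, le_trans hω h.2⟩

end Quantile

/-! ### Uniqueness of families of measures -/

section General

open ProbabilityTheory

/-- A countable generating π-system, obtained from an embedding in the line, so that almost sure
equality of random measures reduces to countably many sets. -/
theorem measure_ext_embeddingReal {Z : Type*} [MeasurableSpace Z] [StandardBorelSpace Z]
    {μ ν : Measure Z} [IsFiniteMeasure μ]
    (h : ∀ r : ℚ, μ (embeddingReal Z ⁻¹' Iic (r : ℝ)) = ν (embeddingReal Z ⁻¹' Iic (r : ℝ)))
    (hu : μ univ = ν univ) : μ = ν := by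
  refine ext_of_generate_finite (preimage (embeddingReal Z) '' (⋃ a : ℚ, {Iic (a : ℝ)})) ?_ ?_ ?_ hu
  · rw [← MeasurableSpace.comap_generateFrom, ← Real.borel_eq_generateFrom_Iic_rat,
      ← BorelSpace.measurable_eq (α := ℝ)]
    exact (measurableEmbedding_embeddingReal Z).comap_eq.symm
  · exact Real.isPiSystem_Iic_rat.comap _
  · rintro _ ⟨s, hs, rfl⟩
    obtain ⟨r, hr⟩ := mem_iUnion.1 hs
    rw [mem_singleton_iff.1 hr]
    exact h r

/-- Two families of measures with the same set integrals agree almost everywhere. -/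
theorem ae_eq_of_setLIntegral_eq {A Z : Type*} [MeasurableSpace A] [MeasurableSpace Z]
    [StandardBorelSpace Z] {q : Measure A} [SigmaFinite q] {μ ν : A → Measure Z} {B : ℕ → Set Z}
    (hB : ∀ k, MeasurableSet (B k)) (hBU : ⋃ k, B k = univ)
    (hfin : ∀ k, ∀ᵐ a ∂q, μ a (B k) ≠ ∞)
    (hμ : ∀ D, MeasurableSet D → AEMeasurable (fun a => μ a D) q)
    (hν : ∀ D, MeasurableSet D → AEMeasurable (fun a => ν a D) q)
    (h : ∀ D C, MeasurableSet D → MeasurableSet C → ∫⁻ a in C, μ a D ∂q = ∫⁻ a in C, ν a D ∂q) :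
    ∀ᵐ a ∂q, μ a = ν a := by
  have hD : ∀ D, MeasurableSet D → ∀ᵐ a ∂q, μ a D = ν a D := fun D hD =>
    ae_eq_of_forall_setLIntegral_eq_of_sigmaFinite₀ (hμ D hD) (hν D hD) fun C hC _ => h D C hD hC
  have h1 : ∀ᵐ a ∂q, ∀ k, μ a (B k) = ν a (B k) := ae_all_iff.2 fun k => hD _ (hB k)
  have h2 : ∀ᵐ a ∂q, ∀ k, ∀ r : ℚ, μ a (embeddingReal Z ⁻¹' Iic (r : ℝ) ∩ B k) =
      ν a (embeddingReal Z ⁻¹' Iic (r : ℝ) ∩ B k) := ae_all_iff.2 fun k => ae_all_iff.2 fun r =>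
    hD _ (((measurableEmbedding_embeddingReal Z).measurable measurableSet_Iic).inter (hB k))
  filter_upwards [h1, h2, ae_all_iff.2 hfin] with a h1 h2 h3
  rw [← Measure.restrict_univ (μ := μ a), ← Measure.restrict_univ (μ := ν a), ← hBU,
    Measure.restrict_iUnion_congr]
  intro k
  have : IsFiniteMeasure ((μ a).restrict (B k)) := ⟨by
    rw [Measure.restrict_apply_univ]; exact (h3 k).lt_top⟩
  refine measure_ext_embeddingReal (fun r => ?_) ?_
  · rw [Measure.restrict_apply' (hB k), Measure.restrict_apply' (hB k)]
    exact h2 k r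
  · rw [Measure.restrict_apply_univ, Measure.restrict_apply_univ]
    exact h1 k

end General

/-! ### Existence and comparison of disintegrations -/

section Disintegration

open ProbabilityTheory

variable {X : Type*} [TopologicalCausalSpace X] [MeasurableSpace X] [BorelSpace X] {H : Set X}
variable [hH : Fact (IsClosed H)] {G : noEnds H → ℝ} {m : Measure H}

/-- A disintegration along the rays with respect to the Borel quotient map `rayIndex`, given by a
kernel. -/
structure IsRayDisintegration (hS : RaySetting H G) (m : Measure H) (q : Measure (noEnds H))
    (K : Kernel (noEnds H) (noEnds H)) : Prop where
  isFiniteMeasure : IsFiniteMeasure q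
  isSFiniteKernel : IsSFiniteKernel K
  index_eq : ∀ᵐ β ∂q, hS.rayIndex β = β
  concentrated : ∀ᵐ β ∂q, ∀ᵐ x ∂K β, hS.rayIndex x = β
  compProd_eq : q ⊗ₘ K = (restrictNoEnds m).map fun x => (hS.rayIndex x, x)
  bounded : ∀ C : Set X, IsCompact C → ∃ c : ℝ≥0, ∀ β, K β {x : noEnds H | ((x : H) : X) ∈ C} ≤ c

theorem measurable_coe_coe : Measurable fun x : noEnds H => ((x : H) : X) :=
  measurable_subtype_coe.comp measurable_subtype_coe

theorem restrictNoEnds_compact_lt_top [IsFiniteMeasureOnCompacts m] {C : Set X} (hC : IsCompact C) :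
    restrictNoEnds m {x : noEnds H | ((x : H) : X) ∈ C} < ∞ := by
  rw [restrictNoEnds, measurableEmbedding_noEnds.comap_apply]
  refine lt_of_le_of_lt (measure_mono ?_)
    (hH.out.isClosedEmbedding_subtypeVal.isCompact_preimage hC).measure_lt_top
  rintro _ ⟨x, hx, rfl⟩
  exact hx

/-- `m` may be infinite, whereas conditional probabilities need a finite measure. Dividing by the
weight makes it finite, and local boundedness of the weight bounds the conditional measures on
compact sets after multiplying back. -/
theorem exists_weight [IsFiniteMeasureOnCompacts m] : ∃ D : noEnds H → ℝ≥0, Measurable D ∧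
    (∀ x, D x ≠ 0) ∧ ∫⁻ x, (D x : ℝ≥0∞)⁻¹ ∂restrictNoEnds m ≠ ∞ ∧
    ∀ C : Set X, IsCompact C → ∃ c : ℝ≥0, ∀ x : noEnds H, ((x : H) : X) ∈ C → D x ≤ c := by
  let E := CompactExhaustion.choice X
  let a : ℕ → ℝ≥0 := fun k => (restrictNoEnds m {x : noEnds H | ((x : H) : X) ∈ E k}).toNNReal
  -- On the `k`-th shell, of mass at most `a k`, the integral of `1/D` is at most `a k / d k ≤ 2 ^
  -- (-k)`.
  let d : ℕ → ℝ≥0 := fun k => 2 ^ k * (1 + a k)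
  have hd : ∀ k, d k ≠ 0 := fun k => by positivity
  have hfind : Measurable fun x : X => E.find x := by
    refine measurable_of_Iic fun k => ?_
    have : (fun x : X => E.find x) ⁻¹' Iic k = E k := by
      ext x; exact E.mem_iff_find_le.symm
    rw [this]
    exact (E.isCompact k).isClosed.measurableSet
  have hf : Measurable fun x : noEnds H => E.find ((x : H) : X) := hfind.comp measurable_coe_coe
  refine ⟨fun x => d (E.find ((x : H) : X)), (measurable_from_nat (f := d)).comp hf, fun x => hd _, ?_, ?_⟩
  · have hU : ⋃ k, (fun x : noEnds H => E.find ((x : H) : X)) ⁻¹' {k} = univ := by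
      rw [← preimage_iUnion, iUnion_of_singleton, preimage_univ]
    rw [← setLIntegral_univ, ← hU]
    refine ne_top_of_le_ne_top ?_ (lintegral_iUnion_le _ _)
    refine ne_top_of_le_ne_top (b := ∑' k : ℕ, (2⁻¹ : ℝ≥0∞) ^ k)
      (by rw [ENNReal.tsum_geometric, ENNReal.one_sub_inv_two, inv_inv]; exact ENNReal.ofNat_ne_top)
      (ENNReal.tsum_le_tsum fun k => ?_)
    rw [setLIntegral_congr_fun (g := fun _ => (d k : ℝ≥0∞)⁻¹) (hf (measurableSet_singleton k))
      fun x hx => by simp only; rw [show E.find ((x : H) : X) = k from hx], setLIntegral_const]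
    have hak : restrictNoEnds m ((fun x : noEnds H => E.find ((x : H) : X)) ⁻¹' {k}) ≤ a k := by
      rw [ENNReal.coe_toNNReal (restrictNoEnds_compact_lt_top (E.isCompact k)).ne]
      refine measure_mono fun x hx => ?_
      have : E.find ((x : H) : X) = k := hx
      exact E.mem_iff_find_le.2 this.le
    refine (mul_le_mul' le_rfl hak).trans ?_
    rw [← ENNReal.coe_inv (hd k), ← ENNReal.coe_mul]
    have : (2⁻¹ : ℝ≥0∞) ^ k = (((2 : ℝ≥0)⁻¹ ^ k : ℝ≥0) : ℝ≥0∞) := by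
      rw [ENNReal.coe_pow, ENNReal.coe_inv two_ne_zero, ENNReal.coe_ofNat]
    rw [this, ENNReal.coe_le_coe]
    simp only [d]
    rw [mul_inv, mul_assoc, ← inv_pow]
    refine mul_le_of_le_one_right' ?_
    rw [inv_mul_le_iff₀ (by positivity), mul_one]
    exact le_add_self
  · intro C hC
    obtain ⟨k, hk⟩ := E.exists_superset_of_isCompact hC
    refine ⟨∑ i ∈ Finset.range (k + 1), d i, fun x hx => ?_⟩
    exact Finset.single_le_sum (f := d) (fun i _ => zero_le) (Finset.mem_range_succ_iff.2
      (E.mem_iff_find_le.1 (hk hx)))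

/-- The weighted finite measure is disintegrated by conditional distributions, which are then
multiplied by the weight. The extra absolute continuity says that no mass of `q` sits on rays
invisible to `m`; the comparison of disintegrations depends on it. -/
theorem exists_isRayDisintegration (hS : RaySetting H G) [IsFiniteMeasureOnCompacts m]
    [Nonempty (noEnds H)] : ∃ q K, IsRayDisintegration hS m q K ∧
      q ≪ (restrictNoEnds m).map hS.rayIndex := by
  obtain ⟨D, hDm, hD0, hDi, hDc⟩ := exists_weight (m := m)
  have hDm' : Measurable fun x => (D x : ℝ≥0∞) := hDm.coe_nnreal_ennreal
  set P : Measure (noEnds H) := (restrictNoEnds m).withDensity fun x => (D x : ℝ≥0∞)⁻¹ with hP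
  have hPf : IsFiniteMeasure P := isFiniteMeasure_withDensity hDi
  have hPm : P.withDensity (fun x => (D x : ℝ≥0∞)) = restrictNoEnds m := by
    have := withDensity_inv_same (μ := restrictNoEnds m) (f := fun x => (D x : ℝ≥0∞)⁻¹) hDm'.inv
      (ae_of_all _ fun x => by simp) (ae_of_all _ fun x => by simp [hD0 x])
    simpa using this
  have hr := hS.measurable_rayIndex
  have hunc : Measurable (Function.uncurry fun (_ : noEnds H) (x : noEnds H) => (D x : ℝ≥0∞)) :=
    hDm'.comp measurable_snd
  set K' : Kernel (noEnds H) (noEnds H) := condDistrib id hS.rayIndex P with hK'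
  set K := K'.withDensity fun _ x => (D x : ℝ≥0∞) with hK
  have hsf : IsSFiniteKernel K := by
    rw [hK]
    exact Kernel.IsSFiniteKernel.withDensity _ fun _ _ => ENNReal.coe_ne_top
  have hKa : ∀ β, K β = (K' β).withDensity fun x => (D x : ℝ≥0∞) := fun β =>
    Kernel.withDensity_apply _ hunc β
  have hgr : Measurable fun x => (hS.rayIndex x, x) := hr.prodMk measurable_id
  have hcomp : P.map hS.rayIndex ⊗ₘ K = (restrictNoEnds m).map fun x => (hS.rayIndex x, x) := by
    ext A hA
    have e := compProd_map_condDistrib (mβ := inferInstance) (μ := P) (X := hS.rayIndex) (Y := id)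
      aemeasurable_id
    have hf2 : Measurable fun z : noEnds H × noEnds H => A.indicator (fun z => (D z.2 : ℝ≥0∞)) z :=
      (hDm'.comp measurable_snd).indicator hA
    rw [Measure.map_apply hgr hA, ← hPm, withDensity_apply _ (hgr hA),
      ← lintegral_indicator (hgr hA), Measure.compProd_apply hA]
    have e1 : ∫⁻ x, ((fun x => (hS.rayIndex x, x)) ⁻¹' A).indicator (fun x => (D x : ℝ≥0∞)) x ∂P =
        ∫⁻ z, A.indicator (fun z => (D z.2 : ℝ≥0∞)) z ∂P.map (fun x => (hS.rayIndex x, id x)) := by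
      rw [lintegral_map hf2 (hr.prodMk measurable_id)]
      rfl
    rw [e1, ← e, Measure.lintegral_compProd hf2]
    refine lintegral_congr fun β => ?_
    rw [hKa, withDensity_apply _ (measurable_prodMk_left hA),
      ← lintegral_indicator (measurable_prodMk_left hA)]
    rfl
  have hac : P ≪ restrictNoEnds m := withDensity_absolutelyContinuous _ _
  refine ⟨P.map hS.rayIndex, K, ⟨inferInstance, hsf, ?_, ?_, hcomp, ?_⟩, ?_⟩
  · rw [ae_map_iff (p := fun β => hS.rayIndex β = β) hr.aemeasurable
      (measurableSet_eq_fun hr measurable_id)]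
    exact ae_of_all _ fun x => hS.rayIndex_rayIndex x
  · refine Measure.ae_ae_of_ae_compProd (p := fun z => hS.rayIndex z.2 = z.1) ?_
    rw [hcomp, ae_map_iff (p := fun z => hS.rayIndex z.2 = z.1) hgr.aemeasurable
      (measurableSet_eq_fun (hr.comp measurable_snd) measurable_fst)]
    exact ae_of_all _ fun x => rfl
  · intro C hC
    obtain ⟨c, hc⟩ := hDc C hC
    have key : ∀ S, MeasurableSet S → (∀ x ∈ S, D x ≤ c) → ∀ β, K β S ≤ c := by
      intro S hSm hSc β
      rw [hKa, withDensity_apply _ hSm]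
      refine (setLIntegral_mono (g := fun _ => (c : ℝ≥0∞)) measurable_const
        fun x hx => ENNReal.coe_le_coe.2 (hSc x hx)).trans ?_
      rw [setLIntegral_const]
      exact mul_le_of_le_one_right' prob_le_one
    exact ⟨c, key _ (measurable_coe_coe hC.isClosed.measurableSet) hc⟩
  · exact hac.map hr

namespace IsRayDisintegration

variable {hS : RaySetting H G} {q : Measure (noEnds H)} {K : Kernel (noEnds H) (noEnds H)}

theorem measurable_index_id (hS : RaySetting H G) :
    Measurable fun x : noEnds H => (hS.rayIndex x, x) :=
  hS.measurable_rayIndex.prodMk measurable_id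

theorem setLIntegral_eq (h : IsRayDisintegration hS m q K) {B C : Set (noEnds H)}
    (hB : MeasurableSet B) (hC : MeasurableSet C) :
    restrictNoEnds m (B ∩ hS.rayIndex ⁻¹' C) = ∫⁻ β in C, K β B ∂q := by
  have := h.isFiniteMeasure
  have := h.isSFiniteKernel
  rw [← Measure.compProd_apply_prod hC hB, h.compProd_eq,
    Measure.map_apply (measurable_index_id hS) (hC.prod hB), inter_comm]
  rfl

theorem map_absolutelyContinuous (h : IsRayDisintegration hS m q K) :
    (restrictNoEnds m).map hS.rayIndex ≪ q := by
  refine Measure.AbsolutelyContinuous.mk fun C hC hC0 => ?_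
  have := h.setLIntegral_eq MeasurableSet.univ hC
  rw [Measure.map_apply hS.measurable_rayIndex hC, ← univ_inter (hS.rayIndex ⁻¹' C), this,
    Measure.restrict_eq_zero.2 hC0, lintegral_zero_measure]

theorem smul [IsSFiniteKernel K] (h : IsRayDisintegration hS m q K) {c : ℝ≥0} (hc : c ≠ 0) :
    IsRayDisintegration hS m (c • q) (K.withDensity fun _ _ => (c : ℝ≥0∞)⁻¹) := by
  have := h.isFiniteMeasure
  have hK : ∀ β, (K.withDensity fun _ _ => (c : ℝ≥0∞)⁻¹) β = (c : ℝ≥0∞)⁻¹ • K β := fun β => by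
    rw [Kernel.withDensity_apply _ measurable_const, withDensity_const]
  have hac : c • q ≪ q := Measure.smul_absolutelyContinuous
  have hsf : IsSFiniteKernel (K.withDensity fun _ _ => (c : ℝ≥0∞)⁻¹) :=
    Kernel.IsSFiniteKernel.withDensity _ fun _ _ => by simp [hc]
  refine ⟨inferInstance, hsf, hac.ae_le h.index_eq, ?_, ?_, fun C hC => ?_⟩
  · filter_upwards [hac.ae_le h.concentrated] with β hβ
    rw [hK]
    exact Measure.ae_smul_measure hβ _
  · rw [← h.compProd_eq]
    ext A hA
    rw [Measure.compProd_apply hA, Measure.compProd_apply hA, ENNReal.smul_def,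
      lintegral_smul_measure, smul_eq_mul, ← lintegral_const_mul' _ _ ENNReal.coe_ne_top]
    refine lintegral_congr fun β => ?_
    rw [hK, Measure.smul_apply, smul_eq_mul, ← mul_assoc,
      ENNReal.mul_inv_cancel (ENNReal.coe_ne_zero.2 hc) ENNReal.coe_ne_top, one_mul]
  · obtain ⟨c', hc'⟩ := h.bounded C hC
    refine ⟨c⁻¹ * c', fun β => ?_⟩
    rw [hK, Measure.smul_apply, smul_eq_mul, ENNReal.coe_mul, ENNReal.coe_inv hc]
    exact mul_le_mul' le_rfl (hc' β)

theorem ae_ae (h : IsRayDisintegration hS m q K) {p : noEnds H → Prop}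
    (hp : ∀ᵐ x ∂restrictNoEnds m, p x) : ∀ᵐ β ∂q, ∀ᵐ x ∂K β, p x := by
  obtain ⟨N, hN, hNm, hN0⟩ := exists_measurable_superset_of_null (ae_iff.1 hp)
  have := h.setLIntegral_eq hNm MeasurableSet.univ
  rw [preimage_univ, inter_univ, hN0, Measure.restrict_univ, eq_comm,
    lintegral_eq_zero_iff (K.measurable_coe hNm)] at this
  filter_upwards [this] with β hβ
  exact measure_mono_null hN hβ

/-- The Borel identities extend to null-measurable sets: null sets of `m` are null for almost every
conditional measure, and null sets of `q` pull back to null sets of `m`. -/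
theorem isDisintegration [IsProbabilityMeasure q] (h : IsRayDisintegration hS m q K) :
    IsDisintegration m hS.rayIndex q K := by
  have hae : ∀ {B B' : Set (noEnds H)}, B =ᵐ[restrictNoEnds m] B' →
      (fun β => K β B) =ᵐ[q] fun β => K β B' := fun hBB' => by
    filter_upwards [h.ae_ae hBB'] with β hβ using measure_congr hβ
  have hqmp : Measure.QuasiMeasurePreserving hS.rayIndex (restrictNoEnds m) q :=
    ⟨hS.measurable_rayIndex, h.map_absolutelyContinuous⟩
  refine ⟨hS.isQuotientMap_rayIndex, inferInstance, ?_, ?_, ?_, h.concentrated, ?_, ?_⟩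
  · filter_upwards [h.index_eq] with β hβ using ⟨β, hβ⟩
  · intro B hB hB0
    rw [← Measure.map_apply hS.measurable_rayIndex hB]
    exact h.map_absolutelyContinuous hB0
  · rintro B ⟨B', hB', e⟩
    exact ⟨_, K.measurable_coe hB', hae e⟩
  · rintro B C ⟨B', hB', eB⟩ ⟨C', hC', eC⟩
    rw [measure_congr (eB.inter (hqmp.preimage_ae_eq eC)), h.setLIntegral_eq hB' hC',
      setLIntegral_congr eC]
    exact lintegral_congr_ae (ae_restrict_of_ae (hae eB.symm))
  · intro C hC
    obtain ⟨c, hc⟩ := h.bounded C hC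
    exact ⟨c, ae_of_all _ hc⟩

end IsRayDisintegration

theorem exists_isDisintegration (hS : RaySetting H G) [IsFiniteMeasureOnCompacts m]
    [hne : Nonempty (noEnds H)] : ∃ 𝔔 q mc, IsDisintegration m 𝔔 q mc := by
  obtain ⟨q, K, h, hac⟩ := exists_isRayDisintegration hS (m := m)
  have := h.isFiniteMeasure
  have := h.isSFiniteKernel
  by_cases hq : q = 0
  -- If `m` vanishes on `H°`, no probability is obtained by normalising `q`; a Dirac mass at some
  -- ray with zero conditional measures serves.
  · have hm : restrictNoEnds m = 0 := by
      have h0 := h.map_absolutelyContinuous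
      rw [hq, Measure.absolutelyContinuous_zero_iff] at h0
      exact (Measure.map_eq_zero_iff hS.measurable_rayIndex.aemeasurable).1 h0
    obtain ⟨β⟩ := hne
    refine ⟨_, _, _, IsRayDisintegration.isDisintegration (hS := hS)
      (q := Measure.dirac (hS.rayIndex β)) (K := 0) ⟨inferInstance, inferInstance, ?_, ?_, ?_, ?_⟩⟩
    · rw [ae_dirac_iff (p := fun β => hS.rayIndex β = β)
        (measurableSet_eq_fun hS.measurable_rayIndex measurable_id)]
      exact hS.rayIndex_rayIndex β
    · exact ae_of_all _ fun β => by simp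
    · rw [hm, Measure.map_zero, Measure.compProd_zero_right]
    · exact fun C _ => ⟨0, fun β => by simp⟩
  · have hq0 : (q univ).toNNReal ≠ 0 :=
      (ENNReal.toNNReal_ne_zero).2 ⟨by simpa using hq, measure_ne_top _ _⟩
    have hqu : (q univ).toNNReal⁻¹ ≠ 0 := inv_ne_zero hq0
    have hp : IsProbabilityMeasure ((q univ).toNNReal⁻¹ • q) := ⟨by
      rw [Measure.smul_apply, ENNReal.smul_def, ENNReal.coe_inv hq0,
        ENNReal.coe_toNNReal (measure_ne_top _ _), smul_eq_mul,
        ENNReal.inv_mul_cancel (by simpa using hq) (measure_ne_top _ _)]⟩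
    exact ⟨_, _, _, (h.smul hqu).isDisintegration⟩

/-- Comparison of an arbitrary disintegration with a kernel disintegration. -/
theorem IsDisintegration.exists_comparison {hS : RaySetting H G} {q₀ : Measure (noEnds H)}
    {K : Kernel (noEnds H) (noEnds H)} (h : IsRayDisintegration hS m q₀ K)
    (hac : q₀ ≪ (restrictNoEnds m).map hS.rayIndex) {𝔔 : noEnds H → noEnds H}
    {q : Measure (noEnds H)} {mc : noEnds H → Measure (noEnds H)}
    (hD : IsDisintegration m 𝔔 q mc) :
    ∃ θ : noEnds H → ℝ≥0∞, (∀ᵐ α ∂q, mc α = θ (hS.rayIndex α) • K (hS.rayIndex α) ∧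
        θ (hS.rayIndex α) ≠ ∞) ∧
      (∀ p : noEnds H → Prop, (∀ᵐ α ∂q, p α) →
        ∀ᵐ β ∂q₀, ∃ α, hS.rayIndex α = β ∧ p α ∧ θ β ≠ 0) ∧
      ∀ p : noEnds H → Prop, (∀ᵐ β ∂q₀, p β) →
        ∀ᵐ α ∂q, θ (hS.rayIndex α) = 0 ∨ p (hS.rayIndex α) := by
  have := h.isFiniteMeasure
  have := h.isSFiniteKernel
  have := hD.isProbabilityMeasure
  have hr := hS.measurable_rayIndex
  have h𝔔r : ∀ x, hS.rayIndex (𝔔 x) = hS.rayIndex x := fun x =>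
    hS.rayIndex_eq_iff.2 (hD.quotient.related x).symm
  have hidem : ∀ᵐ α ∂q, 𝔔 α = α := by
    filter_upwards [hD.concentrated_quotient] with α hα
    obtain ⟨x, rfl⟩ := hα
    exact ((hD.quotient.eq_iff _ _).2 (hD.quotient.related x)).symm
  -- full Borel sets on which `rayIndex` is injective
  have hfull : ∀ p : noEnds H → Prop, (∀ᵐ α ∂q, p α) → ∃ A, MeasurableSet A ∧ q Aᶜ = 0 ∧
      (∀ α ∈ A, p α) ∧ InjOn hS.rayIndex A := by
    intro p hp
    obtain ⟨N, hN, hNm, hN0⟩ := exists_measurable_superset_of_null (ae_iff.1 (hp.and hidem))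
    have hA : ∀ α ∈ Nᶜ, p α ∧ 𝔔 α = α := fun α hα => by
      by_contra hcon
      exact hα (hN hcon)
    refine ⟨Nᶜ, hNm.compl, by rwa [compl_compl], fun α hα => (hA α hα).1, fun a ha b hb hab => ?_⟩
    rw [← (hA a ha).2, ← (hA b hb).2]
    exact (hD.quotient.eq_iff _ _).2 (hS.rayIndex_eq_iff.1 hab)
  -- Here `rayIndex ∘ 𝔔 = rayIndex` transfers the absolute continuity of the image under `𝔔` to the
  -- image under `rayIndex`.
  have hq'ac : q₀ ≪ q.map hS.rayIndex := by
    refine hac.trans (Measure.AbsolutelyContinuous.mk fun C hC hC0 => ?_)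
    rw [Measure.map_apply hr hC] at hC0 ⊢
    have := hD.map_absolutelyContinuous _ (hr hC) hC0
    rwa [← preimage_comp, show hS.rayIndex ∘ 𝔔 = hS.rayIndex from funext h𝔔r] at this
  set q' := q.map hS.rayIndex with hq'
  -- The factor between the two disintegrations is the density of one quotient measure relative to
  -- the other, both viewed on the indices of the rays.
  set θ := q₀.rnDeriv q' with hθ
  have hθm : Measurable θ := Measure.measurable_rnDeriv _ _
  have hθq : q'.withDensity θ = q₀ := Measure.withDensity_rnDeriv_eq _ _ hq'ac
  refine ⟨θ, ?_, ?_, ?_⟩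
  · have hfin : ∀ᵐ α ∂q, θ (hS.rayIndex α) ≠ ∞ := by
      have := Measure.rnDeriv_lt_top q₀ q'
      filter_upwards [ae_of_ae_map hr.aemeasurable this] with α hα using hα.ne
    refine Filter.Eventually.and ?_ hfin
    obtain ⟨A, hAm, hA0, -, hAi⟩ := hfull (fun _ => True) (ae_of_all _ fun _ => trivial)
    let E := CompactExhaustion.choice X
    refine ae_eq_of_setLIntegral_eq (B := fun k => (fun x : noEnds H => ((x : H) : X)) ⁻¹' E k)
      (fun k => measurable_coe_coe (E.isCompact k).isClosed.measurableSet)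
      (by rw [← preimage_iUnion, E.iUnion_eq, preimage_univ]) (fun k => ?_)
      (fun D hDm => hD.measurable D hDm.nullMeasurableSet) (fun D hDm => ?_) (fun D C hDm hC => ?_)
    · obtain ⟨c, hc⟩ := hD.locally_bounded (E k) (E.isCompact k)
      filter_upwards [hc] with α hα
      exact (lt_of_le_of_lt hα ENNReal.coe_lt_top).ne
    · exact ((hθm.mul (K.measurable_coe hDm)).comp hr).aemeasurable
    -- Up to a `q`-null set, `C` is the preimage of a Borel set of indices, because `rayIndex` is
    -- injective on the full set `A`; only for such sets can both disintegration formulas be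
    -- compared.
    · set C' := hS.rayIndex '' (C ∩ A) with hC'
      have hC'm : MeasurableSet C' :=
        (hC.inter hAm).image_of_measurable_injOn hr (hAi.mono inter_subset_right)
      have hCC' : (C : Set (noEnds H)) =ᵐ[q] hS.rayIndex ⁻¹' C' := by
        have hAae : ∀ᵐ α ∂q, α ∈ A := by
          rw [ae_iff]; exact hA0
        filter_upwards [hAae] with α hα
        refine propext ⟨fun hαC => ⟨α, ⟨hαC, hα⟩, rfl⟩, ?_⟩
        rintro ⟨γ, ⟨hγC, hγA⟩, hγ⟩
        rwa [← hAi hγA hα hγ]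
      rw [setLIntegral_congr hCC', setLIntegral_congr hCC', ← hD.disintegration D _
        hDm.nullMeasurableSet (hr hC'm).nullMeasurableSet, ← preimage_comp,
        show hS.rayIndex ∘ 𝔔 = hS.rayIndex from funext h𝔔r, h.setLIntegral_eq hDm hC'm, ← hθq,
        restrict_withDensity hC'm, lintegral_withDensity_eq_lintegral_mul _ hθm
          (K.measurable_coe hDm), hq', setLIntegral_map hC'm (hθm.mul (K.measurable_coe hDm)) hr]
      rfl
  · intro p hp
    obtain ⟨A, hAm, hA0, hAp, hAi⟩ := hfull p hp
    have hrA : MeasurableSet (hS.rayIndex '' A) := hAm.image_of_measurable_injOn hr hAi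
    have hmem : ∀ᵐ β ∂q', β ∈ hS.rayIndex '' A := by
      rw [ae_map_iff (p := fun β => β ∈ hS.rayIndex '' A) hr.aemeasurable hrA]
      have hAae : ∀ᵐ α ∂q, α ∈ A := by
        rw [ae_iff]; exact hA0
      filter_upwards [hAae] with α hα using mem_image_of_mem _ hα
    filter_upwards [hq'ac.ae_le hmem, Measure.rnDeriv_pos hq'ac] with β ⟨α, hα, hαβ⟩ hβ
    exact ⟨α, hαβ, hAp α hα, hβ.ne'⟩
  · intro p hp
    obtain ⟨N, hN, hNm, hN0⟩ := exists_measurable_superset_of_null (ae_iff.1 hp)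
    rw [← hθq, withDensity_apply _ hNm, lintegral_eq_zero_iff hθm, EventuallyEq,
      ae_restrict_iff' hNm] at hN0
    filter_upwards [ae_of_ae_map hr.aemeasurable hN0] with α hα
    by_cases hαN : hS.rayIndex α ∈ N
    · exact Or.inl (hα hαN)
    · exact Or.inr (by_contra fun hcon => hαN (hN hcon))

end Disintegration

/-! ### Measures with a concave power of the density -/

section ConcaveDensity

/-- `M` has a density on `I` whose `(n-1)`-th root is concave. -/
def HasConcaveDensity (n : ℝ) (I : Set ℝ) (M : Measure ℝ) : Prop :=
  ∃ h : ℝ → ℝ, Measurable h ∧ (∀ s ∈ I, 0 ≤ h s) ∧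
    M = (volume.restrict I).withDensity (fun s => ENNReal.ofReal (h s)) ∧
    ConcaveOn ℝ I fun s => h s ^ (1 / (n - 1))

variable {n : ℝ} {I J : Set ℝ} {M : Measure ℝ}

theorem HasConcaveDensity.translate (h : HasConcaveDensity n I M) (c : ℝ) :
    HasConcaveDensity n ((fun t => t + c) ⁻¹' I) (M.map fun s => s - c) := by
  obtain ⟨h, hm, h0, hM, hc⟩ := h
  have hI : MeasurableSet I := hc.1.ordConnected.measurableSet
  have hadd : Measurable fun t : ℝ => t + c := measurable_id.add_const c
  have hsub : Measurable fun t : ℝ => t - c := measurable_id.sub_const c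
  refine ⟨fun t => h (t + c), hm.comp hadd, fun t ht => h0 _ ht, ?_, ?_⟩
  swap
  · have := hc.translate_left c
    simp only [add_comm c] at this
    exact this
  ext A hA
  rw [Measure.map_apply hsub hA, hM, withDensity_apply _ (hsub hA), withDensity_apply _ hA,
    Measure.restrict_restrict (hsub hA), Measure.restrict_restrict hA,
    ← lintegral_indicator ((hsub hA).inter hI), ← lintegral_indicator (hA.inter (hadd hI)),
    ← lintegral_add_right_eq_self _ c]
  refine lintegral_congr fun t => ?_
  have : t + c ∈ (fun t => t - c) ⁻¹' A ∩ I ↔ t ∈ A ∩ (fun t => t + c) ⁻¹' I := by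
    simp [mem_inter_iff]
  by_cases ht : t ∈ A ∩ (fun t => t + c) ⁻¹' I
  · rw [indicator_of_mem ht, indicator_of_mem (this.2 ht)]
  · rw [indicator_of_notMem ht, indicator_of_notMem fun h => ht (this.1 h)]

theorem HasConcaveDensity.smul (h : HasConcaveDensity n I M) {c : ℝ≥0∞} (hc : c ≠ ∞) :
    HasConcaveDensity n I (c • M) := by
  obtain ⟨h, hm, h0, hM, hcc⟩ := h
  refine ⟨fun s => c.toReal * h s, hm.const_mul _, fun s hs => mul_nonneg ENNReal.toReal_nonneg
    (h0 s hs), ?_, ?_⟩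
  · rw [hM, ← withDensity_smul _ hm.ennreal_ofReal]
    congr 1
    ext s
    rw [Pi.smul_apply, smul_eq_mul, ENNReal.ofReal_mul ENNReal.toReal_nonneg,
      ENNReal.ofReal_toReal hc]
  · refine (hcc.smul (Real.rpow_nonneg (ENNReal.toReal_nonneg (a := c)) (1 / (n - 1)))).congr fun s hs => ?_
    simp only [smul_eq_mul]
    rw [Real.mul_rpow ENNReal.toReal_nonneg (h0 s hs)]

theorem Ioo_subset_of_mem_closure (hJc : J.OrdConnected) {x y : ℝ} (hx : x ∈ closure J)
    (hy : y ∈ closure J) : Ioo x y ⊆ J := by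
  intro z hz
  obtain ⟨x', hx', hxJ⟩ := mem_closure_iff.1 hx _ isOpen_Iio hz.1
  obtain ⟨y', hy', hyJ⟩ := mem_closure_iff.1 hy _ isOpen_Ioi hz.2
  exact hJc.out hxJ hyJ ⟨le_of_lt hx', le_of_lt hy'⟩

/-- A nonnegative concave function on an open interval remains concave when extended by `0` to the
end-points. -/
theorem concaveOn_of_closure {g : ℝ → ℝ} (hJc : J.OrdConnected) (hJI : J ⊆ I)
    (hI : I ⊆ closure J) (hg : ConcaveOn ℝ J g) (hg0 : ∀ x, 0 ≤ g x) (hgJ : ∀ x ∉ J, g x = 0) :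
    ConcaveOn ℝ I g := by
  have hsub : ∀ x ∈ I, ∀ y ∈ I, Ioo x y ⊆ J := fun x hx y hy =>
    Ioo_subset_of_mem_closure hJc (hI hx) (hI hy)
  have hconv : Convex ℝ I := by
    refine OrdConnected.convex (ordConnected_of_Ioo fun x hx y hy _ => ?_)
    exact (hsub x hx y hy).trans hJI
  refine LinearOrder.concaveOn_of_lt hconv fun x hx y hy hxy a b ha hb hab => ?_
  simp only [smul_eq_mul]
  obtain rfl : a = 1 - b := by linarith
  set z := (1 - b) * x + b * y with hz
  have hxz : x < z := by nlinarith
  have hzy : z < y := by nlinarith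
  by_cases hxJ : x ∈ J
  · by_cases hyJ : y ∈ J
    · exact hg.2 hxJ hyJ ha.le hb.le hab
    · rw [hgJ y hyJ, mul_zero, add_zero]
      -- Concavity is used between `x` and a point `y'` of `J` just before `y`; the nonnegative
      -- contribution of `y'` is dropped before letting `y'` tend to `y`.
      have hlim : Tendsto (fun y' => (y' - z) / (y' - x) * g x) (𝓝[<] y)
          (𝓝 ((y - z) / (y - x) * g x)) := by
        refine Tendsto.mono_left ?_ nhdsWithin_le_nhds
        exact (((continuous_id.sub continuous_const).tendsto y).div
          ((continuous_id.sub continuous_const).tendsto y) (sub_ne_zero.2 hxy.ne')).mul_const _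
      have e : (y - z) / (y - x) = 1 - b := by
        rw [hz, div_eq_iff (sub_ne_zero.2 hxy.ne')]; ring
      rw [e] at hlim
      refine le_of_tendsto hlim ?_
      filter_upwards [Ioo_mem_nhdsLT hzy] with y' hy'
      have hp : 0 < y' - x := by linarith [hy'.1]
      have hy'J : y' ∈ J := hsub x hx y hy ⟨by linarith, hy'.2⟩
      have := hg.2 hxJ hy'J
        (show 0 ≤ (y' - z) / (y' - x) from div_nonneg (by linarith [hy'.1]) hp.le)
        (show 0 ≤ (z - x) / (y' - x) from div_nonneg (by linarith) hp.le)
        (by rw [← add_div, div_eq_one_iff_eq hp.ne']; ring)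
      have ez : (y' - z) / (y' - x) * x + (z - x) / (y' - x) * y' = z := by
        field_simp; ring
      simp only [smul_eq_mul, ez] at this
      have h2 : 0 ≤ (z - x) / (y' - x) * g y' :=
        mul_nonneg (div_nonneg (by linarith) hp.le) (hg0 _)
      linarith
  · rw [hgJ x hxJ, mul_zero, zero_add]
    by_cases hyJ : y ∈ J
    · have hlim : Tendsto (fun x' => (z - x') / (y - x') * g y) (𝓝[>] x)
          (𝓝 ((z - x) / (y - x) * g y)) := by
        refine Tendsto.mono_left ?_ nhdsWithin_le_nhds
        exact (((continuous_const.sub continuous_id).tendsto x).div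
          ((continuous_const.sub continuous_id).tendsto x) (sub_ne_zero.2 hxy.ne')).mul_const _
      have e : (z - x) / (y - x) = b := by
        rw [hz, div_eq_iff (sub_ne_zero.2 hxy.ne')]; ring
      rw [e] at hlim
      refine le_of_tendsto hlim ?_
      filter_upwards [Ioo_mem_nhdsGT hxz] with x' hx'
      have hp : 0 < y - x' := by linarith [hx'.2]
      have hx'J : x' ∈ J := hsub x hx y hy ⟨hx'.1, by linarith [hx'.2]⟩
      have := hg.2 hx'J hyJ
        (show 0 ≤ (y - z) / (y - x') from div_nonneg (by linarith) hp.le)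
        (show 0 ≤ (z - x') / (y - x') from div_nonneg (by linarith [hx'.2]) hp.le)
        (by rw [← add_div, div_eq_one_iff_eq hp.ne']; ring)
      have ez : (y - z) / (y - x') * x' + (z - x') / (y - x') * y = z := by
        field_simp; ring
      simp only [smul_eq_mul, ez] at this
      have h2 : 0 ≤ (y - z) / (y - x') * g x' :=
        mul_nonneg (div_nonneg (by linarith) hp.le) (hg0 _)
      linarith
    · rw [hgJ y hyJ, mul_zero]
      exact hg0 _

theorem BrunnMinkowski.hasConcaveDensity (hBM : BrunnMinkowski n J M) (hn : 1 < n)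
    (hJo : IsOpen J) (hJc : J.OrdConnected) (hfin : ∀ a ∈ J, ∀ b ∈ J, M (Icc a b) ≠ ∞)
    (hM : M Jᶜ = 0) (hJI : J ⊆ I) (hI : I ⊆ closure J) : HasConcaveDensity n I M := by
  obtain ⟨h, hm, h0, hz, hc, hd⟩ := hBM.exists_density hn hJo hJc hfin
  have hn1 : 1 / (n - 1) ≠ 0 := one_div_ne_zero (by linarith)
  have hcI := concaveOn_of_closure hJc hJI hI hc (fun x => Real.rpow_nonneg (h0 x) _)
    (fun x hx => by rw [hz x hx, Real.zero_rpow hn1])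
  refine ⟨h, hm, fun s _ => h0 s, ?_, hcI⟩
  have hIm : MeasurableSet I := hcI.1.ordConnected.measurableSet
  have hMJ : M.restrict J = M := Measure.restrict_eq_self_of_ae_mem (by
    rw [ae_iff]; exact hM)
  rw [← hMJ, hd, ← withDensity_indicator hIm]
  congr 1
  ext s
  by_cases hs : s ∈ I
  · rw [indicator_of_mem hs]
  · rw [indicator_of_notMem hs, hz s fun hsJ => hs (hJI hsJ), ENNReal.ofReal_zero]

end ConcaveDensity

/-! ### The parameter interval of a ray with its end-points -/

section RayDensity

variable {X : Type*} [TopologicalCausalSpace X] [MeasurableSpace X] {H : Set X}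
variable {G : noEnds H → ℝ}

/-- The values of the extended gauge on the ray of `β` with its end-points. -/
def closedGaugeRange (G : noEnds H → ℝ) (β : noEnds H) : Set ℝ := {s | (β, s) ∈ RaySetting.rayRange G}

theorem gaugeRange_subset_closedGaugeRange (β : noEnds H) :
    gaugeRange G β ⊆ closedGaugeRange G β := by
  rintro s ⟨y, hy, rfl⟩
  exact ⟨y, hy, rayGauge_coe β y⟩

theorem gaugeRange_eq (β : noEnds H) : gaugeRange G β = {r | ∃ y, Related y β ∧ r = G y} := by
  ext s
  exact exists_congr fun y => and_congr_right fun _ => eq_comm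

/-- Connects the values of the extended gauge with the description of `rayInterval` by infimum and
supremum. An end-point of the ray makes the corresponding extremity finite. -/
theorem RaySetting.closedGaugeRange_eq (hS : RaySetting H G) (β : noEnds H) :
    closedGaugeRange G β = gaugeRange G β
      ∪ {r | (∃ x ∈ initialPoints H, x ≤ (β : H)) ∧ IsGLB (gaugeRange G β) r}
      ∪ {r | (∃ x ∈ finalPoints H, (β : H) ≤ x) ∧ IsLUB (gaugeRange G β) r} := by
  rw [gaugeRange_eq]
  ext s
  constructor
  · rintro ⟨x, hx, hs⟩
    simp only at hx hs
    subst hs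
    by_cases hxi : x ∈ initialPoints H
    · have hle := hx.le_of_initial hxi
      rw [rayGauge_initial hxi]
      exact Or.inl (Or.inr ⟨⟨x, hxi, hle⟩, hS.isGLB_of_initial hxi hle⟩)
    · by_cases hxf : x ∈ finalPoints H
      · have hle := hx.le_of_final hxf
        rw [rayGauge_final hxf hxi]
        exact Or.inr ⟨⟨x, hxf, hle⟩, hS.isLUB_of_final hxf hle⟩
      · have hxE : x ∈ noEnds H := fun h => h.elim hxi hxf
        exact Or.inl (Or.inl ⟨⟨x, hxE⟩, hx, rayGauge_coe β ⟨x, hxE⟩⟩)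
  · rintro ((⟨y, hy, rfl⟩ | ⟨⟨x, hxi, hle⟩, h⟩) | ⟨⟨x, hxf, hle⟩, h⟩)
    · exact ⟨y, hy, rayGauge_coe β y⟩
    · refine ⟨x, Or.inl hle, ?_⟩
      simp only
      rw [rayGauge_initial hxi]
      exact (hS.isGLB_of_initial hxi hle).unique h
    · have hon : OnRay β x := Or.inr hle
      refine ⟨x, hon, ?_⟩
      simp only
      rw [rayGauge_final hxf fun hxi => hon.notMem_final hxi hxf]
      exact (hS.isLUB_of_final hxf hle).unique h

theorem RaySetting.closedGaugeRange_subset_closure (hS : RaySetting H G) (β : noEnds H) :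
    closedGaugeRange G β ⊆ closure (gaugeRange G β) := by
  rw [hS.closedGaugeRange_eq]
  have hne : (gaugeRange G β).Nonempty := ⟨_, mem_gaugeRange_self β⟩
  rintro s ((h | ⟨-, h⟩) | ⟨-, h⟩)
  · exact subset_closure h
  · exact h.mem_closure hne
  · exact h.mem_closure hne

theorem RaySetting.closedGaugeRange_congr (hS : RaySetting H G) {β β' : noEnds H}
    (h : Related β β') : closedGaugeRange G β = closedGaugeRange G β' := by
  rw [hS.closedGaugeRange_eq, hS.closedGaugeRange_eq, hS.gaugeRange_congr h]
  have hi : (∃ x ∈ initialPoints H, x ≤ (β : H)) ↔ ∃ x ∈ initialPoints H, x ≤ (β' : H) :=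
    ⟨fun ⟨x, hx, hle⟩ => ⟨x, hx, hS.le_of_initial hx hle h.symm⟩,
      fun ⟨x, hx, hle⟩ => ⟨x, hx, hS.le_of_initial hx hle h⟩⟩
  have hf : (∃ x ∈ finalPoints H, (β : H) ≤ x) ↔ ∃ x ∈ finalPoints H, (β' : H) ≤ x :=
    ⟨fun ⟨x, hx, hle⟩ => ⟨x, hx, hS.le_of_final hx hle h.symm⟩,
      fun ⟨x, hx, hle⟩ => ⟨x, hx, hS.le_of_final hx hle h⟩⟩
  rw [hi, hf]

theorem openRayInterval_eq (α : noEnds H) :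
    openRayInterval G α = (fun t => t + G α) ⁻¹' gaugeRange G α := by
  ext t
  exact exists_congr fun y => and_congr_right fun _ => sub_eq_iff_eq_add

theorem RaySetting.rayInterval_eq (hS : RaySetting H G) (α : noEnds H) :
    rayInterval G α = (fun t => t + G α) ⁻¹' closedGaugeRange G α := by
  have hpre : ∀ S : Set ℝ, (fun t => t + G α) ⁻¹' S = OrderIso.addRight (-G α) '' S := fun S => by
    rw [OrderIso.image_eq_preimage_symm]
    ext t
    simp
  have hG : ∀ r, IsGLB (openRayInterval G α) r ↔ IsGLB (gaugeRange G α) (r + G α) := fun r => by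
    rw [openRayInterval_eq, hpre, OrderIso.isGLB_image]
    simp
  have hL : ∀ r, IsLUB (openRayInterval G α) r ↔ IsLUB (gaugeRange G α) (r + G α) := fun r => by
    rw [openRayInterval_eq, hpre, OrderIso.isLUB_image]
    simp
  rw [hS.closedGaugeRange_eq, rayInterval]
  ext t
  simp only [mem_union, mem_preimage, mem_ofPred_eq, hG, hL]
  rw [openRayInterval_eq, mem_preimage]

theorem rayCD_iff {N : ℝ} {α : noEnds H} {μ : Measure (noEnds H)} :
    RayCD G N α μ ↔ HasConcaveDensity (N - 1) (rayInterval G α) (μ.map fun y => G y - G α) := by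
  rw [RayCD, HasConcaveDensity, sub_sub, one_add_one_eq_two]

/-- Translation by `G α` removes the base point, so the condition depends only on the ray and the
measure. -/
theorem RaySetting.rayCD_iff_hasConcaveDensity (hS : RaySetting H G) {N : ℝ} {α : noEnds H}
    {μ : Measure (noEnds H)} :
    RayCD G N α μ ↔ HasConcaveDensity (N - 1) (closedGaugeRange G α) (μ.map G) := by
  have hG := hS.gauge.measurable
  have hsub : ∀ c : ℝ, Measurable fun s : ℝ => s - c := fun c => measurable_id.sub_const c
  rw [rayCD_iff, hS.rayInterval_eq]
  have e : μ.map (fun y => G y - G α) = (μ.map G).map fun s => s - G α := by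
    rw [Measure.map_map (hsub _) hG]
    rfl
  constructor
  · intro h
    have h2 := h.translate (-G α)
    rw [e, Measure.map_map (hsub _) (hsub _)] at h2
    convert h2 using 1
    · ext s; simp
    · rw [show ((fun s => s - -G α) ∘ fun s => s - G α) = id by ext; simp, Measure.map_id]
  · intro h
    rw [e]
    exact h.translate (G α)

end RayDensity

/-! ### The null energy condition tested on sets of rays -/

section Localization

open ProbabilityTheory

variable {X : Type*} [TopologicalCausalSpace X] [MeasurableSpace X] [BorelSpace X] {H : Set X}
variable [hH : Fact (IsClosed H)] {G : noEnds H → ℝ} {m : Measure H} {N n : ℝ}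
variable {hS : RaySetting H G} {q : Measure (noEnds H)} {K : Kernel (noEnds H) (noEnds H)}

theorem RaySetting.related_of_rayIndex_eq (hS : RaySetting H G) {x β : noEnds H}
    (h : hS.rayIndex x = β) : Related x β := h ▸ (hS.related_rayIndex x).symm

/-- The points of the ray with gauge between those of `y` and `z` lie on one curve from `y` to `z`,
whose range is compact. -/
theorem IsRayDisintegration.measure_gauge_Icc_ne_top (h : IsRayDisintegration hS m q K) :
    ∀ᵐ β ∂q, ∀ a ∈ gaugeRange G β, ∀ b ∈ gaugeRange G β, K β (G ⁻¹' Icc a b) ≠ ∞ := by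
  filter_upwards [h.concentrated] with β hβ
  rintro _ ⟨y, hy, rfl⟩ _ ⟨z, hz, rfl⟩
  rcases lt_or_ge (G z) (G y) with hlt | hle
  · rw [Icc_eq_empty (not_le.2 hlt), preimage_empty, measure_empty]
    exact ENNReal.zero_ne_top
  have hyz : y ≤ z := hS.le_of_gauge_le (hS.related_trans hy hz.symm) hle
  obtain ⟨c, hcm, hc0, hc1, hon, hca⟩ := hS.exists_affine_curve (β := β) (x := y) (y := z) hy hz hyz
  have hcomp : IsCompact (range fun t => ((c t : H) : X)) :=
    isCompact_range (continuous_subtype_val.comp c.continuous)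
  obtain ⟨k, hk⟩ := h.bounded _ hcomp
  refine ne_top_of_le_ne_top ENNReal.coe_ne_top (le_trans (measure_mono_ae ?_) (hk β))
  filter_upwards [hβ] with x hx hxI
  have hxβ := hS.related_of_rayIndex_eq hx
  have hcont : ContinuousOn (fun t => rayGauge G β (c t)) univ := by
    simp only [hca]
    fun_prop
  have hmem : G x ∈ (fun t => rayGauge G β (c t)) '' univ := by
    refine (isPreconnected_univ (α := unitInterval)).intermediate_value (mem_univ 0) (mem_univ 1)
      hcont ?_
    rw [hc0, hc1, rayGauge_coe, rayGauge_coe]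
    exact hxI
  obtain ⟨t, -, ht⟩ := hmem
  refine ⟨t, congrArg Subtype.val (hS.eq_of_rayGauge_eq (hon t) (onRay_coe.2 hxβ) ?_)⟩
  rw [rayGauge_coe]
  exact ht

/-- The conditional measure on the gauge interval, normalised. If `r = 0` its mass may vanish; then
only the support matters and a Dirac mass at level `a` is taken. -/
theorem IsRayDisintegration.exists_markov [IsSFiniteKernel K] (h : IsRayDisintegration hS m q K)
    {C : Set (noEnds H)} (hC : MeasurableSet C) {a b r : ℝ} (hr : 0 ≤ r) (hab : a ≤ b)
    (haC : ∀ β ∈ C, a ∈ gaugeRange G β)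
    (hrC : ∀ β ∈ C, ENNReal.ofReal r ≤ K β (G ⁻¹' Icc a b) ∧ K β (G ⁻¹' Icc a b) ≠ ∞) :
    ∃ L : Kernel (noEnds H) (noEnds H), IsMarkovKernel L ∧
      (∀ᵐ β ∂q, β ∈ C → ∀ᵐ x ∂L β, Related x β ∧ G x ∈ Icc a b) ∧
      (0 < r → ∀ β ∈ C, ∀ B, ENNReal.ofReal r * L β B ≤ K β B) := by
  classical
  have hI : MeasurableSet (G ⁻¹' Icc a b) := hS.gauge.measurable measurableSet_Icc
  rcases hr.eq_or_lt with rfl | hr0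
  · refine ⟨Kernel.deterministic (levelPoint G a) (hS.measurable_levelPoint a), inferInstance, ?_,
      fun h => absurd h (lt_irrefl 0)⟩
    refine ae_of_all _ fun β hβ => ?_
    rw [Kernel.deterministic_apply, ae_dirac_eq]
    have := levelPoint_spec (haC β hβ)
    exact ⟨this.1, this.2.ge, this.2.le.trans hab⟩
  · have hm : Measurable (Function.uncurry fun (β _ : noEnds H) => (K β (G ⁻¹' Icc a b))⁻¹) :=
      ((K.measurable_coe hI).comp measurable_fst).inv
    set L₁ := (K.restrict hI).withDensity fun β _ => (K β (G ⁻¹' Icc a b))⁻¹ with hL₁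
    have hL₁a : ∀ β, L₁ β = (K β (G ⁻¹' Icc a b))⁻¹ • (K β).restrict (G ⁻¹' Icc a b) := fun β => by
      rw [hL₁, Kernel.withDensity_apply _ hm, withDensity_const, Kernel.restrict_apply]
    have hpos : ∀ β ∈ C, K β (G ⁻¹' Icc a b) ≠ 0 := fun β hβ =>
      (lt_of_lt_of_le (ENNReal.ofReal_pos.2 hr0) (hrC β hβ).1).ne'
    refine ⟨Kernel.piecewise hC L₁ (Kernel.deterministic id measurable_id), ⟨fun β => ?_⟩, ?_, ?_⟩
    · rw [Kernel.piecewise_apply]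
      split_ifs with hβ
      · refine ⟨?_⟩
        rw [hL₁a, Measure.smul_apply, Measure.restrict_apply_univ, smul_eq_mul,
          ENNReal.inv_mul_cancel (hpos β hβ) (hrC β hβ).2]
      · infer_instance
    · filter_upwards [h.concentrated] with β hβ hβC
      rw [Kernel.piecewise_apply, if_pos hβC, hL₁a]
      refine Measure.ae_smul_measure ?_ _
      filter_upwards [ae_restrict_of_ae hβ, ae_restrict_mem hI] with x hx hxI
      exact ⟨hS.related_of_rayIndex_eq hx, hxI⟩
    · intro _ β hβ B
      rw [Kernel.piecewise_apply, if_pos hβ, hL₁a, Measure.smul_apply, smul_eq_mul, ← mul_assoc]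
      refine (mul_le_mul' ?_ (Measure.restrict_apply_le _ _)).trans_eq (one_mul _)
      rw [← div_eq_mul_inv]
      exact ENNReal.div_le_of_le_mul (by rw [one_mul]; exact (hrC β hβ).1)

theorem restrictNoEnds_image (B : Set (noEnds H)) :
    restrictNoEnds m B = m (Subtype.val '' B) := measurableEmbedding_noEnds.comap_apply _ _

theorem map_restrictNoEnds_le : (restrictNoEnds m).map Subtype.val ≤ m := by
  rw [restrictNoEnds, measurableEmbedding_noEnds.map_comap]
  exact Measure.restrict_le_self

/-- The key estimate: on the rays in `C` the Brunn-Minkowski inequality cannot fail. -/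
theorem NCe.brunnMinkowski_of_subset [IsFiniteMeasureOnCompacts m] (hNC : NCe G m N) (hN : 1 < N)
    (h : IsRayDisintegration hS m q K) {C : Set (noEnds H)} (hC : MeasurableSet C)
    (hCq : q C ≠ 0) (hCi : ∀ β ∈ C, hS.rayIndex β = β)
    {a₀ b₀ a₁ b₁ t r₀ r₁ rt : ℝ} (h0 : a₀ ≤ b₀) (h01 : b₀ < a₁) (h1 : a₁ ≤ b₁) (ht0 : 0 < t)
    (ht1 : t < 1) (ha₀ : ∀ β ∈ C, a₀ ∈ gaugeRange G β) (hb₁ : ∀ β ∈ C, b₁ ∈ gaugeRange G β)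
    (hr₀ : 0 ≤ r₀) (hr₁ : 0 ≤ r₁) (hrt : 0 ≤ rt)
    (hK₀ : ∀ β ∈ C, ENNReal.ofReal r₀ ≤ K β (G ⁻¹' Icc a₀ b₀) ∧ K β (G ⁻¹' Icc a₀ b₀) ≠ ∞)
    (hK₁ : ∀ β ∈ C, ENNReal.ofReal r₁ ≤ K β (G ⁻¹' Icc a₁ b₁) ∧ K β (G ⁻¹' Icc a₁ b₁) ≠ ∞)
    (hKt : ∀ β ∈ C, K β (G ⁻¹' Icc ((1 - t) * a₀ + t * a₁) ((1 - t) * b₀ + t * b₁)) ≤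
      ENNReal.ofReal rt) :
    (1 - t) * r₀ ^ (1 / (N - 1)) + t * r₁ ^ (1 / (N - 1)) ≤ rt ^ (1 / (N - 1)) := by
  have hn : 0 < N - 1 := by linarith
  have := h.isFiniteMeasure
  have := h.isSFiniteKernel
  have hG := hS.gauge.measurable
  obtain ⟨L₀, hL₀, hL₀c, hL₀d⟩ := h.exists_markov hC hr₀ h0 ha₀ hK₀
  obtain ⟨L₁, hL₁, hL₁c, hL₁d⟩ := h.exists_markov hC hr₁ h1 (fun β hβ =>
    (hS.ordConnected_gaugeRange β).out (ha₀ β hβ) (hb₁ β hβ) ⟨by linarith, h1⟩) hK₁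
  have hCtop : q C ≠ ∞ := measure_ne_top _ _
  set Q : ℝ := (q C).toReal with hQ
  have hQ0 : 0 < Q := ENNReal.toReal_pos hCq hCtop
  have hcond : IsProbabilityMeasure ((q C)⁻¹ • q.restrict C) := ⟨by
    rw [Measure.smul_apply, Measure.restrict_apply_univ, smul_eq_mul,
      ENNReal.inv_mul_cancel hCq hCtop]⟩
  -- A ray is drawn in `C`, then two independent points on it. Since `b₀ < a₁`, every such pair is
  -- causal and no special coupling is needed.
  set P := ((q C)⁻¹ • q.restrict C) ⊗ₘ (L₀ ×ₖ L₁) with hP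
  have hcoe : Measurable (Subtype.val : noEnds H → H) := measurable_subtype_coe
  have hx₀ : Measurable fun p : noEnds H × noEnds H × noEnds H => (p.2.1 : H) :=
    hcoe.comp (measurable_fst.comp measurable_snd)
  have hx₁ : Measurable fun p : noEnds H × noEnds H × noEnds H => (p.2.2 : H) :=
    hcoe.comp (measurable_snd.comp measurable_snd)
  have hae : ∀ {p : noEnds H → Prop}, (∀ᵐ β ∂q, β ∈ C → p β) →
      ∀ᵐ β ∂((q C)⁻¹ • q.restrict C), β ∈ C ∧ p β := fun hp => by
    refine Measure.ae_smul_measure ?_ _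
    filter_upwards [ae_restrict_of_ae hp, ae_restrict_mem hC] with β h1 h2 using ⟨h2, h1 h2⟩
  -- the sets carrying the marginals
  let A : ℝ → ℝ → Set (noEnds H) := fun a b => G ⁻¹' Icc a b ∩ hS.rayIndex ⁻¹' C
  have hA : ∀ a b, MeasurableSet (A a b) := fun a b =>
    (hG measurableSet_Icc).inter (hS.measurable_rayIndex hC)
  have hA' : ∀ a b, MeasurableSet (Subtype.val '' A a b : Set H) := fun a b =>
    measurableEmbedding_noEnds.measurableSet_image.2 (hA a b)
  have hAmem : ∀ {x β : noEnds H} {a b : ℝ}, β ∈ C → Related x β → G x ∈ Icc a b → x ∈ A a b :=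
    fun hβ hx hI => ⟨hI, by
      rw [mem_preimage, hS.rayIndex_eq_iff.2 hx, hCi _ hβ]; exact hβ⟩
  have hgood : ∀ᵐ p ∂P, p.2.1 ∈ A a₀ b₀ ∧ p.2.2 ∈ A a₁ b₁ ∧ (p.2.1 : H) ≤ p.2.2 := by
    have hset : MeasurableSet {p : noEnds H × noEnds H × noEnds H |
        p.2.1 ∈ A a₀ b₀ ∧ p.2.2 ∈ A a₁ b₁ ∧ (p.2.1 : H) ≤ p.2.2} :=
      ((measurable_fst.comp measurable_snd) (hA a₀ b₀)).inter
        (((measurable_snd.comp measurable_snd) (hA a₁ b₁)).inter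
        ((hx₀.prodMk hx₁) (isClosed_le continuous_fst continuous_snd).measurableSet))
    rw [hP, Measure.ae_compProd_iff hset]
    filter_upwards [hae hL₀c, hae hL₁c] with β hβ₀ hβ₁
    rw [Kernel.prod_apply]
    have e0 : ∀ᵐ z ∂(L₀ β).prod (L₁ β), Related z.1 β ∧ G z.1 ∈ Icc a₀ b₀ :=
      Measure.quasiMeasurePreserving_fst.ae hβ₀.2
    have e1 : ∀ᵐ z ∂(L₀ β).prod (L₁ β), Related z.2 β ∧ G z.2 ∈ Icc a₁ b₁ :=
      Measure.quasiMeasurePreserving_snd.ae hβ₁.2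
    filter_upwards [e0, e1] with z hz0 hz1
    refine ⟨hAmem hβ₀.1 hz0.1 hz0.2, hAmem hβ₀.1 hz1.1 hz1.2, ?_⟩
    exact hS.le_of_gauge_le (hS.related_trans hz0.1 hz1.1.symm)
      (by linarith [hz0.2.2, hz1.2.1])
  obtain ⟨ν, hν, hU⟩ := hNC (P.map fun p => (p.2.1 : H)) (P.map fun p => (p.2.2 : H))
    (Measure.isProbabilityMeasure_map hx₀.aemeasurable)
    (Measure.isProbabilityMeasure_map hx₁.aemeasurable)
    ⟨P.map fun p => ((p.2.1 : H), (p.2.2 : H)),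
      Measure.isProbabilityMeasure_map (hx₀.prodMk hx₁).aemeasurable,
      by rw [Measure.map_map measurable_fst (hx₀.prodMk hx₁)]; rfl,
      by rw [Measure.map_map measurable_snd (hx₀.prodMk hx₁)]; rfl,
      (ae_map_iff (hx₀.prodMk hx₁).aemeasurable
        (isClosed_le continuous_fst continuous_snd).measurableSet).2 (hgood.mono fun p hp => hp.2.2)⟩
  have := hν.isProbabilityMeasure
  -- the lower bounds
  have hlow : ∀ (x : noEnds H × noEnds H × noEnds H → noEnds H)
      (L : Kernel (noEnds H) (noEnds H)) (r : ℝ), Measurable x →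
      (∀ B, MeasurableSet B → P (x ⁻¹' B) = ∫⁻ β, L β B ∂((q C)⁻¹ • q.restrict C)) → 0 ≤ r →
      (0 < r → ∀ β ∈ C, ∀ B, ENNReal.ofReal r * L β B ≤ K β B) →
      ENNReal.ofReal ((Q * r) ^ (1 / (N - 1))) ≤
        entropyPower (N - 1) (P.map fun p => (x p : H)) m := by
    intro x L r hx hxL hr hrL
    rcases hr.eq_or_lt with rfl | hr
    · rw [mul_zero, Real.zero_rpow (one_div_ne_zero hn.ne'), ENNReal.ofReal_zero]
      exact zero_le
    have hQr : 0 < Q * r := by positivity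
    have hp : IsProbabilityMeasure (P.map fun p => (x p : H)) :=
      Measure.isProbabilityMeasure_map (hcoe.comp hx).aemeasurable
    have := le_entropyPower_of_le_smul (m := m) (μ := P.map fun p => (x p : H))
      (c := (Q * r)⁻¹) (inv_pos.2 hQr) ?_ hn
    · rwa [neg_div, Real.rpow_neg (inv_pos.2 hQr).le, Real.inv_rpow hQr.le, inv_inv] at this
    -- Normalising over the rays costs `1/Q`, and on each ray `r • L ≤ K`; together the density with
    -- respect to `m` is at most `1/(Q r)`.
    · have hle : P.map x ≤ ENNReal.ofReal (Q * r)⁻¹ • restrictNoEnds m := by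
        refine Measure.le_iff.2 fun B hB => ?_
        rw [Measure.map_apply hx hB, hxL B hB, lintegral_smul_measure, smul_eq_mul,
          Measure.smul_apply, smul_eq_mul, ENNReal.ofReal_inv_of_pos hQr, ENNReal.ofReal_mul hQ0.le,
          hQ, ENNReal.ofReal_toReal hCtop, ENNReal.mul_inv (Or.inl hCq) (Or.inl hCtop), mul_assoc]
        refine mul_le_mul' le_rfl ?_
        have hKB := h.setLIntegral_eq hB MeasurableSet.univ
        rw [preimage_univ, inter_univ, Measure.restrict_univ] at hKB
        rw [← ENNReal.mul_le_iff_le_inv (ENNReal.ofReal_pos.2 hr).ne' ENNReal.ofReal_ne_top, hKB,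
          ← lintegral_const_mul' _ _ ENNReal.ofReal_ne_top]
        refine (setLIntegral_mono (K.measurable_coe hB) fun β hβ => hrL hr β hβ B).trans ?_
        exact setLIntegral_le_lintegral _ _
      have e : (P.map fun p => (x p : H)) = (P.map x).map Subtype.val := by
        rw [Measure.map_map hcoe hx]; rfl
      rw [e]
      refine (Measure.map_mono hle hcoe).trans ?_
      rw [Measure.map_smul]
      exact Measure.le_iff.2 fun B _ => by
        rw [Measure.smul_apply, Measure.smul_apply]
        exact mul_le_mul' le_rfl (map_restrictNoEnds_le B)
  have hlow₀ := hlow (fun p => p.2.1) L₀ r₀ (measurable_fst.comp measurable_snd) (fun B hB => by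
    have e : (fun p : noEnds H × noEnds H × noEnds H => p.2.1) ⁻¹' B = univ ×ˢ (B ×ˢ univ) := by
      ext p; simp
    rw [e, hP, Measure.compProd_apply_prod MeasurableSet.univ (hB.prod MeasurableSet.univ),
      Measure.restrict_univ]
    refine lintegral_congr fun β => ?_
    rw [Kernel.prod_apply, Measure.prod_prod, measure_univ, mul_one]) hr₀ hL₀d
  have hlow₁ := hlow (fun p => p.2.2) L₁ r₁ (measurable_snd.comp measurable_snd) (fun B hB => by
    have e : (fun p : noEnds H × noEnds H × noEnds H => p.2.2) ⁻¹' B = univ ×ˢ (univ ×ˢ B) := by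
      ext p; simp
    rw [e, hP, Measure.compProd_apply_prod MeasurableSet.univ (MeasurableSet.univ.prod hB),
      Measure.restrict_univ]
    refine lintegral_congr fun β => ?_
    rw [Kernel.prod_apply, Measure.prod_prod, measure_univ, one_mul]) hr₁ hL₁d
  -- the upper bound
  set T : unitInterval := ⟨t, ht0.le, ht1.le⟩ with hT
  set at' := (1 - t) * a₀ + t * a₁ with hat
  set bt' := (1 - t) * b₀ + t * b₁ with hbt
  -- Whichever plan the condition provides, its curves stay on their rays and are affine in the
  -- gauge, so at time `t` they are confined to the interpolated gauge interval on the rays of `C`.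
  have hconc : ∀ᵐ γ ∂ν, γ T ∈ (Subtype.val '' A at' bt' : Set H) := by
    have e0 : ∀ᵐ γ ∂ν, γ 0 ∈ (Subtype.val '' A a₀ b₀ : Set H) := by
      refine ae_marginal (p := fun x => x ∈ (Subtype.val '' A a₀ b₀ : Set H)) hν.marginal_zero ?_
      rw [ae_map_iff (p := fun x => x ∈ (Subtype.val '' A a₀ b₀ : Set H)) hx₀.aemeasurable (hA' _ _)]
      filter_upwards [hgood] with p hp using ⟨_, hp.1, rfl⟩
    have e1 : ∀ᵐ γ ∂ν, γ 1 ∈ (Subtype.val '' A a₁ b₁ : Set H) := by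
      refine ae_marginal (p := fun x => x ∈ (Subtype.val '' A a₁ b₁ : Set H)) hν.marginal_one ?_
      rw [ae_map_iff (p := fun x => x ∈ (Subtype.val '' A a₁ b₁ : Set H)) hx₁.aemeasurable (hA' _ _)]
      filter_upwards [hgood] with p hp using ⟨_, hp.2.1, rfl⟩
    filter_upwards [hν.gCausal, e0, e1] with γ hγ ⟨x, hx, hx0⟩ ⟨y, hy, hy1⟩
    obtain ⟨hE, hGt⟩ := hS.gauge_gCausal hγ (hx0 ▸ x.2) (hy1 ▸ y.2) T
    have ex : (⟨γ 0, hx0 ▸ x.2⟩ : noEnds H) = x := Subtype.ext hx0.symm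
    have ey : (⟨γ 1, hy1 ▸ y.2⟩ : noEnds H) = y := Subtype.ext hy1.symm
    rw [ex, ey] at hGt
    refine ⟨⟨γ T, hE⟩, ⟨?_, ?_⟩, rfl⟩
    · rw [mem_preimage, hGt, hat, hbt]
      have u1 := hx.1.1; have u2 := hx.1.2; have u3 := hy.1.1; have u4 := hy.1.2
      have t1 : 0 ≤ 1 - t := by linarith
      constructor
      · exact add_le_add (mul_le_mul_of_nonneg_left u1 t1) (mul_le_mul_of_nonneg_left u3 ht0.le)
      · exact add_le_add (mul_le_mul_of_nonneg_left u2 t1) (mul_le_mul_of_nonneg_left u4 ht0.le)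
    · have hrel : Related (⟨γ T, hE⟩ : noEnds H) x := Or.inr (by
        change (x : H) ≤ γ T
        rw [hx0]; exact hγ.1 unitInterval.nonneg')
      rw [mem_preimage, hS.rayIndex_eq_iff.2 hrel]
      exact hx.2
  have hmA : m (Subtype.val '' A at' bt') ≤ ENNReal.ofReal (Q * rt) := by
    rw [← restrictNoEnds_image, h.setLIntegral_eq (hG measurableSet_Icc) hC,
      ENNReal.ofReal_mul hQ0.le, hQ, ENNReal.ofReal_toReal hCtop, mul_comm]
    refine (setLIntegral_mono measurable_const fun β hβ => hKt β hβ).trans_eq ?_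
    rw [setLIntegral_const]
  have hmAtop : m (Subtype.val '' A at' bt') ≠ ∞ := ne_top_of_le_ne_top ENNReal.ofReal_ne_top hmA
  have hpT : IsProbabilityMeasure (marginal ν T) :=
    Measure.isProbabilityMeasure_map (measurable_eval T).aemeasurable
  have hup := entropyPower_le_of_concentrated (μ := marginal ν T) (hA' at' bt') (by
    rw [← mem_ae_iff]
    exact (ae_map_iff (p := fun x => x ∈ (Subtype.val '' A at' bt' : Set H))
      (measurable_eval T).aemeasurable (hA' _ _)).2 hconc) hmAtop hn
  have hup' : entropyPower (N - 1) (marginal ν T) m ≤ ENNReal.ofReal ((Q * rt) ^ (1 / (N - 1))) := by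
    refine hup.trans (ENNReal.ofReal_le_ofReal (Real.rpow_le_rpow ENNReal.toReal_nonneg ?_
      (by positivity)))
    exact ENNReal.toReal_le_of_le_ofReal (by positivity) hmA
  have hfinal := ((add_le_add (mul_le_mul' le_rfl hlow₀) (mul_le_mul' le_rfl hlow₁)).trans
    (hU T)).trans hup'
  have t1 : 0 ≤ 1 - t := by linarith
  have hcoeT : (T : ℝ) = t := rfl
  rw [hcoeT, ← ENNReal.ofReal_mul t1, ← ENNReal.ofReal_mul ht0.le, ← ENNReal.ofReal_add
    (by positivity) (by positivity), ENNReal.ofReal_le_ofReal_iff (by positivity),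
    Real.mul_rpow hQ0.le hr₀, Real.mul_rpow hQ0.le hr₁, Real.mul_rpow hQ0.le hrt] at hfinal
  -- The three terms carry the same power of `Q`, which cancels; the global inequality becomes one
  -- about single rays.
  have hQp : 0 < Q ^ (1 / (N - 1)) := Real.rpow_pos_of_pos hQ0 _
  refine le_of_mul_le_mul_left ?_ hQp
  linarith

end Localization

/-! ### Concave densities on almost every ray -/

section Density

open ProbabilityTheory

variable {X : Type*} [TopologicalCausalSpace X] [MeasurableSpace X] [BorelSpace X] {H : Set X}
variable [hH : Fact (IsClosed H)] {G : noEnds H → ℝ} {m : Measure H} {N n : ℝ}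
variable {hS : RaySetting H G} {q : Measure (noEnds H)} {K : Kernel (noEnds H) (noEnds H)}

theorem exists_rat_le_of_lt {f : ℝ → ℝ} (hf : Continuous f) {x c : ℝ} (hx : 0 ≤ x) (h : c < f x) :
    ∃ r : ℚ, 0 ≤ (r : ℝ) ∧ (r : ℝ) ≤ x ∧ c < f r := by
  rcases hx.eq_or_lt with rfl | hx
  · exact ⟨0, by simp, by simp, by simpa using h⟩
  obtain ⟨l, hl, hlx⟩ := exists_Ioc_subset_of_mem_nhds
    (hf.continuousAt.eventually (lt_mem_nhds h)) ⟨0, hx⟩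
  obtain ⟨r, hr, hrx⟩ := exists_rat_btwn (max_lt hl hx)
  exact ⟨r, ((le_max_right _ _).trans_lt hr).le, hrx.le,
    hlx ⟨(le_max_left _ _).trans_lt hr, hrx.le⟩⟩

theorem exists_rat_ge_of_lt {f : ℝ → ℝ} (hf : Continuous f) {x c : ℝ} (h : f x < c) :
    ∃ r : ℚ, x ≤ (r : ℝ) ∧ f r < c := by
  obtain ⟨u, hu, hux⟩ := exists_Ico_subset_of_mem_nhds
    (hf.continuousAt.eventually (gt_mem_nhds h)) ⟨x + 1, by linarith⟩
  obtain ⟨r, hr, hrx⟩ := exists_rat_btwn hu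
  exact ⟨r, hr.le, hux ⟨hr.le, hrx⟩⟩

/-- For each choice of rational parameters the exceptional rays form a Borel set that is null by
`NCe.brunnMinkowski_of_subset`; off the countable union the Brunn-Minkowski inequality holds on the
ray. -/
theorem NCe.hasConcaveDensity [IsFiniteMeasureOnCompacts m] (hNC : NCe G m N) (hN : 2 < N)
    (h : IsRayDisintegration hS m q K) :
    ∀ᵐ β ∂q, HasConcaveDensity (N - 1) (closedGaugeRange G β) ((K β).map G) := by
  have hn : 0 < N - 1 := by linarith
  have hp : 0 < 1 / (N - 1) := one_div_pos.2 hn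
  have := h.isSFiniteKernel
  have hG := hS.gauge.measurable
  have hKm : ∀ a b : ℝ, Measurable fun β => K β (G ⁻¹' Icc a b) := fun a b =>
    K.measurable_coe (hG measurableSet_Icc)
  have key : ∀ a₀ b₀ a₁ b₁ t r₀ r₁ rt : ℚ, ∀ᵐ β ∂q, (a₀ : ℝ) ≤ b₀ → (b₀ : ℝ) < a₁ → (a₁ : ℝ) ≤ b₁ →
      (0 : ℝ) < t → (t : ℝ) < 1 → (a₀ : ℝ) ∈ gaugeRange G β → (b₁ : ℝ) ∈ gaugeRange G β →
      (0 : ℝ) ≤ r₀ → (0 : ℝ) ≤ r₁ → (0 : ℝ) ≤ rt →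
      (ENNReal.ofReal r₀ ≤ K β (G ⁻¹' Icc a₀ b₀) ∧ K β (G ⁻¹' Icc a₀ b₀) ≠ ∞) →
      (ENNReal.ofReal r₁ ≤ K β (G ⁻¹' Icc a₁ b₁) ∧ K β (G ⁻¹' Icc a₁ b₁) ≠ ∞) →
      K β (G ⁻¹' Icc ((1 - t) * a₀ + t * a₁) ((1 - t) * b₀ + t * b₁)) ≤ ENNReal.ofReal rt →
      (1 - t : ℝ) * (r₀ : ℝ) ^ (1 / (N - 1)) + t * (r₁ : ℝ) ^ (1 / (N - 1)) ≤
        (rt : ℝ) ^ (1 / (N - 1)) := by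
    intro a₀ b₀ a₁ b₁ t r₀ r₁ rt
    by_contra hcon
    let C : Set (noEnds H) := {β | hS.rayIndex β = β} ∩ ({β | (a₀ : ℝ) ∈ gaugeRange G β} ∩
      ({β | (b₁ : ℝ) ∈ gaugeRange G β} ∩
      ({β | ENNReal.ofReal r₀ ≤ K β (G ⁻¹' Icc (a₀ : ℝ) b₀) ∧ K β (G ⁻¹' Icc (a₀ : ℝ) b₀) ≠ ∞} ∩
      ({β | ENNReal.ofReal r₁ ≤ K β (G ⁻¹' Icc (a₁ : ℝ) b₁) ∧ K β (G ⁻¹' Icc (a₁ : ℝ) b₁) ≠ ∞} ∩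
      {β | K β (G ⁻¹' Icc ((1 - t) * a₀ + t * a₁ : ℝ) ((1 - t) * b₀ + t * b₁)) ≤
        ENNReal.ofReal rt}))))
    have hC : MeasurableSet C := by
      refine (measurableSet_eq_fun hS.measurable_rayIndex measurable_id).inter
        ((hS.measurableSet_mem_gaugeRange _).inter ((hS.measurableSet_mem_gaugeRange _).inter
        (MeasurableSet.inter ?_ (MeasurableSet.inter ?_ ?_))))
      · exact (measurableSet_le measurable_const (hKm _ _)).inter
          ((hKm _ _) (measurableSet_singleton ∞).compl)
      · exact (measurableSet_le measurable_const (hKm _ _)).inter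
          ((hKm _ _) (measurableSet_singleton ∞).compl)
      · exact measurableSet_le (hKm _ _) measurable_const
    -- The desired numerical inequality does not involve `β`: it holds outright if `C` has positive
    -- measure, and otherwise its premises fail for almost every `β`.
    by_cases hCq : q C = 0
    · refine hcon ?_
      filter_upwards [h.index_eq, compl_mem_ae_iff.2 hCq] with β hβ hβC
      intro _ _ _ _ _ h6 h7 _ _ _ h11 h12 h13
      exact absurd ⟨hβ, h6, h7, h11, h12, h13⟩ hβC
    · refine hcon (ae_of_all _ fun β => ?_)
      intro h1 h2 h3 h4 h5 _ _ h8 h9 h10 _ _ _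
      exact hNC.brunnMinkowski_of_subset (by linarith) h hC hCq (fun β hβ => hβ.1) h1 h2 h3 h4 h5
        (fun β hβ => hβ.2.1) (fun β hβ => hβ.2.2.1) h8 h9 h10 (fun β hβ => hβ.2.2.2.1)
        (fun β hβ => hβ.2.2.2.2.1) (fun β hβ => hβ.2.2.2.2.2)
  simp only [← ae_all_iff] at key
  filter_upwards [key, h.concentrated, h.measure_gauge_Icc_ne_top] with β hβ hconc hfin
  have hmap : ∀ a b : ℝ, (K β).map G (Icc a b) = K β (G ⁻¹' Icc a b) := fun a b =>
    Measure.map_apply hG measurableSet_Icc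
  have hJo := hS.isOpen_gaugeRange β
  have hJc := hS.ordConnected_gaugeRange β
  have hfin' : ∀ a ∈ gaugeRange G β, ∀ b ∈ gaugeRange G β, (K β).map G (Icc a b) ≠ ∞ :=
    fun a ha b hb => by rw [hmap]; exact hfin a ha b hb
  refine BrunnMinkowski.hasConcaveDensity (J := gaugeRange G β)
    (brunnMinkowski_of_rat hn hJo hfin' ?_) (by linarith) hJo hJc hfin' ?_
    (gaugeRange_subset_closedGaugeRange β) (hS.closedGaugeRange_subset_closure β)
  · intro a₀ b₀ a₁ b₁ t h0 h01 h1 ht0 ht1 ha hb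
    have h0' : (a₀ : ℝ) ≤ b₀ := by exact_mod_cast h0
    have h01' : (b₀ : ℝ) < a₁ := by exact_mod_cast h01
    have h1' : (a₁ : ℝ) ≤ b₁ := by exact_mod_cast h1
    have ht0' : (0 : ℝ) < t := by exact_mod_cast ht0
    have ht1' : (t : ℝ) < 1 := by exact_mod_cast ht1
    have hm : ∀ s, (a₀ : ℝ) ≤ s → s ≤ b₁ → s ∈ gaugeRange G β := fun s u v => hJc.out ha hb ⟨u, v⟩
    have m0 := hfin' _ (hm a₀ le_rfl (by linarith)) _ (hm b₀ (by linarith) (by linarith))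
    have m1 := hfin' _ (hm a₁ (by linarith) (by linarith)) _ (hm b₁ (by linarith) (by linarith))
    have mt := hfin' _ (hm ((1 - t) * a₀ + t * a₁) (by nlinarith) (by nlinarith)) _
      (hm ((1 - t) * b₀ + t * b₁) (by nlinarith) (by nlinarith))
    -- A strict violation survives replacing the middle mass by a slightly larger rational and the
    -- other two by slightly smaller ones.
    by_contra! hlt
    have hcont : Continuous fun r : ℝ => r ^ (1 / (N - 1)) :=
      Real.continuous_rpow_const hp.le
    obtain ⟨rt, hrt, hlt⟩ := exists_rat_ge_of_lt hcont hlt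
    obtain ⟨r₀, hr0, hr0x, hlt⟩ := exists_rat_le_of_lt
      (f := fun r => (1 - t : ℝ) * r ^ (1 / (N - 1)) + t * ((K β).map G (Icc (a₁ : ℝ) b₁)).toReal ^ (1 / (N - 1)))
      ((continuous_const.mul hcont).add continuous_const) ENNReal.toReal_nonneg hlt
    obtain ⟨r₁, hr1, hr1x, hlt⟩ := exists_rat_le_of_lt
      (f := fun r => (1 - t : ℝ) * (r₀ : ℝ) ^ (1 / (N - 1)) + t * r ^ (1 / (N - 1)))
      (continuous_const.add (continuous_const.mul hcont)) ENNReal.toReal_nonneg hlt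
    refine absurd (hβ a₀ b₀ a₁ b₁ t r₀ r₁ rt h0' h01' h1' ht0' ht1' ha hb hr0 hr1
      (ENNReal.toReal_nonneg.trans hrt) ?_ ?_ ?_) (not_le.2 hlt)
    · rw [← hmap]
      exact ⟨ENNReal.ofReal_le_of_le_toReal hr0x, m0⟩
    · rw [← hmap]
      exact ⟨ENNReal.ofReal_le_of_le_toReal hr1x, m1⟩
    · rw [← hmap]
      exact (ENNReal.le_ofReal_iff_toReal_le mt (ENNReal.toReal_nonneg.trans hrt)).2 hrt
  · rw [Measure.map_apply hG hJo.measurableSet.compl]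
    refine measure_mono_null ?_ (ae_iff.1 hconc)
    intro x hx hxβ
    exact hx ⟨x, hS.related_of_rayIndex_eq hxβ, rfl⟩

end Density

/-! ### Monotone interpolation on one ray -/

section Fibre

variable {n θ : ℝ} {I s : Set ℝ} {h Y Y₀ Y₁ : ℝ → ℝ}

theorem withDensity_withDensity_restrict (hI : MeasurableSet I) (hh : Measurable h)
    {r : ℝ → ℝ≥0∞} (hr : Measurable r) :
    ((volume.restrict I).withDensity fun s => ENNReal.ofReal (h s)).withDensity r =
      volume.withDensity (I.indicator fun s => ENNReal.ofReal (h s) * r s) := by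
  rw [← withDensity_mul _ hh.ennreal_ofReal hr, withDensity_indicator hI]
  rfl

/-- The change of variables formula for a push-forward with a density relative to `h`. -/
theorem rpow_neg_density_eq (hs : IsOpen s) (hsc : s.OrdConnected) (hY : MonotoneOn Y s)
    (hYm : Measurable Y) (hI : MeasurableSet I) (hh : Measurable h) {r : ℝ → ℝ≥0∞}
    (hr : Measurable r) {c : ℝ≥0∞} (hc0 : c ≠ 0) (hc : c ≠ ∞)
    (hlaw : c • (volume.restrict s).map Y =
      ((volume.restrict I).withDensity fun s => ENNReal.ofReal (h s)).withDensity r) :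
    ∀ᵐ u ∂volume.restrict s, Real.exp (-Real.log (r (Y u)).toReal / n) =
      (h (Y u) * (deriv Y u / c.toReal)) ^ (1 / n) := by
  have hm : Measurable (I.indicator fun s => ENNReal.ofReal (h s) * r s) :=
    (hh.ennreal_ofReal.mul hr).indicator hI
  have hlaw' : (volume.restrict s).map Y =
      volume.withDensity (c⁻¹ • I.indicator fun s => ENNReal.ofReal (h s) * r s) := by
    rw [withDensity_smul _ hm, ← withDensity_withDensity_restrict hI hh hr, ← hlaw, smul_smul,
      ENNReal.inv_mul_cancel hc0 hc, one_smul]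
  filter_upwards [deriv_mul_density_eq_one hs hsc hY hYm (hm.const_smul c⁻¹) hlaw'] with u hu
  obtain ⟨⟨-, -, hpos⟩, h1⟩ := hu
  rw [Pi.smul_apply, smul_eq_mul] at h1
  have hYI : Y u ∈ I := by
    by_contra hYI
    rw [indicator_of_notMem hYI, mul_zero, mul_zero] at h1
    exact zero_ne_one h1
  rw [indicator_of_mem hYI] at h1
  have hh0 : 0 < h (Y u) := by
    by_contra hh0
    rw [ENNReal.ofReal_of_nonpos (not_lt.1 hh0), zero_mul, mul_zero, mul_zero] at h1
    exact zero_ne_one h1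
  have h2 := congrArg ENNReal.toReal h1
  rw [ENNReal.toReal_mul, ENNReal.toReal_mul, ENNReal.toReal_mul, ENNReal.toReal_inv,
    ENNReal.toReal_ofReal hpos.le, ENNReal.toReal_ofReal hh0.le, ENNReal.toReal_one] at h2
  have hcpos : 0 < c.toReal := ENNReal.toReal_pos hc0 hc
  have hr0 : 0 < (r (Y u)).toReal := by
    refine lt_of_le_of_ne ENNReal.toReal_nonneg fun e => ?_
    rw [← e] at h2
    simp at h2
  have e : h (Y u) * (deriv Y u / c.toReal) = (r (Y u)).toReal⁻¹ := by
    rw [← one_div, eq_div_iff hr0.ne', ← h2]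
    field_simp
  rw [e, Real.rpow_def_of_pos (inv_pos.2 hr0), Real.log_inv]
  congr 1
  ring

theorem interpolation_mem_derivPos (hs : IsOpen s) (hY₁ : MonotoneOn Y₁ s) {w₀ w₁ : ℝ}
    (hw₀ : 0 < w₀) (hw₁ : 0 ≤ w₁) (hpos : ∀ᵐ u ∂volume.restrict s, u ∈ derivPos Y₀ s) :
    ∀ᵐ u ∂volume.restrict s, u ∈ derivPos (fun u => w₀ * Y₀ u + w₁ * Y₁ u) s := by
  filter_upwards [hpos, ae_differentiableAt_of_monotoneOn hs hY₁] with u hu hu₁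
  have hd := (hu.2.1.hasDerivAt.const_mul w₀).add (hu₁.2.1.hasDerivAt.const_mul w₁)
  refine ⟨hu.1, hd.differentiableAt, ?_⟩
  have := hd.deriv
  change deriv (fun u => w₀ * Y₀ u + w₁ * Y₁ u) u = _ at this
  rw [this]
  exact add_pos_of_pos_of_nonneg (mul_pos hw₀ hu.2.2) (mul_nonneg hw₁ hu₁.2.2)

theorem ae_density_pos (hI : MeasurableSet I) (hh : Measurable h) :
    ∀ᵐ x ∂(volume.restrict I).withDensity fun s => ENNReal.ofReal (h s), x ∈ I ∧ 0 < h x := by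
  rw [ae_withDensity_iff hh.ennreal_ofReal]
  filter_upwards [ae_restrict_mem hI] with x hx hx0
  exact ⟨hx, ENNReal.ofReal_pos.1 (pos_iff_ne_zero.2 hx0)⟩

/-- Monotone interpolation preserves absolute continuity with respect to a measure whose density
has a concave power. -/
theorem map_interpolation_absolutelyContinuous (hs : IsOpen s) (hsc : s.OrdConnected)
    (hY₀ : MonotoneOn Y₀ s) (hY₁ : MonotoneOn Y₁ s) (hm₀ : Measurable Y₀) (hm₁ : Measurable Y₁)
    [IsFiniteMeasure (volume.restrict s)]
    (hn : 1 < n) (hh : Measurable h) (h0 : ∀ x ∈ I, 0 ≤ h x)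
    (hc : ConcaveOn ℝ I fun x => h x ^ (1 / (n - 1))) {w₀ w₁ : ℝ} (hw₀ : 0 < w₀) (hw₁ : 0 ≤ w₁)
    (hw : w₀ + w₁ = 1) (hI₁ : ∀ᵐ u ∂volume.restrict s, Y₁ u ∈ I)
    (hac : (volume.restrict s).map Y₀ ≪
      (volume.restrict I).withDensity fun s => ENNReal.ofReal (h s)) :
    (volume.restrict s).map (fun u => w₀ * Y₀ u + w₁ * Y₁ u) ≪
      (volume.restrict I).withDensity fun s => ENNReal.ofReal (h s) := by
  have hIm : MeasurableSet I := hc.1.ordConnected.measurableSet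
  have hp : 0 < 1 / (n - 1) := one_div_pos.2 (by linarith)
  have hvol : (volume.restrict s).map Y₀ ≪ volume :=
    hac.trans ((withDensity_absolutelyContinuous _ _).trans Measure.absolutelyContinuous_restrict)
  have hpos : ∀ᵐ u ∂volume.restrict s, u ∈ derivPos Y₀ s :=
    (deriv_mul_density_eq_one hs hsc hY₀ hm₀ (Measure.measurable_rnDeriv _ _)
      (Measure.withDensity_rnDeriv_eq _ _ hvol).symm).mono fun u hu => hu.1
  have hYt : MonotoneOn (fun u => w₀ * Y₀ u + w₁ * Y₁ u) s := fun u hu v hv huv =>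
    add_le_add (mul_le_mul_of_nonneg_left (hY₀ hu hv huv) hw₀.le)
      (mul_le_mul_of_nonneg_left (hY₁ hu hv huv) hw₁)
  have hmt : Measurable fun u => w₀ * Y₀ u + w₁ * Y₁ u :=
    (hm₀.const_mul w₀).add (hm₁.const_mul w₁)
  have hvt := map_absolutelyContinuous_of_deriv_pos hs hYt hmt
    (interpolation_mem_derivPos hs hY₁ hw₀ hw₁ hpos)
  -- Concavity keeps `h` positive at the interpolated point as soon as it is positive at `Y₀ u`,
  -- since the weight `w₀` is positive.
  have hgood : ∀ᵐ u ∂volume.restrict s, (w₀ * Y₀ u + w₁ * Y₁ u) ∈ I ∧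
      0 < h (w₀ * Y₀ u + w₁ * Y₁ u) := by
    have e0 := ae_of_ae_map hm₀.aemeasurable (hac.ae_le (ae_density_pos hIm hh))
    filter_upwards [e0, hI₁] with u ⟨huI, hu0⟩ hu1
    have hmem : w₀ * Y₀ u + w₁ * Y₁ u ∈ I := hc.1 huI hu1 hw₀.le hw₁ hw
    refine ⟨hmem, (h0 _ hmem).lt_of_ne fun e => ?_⟩
    have := hc.2 huI hu1 hw₀.le hw₁ hw
    simp only [smul_eq_mul] at this
    rw [← e, Real.zero_rpow hp.ne'] at this
    have p1 := mul_pos hw₀ (Real.rpow_pos_of_pos hu0 (1 / (n - 1)))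
    have p2 := mul_nonneg hw₁ (Real.rpow_nonneg (h0 _ hu1) (1 / (n - 1)))
    linarith
  refine Measure.AbsolutelyContinuous.mk fun A hA hA0 => ?_
  rw [withDensity_apply_eq_zero hh.ennreal_ofReal, Measure.restrict_apply' hIm] at hA0
  have hz := hvt hA0
  rw [Measure.map_apply hmt hA]
  have hz' := Measure.preimage_null_of_map_null hmt.aemeasurable hz
  refine measure_mono_null (fun u hu => ?_) (measure_union_null hz' (ae_iff.1 hgood))
  by_cases hg : (w₀ * Y₀ u + w₁ * Y₁ u) ∈ I ∧ 0 < h (w₀ * Y₀ u + w₁ * Y₁ u)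
  · exact Or.inl ⟨⟨(ENNReal.ofReal_pos.2 hg.2).ne', hu⟩, hg.1⟩
  · exact Or.inr hg

/-- The derivative of the interpolation is affine in `t` and the `(n-1)`-th root of `h` is concave;
`rpow_mul_rpow_concave` combines the two. No absolute continuity of the laws is needed here. -/
theorem interpolation_inequality (hs : IsOpen s) (hY₀ : MonotoneOn Y₀ s) (hY₁ : MonotoneOn Y₁ s)
    (hn : 1 < n) (h0 : ∀ x ∈ I, 0 ≤ h x) (hc : ConcaveOn ℝ I fun x => h x ^ (1 / (n - 1)))
    {t : ℝ} (ht0 : 0 ≤ t) (ht1 : t ≤ 1) (hθ : 0 ≤ θ)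
    (hI₀ : ∀ᵐ u ∂volume.restrict s, Y₀ u ∈ I) (hI₁ : ∀ᵐ u ∂volume.restrict s, Y₁ u ∈ I) :
    ∀ᵐ u ∂volume.restrict s, 0 ≤ (h (Y₀ u) * (deriv Y₀ u / θ)) ^ (1 / n) ∧
      0 ≤ (h (Y₁ u) * (deriv Y₁ u / θ)) ^ (1 / n) ∧
      (1 - t) * (h (Y₀ u) * (deriv Y₀ u / θ)) ^ (1 / n) +
        t * (h (Y₁ u) * (deriv Y₁ u / θ)) ^ (1 / n) ≤
      (h ((1 - t) * Y₀ u + t * Y₁ u) *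
        (deriv (fun u => (1 - t) * Y₀ u + t * Y₁ u) u / θ)) ^ (1 / n) := by
  filter_upwards [hI₀, hI₁, ae_differentiableAt_of_monotoneOn hs hY₀,
    ae_differentiableAt_of_monotoneOn hs hY₁] with u hu₀ hu₁ hd₀ hd₁
  have ht1' : 0 ≤ 1 - t := by linarith
  have hn1 : n - 1 ≠ 0 := by linarith
  have hd := (hd₀.2.1.hasDerivAt.const_mul (1 - t)).add (hd₁.2.1.hasDerivAt.const_mul t)
  have hd' : deriv (fun u => (1 - t) * Y₀ u + t * Y₁ u) u =
    (1 - t) * deriv Y₀ u + t * deriv Y₁ u := hd.deriv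
  have b₀ : 0 ≤ deriv Y₀ u / θ := div_nonneg hd₀.2.2 hθ
  have b₁ : 0 ≤ deriv Y₁ u / θ := div_nonneg hd₁.2.2 hθ
  have a : ∀ x ∈ I, (h x ^ (1 / (n - 1))) ^ (n - 1) = h x := fun x hx => by
    rw [← Real.rpow_mul (h0 x hx), one_div_mul_cancel hn1, Real.rpow_one]
  have a₀ := Real.rpow_nonneg (h0 _ hu₀) (1 / (n - 1))
  have a₁ := Real.rpow_nonneg (h0 _ hu₁) (1 / (n - 1))
  have hmem : (1 - t) * Y₀ u + t * Y₁ u ∈ I := hc.1 hu₀ hu₁ ht1' ht0 (by ring)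
  have hconc := hc.2 hu₀ hu₁ ht1' ht0 (by ring)
  simp only [smul_eq_mul] at hconc
  refine ⟨Real.rpow_nonneg (mul_nonneg (h0 _ hu₀) b₀) _,
    Real.rpow_nonneg (mul_nonneg (h0 _ hu₁) b₁) _, ?_⟩
  have key := rpow_mul_rpow_concave hn ht0 ht1 a₀ a₁ b₀ b₁
  rw [a _ hu₀, a _ hu₁] at key
  refine key.trans (Real.rpow_le_rpow (by positivity) ?_ (by positivity))
  have e : (1 - t) * (deriv Y₀ u / θ) + t * (deriv Y₁ u / θ) =
      deriv (fun u => (1 - t) * Y₀ u + t * Y₁ u) u / θ := by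
    rw [hd']; ring
  rw [← e]
  refine mul_le_mul_of_nonneg_right ?_ (by positivity)
  calc _ ≤ (h ((1 - t) * Y₀ u + t * Y₁ u) ^ (1 / (n - 1))) ^ (n - 1) :=
        Real.rpow_le_rpow (by positivity) hconc (by linarith)
    _ = _ := a _ hmem

end Fibre

/-! ### Conditional laws along the rays -/

section RayLaws

open ProbabilityTheory

variable {X : Type*} [TopologicalCausalSpace X] [MeasurableSpace X] [BorelSpace X] {H : Set X}
variable [hH : Fact (IsClosed H)] {G : noEnds H → ℝ} {m : Measure H}
variable {hS : RaySetting H G} {q : Measure (noEnds H)} {K : Kernel (noEnds H) (noEnds H)}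

/-- A measurable choice of the ray through two causally related points. -/
theorem RaySetting.exists_pairIndex (hS : RaySetting H G) [hne : Nonempty (noEnds H)] :
    ∃ w : H × H → noEnds H, Measurable w ∧ ∀ x y, x ≤ y → x ≠ y ∨ x ∈ noEnds H →
      hS.rayIndex (w (x, y)) = w (x, y) ∧ OnRay (w (x, y)) x ∧ OnRay (w (x, y)) y := by
  classical
  -- A point strictly between `x` and `y` belongs to `H°`, so it determines a ray even when `x` and
  -- `y` are both end-points.
  let R : Set ((H × H) × H) := {p | p.1.1 ≤ p.2 ∧ p.2 ≤ p.1.2} ∩ {p | p.1.1 ≠ p.2 ∧ p.1.2 ≠ p.2}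
  have hR : IsSigmaCompact R := by
    refine isSigmaCompact_of_isClosed_inter_isOpen ?_ ?_
    · exact (isClosed_le (α := H) (continuous_fst.comp continuous_fst) continuous_snd).inter
        (isClosed_le (α := H) continuous_snd (continuous_snd.comp continuous_fst))
    · exact (isOpen_ne_fun (continuous_fst.comp continuous_fst) continuous_snd).inter
        (isOpen_ne_fun (continuous_snd.comp continuous_fst) continuous_snd)
  have : Nonempty H := ⟨hne.some⟩
  obtain ⟨f, hf, hfR⟩ := exists_measurable_selection hR
  let ret : H → noEnds H := fun x => if h : x ∈ noEnds H then ⟨x, h⟩ else hne.some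
  have hret : Measurable ret :=
    Measurable.dite (s := noEnds H) (f := fun x => x) (g := fun _ => hne.some) measurable_id
      measurable_const measurableSet_noEnds
  have hretc : ∀ x (hx : x ∈ noEnds H), ret x = ⟨x, hx⟩ := fun x hx => dif_pos hx
  refine ⟨fun p => hS.rayIndex (ret (if p.1 = p.2 then p.1 else f p)),
    hS.measurable_rayIndex.comp (hret.comp
      (Measurable.ite (measurableSet_eq_fun measurable_fst measurable_snd) measurable_fst hf)),
    fun x y hxy h => ⟨hS.rayIndex_rayIndex _, ?_⟩⟩
  by_cases hxy' : x = y
  · subst hxy'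
    have hx : x ∈ noEnds H := h.resolve_left fun h => h rfl
    simp only [if_true, hretc x hx]
    have : OnRay (hS.rayIndex ⟨x, hx⟩) x := (hS.related_rayIndex ⟨x, hx⟩).symm
    exact ⟨this, this⟩
  · simp only [if_neg hxy']
    obtain ⟨σ, -, hm, hi, h0, h1⟩ := hS.weaklyConvex.exists_arc hxy hxy'
    have hl : x ≤ σ half := h0 ▸ hm unitInterval.nonneg'
    have hr : σ half ≤ y := h1 ▸ hm unitInterval.le_one'
    obtain ⟨⟨h1, h2⟩, h3, h4⟩ := hfR (x, y) (σ half) ⟨⟨hl, hr⟩,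
      fun h => half_mem.1.ne (hi (h0.trans h)), fun h => half_mem.2.ne' (hi (h1.trans h))⟩
    have hE : f (x, y) ∈ noEnds H := mem_noEnds_of_between h1 h2 (Or.inl h3) (Or.inl h4)
    rw [hretc _ hE]
    have hr := hS.related_rayIndex ⟨f (x, y), hE⟩
    exact ⟨hS.onRay_congr hr.symm (Or.inl h1), hS.onRay_congr hr.symm (Or.inr h2)⟩

theorem ae_mem_noEnds {μ : Measure H} (hends : m (initialPoints H ∪ finalPoints H) = 0)
    (hac : μ ≪ m) : ∀ᵐ x ∂μ, x ∈ noEnds H := by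
  rw [ae_iff]
  refine hac (measure_mono_null (fun x hx => ?_) hends)
  exact not_not.1 hx

variable {p : Measure (noEnds H)} {κ : Kernel (noEnds H) ℝ}

/-- Almost every point of an absolutely continuous measure, written in ray coordinates. -/
theorem ae_rayPoint_mem [SFinite p] [IsSFiniteKernel κ]
    (hends : m (initialPoints H ∪ finalPoints H) = 0)
    (hray : ∀ᵐ z ∂(p ⊗ₘ κ), hS.rayIndex z.1 = z.1 ∧ z ∈ RaySetting.rayRange G)
    (hac : (p ⊗ₘ κ).map hS.rayPoint ≪ m) :
    ∀ᵐ z ∂(p ⊗ₘ κ), ∃ y : noEnds H, hS.rayPoint z = y ∧ hS.rayIndex y = z.1 ∧ G y = z.2 := by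
  filter_upwards [hray, ae_of_ae_map hS.measurable_rayPoint.aemeasurable (ae_mem_noEnds hends hac)]
    with z ⟨hz1, hz2⟩ hzE
  obtain ⟨hon, hg⟩ := hS.onRay_rayPoint (β := z.1) (s := z.2) hz2
  refine ⟨⟨_, hzE⟩, rfl, ?_, ?_⟩
  · rw [← hz1]
    exact hS.rayIndex_eq_iff.2 hon
  · rw [← rayGauge_coe (G := G) z.1]
    exact hg

theorem map_rayPoint_apply [SFinite p] [IsSFiniteKernel κ]
    (hends : m (initialPoints H ∪ finalPoints H) = 0)
    (hray : ∀ᵐ z ∂(p ⊗ₘ κ), hS.rayIndex z.1 = z.1 ∧ z ∈ RaySetting.rayRange G)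
    (hac : (p ⊗ₘ κ).map hS.rayPoint ≪ m) {C : Set (noEnds H)} (hC : MeasurableSet C) {D : Set ℝ}
    (hD : MeasurableSet D) :
    (p ⊗ₘ κ).map hS.rayPoint (Subtype.val '' (G ⁻¹' D ∩ hS.rayIndex ⁻¹' C)) =
      (p ⊗ₘ κ) (C ×ˢ D) := by
  rw [Measure.map_apply hS.measurable_rayPoint (measurableEmbedding_noEnds.measurableSet_image.2
    ((hS.gauge.measurable hD).inter (hS.measurable_rayIndex hC)))]
  refine measure_congr ?_
  filter_upwards [ae_rayPoint_mem hends hray hac] with z ⟨y, hy, hi, hg⟩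
  refine propext ⟨?_, ?_⟩
  · rintro ⟨y', ⟨h1, h2⟩, h3⟩
    obtain rfl : y' = y := Subtype.ext (h3.trans hy)
    exact ⟨hi ▸ (show hS.rayIndex y' ∈ C from h2), hg ▸ (show G y' ∈ D from h1)⟩
  · rintro ⟨h1, h2⟩
    exact ⟨y, ⟨by rwa [mem_preimage, hg], by rwa [mem_preimage, hi]⟩, hy.symm⟩

/-- Rays indexed by a `q`-null set have total `m`-mass zero, hence carry none of the law. -/
theorem IsRayDisintegration.absolutelyContinuous_index [SFinite p] [IsMarkovKernel κ]
    (h : IsRayDisintegration hS m q K) (hends : m (initialPoints H ∪ finalPoints H) = 0)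
    (hray : ∀ᵐ z ∂(p ⊗ₘ κ), hS.rayIndex z.1 = z.1 ∧ z ∈ RaySetting.rayRange G)
    (hac : (p ⊗ₘ κ).map hS.rayPoint ≪ m) : p ≪ q := by
  refine Measure.AbsolutelyContinuous.mk fun C hC hC0 => ?_
  have h1 := h.map_absolutelyContinuous hC0
  rw [Measure.map_apply hS.measurable_rayIndex hC, restrictNoEnds_image] at h1
  have h2 := hac h1
  have h3 := map_rayPoint_apply hends hray hac hC MeasurableSet.univ
  rw [preimage_univ, univ_inter, h2, Measure.compProd_apply_prod hC MeasurableSet.univ] at h3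
  simpa using h3.symm

/-- The conditional laws of an absolutely continuous measure along the rays. -/
theorem IsRayDisintegration.conditional_eq [IsFiniteMeasureOnCompacts m] [IsProbabilityMeasure p]
    [IsMarkovKernel κ] (h : IsRayDisintegration hS m q K)
    (hends : m (initialPoints H ∪ finalPoints H) = 0)
    (hray : ∀ᵐ z ∂(p ⊗ₘ κ), hS.rayIndex z.1 = z.1 ∧ z ∈ RaySetting.rayRange G)
    (hac : (p ⊗ₘ κ).map hS.rayPoint ≪ m) :
    ∀ᵐ β ∂q, p.rnDeriv q β • κ β = ((K β).map G).withDensity fun s =>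
      ((p ⊗ₘ κ).map hS.rayPoint).rnDeriv m (hS.rayPoint (β, s)) := by
  have := h.isFiniteMeasure
  have := h.isSFiniteKernel
  have hG := hS.gauge.measurable
  set μ := (p ⊗ₘ κ).map hS.rayPoint with hμ
  have hρ : Measurable (μ.rnDeriv m) := Measure.measurable_rnDeriv _ _
  have hpq := h.absolutelyContinuous_index hends hray hac
  have hρm : Measurable (Function.uncurry fun (β : noEnds H) (s : ℝ) =>
      μ.rnDeriv m (hS.rayPoint (β, s))) := hρ.comp hS.measurable_rayPoint
  have hρm' : ∀ β, Measurable fun s => μ.rnDeriv m (hS.rayPoint (β, s)) := fun β =>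
    hρm.comp (measurable_prodMk_left (x := β))
  have hL : ∀ β, ((K.map G).withDensity fun β s => μ.rnDeriv m (hS.rayPoint (β, s))) β =
      ((K β).map G).withDensity fun s => μ.rnDeriv m (hS.rayPoint (β, s)) := fun β => by
    rw [Kernel.withDensity_apply _ hρm, Kernel.map_apply _ hG]
  refine ae_eq_of_setLIntegral_eq (B := fun _ => univ) (fun _ => MeasurableSet.univ)
    (iUnion_const _) (fun _ => ?_) (fun D hD => ?_) (fun D hD => ?_) (fun D C hD hC => ?_)
  · filter_upwards [Measure.rnDeriv_lt_top p q] with β hβ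
    rw [Measure.smul_apply, measure_univ, smul_eq_mul, mul_one]
    exact hβ.ne
  · simp only [Measure.smul_apply, smul_eq_mul]
    exact ((Measure.measurable_rnDeriv _ _).mul (κ.measurable_coe hD)).aemeasurable
  · simp only [← hL]
    exact (Kernel.measurable_coe _ hD).aemeasurable
  · simp only [Measure.smul_apply, smul_eq_mul]
    rw [setLIntegral_rnDeriv_mul hpq (κ.measurable_coe hD).aemeasurable hC,
      ← Measure.compProd_apply_prod hC hD, ← map_rayPoint_apply hends hray hac hC hD, ← hμ,
      ← Measure.setLIntegral_rnDeriv hac]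
    -- Both sides integrate to the mass of the points with index in `C` and gauge in `D`: the left
    -- one through the ray coordinates of the law, the right one through the disintegration of `m`.
    have e1 : ∀ᵐ β ∂q, (((K β).map G).withDensity fun s => μ.rnDeriv m (hS.rayPoint (β, s))) D =
        ∫⁻ x in G ⁻¹' D, μ.rnDeriv m x ∂K β := by
      filter_upwards [h.concentrated] with β hβ
      rw [withDensity_apply _ hD, setLIntegral_map hD (hρm' β) hG]
      refine setLIntegral_congr_fun_ae (hG hD) ?_
      filter_upwards [hβ] with x hx _
      rw [hS.rayPoint_gauge (hS.related_of_rayIndex_eq hx)]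
    rw [setLIntegral_congr_fun_ae hC (e1.mono fun β hβ _ => hβ),
      ← Measure.setLIntegral_compProd (f := fun z : noEnds H × noEnds H => μ.rnDeriv m z.2)
        (hρ.comp (measurable_subtype_coe.comp measurable_snd)) hC (hG hD), h.compProd_eq,
      setLIntegral_map (f := fun z : noEnds H × noEnds H => μ.rnDeriv m z.2) (hC.prod (hG hD))
        (hρ.comp (measurable_subtype_coe.comp measurable_snd))
        (IsRayDisintegration.measurable_index_id hS)]
    have hA : MeasurableSet (G ⁻¹' D ∩ hS.rayIndex ⁻¹' C) :=
      (hG hD).inter (hS.measurable_rayIndex hC)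
    rw [← lintegral_indicator (measurableEmbedding_noEnds.measurableSet_image.2 hA)]
    have e2 : (fun x : noEnds H => (hS.rayIndex x, x)) ⁻¹' C ×ˢ (G ⁻¹' D) =
        G ⁻¹' D ∩ hS.rayIndex ⁻¹' C := by
      ext x; exact and_comm
    rw [e2, ← lintegral_indicator hA, restrictNoEnds]
    have e3 : ∫⁻ x : noEnds H, (G ⁻¹' D ∩ hS.rayIndex ⁻¹' C).indicator
        (fun x => μ.rnDeriv m x) x ∂(m.comap Subtype.val) =
        ∫⁻ x : noEnds H, (Subtype.val '' (G ⁻¹' D ∩ hS.rayIndex ⁻¹' C)).indicator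
          (μ.rnDeriv m) x ∂(m.comap Subtype.val) := by
      refine lintegral_congr fun x => ?_
      by_cases hx : x ∈ G ⁻¹' D ∩ hS.rayIndex ⁻¹' C
      · rw [indicator_of_mem hx, indicator_of_mem (mem_image_of_mem _ hx)]
      · rw [indicator_of_notMem hx, indicator_of_notMem]
        rintro ⟨y, hy, hyx⟩
        exact hx (Subtype.ext hyx ▸ hy)
    rw [e3, lintegral_subtype_comap measurableSet_noEnds, ← lintegral_indicator measurableSet_noEnds]
    refine lintegral_congr fun x => ?_
    by_cases hx : x ∈ noEnds H
    · rw [indicator_of_mem hx]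
    · rw [indicator_of_notMem hx, indicator_of_notMem]
      rintro ⟨y, -, hyx⟩
      exact hx (hyx ▸ y.2)

/-- A law whose conditional laws are absolutely continuous along the rays is absolutely
continuous. -/
theorem IsRayDisintegration.map_rayPoint_absolutelyContinuous [SFinite p] [IsSFiniteKernel κ]
    (h : IsRayDisintegration hS m q K) (hpq : p ≪ q) (hκ : ∀ᵐ β ∂p, κ β ≪ (K β).map G) :
    (p ⊗ₘ κ).map hS.rayPoint ≪ m := by
  have hG := hS.gauge.measurable
  refine Measure.AbsolutelyContinuous.mk fun A hA hA0 => ?_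
  have hnull : ∀ᵐ x : noEnds H ∂restrictNoEnds m, (x : H) ∉ A := by
    rw [ae_iff, restrictNoEnds_image]
    refine measure_mono_null ?_ hA0
    rintro _ ⟨x, hx, rfl⟩
    exact not_not.1 hx
  rw [Measure.map_apply hS.measurable_rayPoint hA]
  have := h.isSFiniteKernel
  refine compl_mem_ae_iff.1 ((Measure.ae_compProd_iff (p := fun z => z ∉ hS.rayPoint ⁻¹' A)
    (hS.measurable_rayPoint hA).compl).2 ?_)
  filter_upwards [hκ, hpq.ae_le h.concentrated, hpq.ae_le (h.ae_ae hnull)] with β h1 h2 h3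
  refine h1.ae_le ?_
  have hm : MeasurableSet {s | (β, s) ∉ hS.rayPoint ⁻¹' A} :=
    (measurable_prodMk_left (hS.measurable_rayPoint hA)).compl
  refine (ae_map_iff (p := fun s => (β, s) ∉ hS.rayPoint ⁻¹' A) hG.aemeasurable hm).2 ?_
  filter_upwards [h2, h3] with x hx hxA
  rwa [mem_preimage, hS.rayPoint_gauge (hS.related_of_rayIndex_eq hx)]

end RayLaws

/-! ### Concavity of the entropy power along monotone rearrangements -/

section Converse

open ProbabilityTheory

/-- Writes the interpolated laws as conditional laws given by a kernel, so that `conditional_eq`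
also applies at intermediate times. -/
theorem exists_kernel_map_prod {α : Type*} [MeasurableSpace α] (p : Measure α) [SFinite p]
    (U : Measure ℝ) [IsProbabilityMeasure U] {Y : α × ℝ → ℝ} (hY : Measurable Y) :
    ∃ κ : Kernel α ℝ, IsMarkovKernel κ ∧ (∀ a, κ a = U.map fun u => Y (a, u)) ∧
      (p.prod U).map (fun z => (z.1, Y z)) = p ⊗ₘ κ := by
  have hκ : ∀ a, ((Kernel.deterministic id measurable_id ×ₖ Kernel.const α U).map Y) a =
      U.map fun u => Y (a, u) := fun a => by
    rw [Kernel.map_apply _ hY, Kernel.prod_apply, Kernel.deterministic_apply, Kernel.const_apply,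
      Measure.dirac_prod, Measure.map_map hY measurable_prodMk_left]
    rfl
  have hm : Measurable fun z : α × ℝ => (z.1, Y z) := measurable_fst.prodMk hY
  refine ⟨_, Kernel.IsMarkovKernel.map _ hY, hκ, ?_⟩
  ext A hA
  rw [Measure.map_apply hm hA, Measure.prod_apply (hm hA), Measure.compProd_apply hA]
  refine lintegral_congr fun a => ?_
  have ha : Measurable fun u => Y (a, u) := hY.comp measurable_prodMk_left
  rw [hκ, Measure.map_apply ha (measurable_prodMk_left hA)]
  rfl

variable {X : Type*} [TopologicalCausalSpace X] [MeasurableSpace X] [BorelSpace X] {H : Set X}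
variable [hH : Fact (IsClosed H)] {G : noEnds H → ℝ} {m : Measure H} {N n : ℝ}
variable {hS : RaySetting H G} {q : Measure (noEnds H)} {K : Kernel (noEnds H) (noEnds H)}
variable {p : Measure (noEnds H)} {κ₀ κ₁ : Kernel (noEnds H) ℝ}

theorem isProbabilityMeasure_restrict_Ioo :
    IsProbabilityMeasure (volume.restrict (Ioo (0 : ℝ) 1)) :=
  ⟨by simp⟩

theorem exists_measurable_retract [hne : Nonempty (noEnds H)] :
    ∃ ret : H → noEnds H, Measurable ret ∧ ∀ x : noEnds H, ret x = x := by
  obtain ⟨ret, h1, h2⟩ := (measurableEmbedding_noEnds (H := H)).exists_measurable_extend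
    measurable_id fun _ => hne
  exact ⟨ret, h1, congrFun h2⟩

/-- A measurable set of `G`-causal curves that contains the constant curves and the gauge-affine
curves. -/
theorem RaySetting.exists_measurable_gCausal (hS : RaySetting H G) [hne : Nonempty (noEnds H)] :
    ∃ S : Set C(unitInterval, H), MeasurableSet S ∧ S ⊆ gCausalCurves G ∧
      (∀ x, ContinuousMap.const _ x ∈ S) ∧
      ∀ p ∈ RaySetting.curveDomain G, hS.rayIndex p.1 = p.1 → hS.affineCurve p ∈ S := by
  obtain ⟨ret, hret, hretc⟩ := exists_measurable_retract (H := H)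
  -- A non-constant gauge-affine curve can be rebuilt from the ray through its midpoint and the
  -- gauge values at its ends. The set consists of the curves equal to their reconstruction,
  -- together with the constant ones.
  let b : C(unitInterval, H) → noEnds H := fun γ => hS.rayIndex (ret (γ half))
  have hb : Measurable b := hS.measurable_rayIndex.comp (hret.comp (measurable_eval half))
  let Φ : C(unitInterval, H) → noEnds H × ℝ × ℝ := fun γ =>
    (b γ, rayGauge G (b γ) (γ 0), rayGauge G (b γ) (γ 1))
  have hΦ : Measurable Φ := hb.prodMk
    ((hS.measurable_rayGauge.comp (hb.prodMk (measurable_eval 0))).prodMk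
      (hS.measurable_rayGauge.comp (hb.prodMk (measurable_eval 1))))
  let S₀ : Set C(unitInterval, H) := {γ | ∀ t, γ t = γ 0}
  have hS₀ : MeasurableSet S₀ := by
    have : S₀ = ⋂ t, {γ : C(unitInterval, H) | γ t = γ 0} := by
      ext γ
      simp [S₀]
    rw [this]
    exact (isClosed_iInter fun t => isClosed_eq (continuous_eval_const t)
      (continuous_eval_const 0)).measurableSet
  refine ⟨S₀ ∪ {γ | Φ γ ∈ RaySetting.curveDomain G ∧ hS.affineCurve (Φ γ) = γ},
    hS₀.union ((hΦ hS.measurableSet_curveDomain).inter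
      (measurableSet_eq_fun (hS.measurable_affineCurve.comp hΦ) measurable_id)), ?_,
    fun x => Or.inl fun _ => rfl, fun p hp hi => ?_⟩
  · rintro γ (hγ | hγ)
    · exact ⟨fun s t _ => ((hγ s).trans (hγ t).symm).le,
        Or.inl fun s t => (hγ s).trans (hγ t).symm⟩
    · rw [← hγ.2]
      exact hS.affineCurve_mem hγ.1
  · obtain ⟨β, s₀, s₁⟩ := p
    simp only at hi
    have hle : s₀ ≤ s₁ := hp.2.2
    have happ := hS.affineCurve_apply hp
    have hon : ∀ t, OnRay β (hS.affineCurve (β, s₀, s₁) t) ∧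
        rayGauge G β (hS.affineCurve (β, s₀, s₁) t) = (1 - (t : ℝ)) * s₀ + t * s₁ := fun t => by
      obtain ⟨c, -, hc⟩ := hS.exists_curve hp
      rw [happ t]
      exact hS.onRay_rayPoint ⟨c t, hc t⟩
    rcases hle.eq_or_lt with rfl | hlt
    · refine Or.inl fun t => ?_
      rw [happ, happ]
      congr 2
      ring
    · refine Or.inr ?_
      have hE : hS.affineCurve (β, s₀, s₁) half ∈ noEnds H := by
        have hm := (hS.affineCurve_mem hp).1
        have hg : ∀ s t : unitInterval, (s : ℝ) ≠ t →
            hS.affineCurve (β, s₀, s₁) s ≠ hS.affineCurve (β, s₀, s₁) t := fun s t hst h => by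
          have e := (hon s).2
          rw [h, (hon t).2] at e
          refine hst (mul_right_cancel₀ (sub_ne_zero.2 hlt.ne') ?_)
          linarith
        refine mem_noEnds_of_between (hm (unitInterval.nonneg' (t := half)))
          (hm (unitInterval.le_one' (t := half))) (Or.inl (hg _ _ ?_)) (Or.inl (hg _ _ ?_))
        · rw [coe_half]; norm_num
        · rw [coe_half]; norm_num
      have hbβ : b (hS.affineCurve (β, s₀, s₁)) = β := by
        have := hretc ⟨_, hE⟩
        simp only [b]
        rw [this]
        exact (hS.rayIndex_eq_iff.2 (show Related ⟨_, hE⟩ β from (hon half).1)).trans hi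
      have hΦβ : Φ (hS.affineCurve (β, s₀, s₁)) = (β, s₀, s₁) := by
        simp only [Φ, hbβ]
        rw [(hon 0).2, (hon 1).2]
        simp
      refine ⟨?_, ?_⟩
      · rw [hΦβ]; exact hp
      · rw [hΦβ]

set_option maxHeartbeats 400000 in
/-- Monotone rearrangement along the rays gives a plan along which the entropy power is concave. -/
theorem IsRayDisintegration.exists_plan [IsFiniteMeasureOnCompacts m] [IsProbabilityMeasure p]
    [IsMarkovKernel κ₀] [IsMarkovKernel κ₁] (h : IsRayDisintegration hS m q K) (hN : 2 < N)
    (hends : m (initialPoints H ∪ finalPoints H) = 0)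
    (hCD : ∀ᵐ β ∂q, HasConcaveDensity (N - 1) (closedGaugeRange G β) ((K β).map G))
    (hr₀ : ∀ᵐ z ∂(p ⊗ₘ κ₀), hS.rayIndex z.1 = z.1 ∧ z ∈ RaySetting.rayRange G)
    (hr₁ : ∀ᵐ z ∂(p ⊗ₘ κ₁), hS.rayIndex z.1 = z.1 ∧ z ∈ RaySetting.rayRange G)
    (hle : ∀ᵐ β ∂p, ∀ r : ℚ, κ₁ β (Iic (r : ℝ)) ≤ κ₀ β (Iic (r : ℝ))) {μ₀ μ₁ : Measure H}
    (hμ₀ : (p ⊗ₘ κ₀).map hS.rayPoint = μ₀) (hμ₁ : (p ⊗ₘ κ₁).map hS.rayPoint = μ₁) :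
    ∃ ν : Measure C(unitInterval, H), IsGCausalPlan G μ₀ μ₁ ν ∧ ∀ t : unitInterval,
      ENNReal.ofReal (1 - (t : ℝ)) * entropyPower (N - 1) μ₀ m
          + ENNReal.ofReal (t : ℝ) * entropyPower (N - 1) μ₁ m
        ≤ entropyPower (N - 1) (marginal ν t) m := by
  classical
  have hn : 0 < N - 1 := by linarith
  have := h.isFiniteMeasure
  have := h.isSFiniteKernel
  have hU := isProbabilityMeasure_restrict_Ioo
  set U : Measure ℝ := volume.restrict (Ioo (0 : ℝ) 1) with hUdef
  set P := p.prod U with hP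
  -- The same uniform variable drives both quantile functions: this is the monotone coupling on each
  -- ray, ordered by `hle`.
  let Y₀ : noEnds H × ℝ → ℝ := fun z => quantile (κ₀ z.1) z.2
  let Y₁ : noEnds H × ℝ → ℝ := fun z => quantile (κ₁ z.1) z.2
  have hY₀ : Measurable Y₀ := measurable_quantile κ₀
  have hY₁ : Measurable Y₁ := measurable_quantile κ₁
  have hL₀ : P.map (fun z => (z.1, Y₀ z)) = p ⊗ₘ κ₀ := map_prod_quantile p κ₀
  have hL₁ : P.map (fun z => (z.1, Y₁ z)) = p ⊗ₘ κ₁ := map_prod_quantile p κ₁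
  have hm₀ : Measurable fun z => (z.1, Y₀ z) := measurable_fst.prodMk hY₀
  have hm₁ : Measurable fun z => (z.1, Y₁ z) := measurable_fst.prodMk hY₁
  let Yt : ℝ → noEnds H × ℝ → ℝ := fun t z => (1 - t) * Y₀ z + t * Y₁ z
  have hYt : ∀ t, Measurable (Yt t) := fun t => (hY₀.const_mul _).add (hY₁.const_mul _)
  have hmt : ∀ t, Measurable fun z => (z.1, Yt t z) := fun t => measurable_fst.prodMk (hYt t)
  let x : ℝ → noEnds H × ℝ → H := fun t z => hS.rayPoint (z.1, Yt t z)
  have hx : ∀ t, Measurable (x t) := fun t => hS.measurable_rayPoint.comp (hmt t)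
  -- the curves
  have hdom : ∀ᵐ z ∂P, hS.rayIndex z.1 = z.1 ∧ (z.1, Y₀ z, Y₁ z) ∈ RaySetting.curveDomain G := by
    have e0 := ae_of_ae_map hm₀.aemeasurable (hL₀ ▸ hr₀)
    have e1 := ae_of_ae_map hm₁.aemeasurable (hL₁ ▸ hr₁)
    have e2 : ∀ᵐ z ∂P, ∀ r : ℚ, κ₁ z.1 (Iic (r : ℝ)) ≤ κ₀ z.1 (Iic (r : ℝ)) :=
      Measure.quasiMeasurePreserving_fst.ae hle
    have e3 : ∀ᵐ z ∂P, z.2 ∈ Ioo (0 : ℝ) 1 :=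
      Measure.quasiMeasurePreserving_snd.ae (ae_restrict_mem measurableSet_Ioo)
    filter_upwards [e0, e1, e2, e3] with z h0 h1 h2 h3
    exact ⟨h0.1, h0.2, h1.2, quantile_le_quantile h2 h3⟩
  let c : noEnds H × ℝ → C(unitInterval, H) := fun z => hS.affineCurve (z.1, Y₀ z, Y₁ z)
  have hc : Measurable c :=
    hS.measurable_affineCurve.comp (measurable_fst.prodMk (hY₀.prodMk hY₁))
  have hmarg : ∀ t : unitInterval, marginal (P.map c) t = P.map (x t) := fun t => by
    rw [marginal, Measure.map_map (measurable_eval t) hc]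
    refine Measure.map_congr ?_
    filter_upwards [hdom] with z hz
    exact hS.affineCurve_apply hz.2 t
  have hx₀ : P.map (x 0) = μ₀ := by
    rw [← hμ₀, ← hL₀, Measure.map_map hS.measurable_rayPoint hm₀]
    congr 1
    funext z
    simp [x, Yt]
  have hx₁ : P.map (x 1) = μ₁ := by
    rw [← hμ₁, ← hL₁, Measure.map_map hS.measurable_rayPoint hm₁]
    congr 1
    funext z
    simp [x, Yt]
  have hg₀ : marginal (P.map c) 0 = μ₀ := (hmarg 0).trans hx₀
  have hg₁ : marginal (P.map c) 1 = μ₁ := (hmarg 1).trans hx₁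
  have hPc : IsProbabilityMeasure (P.map c) := Measure.isProbabilityMeasure_map hc.aemeasurable
  have hpμ₀ : IsProbabilityMeasure μ₀ := hx₀ ▸ Measure.isProbabilityMeasure_map (hx 0).aemeasurable
  have hpμ₁ : IsProbabilityMeasure μ₁ := hx₁ ▸ Measure.isProbabilityMeasure_map (hx 1).aemeasurable
  refine ⟨P.map c, ⟨hPc, hg₀, hg₁, ?_⟩, fun t => ?_⟩
  · have hne : Nonempty (noEnds H) := nonempty_of_isProbabilityMeasure p
    obtain ⟨S, hSm, hSG, -, hSc⟩ := hS.exists_measurable_gCausal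
    refine ((ae_map_iff (p := fun γ => γ ∈ S) hc.aemeasurable hSm).2 ?_).mono fun γ hγ => hSG hγ
    filter_upwards [hdom] with z hz using hSc _ hz.2 hz.1
  rcases t.2.1.eq_or_lt with ht0 | ht0
  · have : t = 0 := Subtype.ext ht0.symm
    subst this
    rw [hg₀]
    simp
  rcases t.2.2.eq_or_lt with ht1 | ht1
  · have : t = 1 := Subtype.ext ht1
    subst this
    rw [hg₁]
    simp
  by_cases hac : ¬ μ₀ ≪ m ∧ ¬ μ₁ ≪ m
  · rw [entropyPower_eq_zero fun h => hac.1 h.1, entropyPower_eq_zero fun h => hac.2 h.1, mul_zero,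
      mul_zero, add_zero]
    exact zero_le
  rw [hmarg]
  have ht1' : 0 < 1 - (t : ℝ) := by linarith
  -- the densities along the rays
  have hpq : p ≪ q := by
    by_cases h0 : μ₀ ≪ m
    · exact h.absolutelyContinuous_index hends hr₀ (hμ₀ ▸ h0)
    · have h1 : μ₁ ≪ m := by
        by_contra h1
        exact hac ⟨h0, h1⟩
      exact h.absolutelyContinuous_index hends hr₁ (hμ₁ ▸ h1)
  have hθ : ∀ᵐ β ∂p, p.rnDeriv q β ≠ 0 ∧ p.rnDeriv q β ≠ ∞ := by
    filter_upwards [Measure.rnDeriv_pos hpq, hpq.ae_le (Measure.rnDeriv_lt_top p q)] with β h1 h2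
    exact ⟨h1.ne', h2.ne⟩
  have hd₀ : ∀ᵐ β ∂p, μ₀ ≪ m → p.rnDeriv q β • κ₀ β =
      ((K β).map G).withDensity fun s => μ₀.rnDeriv m (hS.rayPoint (β, s)) := by
    rw [ae_all_iff, ← hμ₀]
    exact fun hac => hpq.ae_le (h.conditional_eq hends hr₀ hac)
  have hd₁ : ∀ᵐ β ∂p, μ₁ ≪ m → p.rnDeriv q β • κ₁ β =
      ((K β).map G).withDensity fun s => μ₁.rnDeriv m (hS.rayPoint (β, s)) := by
    rw [ae_all_iff, ← hμ₁]
    exact fun hac => hpq.ae_le (h.conditional_eq hends hr₁ hac)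
  have hJ₀ : ∀ᵐ z ∂P, Y₀ z ∈ closedGaugeRange G z.1 := hdom.mono fun z hz => hz.2.1
  have hI₀ : ∀ᵐ β ∂p, ∀ᵐ u ∂U, Y₀ (β, u) ∈ closedGaugeRange G β :=
    Measure.ae_ae_of_ae_prod hJ₀
  have hJ₁ : ∀ᵐ z ∂P, Y₁ z ∈ closedGaugeRange G z.1 := hdom.mono fun z hz => hz.2.2.1
  have hI₁ : ∀ᵐ β ∂p, ∀ᵐ u ∂U, Y₁ (β, u) ∈ closedGaugeRange G β :=
    Measure.ae_ae_of_ae_prod hJ₁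
  obtain ⟨κt, hκt, hκta, hLt⟩ := exists_kernel_map_prod p U (hYt t)
  have hmono₀ : ∀ β, MonotoneOn (fun u => Y₀ (β, u)) (Ioo 0 1) :=
    fun β => monotoneOn_quantile (μ := κ₀ β)
  have hmono₁ : ∀ β, MonotoneOn (fun u => Y₁ (β, u)) (Ioo 0 1) :=
    fun β => monotoneOn_quantile (μ := κ₁ β)
  have hmt₀ : ∀ β, Measurable fun u => Y₀ (β, u) := fun β => hY₀.comp measurable_prodMk_left
  have hmt₁ : ∀ β, Measurable fun u => Y₁ (β, u) := fun β => hY₁.comp measurable_prodMk_left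
  have hl₀ : ∀ β, U.map (fun u => Y₀ (β, u)) = κ₀ β := fun β => map_quantile (μ := κ₀ β)
  have hl₁ : ∀ β, U.map (fun u => Y₁ (β, u)) = κ₁ β := fun β => map_quantile (μ := κ₁ β)
  have hacm : ∀ {κ : Measure ℝ} {M : Measure ℝ} {θ : ℝ≥0∞} {f : ℝ → ℝ≥0∞}, θ ≠ 0 →
      θ • κ = M.withDensity f → κ ≪ M := fun hθ0 e =>
    (Measure.absolutelyContinuous_smul hθ0).trans (e ▸ withDensity_absolutelyContinuous _ _)
  -- One absolutely continuous end is enough. If it is the second one, the roles of the two ends are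
  -- exchanged.
  have hκtac : ∀ᵐ β ∂p, κt β ≪ (K β).map G := by
    filter_upwards [hd₀, hd₁, hθ, hpq.ae_le hCD, hI₀, hI₁] with β e0 e1 hθ ⟨f, hfm, hf0, hfM, hfc⟩
      i0 i1
    rw [hκta]
    by_cases h0 : μ₀ ≪ m
    · have a0 := hacm hθ.1 (e0 h0)
      rw [← hl₀, hfM] at a0
      rw [hfM]
      exact map_interpolation_absolutelyContinuous isOpen_Ioo ordConnected_Ioo (hmono₀ β) (hmono₁ β)
        (hmt₀ β) (hmt₁ β) (by linarith) hfm hf0 hfc ht1' ht0.le (by ring) i1 a0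
    · have h1 : μ₁ ≪ m := by
        by_contra h1
        exact hac ⟨h0, h1⟩
      have a1 := hacm hθ.1 (e1 h1)
      rw [← hl₁, hfM] at a1
      rw [hfM]
      have e : (fun u => Yt t (β, u)) = fun u => (t : ℝ) * Y₁ (β, u) + (1 - t) * Y₀ (β, u) :=
        funext fun u => add_comm _ _
      rw [e]
      exact map_interpolation_absolutelyContinuous isOpen_Ioo ordConnected_Ioo (hmono₁ β)
        (hmono₀ β) (hmt₁ β) (hmt₀ β) (by linarith) hfm hf0 hfc ht0 ht1'.le (by ring) i0 a1
  have hμt : (p ⊗ₘ κt).map hS.rayPoint = P.map (x t) := by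
    rw [← hLt, Measure.map_map hS.measurable_rayPoint (hmt t)]
    rfl
  have hact : P.map (x t) ≪ m := hμt ▸ h.map_rayPoint_absolutelyContinuous hpq hκtac
  have hrt : ∀ᵐ z ∂(p ⊗ₘ κt), hS.rayIndex z.1 = z.1 ∧ z ∈ RaySetting.rayRange G := by
    rw [← hLt]
    refine (ae_map_iff (p := fun z => hS.rayIndex z.1 = z.1 ∧ z ∈ RaySetting.rayRange G)
      (hmt t).aemeasurable ?_).2 ?_
    · exact (measurableSet_eq_fun (hS.measurable_rayIndex.comp measurable_fst) measurable_fst).inter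
        hS.measurableSet_rayRange
    · filter_upwards [hdom] with z hz
      obtain ⟨γ, -, hγ⟩ := hS.exists_curve hz.2
      exact ⟨hz.1, γ t, hγ t⟩
  have hdt : ∀ᵐ β ∂p, p.rnDeriv q β • κt β =
      ((K β).map G).withDensity fun s => (P.map (x t)).rnDeriv m (hS.rayPoint (β, s)) := by
    have := hpq.ae_le (h.conditional_eq hends hrt (hμt ▸ hact))
    rwa [hμt] at this
  -- the pointwise inequality
  let e₀ : H → ℝ := fun y => if μ₀ ≪ m then Real.exp (-logDensity μ₀ m y / (N - 1)) else 0
  let e₁ : H → ℝ := fun y => if μ₁ ≪ m then Real.exp (-logDensity μ₁ m y / (N - 1)) else 0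
  have hem : ∀ μ : Measure H, Measurable fun y => Real.exp (-logDensity μ m y / (N - 1)) :=
    fun μ => Real.measurable_exp.comp ((measurable_logDensity.neg).div_const _)
  have he₀ : Measurable e₀ := Measurable.ite (MeasurableSet.const _) (hem μ₀) measurable_const
  have he₁ : Measurable e₁ := Measurable.ite (MeasurableSet.const _) (hem μ₁) measurable_const
  have hkey : ∀ᵐ z ∂P, (1 - (t : ℝ)) * e₀ (x 0 z) + t * e₁ (x 1 z) ≤
      Real.exp (-logDensity (P.map (x t)) m (x t z) / (N - 1)) := by
    have hset : MeasurableSet {z | (1 - (t : ℝ)) * e₀ (x 0 z) + t * e₁ (x 1 z) ≤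
        Real.exp (-logDensity (P.map (x t)) m (x t z) / (N - 1))} :=
      measurableSet_le (((he₀.comp (hx 0)).const_mul _).add ((he₁.comp (hx 1)).const_mul _))
        ((hem _).comp (hx t))
    refine (Measure.ae_prod_mem_iff_ae_ae_mem hset).2 ?_
    filter_upwards [hd₀, hd₁, hdt, hθ, hpq.ae_le hCD, hI₀, hI₁] with β d0 d1 dt hθ
      ⟨f, hfm, hf0, hfM, hfc⟩ i0 i1
    have hIm : MeasurableSet (closedGaugeRange G β) := hfc.1.ordConnected.measurableSet
    have hmonot : MonotoneOn (fun u => Yt t (β, u)) (Ioo 0 1) := fun u hu v hv huv =>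
      add_le_add (mul_le_mul_of_nonneg_left (hmono₀ β hu hv huv) ht1'.le)
        (mul_le_mul_of_nonneg_left (hmono₁ β hu hv huv) ht0.le)
    have hdens : ∀ μ : Measure H, Measurable fun s => μ.rnDeriv m (hS.rayPoint (β, s)) := fun μ =>
      (Measure.measurable_rnDeriv _ _).comp (hS.measurable_rayPoint.comp measurable_prodMk_left)
    have k0 : μ₀ ≪ m → ∀ᵐ u ∂U, Real.exp (-logDensity μ₀ m (hS.rayPoint (β, Y₀ (β, u))) / (N - 1)) =
        (f (Y₀ (β, u)) * (deriv (fun u => Y₀ (β, u)) u / (p.rnDeriv q β).toReal)) ^ (1 / (N - 1)) :=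
      fun hac => rpow_neg_density_eq isOpen_Ioo ordConnected_Ioo (hmono₀ β) (hmt₀ β) hIm hfm
        (hdens μ₀) hθ.1 hθ.2 (by rw [← hUdef, hl₀, d0 hac, hfM])
    have k1 : μ₁ ≪ m → ∀ᵐ u ∂U, Real.exp (-logDensity μ₁ m (hS.rayPoint (β, Y₁ (β, u))) / (N - 1)) =
        (f (Y₁ (β, u)) * (deriv (fun u => Y₁ (β, u)) u / (p.rnDeriv q β).toReal)) ^ (1 / (N - 1)) :=
      fun hac => rpow_neg_density_eq isOpen_Ioo ordConnected_Ioo (hmono₁ β) (hmt₁ β) hIm hfm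
        (hdens μ₁) hθ.1 hθ.2 (by rw [← hUdef, hl₁, d1 hac, hfM])
    have hlaw : p.rnDeriv q β • U.map (fun u => Yt t (β, u)) = ((volume.restrict
        (closedGaugeRange G β)).withDensity fun s => ENNReal.ofReal (f s)).withDensity fun s =>
          (P.map (x t)).rnDeriv m (hS.rayPoint (β, s)) := by
      rw [← hκta, dt, hfM]
    have kt := rpow_neg_density_eq (n := N - 1) isOpen_Ioo ordConnected_Ioo hmonot
      ((hYt t).comp measurable_prodMk_left) hIm hfm (hdens _) hθ.1 hθ.2 hlaw
    have hineq := interpolation_inequality (n := N - 1) (θ := (p.rnDeriv q β).toReal) isOpen_Ioo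
      (hmono₀ β) (hmono₁ β) (by linarith) hf0 hfc ht0.le ht1.le ENNReal.toReal_nonneg i0 i1
    filter_upwards [ae_all_iff.2 k0, ae_all_iff.2 k1, kt, hineq] with u k0 k1 kt ⟨p0, p1, hineq⟩
    have hxe₀ : x 0 (β, u) = hS.rayPoint (β, Y₀ (β, u)) := by simp [x, Yt]
    have hxe₁ : x 1 (β, u) = hS.rayPoint (β, Y₁ (β, u)) := by simp [x, Yt]
    have b0 : e₀ (x 0 (β, u)) ≤ (f (Y₀ (β, u)) *
        (deriv (fun u => Y₀ (β, u)) u / (p.rnDeriv q β).toReal)) ^ (1 / (N - 1)) := by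
      by_cases hac : μ₀ ≪ m
      · rw [hxe₀, ← k0 hac]
        simp only [e₀, if_pos hac, le_refl]
      · simp only [e₀, if_neg hac]
        exact p0
    have b1 : e₁ (x 1 (β, u)) ≤ (f (Y₁ (β, u)) *
        (deriv (fun u => Y₁ (β, u)) u / (p.rnDeriv q β).toReal)) ^ (1 / (N - 1)) := by
      by_cases hac : μ₁ ≪ m
      · rw [hxe₁, ← k1 hac]
        simp only [e₁, if_pos hac, le_refl]
      · simp only [e₁, if_neg hac]
        exact p1
    refine (add_le_add (mul_le_mul_of_nonneg_left b0 ht1'.le)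
      (mul_le_mul_of_nonneg_left b1 ht0.le)).trans (hineq.trans (le_of_eq ?_))
    exact kt.symm
  have hpos₀ : ∀ y, 0 ≤ e₀ y := fun y => by
    simp only [e₀]; split_ifs <;> positivity
  have hpos₁ : ∀ y, 0 ≤ e₁ y := fun y => by
    simp only [e₁]; split_ifs <;> positivity
  have hac₀ : entropyPower (N - 1) μ₀ m ≠ 0 → μ₀ ≪ m := fun h => by
    by_contra hac
    exact h (entropyPower_eq_zero fun h => hac h.1)
  have hac₁ : entropyPower (N - 1) μ₁ m ≠ 0 → μ₁ ≪ m := fun h => by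
    by_contra hac
    exact h (entropyPower_eq_zero fun h => hac h.1)
  have ee₀ : entropyPower (N - 1) μ₀ m ≠ 0 → ∀ y, e₀ y =
      Real.exp (-logDensity (P.map (x 0)) m y / (N - 1)) := fun h y => by
    simp only [e₀, if_pos (hac₀ h), hx₀]
  have ee₁ : entropyPower (N - 1) μ₁ m ≠ 0 → ∀ y, e₁ y =
      Real.exp (-logDensity (P.map (x 1)) m y / (N - 1)) := fun h y => by
    simp only [e₁, if_pos (hac₁ h), hx₁]
  -- A vanishing entropy power is treated apart: the corresponding term of the pointwise inequality
  -- is merely nonnegative and is dropped.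
  by_cases hU₀ : entropyPower (N - 1) μ₀ m = 0
  · by_cases hU₁ : entropyPower (N - 1) μ₁ m = 0
    · rw [hU₀, hU₁, mul_zero, mul_zero, add_zero]
      exact zero_le
    · rw [hU₀, mul_zero, zero_add, ← hx₁]
      refine mul_entropyPower_le hn (hx 1) (hx t) hact ht0 ?_
      filter_upwards [hkey] with z hz
      rw [← ee₁ hU₁]
      linarith [mul_nonneg ht1'.le (hpos₀ (x 0 z))]
  · by_cases hU₁ : entropyPower (N - 1) μ₁ m = 0
    · rw [hU₁, mul_zero, add_zero, ← hx₀]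
      refine mul_entropyPower_le hn (hx 0) (hx t) hact ht1' ?_
      filter_upwards [hkey] with z hz
      rw [← ee₀ hU₀]
      linarith [mul_nonneg ht0.le (hpos₁ (x 1 z))]
    · rw [← hx₀, ← hx₁]
      refine add_mul_entropyPower_le hn (hx 0) (hx 1) (hx t) hact ht1' ht0 ?_ (hx₀ ▸ hU₀)
        (hx₁ ▸ hU₁)
      filter_upwards [hkey] with z hz
      rw [← ee₀ hU₀, ← ee₁ hU₁]
      exact hz

end Converse

/-! ### The equivalence -/

section Equivalence

open ProbabilityTheory

variable {X : Type*} [TopologicalCausalSpace X] [MeasurableSpace X] [BorelSpace X] {H : Set X}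
variable [hH : Fact (IsClosed H)] {G : noEnds H → ℝ} {m : Measure H} {N n : ℝ}
variable {hS : RaySetting H G} {q : Measure (noEnds H)} {K : Kernel (noEnds H) (noEnds H)}

/-- When neither marginal is absolutely continuous, the entropy inequality is void and only a plan
is required: each pair is joined by the affine curve on a selected ray. -/
theorem IsCausalCoupling.exists_gCausalPlan (hS : RaySetting H G)
    [Nonempty (noEnds H)] {μ₀ μ₁ : Measure H} {π : Measure (H × H)}
    (hπ : IsCausalCoupling μ₀ μ₁ π) : ∃ ν, IsGCausalPlan G μ₀ μ₁ ν := by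
  classical
  have := hπ.isProbabilityMeasure
  obtain ⟨w, hw, hwr⟩ := hS.exists_pairIndex
  obtain ⟨S, hSm, hSG, hSc, hSa⟩ := hS.exists_measurable_gCausal
  let c : H × H → C(unitInterval, H) := fun p => if p.1 = p.2 then ContinuousMap.const _ p.1
    else hS.affineCurve (w p, rayGauge G (w p) p.1, rayGauge G (w p) p.2)
  have hc : Measurable c := by
    refine Measurable.ite (measurableSet_eq_fun measurable_fst measurable_snd) ?_ ?_
    · exact measurable_curve_iff.2 fun t => measurable_fst
    · exact hS.measurable_affineCurve.comp (hw.prodMk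
        ((hS.measurable_rayGauge.comp (hw.prodMk measurable_fst)).prodMk
          (hS.measurable_rayGauge.comp (hw.prodMk measurable_snd))))
  have hgood : ∀ᵐ p ∂π, c p ∈ S ∧ c p 0 = p.1 ∧ c p 1 = p.2 := by
    filter_upwards [hπ.causal] with ⟨x, y⟩ hxy
    by_cases h : x = y
    · subst h
      simp only [c, if_true]
      exact ⟨hSc x, rfl, rfl⟩
    · obtain ⟨h1, h2, h3⟩ := hwr x y hxy (Or.inl h)
      have hdom : (w (x, y), rayGauge G (w (x, y)) x, rayGauge G (w (x, y)) y) ∈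
          RaySetting.curveDomain G := ⟨⟨x, h2, rfl⟩, ⟨y, h3, rfl⟩, hS.rayGauge_mono h2 h3 hxy⟩
      simp only [c, if_neg h]
      refine ⟨hSa _ hdom h1, ?_, ?_⟩
      · rw [hS.affineCurve_apply hdom]
        simpa using hS.rayPoint_rayGauge h2
      · rw [hS.affineCurve_apply hdom]
        simpa using hS.rayPoint_rayGauge h3
  refine ⟨π.map c, Measure.isProbabilityMeasure_map hc.aemeasurable, ?_, ?_, ?_⟩
  · rw [marginal, Measure.map_map (measurable_eval 0) hc, ← hπ.map_fst]
    exact Measure.map_congr (hgood.mono fun p hp => hp.2.1)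
  · rw [marginal, Measure.map_map (measurable_eval 1) hc, ← hπ.map_snd]
    exact Measure.map_congr (hgood.mono fun p hp => hp.2.2)
  · exact ((ae_map_iff (p := fun γ => γ ∈ S) hc.aemeasurable hSm).2
      (hgood.mono fun p hp => hp.1)).mono fun γ hγ => hSG hγ

/-- Concave densities along the rays imply the null energy condition. -/
theorem IsRayDisintegration.nce [IsFiniteMeasureOnCompacts m] [Nonempty (noEnds H)]
    (h : IsRayDisintegration hS m q K) (hN : 2 < N)
    (hends : m (initialPoints H ∪ finalPoints H) = 0)
    (hCD : ∀ᵐ β ∂q, HasConcaveDensity (N - 1) (closedGaugeRange G β) ((K β).map G)) :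
    NCe G m N := by
  intro μ₀ μ₁ hμ₀ hμ₁ ⟨π, hπ⟩
  have := hπ.isProbabilityMeasure
  by_cases hU : ¬ μ₀ ≪ m ∧ ¬ μ₁ ≪ m
  · obtain ⟨ν, hν⟩ := hπ.exists_gCausalPlan hS
    refine ⟨ν, hν, fun t => ?_⟩
    rw [entropyPower_eq_zero fun h => hU.1 h.1, entropyPower_eq_zero fun h => hU.2 h.1, mul_zero,
      mul_zero, add_zero]
    exact zero_le
  obtain ⟨w, hw, hwr⟩ := hS.exists_pairIndex
  have hgood : ∀ᵐ p ∂π, hS.rayIndex (w p) = w p ∧ OnRay (w p) p.1 ∧ OnRay (w p) p.2 ∧ p.1 ≤ p.2 := by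
    -- An absolutely continuous marginal gives no mass to the end-points, so almost every pair has a
    -- member in `H°` and lies on a ray, even if its two points coincide.
    have hE : ∀ᵐ p ∂π, p.1 ∈ noEnds H ∨ p.2 ∈ noEnds H := by
      by_cases h0 : μ₀ ≪ m
      · have := ae_mem_noEnds hends h0
        rw [← hπ.map_fst] at this
        exact (ae_of_ae_map measurable_fst.aemeasurable this).mono fun p hp => Or.inl hp
      · have h1 : μ₁ ≪ m := by
          by_contra h1
          exact hU ⟨h0, h1⟩
        have := ae_mem_noEnds hends h1
        rw [← hπ.map_snd] at this
        exact (ae_of_ae_map measurable_snd.aemeasurable this).mono fun p hp => Or.inr hp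
    filter_upwards [hπ.causal, hE] with ⟨x, y⟩ hxy hE
    have : x ≠ y ∨ x ∈ noEnds H := by
      by_cases hxy : x = y
      · subst hxy
        exact Or.inr (hE.elim id id)
      · exact Or.inl hxy
    obtain ⟨h1, h2, h3⟩ := hwr x y hxy this
    exact ⟨h1, h2, h3, hxy⟩
  have hS₀ : Measurable fun p : H × H => rayGauge G (w p) p.1 :=
    hS.measurable_rayGauge.comp (hw.prodMk measurable_fst)
  have hS₁ : Measurable fun p : H × H => rayGauge G (w p) p.2 :=
    hS.measurable_rayGauge.comp (hw.prodMk measurable_snd)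
  have hp : IsProbabilityMeasure (π.map w) := Measure.isProbabilityMeasure_map hw.aemeasurable
  have hL₀ := compProd_map_condDistrib (μ := π) (X := w) (mβ := inferInstance) hS₀.aemeasurable
  have hL₁ := compProd_map_condDistrib (μ := π) (X := w) (mβ := inferInstance) hS₁.aemeasurable
  have hset : MeasurableSet {z : noEnds H × ℝ | hS.rayIndex z.1 = z.1 ∧ z ∈ RaySetting.rayRange G} :=
    (measurableSet_eq_fun (hS.measurable_rayIndex.comp measurable_fst) measurable_fst).inter
      hS.measurableSet_rayRange
  refine h.exists_plan (p := π.map w) (κ₀ := condDistrib (fun p => rayGauge G (w p) p.1) w π)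
    (κ₁ := condDistrib (fun p => rayGauge G (w p) p.2) w π) hN hends hCD ?_ ?_ ?_ ?_ ?_
  · rw [hL₀]
    refine (ae_map_iff (hw.prodMk hS₀).aemeasurable hset).2 ?_
    exact hgood.mono fun p hp => ⟨hp.1, p.1, hp.2.1, rfl⟩
  · rw [hL₁]
    refine (ae_map_iff (hw.prodMk hS₁).aemeasurable hset).2 ?_
    exact hgood.mono fun p hp => ⟨hp.1, p.2, hp.2.2.1, rfl⟩
  · exact ae_condKernel_Iic_le hw hS₀ hS₁
      (hgood.mono fun p hp => hS.rayGauge_mono hp.2.1 hp.2.2.1 hp.2.2.2)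
  · rw [hL₀, Measure.map_map hS.measurable_rayPoint (hw.prodMk hS₀), ← hπ.map_fst]
    exact Measure.map_congr (hgood.mono fun p hp => hS.rayPoint_rayGauge hp.2.1)
  · rw [hL₁, Measure.map_map hS.measurable_rayPoint (hw.prodMk hS₁), ← hπ.map_snd]
    exact Measure.map_congr (hgood.mono fun p hp => hS.rayPoint_rayGauge hp.2.2.1)

theorem IsSyntheticNullHypersurface.raySetting (hHGm : IsSyntheticNullHypersurface H G m)
    (hnb : NullNonBranching H) (hwc : WeaklyConvex H) : RaySetting H G :=
  ⟨hwc, hnb, hHGm.gauge⟩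

/-- Covers the rays on which the factor `θ` vanishes, where the conditional measure is zero. -/
theorem RaySetting.hasConcaveDensity_zero (hS : RaySetting H G) (hn : 1 < n) (β : noEnds H) :
    HasConcaveDensity n (closedGaugeRange G β) 0 := by
  have hconv : ConcaveOn ℝ (closedGaugeRange G β) fun _ => (0 : ℝ) :=
    concaveOn_of_closure (hS.ordConnected_gaugeRange β) (gaugeRange_subset_closedGaugeRange β)
      (hS.closedGaugeRange_subset_closure β)
      (concaveOn_const _ (hS.ordConnected_gaugeRange β).convex) (fun _ => le_rfl) (fun _ _ => rfl)
  refine ⟨fun _ => 0, measurable_const, fun _ _ => le_rfl, by simp, ?_⟩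
  simpa only [Real.zero_rpow (one_div_ne_zero (sub_ne_zero.2 hn.ne'))] using hconv

/-- Concave densities hold for the Borel disintegration; the given one differs from it by a finite
factor on each ray. -/
theorem NCe.rayCD [IsFiniteMeasureOnCompacts m] [Nonempty (noEnds H)] (hS : RaySetting H G)
    (hNC : NCe G m N) (hN : 2 < N) {𝔔 : noEnds H → noEnds H} {q : Measure (noEnds H)}
    {mc : noEnds H → Measure (noEnds H)} (hD : IsDisintegration m 𝔔 q mc) :
    ∀ᵐ α ∂q, RayCD G N α (mc α) := by
  obtain ⟨q₀, K, h, hac⟩ := exists_isRayDisintegration (m := m) hS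
  obtain ⟨θ, h1, -, h3⟩ := hD.exists_comparison h hac
  filter_upwards [h1, h3 _ (hNC.hasConcaveDensity hN h)] with α ⟨e, ht⟩ hα
  rw [hS.rayCD_iff_hasConcaveDensity, e, Measure.map_smul]
  rcases hα with h0 | hα
  · rw [h0, zero_smul]
    exact hS.hasConcaveDensity_zero (by linarith) α
  · rw [hS.closedGaugeRange_congr (hS.related_rayIndex α)] at hα
    exact hα.smul ht

/-- The converse comparison: `θ` is positive and finite on almost every ray of the Borel
disintegration, so the factor can be divided out. -/
theorem IsDisintegration.nce [IsFiniteMeasureOnCompacts m] [Nonempty (noEnds H)]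
    (hS : RaySetting H G) (hN : 2 < N) (hends : m (initialPoints H ∪ finalPoints H) = 0)
    {𝔔 : noEnds H → noEnds H} {q : Measure (noEnds H)}
    {mc : noEnds H → Measure (noEnds H)} (hD : IsDisintegration m 𝔔 q mc)
    (hCD : ∀ᵐ α ∂q, RayCD G N α (mc α)) : NCe G m N := by
  obtain ⟨q₀, K, h, hac⟩ := exists_isRayDisintegration (m := m) hS
  obtain ⟨θ, h1, h2, -⟩ := hD.exists_comparison h hac
  refine h.nce hN hends ?_
  filter_upwards [h2 _ (h1.and hCD)] with β ⟨α, hα, ⟨⟨e, ht⟩, hCD⟩, h0⟩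
  subst hα
  rw [hS.rayCD_iff_hasConcaveDensity, e, Measure.map_smul,
    ← hS.closedGaugeRange_congr (hS.related_rayIndex α)] at hCD
  have := hCD.smul (ENNReal.inv_ne_top.2 h0)
  rwa [smul_smul, ENNReal.inv_mul_cancel h0 ht, one_smul] at this

end Equivalence

end NullEnergy
theorem theoremT {X : Type*} [NullEnergy.TopologicalCausalSpace X] [MeasurableSpace X]
    [BorelSpace X] (H : Set X) (G : NullEnergy.noEnds H → ℝ) (m : Measure H)
    (hHGm : NullEnergy.IsSyntheticNullHypersurface H G m)
    (hnb : NullEnergy.NullNonBranching H)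
    (hne : (NullEnergy.noEnds H).Nonempty)
    (N : ℝ) (hN : 2 < N) :
    List.TFAE [
      NullEnergy.NCe G m N,
      NullEnergy.WeaklyConvex H ∧
        m (NullEnergy.initialPoints H ∪ NullEnergy.finalPoints H) = 0 ∧
        ∃ (𝔔 : NullEnergy.noEnds H → NullEnergy.noEnds H)
          (q : Measure (NullEnergy.noEnds H))
          (mc : NullEnergy.noEnds H → Measure (NullEnergy.noEnds H)),
          NullEnergy.IsDisintegration m 𝔔 q mc ∧
            ∀ᵐ α ∂q, NullEnergy.RayCD G N α (mc α),
      NullEnergy.WeaklyConvex H ∧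
        m (NullEnergy.initialPoints H ∪ NullEnergy.finalPoints H) = 0 ∧
        ∀ (𝔔 : NullEnergy.noEnds H → NullEnergy.noEnds H)
          (q : Measure (NullEnergy.noEnds H))
          (mc : NullEnergy.noEnds H → Measure (NullEnergy.noEnds H)),
          NullEnergy.IsDisintegration m 𝔔 q mc →
            ∀ᵐ α ∂q, NullEnergy.RayCD G N α (mc α)] := by
  have := hHGm.radon
  have hH : Fact (IsClosed H) := ⟨hHGm.isClosed⟩
  have : Nonempty (NullEnergy.noEnds H) := hne.to_subtype
  tfae_have 1 → 3 := fun h => by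
    have hS := hHGm.raySetting hnb h.weaklyConvex
    exact ⟨hS.weaklyConvex, h.measure_ends_eq_zero hS hHGm.static_null (by linarith),
      fun _ _ _ hD => h.rayCD hS hN hD⟩
  tfae_have 3 → 2 := fun ⟨hwc, hends, h⟩ => by
    obtain ⟨𝔔, q, mc, hD⟩ :=
      NullEnergy.exists_isDisintegration (m := m) (hHGm.raySetting hnb hwc)
    exact ⟨hwc, hends, 𝔔, q, mc, hD, h 𝔔 q mc hD⟩
  tfae_have 2 → 1 := fun ⟨hwc, hends, _, _, _, hD, h⟩ =>
    hD.nce (hHGm.raySetting hnb hwc) hN hends h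
  tfae_finish
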